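/- **Setting.** For each $N$ let $(x_i,s_i,y_i,R_i)$, $i\le N$, be i.i.d. with $x\in\mathbb R^{p}$, $s\in\mathbb R^{K}$, $y\in\mathbb R$ and $P(R=1\mid x,s,y)=\rho(x,s)\in[\varepsilon,1]$, where $\varepsilon>0$ is fixed; $\mathcal V=\{i:R_i=1\}$, $n=|\mathcal V|$, $r=E\rho(x,s)$, $\bar n=E n=rN$. The dimensions $p,d,K\ge 1$, $q=dK$, the estimating functions $m(\beta;y,x)\in\mathbb R^p$, $h(\theta;s^{(k)},x)\in\mathbb R^d$, the rule $\rho$ and the law may depend on $N$. The parameters solve $E\,m(\beta_0;y,x)=0$ and $E\,h(\theta_0^{(k)};s^{(k)},x)=0$, $k\le K$. The estimators $\hat\beta_{\mathcal V}$, $\hat\theta_{\mathcal V}^{(k)}$, $\hat\theta_{\mathcal F}^{(k)}$ solve $$\frac1N\sum_{i\in\mathcal V}\frac{m(\beta;y_i,x_i)}{\rho(x_i,s_i)}=0,\qquad \frac1N\sum_{i\in\mathcal V}\frac{h(\theta;s^{(k)}_i,x_i)}{\rho(x_i,s_i)}=0,\qquad \frac1N\sum_{i=1}^N h(\theta;s_i^{(k)},x_i)=0$$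 (for all $k$, with probability tending to one). Let $\psi=-E\{\partial m(\beta_0)\}^{-1}m(\beta_0;y,x)$, $\eta^{(k)}=-E\{\partial h(\theta_0^{(k)})\}^{-1}h(\theta_0^{(k)};s^{(k)},x)$, $\eta=(\eta^{(1)},\dots,\eta^{(K)})\in\mathbb R^q$, and $$G=E\Big\{\frac{1-\rho}{\rho}\eta\eta^{T}\Big\},\quad H=E\Big\{\frac{1-\rho}{\rho}\psi\eta^{T}\Big\},\quad \Gamma_0=HG^{-1},\quad \Sigma_{SPI^*}=E\Big\{\frac1\rho\psi\psi^T\Big\}-HG^{-1}H^T .$$ The optimal Base-SPI estimator is $\hat\beta^*_{SPI}=\hat\beta_{\mathcal V}-\Gamma_0(\hat\theta_{\mathcal V}-\hat\theta_{\mathcal F})$; the SPI+ estimator is $\hat\beta_{SPI+}=\hat\beta_{\mathcal V}-\hat\Gamma_s(\hat\theta_{\mathcal V}-\hat\theta_{\mathcal F})$, where $\hat\Gamma_s$ minimizes over $\Gamma\in\mathbb R^{p\times q}$ $$\frac1{2n}\sum_{i\in\mathcal V}\frac{1-\rho(x_i,s_i)}{\rho(x_i,s_i)^2}\|\psi_i-\Gamma\eta_i\|^2+\lambda\,\Omega(\Gamma),\qquad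 \lambda>0,$$ with $\Omega(\Gamma)=\sum_{l,j}|\Gamma_{lj}|$ (lasso) or $\Omega(\Gamma)=\sum_j\|\Gamma_{\cdot j}\|$ (group lasso). **Conditions.** Let $\varepsilon,C,c,\delta,\kappa>0$ be constants not depending on $N$. (a) In the $\delta$-balls around the true parameters $m$ and $h$ are differentiable, and $\|\partial m(\beta)-\partial m(\beta_0)\|\le L\|\beta-\beta_0\|$, $\|\partial h(\theta)-\partial h(\theta_0^{(k)})\|\le L\|\theta-\theta^{(k)}_0\|$ for all $k$, where $L$ is a function of $(x,s,y)$ with $EL\le\ell_N$, $\ell_N\ge1$. The mean Jacobians exist and have inverses of norm at most $C$. For all unit vectors $u,v$: $E(u^T\partial m(\beta_0)v)^2\le C$, and $u^T\partial h(\theta_0^{(k)})v$ is sub-exponential with norm at most $C$. (b) For all unit vectors $u$, $u^T\psi$, $u^T(\psi-\Gamma_0\eta)$ and $u^T\eta^{(k)}$ (all $k$) are sub-Gaussian with norm at most $C$; $\lambda_{\min}(G)\ge c$; the absolute row sums of $\Gamma_0$ are at most $C$. (c) $p=o(\sqrt{\bar n})$, $d=o(\sqrt{\bar n})$, $q=O(\bar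 n^{e})$ for some constant $e$, and $\ell_N(p+d+\log q)=o(\sqrt{\bar n})$ (which follows from the former when $\ell_N$ is bounded). (d) The estimators are consistent: $\ell_N\|\hat\beta_{\mathcal V}-\beta_0\|$, $\ell_N\max_k\|\hat\theta^{(k)}_{\mathcal V}-\theta^{(k)}_0\|$ and $\ell_N\max_k\|\hat\theta^{(k)}_{\mathcal F}-\theta^{(k)}_0\|$ tend to $0$ in probability. For an index set $S$ say that $G$ is $\kappa$-incoherent on $S$ if $\|G_{jS}G_{SS}^{-1}\|_1\le1-\kappa$ for every $j\notin S$. **Theorem.** There is a constant $A_0=A_0(\varepsilon,C,c,\delta,\kappa)>0$ such that the following holds under (a)–(d). Assume one of: * *(Lasso)* $\Gamma_0$ has at most $s_*$ nonzero entries with $s_*^2\log(pq)=o(\bar n)$; for some constant $A_1$ and all large $N$, $A_0\sqrt{\log(pq)/\bar n}\le\lambda\le A_1\sqrt{(1+\log(pq))/\bar n}$; and either $G$ is $\kappa$-incoherent on the support of each row of $\Gamma_0$, or $s_*^2\log(pq)\log q=o(\bar n)$. * *(Group lasso)* $\Gamma_0$ has at most $q_*$ nonzero columns with $p\,q_*^2(p\vee\log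 q)=o(\bar n)$; for some constant $A_1$ and all large $N$, $A_0\sqrt{(p\vee\log q)/\bar n}\le\lambda\le A_1\sqrt{(p\vee\log q)/\bar n}$; and either $G$ is $\kappa$-incoherent on the set of nonzero columns of $\Gamma_0$, or $q_*^2(p\vee\log q)\log q=o(\bar n)$. Then: 1. (asymptotic equivalence) $\sqrt n\,\|\hat\beta_{SPI+}-\hat\beta^*_{SPI}\|\to0$ in probability. 2. (asymptotic normality) $\sqrt n(\hat\beta_{SPI+}-\beta_0)$ is asymptotically $N(0,r\Sigma_{SPI^*})$: for fixed $a$ and any matrices $T_N\in\mathbb R^{a\times p}$ with bounded absolute row sums (the identity if $p$ is fixed), the law of $\sqrt n\,T_N(\hat\beta_{SPI+}-\beta_0)$ and $N(0,rT_N\Sigma_{SPI^*}T_N^T)$ merge weakly (integrals of each bounded continuous function differ by $o(1)$); if $rT_N\Sigma_{SPI^*}T_N^T\to S$, then $\sqrt n\,T_N(\hat\beta_{SPI+}-\beta_0)\xrightarrow{d}N(0,S)$. 3. (no harm) With $\tilde\psi_\Gamma=\frac{R}{\rho}\psi+\frac{\rho-R}{\rho}\Gamma\eta$, one has $\Sigma_{SPI^*}=\mathrm{Var}(\tilde\psi_{\Gamma_0})$,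 and for every $\Gamma\in\mathbb R^{p\times q}$ the matrix $\mathrm{Var}(\tilde\psi_\Gamma)-\Sigma_{SPI^*}$ is positive semidefinite and $\mathrm{tr}\,\Sigma_{SPI^*}\le\mathrm{tr}\,\mathrm{Var}(\tilde\psi_\Gamma)$; and $\sqrt n(\hat\beta_{\mathcal V}-\beta_0)$ is asymptotically $N(0,r\mathrm{Var}(\tilde\psi_0))$ in the sense of 2, so SPI+ is asymptotically at least as efficient as $\hat\beta_{\mathcal V}$. -/

import Mathlib

open MeasureTheory ProbabilityTheory Filter Topology Asymptotics
open scoped BoundedContinuousFunction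

noncomputable section

namespace SPI

/-- Euclidean space `ℝ^k`. -/
abbrev E (k : ℕ) : Type := EuclideanSpace ℝ (Fin k)

/-- One complete observation `(x, s, y)`: features, the `K` surrogates, the true label. -/
abbrev Obs (p K : ℕ) : Type := E p × (Fin K → ℝ) × ℝ

/-- A complete observation with its labelling indicator `R` (`true` means selected). -/
abbrev Record (p K : ℕ) : Type := Obs p K × Bool

/-- Index set of the coordinates of `θ = (θ⁽¹⁾, …, θ⁽ᴷ⁾) ∈ ℝ^q`, `q = dK`. -/
abbrev Idx (d K : ℕ) : Type := Fin K × Fin d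

/-- A weighting matrix `Γ ∈ ℝ^{p × q}`. -/
abbrev Weight (p d K : ℕ) : Type := Matrix (Fin p) (Idx d K) ℝ

/-- `X` has Orlicz norm at most `C` for `exp (t ^ a) - 1`:
sub-exponential for `a = 1`, sub-Gaussian for `a = 2`. -/
def OrliczLE {α : Type*} [MeasurableSpace α] (a : ℕ) (X : α → ℝ) (C : ℝ) (μ : Measure α) : Prop :=
  AEMeasurable X μ ∧ ∫⁻ w, ENNReal.ofReal (Real.exp ((|X w| / C) ^ a)) ∂μ ≤ 2

/-- The irrepresentability (mutual incoherence) condition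
`‖G_{jS} (G_{SS})⁻¹‖₁ ≤ 1 - κ` for every `j ∉ S`. -/
def Incoherent {J : Type*} [Fintype J] [DecidableEq J] (G : Matrix J J ℝ) (S : Finset J)
    (κ : ℝ) : Prop :=
  ∀ j, j ∉ S →
    ∑ t : S, |Matrix.vecMul (fun u : S => G j u)
      (G.submatrix (fun u : S => (u : J)) (fun u : S => (u : J)))⁻¹ t| ≤ 1 - κ

/-- The population side of the problem: estimating functions `m(β; y, x)` and `h(θ; s, x)`,
selection rule `ρ(x, s)`, law of `(x, s, y)`, and the true parameters. -/
structure Model (p d K : ℕ) where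
  m : E p → ℝ → E p → E p
  h : E d → ℝ → E p → E d
  rho : E p → (Fin K → ℝ) → ℝ
  law : Measure (Obs p K)
  beta0 : E p
  theta0 : Fin K → E d

namespace Model

variable {p d K : ℕ} (M : Model p d K)

/-- The estimating function for `β` as a function of the observation. -/
def mObs (b : E p) (w : Obs p K) : E p := M.m b w.2.2 w.1

/-- The estimating function for `θ⁽ᵏ⁾` as a function of the observation. -/
def hObs (k : Fin K) (t : E d) (w : Obs p K) : E d := M.h t (w.2.1 k) w.1

/-- The selection probability of an observation. -/
def rhoObs (w : Obs p K) : ℝ := M.rho w.1 w.2.1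

/-- Jacobian of `m` in `β`. -/
def Dm (b : E p) (w : Obs p K) : E p →L[ℝ] E p := fderiv ℝ (fun b' => M.mObs b' w) b

/-- Jacobian of `h` in `θ` for the `k`-th surrogate. -/
def Dh (k : Fin K) (t : E d) (w : Obs p K) : E d →L[ℝ] E d :=
  fderiv ℝ (fun t' => M.hObs k t' w) t

/-- Population Jacobian `E{∂m(β₀)}`. -/
def A : E p →L[ℝ] E p := ∫ w, M.Dm M.beta0 w ∂M.law

/-- Population Jacobian `E{∂h(θ₀⁽ᵏ⁾)}`. -/
def B (k : Fin K) : E d →L[ℝ] E d := ∫ w, M.Dh k (M.theta0 k) w ∂M.law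

/-- Full-data influence function `ψ = -E{∂m(β₀)}⁻¹ m(β₀; y, x)` of `β`. -/
def psi (w : Obs p K) : E p := -(M.A.inverse (M.mObs M.beta0 w))

/-- Full-data influence function `η⁽ᵏ⁾ = -E{∂h(θ₀⁽ᵏ⁾)}⁻¹ h(θ₀⁽ᵏ⁾; s⁽ᵏ⁾, x)` of `θ⁽ᵏ⁾`. -/
def etaBlock (k : Fin K) (w : Obs p K) : E d :=
  -((M.B k).inverse (M.hObs k (M.theta0 k) w))

/-- The stacked influence function `η ∈ ℝ^q`. -/
def eta (w : Obs p K) : Idx d K → ℝ := fun j => M.etaBlock j.1 w j.2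

/-- The overall selection rate `r = E{ρ(x, s)}`. -/
def r : ℝ := ∫ w, M.rhoObs w ∂M.law

/-- `E{(1-ρ)/ρ · η ηᵀ}`. -/
def G : Matrix (Idx d K) (Idx d K) ℝ :=
  fun i j => ∫ w, (1 - M.rhoObs w) / M.rhoObs w * (M.eta w i * M.eta w j) ∂M.law

/-- `E{(1-ρ)/ρ · ψ ηᵀ}`. -/
def crossMoment : Weight p d K :=
  fun l j => ∫ w, (1 - M.rhoObs w) / M.rhoObs w * (M.psi w l * M.eta w j) ∂M.law

/-- `E{ψ ψᵀ / ρ}`. -/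
def baseMoment : Matrix (Fin p) (Fin p) ℝ :=
  fun l l' => ∫ w, 1 / M.rhoObs w * (M.psi w l * M.psi w l') ∂M.law

/-- The optimal weighting matrix `Γ₀`. -/
def Gamma0 : Weight p d K := M.crossMoment * M.G⁻¹

/-- The optimal variance `Σ_{SPI*}`. -/
def SigmaOpt : Matrix (Fin p) (Fin p) ℝ :=
  M.baseMoment - M.crossMoment * M.G⁻¹ * M.crossMoment.transpose

/-- The residual `ψ - Γ₀ η` of the weighted regression. -/
def resid (w : Obs p K) : E p := M.psi w - WithLp.toLp 2 (M.Gamma0.mulVec (M.eta w))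

/-- Joint law of `((x, s, y), R)`: given `(x, s, y)`, `R` is Bernoulli with success
probability `ρ(x, s)`. -/
def recordLaw : Measure (Record p K) :=
  (M.law.withDensity (fun w => ENNReal.ofReal (M.rhoObs w))).map (fun w => (w, true)) +
    (M.law.withDensity (fun w => ENNReal.ofReal (1 - M.rhoObs w))).map (fun w => (w, false))

/-- The influence function `ψ̃ = Rψ/ρ + (ρ-R)/ρ · Γη` of the surrogate-powered estimator
with weighting matrix `Γ`. -/
def psiTilde (Γ : Weight p d K) (z : Record p K) : Fin p → ℝ := fun l =>
  (if z.2 then (1 : ℝ) else 0) * M.psi z.1 l / M.rhoObs z.1 +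
    (M.rhoObs z.1 - (if z.2 then (1 : ℝ) else 0)) / M.rhoObs z.1 * Γ.mulVec (M.eta z.1) l

/-- `Var(ψ̃)` for the weighting matrix `Γ`. -/
def varTilde (Γ : Weight p d K) : Matrix (Fin p) (Fin p) ℝ :=
  fun l l' => cov[fun z => M.psiTilde Γ z l, fun z => M.psiTilde Γ z l'; M.recordLaw]

/-- Nonzero entries of row `l` of `Γ₀`. -/
def rowSupport (l : Fin p) : Finset (Idx d K) := by
  classical exact Finset.univ.filter fun j => M.Gamma0 l j ≠ 0

/-- Nonzero columns of `Γ₀`. -/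
def colSupport : Finset (Idx d K) := by
  classical exact Finset.univ.filter fun j => ∃ l, M.Gamma0 l j ≠ 0

/-- Number of nonzero entries of `Γ₀`. -/
def numNonzero : ℕ := ∑ l, (M.rowSupport l).card

/-- Regularity conditions. `ε` is the lower bound of the selection probability, `C` a bound for
moments and norms, `c` the eigenvalue bound for `E{(1-ρ)/ρ ηηᵀ}`, `δ` the radius of the
neighbourhood of the true parameters in which the estimating functions are smooth, and `ℓ` the
mean Lipschitz modulus of their Jacobians. -/
structure Regular (ε C c δ ℓ : ℝ) : Prop where
  law_prob : IsProbabilityMeasure M.law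
  rho_meas : Measurable M.rhoObs
  rho_ge : ∀ x s, ε ≤ M.rho x s
  rho_le : ∀ x s, M.rho x s ≤ 1
  m_meas : ∀ b, Measurable (M.mObs b)
  h_meas : ∀ k t, Measurable (M.hObs k t)
  -- the true parameters solve the population estimating equations
  m_zero : ∫ w, M.mObs M.beta0 w ∂M.law = 0
  h_zero : ∀ k, ∫ w, M.hObs k (M.theta0 k) w ∂M.law = 0
  -- local smoothness, with nonsingular population Jacobians
  m_diff : ∀ᵐ w ∂M.law, ∀ b ∈ Metric.ball M.beta0 δ,
    DifferentiableAt ℝ (fun b' => M.mObs b' w) b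
  h_diff : ∀ᵐ w ∂M.law, ∀ k, ∀ t ∈ Metric.ball (M.theta0 k) δ,
    DifferentiableAt ℝ (fun t' => M.hObs k t' w) t
  Dm_int : Integrable (M.Dm M.beta0) M.law
  Dh_int : ∀ k, Integrable (M.Dh k (M.theta0 k)) M.law
  A_inv : M.A.IsInvertible ∧ ‖M.A.inverse‖ ≤ C
  B_inv : ∀ k, (M.B k).IsInvertible ∧ ‖(M.B k).inverse‖ ≤ C
  lip : ∃ L : Obs p K → ℝ, AEMeasurable L M.law ∧
    ∫⁻ w, ENNReal.ofReal (L w) ∂M.law ≤ ENNReal.ofReal ℓ ∧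
    ∀ᵐ w ∂M.law,
      (∀ b ∈ Metric.ball M.beta0 δ,
        ‖M.Dm b w - M.Dm M.beta0 w‖ ≤ L w * ‖b - M.beta0‖) ∧
      ∀ k, ∀ t ∈ Metric.ball (M.theta0 k) δ,
        ‖M.Dh k t w - M.Dh k (M.theta0 k) w‖ ≤ L w * ‖t - M.theta0 k‖
  -- tails of Jacobians and influence functions, in every direction
  Dm_tail : ∀ u v : E p, ‖u‖ = 1 → ‖v‖ = 1 →
    ∫⁻ w, ENNReal.ofReal ((inner ℝ u (M.Dm M.beta0 w v)) ^ 2) ∂M.law ≤ ENNReal.ofReal C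
  Dh_tail : ∀ k, ∀ u v : E d, ‖u‖ = 1 → ‖v‖ = 1 →
    OrliczLE 1 (fun w => inner ℝ u (M.Dh k (M.theta0 k) w v)) C M.law
  psi_tail : ∀ u : E p, ‖u‖ = 1 → OrliczLE 2 (fun w => inner ℝ u (M.psi w)) C M.law
  eta_tail : ∀ k, ∀ u : E d, ‖u‖ = 1 → OrliczLE 2 (fun w => inner ℝ u (M.etaBlock k w)) C M.law
  resid_tail : ∀ u : E p, ‖u‖ = 1 → OrliczLE 2 (fun w => inner ℝ u (M.resid w)) C M.law
  -- identifiability and size of the optimal weighting matrix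
  G_lower : ∀ v : Idx d K → ℝ, c * ∑ j, v j ^ 2 ≤ v ⬝ᵥ M.G.mulVec v
  Gamma0_row : ∀ l, ∑ j, |M.Gamma0 l j| ≤ C

/-! Quantities computed from a realized data set `D` of `N` records. -/

variable {N : ℕ} (D : Fin N → Record p K)

/-- The validation set. -/
def valid (D : Fin N → Record p K) : Finset (Fin N) := Finset.univ.filter fun i => (D i).2 = true

/-- The number `n` of validated subjects. -/
def nValid (D : Fin N → Record p K) : ℕ := (valid D).card

/-- `b` solves the weighted estimating equation for `β` on the validation set. -/
def SolvesBetaV (b : E p) : Prop :=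
  (1 / (N : ℝ)) • ∑ i ∈ valid D, (1 / M.rhoObs (D i).1) • M.mObs b (D i).1 = 0

/-- `t` solves the weighted estimating equation for `θ⁽ᵏ⁾` on the validation set. -/
def SolvesThetaV (k : Fin K) (t : E d) : Prop :=
  (1 / (N : ℝ)) • ∑ i ∈ valid D, (1 / M.rhoObs (D i).1) • M.hObs k t (D i).1 = 0

/-- `t` solves the estimating equation for `θ⁽ᵏ⁾` on the full data. -/
def SolvesThetaF (k : Fin K) (t : E d) : Prop :=
  (1 / (N : ℝ)) • ∑ i, M.hObs k t (D i).1 = 0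

/-- Weighted least squares loss of the regression of `ψ` on `η`. -/
def loss (Γ : Weight p d K) : ℝ :=
  1 / (2 * (nValid D : ℝ)) * ∑ i ∈ valid D,
    (1 - M.rhoObs (D i).1) / M.rhoObs (D i).1 ^ 2 *
      ∑ l, (M.psi (D i).1 l - Γ.mulVec (M.eta (D i).1) l) ^ 2

/-- `Γ` is a lasso estimate with tuning parameter `lam`. -/
def IsLasso (lam : ℝ) (Γ : Weight p d K) : Prop :=
  IsMinOn (fun Γ' : Weight p d K => M.loss D Γ' + lam * ∑ l, ∑ j, |Γ' l j|) Set.univ Γ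

/-- `Γ` is a group-lasso estimate (columns as groups) with tuning parameter `lam`. -/
def IsGroupLasso (lam : ℝ) (Γ : Weight p d K) : Prop :=
  IsMinOn (fun Γ' : Weight p d K => M.loss D Γ' + lam * ∑ j, √(∑ l, Γ' l j ^ 2)) Set.univ Γ

end Model

/-- The surrogate-powered estimator `β̂_V - Γ(θ̂_V - θ̂_F)`. -/
def spi {p d K : ℕ} (Γ : Weight p d K) (bV : E p) (tV tF : Fin K → E d) : E p :=
  bV - WithLp.toLp 2 (Γ.mulVec fun j => tV j.1 j.2 - tF j.1 j.2)

/-- The expected size `E n = r N` of the validation set. -/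
def nBar {p d K : ℕ → ℕ} (M : ∀ N, Model (p N) (d N) (K N)) (N : ℕ) : ℝ := (M N).r * N

/-- Convergence to zero in probability along a sequence of probability spaces. -/
def TendstoZeroInProb {Ω : ℕ → Type*} [∀ N, MeasurableSpace (Ω N)] (P : ∀ N, Measure (Ω N))
    (X : ∀ N, Ω N → ℝ) : Prop :=
  ∀ t : ℝ, 0 < t → Tendsto (fun N => P N {ω | t ≤ |X N ω|}) atTop (𝓝 0)

/-- An event holds with probability tending to one. -/
def HoldsWHP {Ω : ℕ → Type*} [∀ N, MeasurableSpace (Ω N)] (P : ∀ N, Measure (Ω N))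
    (Q : ∀ N, Ω N → Prop) : Prop :=
  Tendsto (fun N => P N {ω | ¬ Q N ω}) atTop (𝓝 0)

/-- The lasso regime: `Γ₀` has at most `s_*` nonzero entries with `s_*² log(pq) = o(n)`; the
tuning parameter is of order `√(log(pq)/n)` with a constant at least `A₀`; and either `G` is
incoherent on the support of each row of `Γ₀`, or the sparsity condition holds with an additional
factor `log q`. -/
structure LassoRegime {p d K : ℕ → ℕ} (M : ∀ N, Model (p N) (d N) (K N)) (A0 κ : ℝ)
    (lam : ℕ → ℝ) : Prop where
  sparse : ∃ s : ℕ → ℕ, (∀ N, (M N).numNonzero ≤ s N) ∧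
    ((fun N => (s N : ℝ) ^ 2 * Real.log ((p N : ℝ) * (d N * K N))) =o[atTop] nBar M) ∧
    ((∀ N l, Incoherent (M N).G ((M N).rowSupport l) κ) ∨
      (fun N => (s N : ℝ) ^ 2 * Real.log ((p N : ℝ) * (d N * K N)) *
        Real.log ((d N : ℝ) * K N)) =o[atTop] nBar M)
  lam_pos : ∀ N, 0 < lam N
  lam_ge : ∀ᶠ N in atTop, A0 * √(Real.log ((p N : ℝ) * (d N * K N)) / nBar M N) ≤ lam N
  lam_le : ∃ A1 : ℝ, ∀ᶠ N in atTop,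
    lam N ≤ A1 * √((1 + Real.log ((p N : ℝ) * (d N * K N))) / nBar M N)

/-- The group-lasso regime: `Γ₀` has at most `q_*` nonzero columns with
`p q_*² (p ∨ log q) = o(n)`; the tuning parameter is of order `√((p ∨ log q)/n)` with a constant
at least `A₀`; and either `G` is incoherent on the set of nonzero columns of `Γ₀`, or
`q_*² (p ∨ log q) log q = o(n)` as well. -/
structure GroupLassoRegime {p d K : ℕ → ℕ} (M : ∀ N, Model (p N) (d N) (K N)) (A0 κ : ℝ)
    (lam : ℕ → ℝ) : Prop where
  sparse : ∃ qs : ℕ → ℕ, (∀ N, (M N).colSupport.card ≤ qs N) ∧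
    ((fun N => (p N : ℝ) * (qs N : ℝ) ^ 2 * max (p N : ℝ) (Real.log ((d N : ℝ) * K N)))
      =o[atTop] nBar M) ∧
    ((∀ N, Incoherent (M N).G (M N).colSupport κ) ∨
      (fun N => (qs N : ℝ) ^ 2 * max (p N : ℝ) (Real.log ((d N : ℝ) * K N)) *
        Real.log ((d N : ℝ) * K N)) =o[atTop] nBar M)
  lam_pos : ∀ N, 0 < lam N
  lam_ge : ∀ᶠ N in atTop,
    A0 * √(max (p N : ℝ) (Real.log ((d N : ℝ) * K N)) / nBar M N) ≤ lam N
  lam_le : ∃ A1 : ℝ, ∀ᶠ N in atTop,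
    lam N ≤ A1 * √(max (p N : ℝ) (Real.log ((d N : ℝ) * K N)) / nBar M N)

/-- Sampling and estimation: `N` i.i.d. records; estimators of `β₀` and `θ₀` that solve their
estimating equations with probability tending to one and are consistent (uniformly over the
surrogates, at the scale `1/ℓ` of the curvature of the estimating functions). -/
structure Estimation {p d K : ℕ → ℕ} (M : ∀ N, Model (p N) (d N) (K N)) (ℓ : ℕ → ℝ)
    {Ω : ℕ → Type*} [∀ N, MeasurableSpace (Ω N)] (P : ∀ N, Measure (Ω N))
    (W : ∀ N, Fin N → Ω N → Record (p N) (K N))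
    (bV : ∀ N, Ω N → E (p N)) (tV tF : ∀ N, Ω N → Fin (K N) → E (d N)) : Prop where
  indep : ∀ N, iIndepFun (W N) (P N)
  record : ∀ N i, HasLaw (W N i) (M N).recordLaw (P N)
  bV_meas : ∀ N, AEMeasurable (bV N) (P N)
  tV_meas : ∀ N k, AEMeasurable (fun ω => tV N ω k) (P N)
  tF_meas : ∀ N k, AEMeasurable (fun ω => tF N ω k) (P N)
  bV_solves : HoldsWHP P fun N ω => (M N).SolvesBetaV (fun i => W N i ω) (bV N ω)
  tV_solves : HoldsWHP P fun N ω => ∀ k, (M N).SolvesThetaV (fun i => W N i ω) k (tV N ω k)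
  tF_solves : HoldsWHP P fun N ω => ∀ k, (M N).SolvesThetaF (fun i => W N i ω) k (tF N ω k)
  bV_consistent : ∀ t : ℝ, 0 < t →
    HoldsWHP P fun N ω => ℓ N * ‖bV N ω - (M N).beta0‖ < t
  tV_consistent : ∀ t : ℝ, 0 < t →
    HoldsWHP P fun N ω => ∀ k, ℓ N * ‖tV N ω k - (M N).theta0 k‖ < t
  tF_consistent : ∀ t : ℝ, 0 < t →
    HoldsWHP P fun N ω => ∀ k, ℓ N * ‖tF N ω k - (M N).theta0 k‖ < t

/-- `√n · T(b - β₀)` for a linear map `T : ℝ^p → ℝ^a`, with `n` the realized number of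
validated subjects. -/
def scaled {p d K N a : ℕ} (M : Model p d K) (D : Fin N → Record p K)
    (T : Matrix (Fin a) (Fin p) ℝ) (b : E p) : E a :=
  √(Model.nValid D : ℝ) • WithLp.toLp 2 (T.mulVec fun l => b l - M.beta0 l)

/-- `√n (b_N - β₀)` is asymptotically `N(0, r V_N)`. Since the dimensions may grow with `N`, this
is stated for the images under arbitrary linear maps `T_N : ℝ^{p_N} → ℝ^a` with `a` fixed and
bounded absolute row sums (when `p` does not depend on `N`, `T` may be the identity): the law of
`√n T(b - β₀)` and `N(0, r T V Tᵀ)` merge weakly, and if `r T V Tᵀ` converges to `S`, then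
`√n T(b - β₀)` converges in distribution to `N(0, S)`. -/
def AsympNormal {p d K : ℕ → ℕ} (M : ∀ N, Model (p N) (d N) (K N))
    {Ω : ℕ → Type*} [∀ N, MeasurableSpace (Ω N)] (P : ∀ N, Measure (Ω N))
    [∀ N, IsProbabilityMeasure (P N)]
    (W : ∀ N, Fin N → Ω N → Record (p N) (K N)) (b : ∀ N, Ω N → E (p N))
    (V : ∀ N, Matrix (Fin (p N)) (Fin (p N)) ℝ) : Prop :=
  ∀ (a : ℕ) (T : ∀ N, Matrix (Fin a) (Fin (p N)) ℝ),
    (∃ Q : ℝ, ∀ N i, ∑ l, |T N i l| ≤ Q) →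
    (∀ f : E a →ᵇ ℝ, Tendsto (fun N =>
      (∫ ω, f (scaled (M N) (fun i => W N i ω) (T N) (b N ω)) ∂(P N)) -
        ∫ x, f x ∂(multivariateGaussian 0 ((M N).r • (T N * V N * (T N).transpose))))
      atTop (𝓝 0)) ∧
    ∀ S : Matrix (Fin a) (Fin a) ℝ,
      Tendsto (fun N => (M N).r • (T N * V N * (T N).transpose)) atTop (𝓝 S) →
      TendstoInDistribution
        (fun N ω => scaled (M N) (fun i => W N i ω) (T N) (b N ω)) atTop
        (fun x : E a => x) P (multivariateGaussian 0 S)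

end SPI

end

/-!
# Efficiency of the surrogate-powered estimator

Everything is a triangular array: dimensions, laws and estimating functions change with `N`, so
all bounds below are explicit in `N` and every limit is taken through statements "with probability
tending to one" (`WHP`), along a filter `l ≤ atTop` where a case distinction on `N` is needed.

**Linearization.** A Taylor expansion of an estimating equation around the true parameter
(`root_expansion`) turns consistency into an expansion `θ̂ - θ₀ = η̄ + o(N^{-1/2})`, where `η̄` is
an average of influence functions, provided that the empirical Jacobian is close to its mean in
operator norm and that `ℓ (p + d + log q) = o(√N)`. For the `K` surrogates this has to hold
uniformly: the operator norms are reduced to finitely many directions by a net of the sphere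
(`sphereNet`) and Bernstein's inequality is applied with a union bound over directions and
surrogates. For `β` second moments suffice (`beta_expansion`, `theta_expansion`). The slack in the
growth condition is spent on a factor `w N → ∞` (`SlowScale`) that absorbs all constants.

**Normality.** Consequently `β̂_V - Γ₀ (θ̂_V - θ̂_F) - β₀` is, up to `o(N^{-1/2})` in each bounded
direction, the average of the i.i.d. variables `ψ̃_{Γ₀}`, and `β̂_V - β₀` that of `ψ̃₀`. A central
limit theorem for arrays whose summands have uniformly bounded sub-Gaussian norm
(`asymptotic_normality_array`) gives the Gaussian approximation, and `n / N ≈ r` changes the scale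
to `√n`.

**Variance.** Writing `ψ̃_Γ = ψ + (R - ρ)/ρ · (ψ - Γη)`, the variance is a quadratic function of
`Γ` whose normal equation is `Γ G = H`; completing the square gives
`Var ψ̃_Γ = Σ + (Γ - Γ₀) G (Γ - Γ₀)ᵀ` with `Σ = Var ψ̃_{Γ₀}`, which is the no-harm statement.

**The estimated weights.** `β̂_SPI+ - β̂*_SPI = -(Γ̂ - Γ₀)(θ̂_V - θ̂_F)`, so the task is to show
that this product is `o(N^{-1/2})`. The deterministic lasso analysis treats both penalties at
once: a lasso is a family of group problems with groups in `ℝ`, the group lasso one problem with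
groups in `ℝ^p`. It gives three bounds, collected in `FitBound`. Let `b` be `log (pq)` or
`p ∨ log q`, so that the noise of the regression and `λ` are of order `√(b / N)`.

* If `b` grows slower than a suitable diverging sequence, `p` and `q` are bounded by a slowly
  diverging sequence and any crude bound suffices (`whp_gap_of_crude`). This regime is
  separate because events with probability tending to one are only available at levels `√(x / N)`
  with `x → ∞`, whereas `λ` may be as small as a constant times `√(b / N)` with `b` bounded.
* Otherwise `b → ∞`, and `‖Γ̂ - Γ₀‖₁ ≲ s λ` together with `‖θ̂_V - θ̂_F‖_∞ ≲ √(log q / N)` yields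
  `s √(b log q) / √N → 0` under the stronger sparsity condition (`whp_gap_of_fast`).
* Under incoherence `Γ̂` vanishes off the support of `Γ₀` (the optimality condition tested in a
  corrected direction, `support_recovery`). Only the coordinates of `θ̂_V - θ̂_F` on that support
  matter, their Euclidean norm is `O(√(s / N))` without logarithm, and the `ℓ²` rate `√s λ` for
  `Γ̂ - Γ₀` gives `s √b / √N → 0` (`whp_gap_of_sparse`).

`whp_gap` combines the three.
-/

namespace SPI

/-! ### Orlicz bounds and moments -/

/-- Every polynomial moment is controlled by the exponential moment, because
`u ^ k ≤ k! * exp u`. -/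
lemma abs_pow_le_exp {M : ℝ} (hM : 0 < M) (k : ℕ) (x : ℝ) :
    |x| ^ k ≤ k.factorial * M ^ k * Real.exp (|x| / M) := by
  have h0 : 0 ≤ |x| / M := by positivity
  have h := Real.pow_div_factorial_le_exp _ h0 k
  rw [div_le_iff₀ (by positivity), div_pow, div_le_iff₀ (by positivity)] at h
  linarith

section Orlicz

variable {α : Type*} [MeasurableSpace α] {μ : Measure α} {X : α → ℝ} {M : ℝ}

lemma OrliczLE.integrable_exp (h : OrliczLE 1 X M μ) :
    Integrable (fun w => Real.exp (|X w| / M)) μ := by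
  have hm : AEMeasurable (fun w => Real.exp (|X w| / M)) μ := by
    have := h.1
    exact ((this.norm).div_const M).exp
  refine ⟨hm.aestronglyMeasurable, ?_⟩
  rw [hasFiniteIntegral_iff_ofReal (ae_of_all _ fun _ => (Real.exp_pos _).le)]
  exact lt_of_le_of_lt (by simpa using h.2) ENNReal.ofNat_lt_top

lemma OrliczLE.integral_exp_le (h : OrliczLE 1 X M μ) :
    ∫ w, Real.exp (|X w| / M) ∂μ ≤ 2 := by
  rw [integral_eq_lintegral_of_nonneg_ae (ae_of_all _ fun _ => (Real.exp_pos _).le)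
    h.integrable_exp.1]
  refine ENNReal.toReal_le_of_le_ofReal (by norm_num) ?_
  simpa using h.2

lemma OrliczLE.integrable_pow (h : OrliczLE 1 X M μ) (hM : 0 < M) (k : ℕ) :
    Integrable (fun w => X w ^ k) μ := by
  refine (h.integrable_exp.const_mul (k.factorial * M ^ k)).mono'
    (h.1.pow_const k).aestronglyMeasurable (ae_of_all _ fun w => ?_)
  rw [norm_pow, Real.norm_eq_abs]
  exact abs_pow_le_exp hM k (X w)

lemma OrliczLE.integrable (h : OrliczLE 1 X M μ) (hM : 0 < M) : Integrable X μ := by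
  simpa using h.integrable_pow hM 1

lemma OrliczLE.integral_sq_le (h : OrliczLE 1 X M μ) (hM : 0 < M) :
    ∫ w, X w ^ 2 ∂μ ≤ 4 * M ^ 2 := by
  calc ∫ w, X w ^ 2 ∂μ ≤ ∫ w, 2 * M ^ 2 * Real.exp (|X w| / M) ∂μ := by
        refine integral_mono (h.integrable_pow hM 2) (h.integrable_exp.const_mul _) fun w => ?_
        simpa using abs_pow_le_exp hM 2 (X w)
    _ = 2 * M ^ 2 * ∫ w, Real.exp (|X w| / M) ∂μ := integral_const_mul _ _
    _ ≤ 2 * M ^ 2 * 2 := by gcongr; exact h.integral_exp_le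
    _ = 4 * M ^ 2 := by ring

lemma OrliczLE.memLp_two (h : OrliczLE 1 X M μ) (hM : 0 < M) : MemLp X 2 μ :=
  (memLp_two_iff_integrable_sq h.1.aestronglyMeasurable).2 (h.integrable_pow hM 2)

lemma OrliczLE.of_abs_le {a : ℕ} {Y : α → ℝ} {M' : ℝ} (h : OrliczLE a X M μ) (hM' : 0 < M')
    (hY : AEMeasurable Y μ) (hle : ∀ᵐ w ∂μ, |Y w| / M' ≤ |X w| / M) : OrliczLE a Y M' μ := by
  refine ⟨hY, le_trans (lintegral_mono_ae ?_) h.2⟩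
  filter_upwards [hle] with w hw
  gcongr

lemma OrliczLE.mono {a : ℕ} {M' : ℝ} (h : OrliczLE a X M μ) (hM : 0 < M) (hle : M ≤ M') :
    OrliczLE a X M' μ :=
  h.of_abs_le (hM.trans_le hle) h.1 (ae_of_all _ fun w => by gcongr)

/-- The product of two sub-Gaussian variables is sub-exponential, since
`exp (u * v) ≤ (exp (u ^ 2) + exp (v ^ 2)) / 2`. -/
lemma OrliczLE.mul {Y : α → ℝ} (hX : OrliczLE 2 X M μ) (hY : OrliczLE 2 Y M μ) :
    OrliczLE 1 (fun w => X w * Y w) (M ^ 2) μ := by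
  refine ⟨hX.1.mul hY.1, ?_⟩
  have key : ∀ w, ENNReal.ofReal (Real.exp ((|X w * Y w| / M ^ 2) ^ 1)) ≤
      ENNReal.ofReal (1 / 2) * (ENNReal.ofReal (Real.exp ((|X w| / M) ^ 2)) +
        ENNReal.ofReal (Real.exp ((|Y w| / M) ^ 2))) := by
    intro w
    rw [← ENNReal.ofReal_add (by positivity) (by positivity), ← ENNReal.ofReal_mul (by norm_num)]
    apply ENNReal.ofReal_le_ofReal
    rw [pow_one, abs_mul]
    have h1 : |X w| * |Y w| / M ^ 2 = |X w| / M * (|Y w| / M) := by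
      rw [sq]; exact mul_div_mul_comm _ _ _ _
    rw [h1]
    set u := |X w| / M
    set v := |Y w| / M
    have h2 : Real.exp (u * v) ≤ Real.exp (u ^ 2 / 2) * Real.exp (v ^ 2 / 2) := by
      rw [← Real.exp_add]; apply Real.exp_le_exp.2; nlinarith [sq_nonneg (u - v)]
    have h3 : Real.exp (u ^ 2) = Real.exp (u ^ 2 / 2) ^ 2 := by
      rw [← Real.exp_nat_mul]; congr 1; push_cast; ring
    have h4 : Real.exp (v ^ 2) = Real.exp (v ^ 2 / 2) ^ 2 := by
      rw [← Real.exp_nat_mul]; congr 1; push_cast; ring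
    rw [h3, h4]
    nlinarith [sq_nonneg (Real.exp (u ^ 2 / 2) - Real.exp (v ^ 2 / 2))]
  have mX : AEMeasurable (fun w => ENNReal.ofReal (Real.exp ((|X w| / M) ^ 2))) μ := by
    have := hX.1
    exact (((this.norm.div_const M).pow_const 2).exp).ennreal_ofReal
  calc _ ≤ ∫⁻ w, ENNReal.ofReal (1 / 2) * (ENNReal.ofReal (Real.exp ((|X w| / M) ^ 2)) +
        ENNReal.ofReal (Real.exp ((|Y w| / M) ^ 2))) ∂μ := lintegral_mono key
    _ = ENNReal.ofReal (1 / 2) * (∫⁻ w, ENNReal.ofReal (Real.exp ((|X w| / M) ^ 2)) ∂μ +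
        ∫⁻ w, ENNReal.ofReal (Real.exp ((|Y w| / M) ^ 2)) ∂μ) := by
      rw [lintegral_const_mul' _ _ (by simp), lintegral_add_left' mX]
    _ ≤ ENNReal.ofReal (1 / 2) * (2 + 2) := by gcongr; exacts [hX.2, hY.2]
    _ = 2 := by
      rw [show (2 : ENNReal) + 2 = ENNReal.ofReal 4 by norm_num, ← ENNReal.ofReal_mul (by norm_num)]
      norm_num

/-- A sub-Gaussian variable is sub-exponential: `u / 2 ≤ u ^ 2 / 4 + 1 / 4`. -/
lemma OrliczLE.one_of_two [IsProbabilityMeasure μ] (h : OrliczLE 2 X M μ) (hM : 0 < M) :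
    OrliczLE 1 X (2 * M) μ := by
  refine ⟨h.1, ?_⟩
  have key : ∀ w, ENNReal.ofReal (Real.exp ((|X w| / (2 * M)) ^ 1)) ≤
      ENNReal.ofReal (1 / 4) * (4 + ENNReal.ofReal (Real.exp ((|X w| / M) ^ 2)) * 2) := by
    intro w
    rw [show (4 : ENNReal) = ENNReal.ofReal 4 by norm_num,
      show (2 : ENNReal) = ENNReal.ofReal 2 by norm_num, ← ENNReal.ofReal_mul (by positivity),
      ← ENNReal.ofReal_add (by positivity) (by positivity), ← ENNReal.ofReal_mul (by norm_num)]
    apply ENNReal.ofReal_le_ofReal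
    rw [pow_one, show |X w| / (2 * M) = (|X w| / M) / 2 by field_simp]
    set u := |X w| / M
    have h1 : Real.exp (u / 2) ≤ Real.exp (1 / 4) * Real.exp (u ^ 2 / 4) := by
      rw [← Real.exp_add]; apply Real.exp_le_exp.2; nlinarith [sq_nonneg (u - 1)]
    have h2 : Real.exp (u ^ 2) = Real.exp (u ^ 2 / 4) ^ 4 := by
      rw [← Real.exp_nat_mul]; congr 1; push_cast; ring
    have h3 : Real.exp (1 / 4 : ℝ) ≤ 4 / 3 := by
      have : Real.exp (1 / 4 : ℝ) ^ 4 ≤ (4 / 3) ^ 4 := by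
        rw [← Real.exp_nat_mul]
        norm_num
        linarith [Real.exp_one_lt_d9]
      exact le_of_pow_le_pow_left₀ (by norm_num) (by norm_num) this
    have h4 : 0 < Real.exp (u ^ 2 / 4) := Real.exp_pos _
    rw [h2]
    set y := Real.exp (u ^ 2 / 4)
    have h5 : 4 / 3 * y ≤ 1 + y ^ 4 / 2 := by
      nlinarith [sq_nonneg (y ^ 2 - 1), sq_nonneg (y - 1), sq_nonneg (y ^ 2 - 2 / 3),
        sq_nonneg (y - 2 / 3)]
    nlinarith
  calc _ ≤ ∫⁻ w, ENNReal.ofReal (1 / 4) *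
        (4 + ENNReal.ofReal (Real.exp ((|X w| / M) ^ 2)) * 2) ∂μ := lintegral_mono key
    _ = ENNReal.ofReal (1 / 4) *
        (4 + (∫⁻ w, ENNReal.ofReal (Real.exp ((|X w| / M) ^ 2)) ∂μ) * 2) := by
      rw [lintegral_const_mul' _ _ (by simp), lintegral_add_left measurable_const,
        lintegral_mul_const' _ _ (by simp)]
      simp
    _ ≤ ENNReal.ofReal (1 / 4) * (4 + 2 * 2) := by gcongr; exact h.2
    _ = 2 := by
      rw [show (4 : ENNReal) + 2 * 2 = ENNReal.ofReal 8 by norm_num,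
        ← ENNReal.ofReal_mul (by norm_num)]
      norm_num

/-- The moment generating function of a sub-exponential variable near the origin, without any
centring: `E exp (θ X) ≤ exp (θ E X + 16 θ² M²)` for `|θ| ≤ 1 / (2 M)`. -/
lemma OrliczLE.mgf_le [IsProbabilityMeasure μ] (h : OrliczLE 1 X M μ) (hM : 0 < M) {θ : ℝ}
    (hθ : |θ| * (2 * M) ≤ 1) :
    Integrable (fun w => Real.exp (θ * X w)) μ ∧
      ∫ w, Real.exp (θ * X w) ∂μ ≤ Real.exp (θ * ∫ w, X w ∂μ + 16 * θ ^ 2 * M ^ 2) := by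
  have key : ∀ w, Real.exp (θ * X w) ≤ 1 + θ * X w + 8 * θ ^ 2 * M ^ 2 * Real.exp (|X w| / M) := by
    intro w
    have h1 : |θ * X w| ≤ |X w| / M / 2 := by
      rw [abs_mul, div_div, le_div_iff₀ (by positivity)]
      nlinarith [abs_nonneg (X w)]
    have h2 : Real.exp (θ * X w) - (1 + θ * X w) ≤ |θ * X w| ^ 2 * Real.exp |θ * X w| := by
      have := Complex.norm_exp_sub_sum_le_norm_mul_exp (θ * X w : ℝ) 2
      simp only [Finset.sum_range_succ, Finset.range_zero, Finset.sum_empty, Complex.norm_real,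
        Real.norm_eq_abs] at this
      have h3 : Complex.exp ((θ * X w : ℝ) : ℂ) -
          (0 + ((θ * X w : ℝ) : ℂ) ^ 0 / (Nat.factorial 0 : ℂ) +
          ((θ * X w : ℝ) : ℂ) ^ 1 / (Nat.factorial 1 : ℂ)) =
          ((Real.exp (θ * X w) - (1 + θ * X w) : ℝ) : ℂ) := by
        push_cast; simp
      rw [h3, Complex.norm_real] at this
      exact (le_abs_self _).trans this
    set u := |X w| / M with hu
    have hu0 : 0 ≤ u := by positivity
    have h4 : |θ * X w| ^ 2 = θ ^ 2 * M ^ 2 * u ^ 2 := by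
      rw [abs_mul, mul_pow, sq_abs, hu, div_pow]; field_simp
    have h5 : u ^ 2 ≤ 8 * Real.exp (u / 2) := by
      have := Real.pow_div_factorial_le_exp (u / 2) (by positivity) 2
      norm_num at this; nlinarith
    have h6 : Real.exp |θ * X w| ≤ Real.exp (u / 2) := Real.exp_le_exp.2 h1
    have h7 : Real.exp u = Real.exp (u / 2) * Real.exp (u / 2) := by
      rw [← Real.exp_add]; congr 1; ring
    have h8 : |θ * X w| ^ 2 * Real.exp |θ * X w| ≤
        θ ^ 2 * M ^ 2 * (8 * Real.exp (u / 2)) * Real.exp (u / 2) := by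
      rw [h4]; gcongr
    rw [h7]; nlinarith
  have hi := h.integrable hM
  have hbi : Integrable (fun w => 1 + θ * X w + 8 * θ ^ 2 * M ^ 2 * Real.exp (|X w| / M)) μ :=
    ((integrable_const _).add (hi.const_mul _)).add (h.integrable_exp.const_mul _)
  have hint : Integrable (fun w => Real.exp (θ * X w)) μ := by
    refine hbi.mono' ((h.1.const_mul θ).exp).aestronglyMeasurable (ae_of_all _ fun w => ?_)
    rw [Real.norm_eq_abs, Real.abs_exp]
    exact key w
  refine ⟨hint, (integral_mono hint hbi key).trans ?_⟩
  have hsplit : ∫ w, (1 + θ * X w + 8 * θ ^ 2 * M ^ 2 * Real.exp (|X w| / M)) ∂μ =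
      1 + θ * ∫ w, X w ∂μ + 8 * θ ^ 2 * M ^ 2 * ∫ w, Real.exp (|X w| / M) ∂μ := by
    rw [integral_add (f := fun w => 1 + θ * X w) ((integrable_const _).add (hi.const_mul _))
      (h.integrable_exp.const_mul _), integral_add (integrable_const _) (hi.const_mul _),
      integral_const_mul, integral_const_mul]
    simp
  rw [hsplit]
  have := h.integral_exp_le
  have h9 := Real.add_one_le_exp (θ * ∫ w, X w ∂μ + 16 * θ ^ 2 * M ^ 2)
  have h10 : 8 * θ ^ 2 * M ^ 2 * ∫ w, Real.exp (|X w| / M) ∂μ ≤ 8 * θ ^ 2 * M ^ 2 * 2 := by gcongr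
  linarith

end Orlicz

/-! ### Averages over an i.i.d. sample -/

/-- `W` is an i.i.d. sample of size `N` from the law `μ`. -/
structure IsSample {α Ω : Type*} [MeasurableSpace α] [MeasurableSpace Ω] {N : ℕ}
    (W : Fin N → Ω → α) (μ : Measure α) (P : Measure Ω) : Prop where
  indep : iIndepFun W P
  law : ∀ i, HasLaw (W i) μ P

/-- The average of `f` over the data `D`; it is zero for an empty data set. -/
noncomputable def avg {α : Type*} {N : ℕ} (D : Fin N → α) (f : α → ℝ) : ℝ :=
  1 / (N : ℝ) * ∑ i, f (D i)

section Sample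

variable {α Ω : Type*} [MeasurableSpace α] [MeasurableSpace Ω] {N : ℕ} {W : Fin N → Ω → α}
  {μ : Measure α} {P : Measure Ω} {f : α → ℝ}

lemma IsSample.iIndepFun_comp (h : IsSample W μ P) {β : Type*} [MeasurableSpace β] {f : α → β}
    (hf : AEMeasurable f μ) : iIndepFun (fun i ω => f (W i ω)) P := by
  have := h.indep.comp₀ (fun _ => f) (fun i => (h.law i).aemeasurable)
    (fun i => by rw [(h.law i).map_eq]; exact hf)
  exact this

lemma IsSample.aemeasurable_comp (h : IsSample W μ P) {β : Type*} [MeasurableSpace β] {f : α → β}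
    (hf : AEMeasurable f μ) (i : Fin N) : AEMeasurable (fun ω => f (W i ω)) P := by
  have := (h.law i).aemeasurable
  refine AEMeasurable.comp_aemeasurable ?_ this
  rw [(h.law i).map_eq]; exact hf

lemma IsSample.integral_comp (h : IsSample W μ P) {F : Type*} [NormedAddCommGroup F]
    [NormedSpace ℝ F] {f : α → F} (hf : AEStronglyMeasurable f μ) (i : Fin N) :
    ∫ ω, f (W i ω) ∂P = ∫ x, f x ∂μ := by
  rw [← (h.law i).map_eq, integral_map (h.law i).aemeasurable]
  rw [(h.law i).map_eq]; exact hf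

lemma IsSample.integrable_comp (h : IsSample W μ P) {F : Type*} [NormedAddCommGroup F]
    {f : α → F} (hf : Integrable f μ) (i : Fin N) : Integrable (fun ω => f (W i ω)) P := by
  rw [← (h.law i).map_eq] at hf
  exact hf.comp_aemeasurable (h.law i).aemeasurable

/-- An almost sure property of the law holds for all members of the sample. -/
lemma IsSample.ae_all (h : IsSample W μ P) {p : α → Prop} (hp : ∀ᵐ x ∂μ, p x) :
    ∀ᵐ ω ∂P, ∀ i, p (W i ω) := by
  refine ae_all_iff.2 fun i => ?_
  rw [← (h.law i).map_eq] at hp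
  exact ae_of_ae_map (h.law i).aemeasurable hp

lemma avg_neg {α : Type*} (D : Fin N → α) (f : α → ℝ) : avg D (fun x => - f x) = - avg D f := by
  simp [avg]

/-- One-sided Bernstein inequality for averages of sub-exponential variables. -/
lemma IsSample.bernstein_upper [IsProbabilityMeasure P] [IsProbabilityMeasure μ]
    (h : IsSample W μ P) {M t : ℝ}
    (hM : 0 < M) (hf : OrliczLE 1 f M μ) (ht : 0 ≤ t) (htM : t ≤ 16 * M) :
    P.real {ω | t ≤ avg (fun i => W i ω) f - ∫ x, f x ∂μ} ≤
      Real.exp (-(N * t ^ 2 / (64 * M ^ 2))) := by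
  rcases Nat.eq_zero_or_pos N with rfl | hN
  · simp
  have hN' : (0 : ℝ) < N := by exact_mod_cast hN
  -- the minimizer of the Chernoff exponent `16 θ² M² - θ t`
  set θ : ℝ := t / (32 * M ^ 2) with hθ
  have hθ0 : 0 ≤ θ := by positivity
  have hθM : |θ| * (2 * M) ≤ 1 := by
    rw [abs_of_nonneg hθ0, hθ, div_mul_eq_mul_div, div_le_one (by positivity)]
    nlinarith
  obtain ⟨hi, hle⟩ := hf.mgf_le hM hθM
  set e := ∫ x, f x ∂μ with he
  have hmeas : ∀ i, AEMeasurable (fun ω => f (W i ω)) P := h.aemeasurable_comp hf.1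
  have hind := h.iIndepFun_comp hf.1
  have hint : ∀ i, Integrable (fun ω => Real.exp (θ * f (W i ω))) P := fun i =>
    h.integrable_comp hi i
  have hmgf : ∀ i, mgf (fun ω => f (W i ω)) P θ ≤ Real.exp (θ * e + 16 * θ ^ 2 * M ^ 2) := by
    intro i
    have := h.integral_comp hi.1 i
    simp only [mgf]
    rw [this]; exact hle
  -- the moment generating function is a product of positive numbers, hence not a junk value
  have hsumint : Integrable (fun ω => Real.exp (θ * (∑ i, fun ω => f (W i ω)) ω)) P := by
    by_contra hcon
    have h0 := mgf_undef hcon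
    rw [hind.mgf_sum₀ hmeas] at h0
    exact (Finset.prod_pos fun i _ => mgf_pos (hint i)).ne' h0
  have hset : {ω | t ≤ avg (fun i => W i ω) f - e} ⊆
      {ω | N * (t + e) ≤ (∑ i, fun ω => f (W i ω)) ω} := by
    intro ω hω
    simp only [Set.mem_ofPred_eq, avg, Finset.sum_apply] at hω ⊢
    have h1 : t + e ≤ 1 / (N : ℝ) * ∑ i, f (W i ω) := by linarith
    rw [one_div, inv_mul_eq_div, le_div_iff₀ hN'] at h1
    linarith
  calc _ ≤ P.real {ω | N * (t + e) ≤ (∑ i, fun ω => f (W i ω)) ω} := measureReal_mono hset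
    _ ≤ Real.exp (-θ * (N * (t + e))) * mgf (∑ i, fun ω => f (W i ω)) P θ :=
      measure_ge_le_exp_mul_mgf _ hθ0 hsumint
    _ ≤ Real.exp (-θ * (N * (t + e))) * Real.exp (θ * e + 16 * θ ^ 2 * M ^ 2) ^ N := by
      rw [hind.mgf_sum₀ hmeas]
      gcongr
      calc _ ≤ ∏ i : Fin N, Real.exp (θ * e + 16 * θ ^ 2 * M ^ 2) :=
            Finset.prod_le_prod (fun i _ => mgf_nonneg) fun i _ => hmgf i
        _ = _ := by simp
    _ = Real.exp (-(N * t ^ 2 / (64 * M ^ 2))) := by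
      rw [← Real.exp_nat_mul, ← Real.exp_add]
      congr 1
      rw [hθ]; field_simp; ring

/-- Bernstein's inequality for averages of sub-exponential variables. -/
lemma IsSample.bernstein [IsProbabilityMeasure P] [IsProbabilityMeasure μ]
    (h : IsSample W μ P) {M t : ℝ}
    (hM : 0 < M) (hf : OrliczLE 1 f M μ) (ht : 0 ≤ t) (htM : t ≤ 16 * M) :
    P.real {ω | t ≤ |avg (fun i => W i ω) f - ∫ x, f x ∂μ|} ≤
      2 * Real.exp (-(N * t ^ 2 / (64 * M ^ 2))) := by
  have hneg : OrliczLE 1 (fun x => - f x) M μ :=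
    hf.of_abs_le hM hf.1.neg (ae_of_all _ fun w => by rw [abs_neg])
  have h1 := h.bernstein_upper hM hf ht htM
  have h2 := h.bernstein_upper hM hneg ht htM
  have hset : {ω | t ≤ |avg (fun i => W i ω) f - ∫ x, f x ∂μ|} ⊆
      {ω | t ≤ avg (fun i => W i ω) f - ∫ x, f x ∂μ} ∪
        {ω | t ≤ avg (fun i => W i ω) (fun x => - f x) - ∫ x, - f x ∂μ} := by
    intro ω hω
    simp only [Set.mem_ofPred_eq, Set.mem_union, avg_neg, integral_neg] at hω ⊢
    rcases le_abs.1 hω with h | h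
    · exact Or.inl h
    · right; linarith
  calc _ ≤ _ := measureReal_mono hset
    _ ≤ _ := measureReal_union_le _ _
    _ ≤ _ := by linarith

/-- Bernstein's inequality, uniformly over a finite family. -/
lemma IsSample.bernstein_family [IsProbabilityMeasure P] [IsProbabilityMeasure μ]
    (h : IsSample W μ P) {M t : ℝ} (hM : 0 < M) (ht : 0 ≤ t) (htM : t ≤ 16 * M)
    {ι : Type*} (s : Finset ι) {F : ι → α → ℝ} (hF : ∀ j ∈ s, OrliczLE 1 (F j) M μ) :
    P {ω | ¬ ∀ j ∈ s, |avg (fun i => W i ω) (F j) - ∫ x, F j x ∂μ| < t} ≤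
      ENNReal.ofReal (2 * s.card * Real.exp (-(N * t ^ 2 / (64 * M ^ 2)))) := by
  have hset : {ω | ¬ ∀ j ∈ s, |avg (fun i => W i ω) (F j) - ∫ x, F j x ∂μ| < t} =
      ⋃ j ∈ s, {ω | t ≤ |avg (fun i => W i ω) (F j) - ∫ x, F j x ∂μ|} := by
    ext ω; simp
  rw [hset]
  refine (measure_biUnion_finset_le _ _).trans ?_
  calc _ ≤ ∑ j ∈ s, ENNReal.ofReal (2 * Real.exp (-(N * t ^ 2 / (64 * M ^ 2)))) := by
        refine Finset.sum_le_sum fun j hj => ?_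
        rw [← ofReal_measureReal]
        exact ENNReal.ofReal_le_ofReal (h.bernstein hM (hF j hj) ht htM)
    _ = _ := by
      rw [Finset.sum_const, nsmul_eq_mul, ← ENNReal.ofReal_natCast,
        ← ENNReal.ofReal_mul (by positivity)]
      congr 1; ring

/-- The mean square error of an average of i.i.d. variables. -/
lemma IsSample.integral_sq_avg_le [IsProbabilityMeasure P] [IsProbabilityMeasure μ]
    (h : IsSample W μ P) (hf : MemLp f 2 μ) (hN : 0 < N) :
    ∫⁻ ω, ENNReal.ofReal ((avg (fun i => W i ω) f - ∫ x, f x ∂μ) ^ 2) ∂P ≤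
      ENNReal.ofReal (1 / N * ∫ x, f x ^ 2 ∂μ) := by
  have hN' : (0 : ℝ) < N := by exact_mod_cast hN
  have hmem : ∀ i, MemLp (fun ω => f (W i ω)) 2 P := by
    intro i
    have := hf
    rw [← (h.law i).map_eq] at this
    exact this.comp_of_map (h.law i).aemeasurable
  have hind := h.iIndepFun_comp hf.aemeasurable
  have hmean : ∫ ω, avg (fun i => W i ω) f ∂P = ∫ x, f x ∂μ := by
    simp only [avg]
    rw [integral_const_mul, integral_finsetSum _ (fun i _ => (hmem i).integrable (by norm_num))]
    simp_rw [h.integral_comp hf.1]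
    simp; field_simp
  have hmemavg : MemLp (fun ω => avg (fun i => W i ω) f) 2 P :=
    (memLp_finsetSum _ (fun i _ => hmem i)).const_mul _
  have hvar : variance (fun ω => avg (fun i => W i ω) f) P ≤ 1 / N * ∫ x, f x ^ 2 ∂μ := by
    have e1 : (fun ω => avg (fun i => W i ω) f) =
        fun ω => 1 / (N : ℝ) * (∑ i, fun ω => f (W i ω)) ω := by
      ext ω; simp [avg]
    rw [e1, variance_const_mul, IndepFun.variance_sum (fun i _ => hmem i)
      (fun i _ j _ hij => hind.indepFun hij)]
    have : ∀ i, variance (fun ω => f (W i ω)) P ≤ ∫ x, f x ^ 2 ∂μ := by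
      intro i
      refine (variance_le_expectation_sq (hmem i).aestronglyMeasurable).trans ?_
      have := h.integral_comp (f := fun x => f x ^ 2) (hf.1.pow 2) i
      simpa using this.le
    calc _ ≤ (1 / (N : ℝ)) ^ 2 * ∑ i : Fin N, ∫ x, f x ^ 2 ∂μ := by
          gcongr; exact this _
      _ = _ := by simp; field_simp
  have := variance_eq_integral hmemavg.aemeasurable
  rw [hmean] at this
  rw [this] at hvar
  rw [← ofReal_integral_eq_lintegral_ofReal]
  · exact ENNReal.ofReal_le_ofReal hvar
  · exact (hmemavg.sub (memLp_const _)).integrable_sq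
  · exact ae_of_all _ fun _ => sq_nonneg _

end Sample


/-! ### Events of probability tending to one -/

/-- An event holds with probability tending to one along the filter `l`; `HoldsWHP` is the case
`l = atTop`. Smaller filters serve to distinguish cases along the sequence. -/
def WHP {Ω : ℕ → Type*} [∀ N, MeasurableSpace (Ω N)] (l : Filter ℕ) (P : ∀ N, Measure (Ω N))
    (Q : ∀ N, Ω N → Prop) : Prop :=
  Tendsto (fun N => P N {ω | ¬ Q N ω}) l (𝓝 0)

section WHP

variable {Ω : ℕ → Type*} [∀ N, MeasurableSpace (Ω N)] {l l' : Filter ℕ} {P : ∀ N, Measure (Ω N)}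
  {Q Q' : ∀ N, Ω N → Prop}

lemma WHP.of_le {b : ℕ → ENNReal} (hb : Tendsto b l (𝓝 0))
    (h : ∀ᶠ N in l, P N {ω | ¬ Q N ω} ≤ b N) : WHP l P Q :=
  tendsto_of_tendsto_of_tendsto_of_le_of_le' tendsto_const_nhds hb
    (Eventually.of_forall fun _ => zero_le) h

lemma WHP.mono_ae (h : WHP l P Q) (hQ : ∀ᶠ N in l, ∀ᵐ ω ∂P N, Q N ω → Q' N ω) : WHP l P Q' := by
  refine WHP.of_le h (hQ.mono fun N hN => measure_mono_ae ?_)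
  filter_upwards [hN] with ω hω using mt hω

lemma WHP.mono (h : WHP l P Q) (hQ : ∀ᶠ N in l, ∀ ω, Q N ω → Q' N ω) : WHP l P Q' :=
  h.mono_ae (hQ.mono fun _ hN => ae_of_all _ hN)

lemma WHP.and (h : WHP l P Q) (h' : WHP l P Q') : WHP l P (fun N ω => Q N ω ∧ Q' N ω) := by
  refine WHP.of_le (b := fun N => P N {ω | ¬ Q N ω} + P N {ω | ¬ Q' N ω})
    (by simpa using Tendsto.add h h') (Eventually.of_forall fun N => ?_)
  refine (measure_mono fun ω hω => ?_).trans (measure_union_le _ _)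
  simp only [Set.mem_ofPred_eq, Set.mem_union] at hω ⊢
  tauto

lemma WHP.filter_mono (h : WHP l P Q) (hl : l' ≤ l) : WHP l' P Q := Tendsto.mono_left h hl

lemma WHP.of_split (S : Set ℕ) (h : WHP (l ⊓ 𝓟 S) P Q) (h' : WHP (l ⊓ 𝓟 Sᶜ) P Q) :
    WHP l P Q := by
  have := Tendsto.sup h h'
  rwa [← inf_sup_left, sup_principal, Set.union_compl_self, principal_univ, inf_top_eq] at this

/-- It is enough to find, for each `η`, an event of probability eventually at least `1 - η`. -/
lemma WHP.of_forall (h : ∀ η : ℝ, 0 < η → ∀ᶠ N in l, P N {ω | ¬ Q N ω} ≤ ENNReal.ofReal η) :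
    WHP l P Q := by
  refine ENNReal.tendsto_nhds_zero.2 fun η hη => ?_
  rcases eq_or_ne η ⊤ with rfl | hη'
  · exact Eventually.of_forall fun _ => le_top
  · have := h η.toReal (ENNReal.toReal_pos hη.ne' hη')
    rwa [ENNReal.ofReal_toReal hη'] at this

/-- Markov's inequality along a sequence. -/
lemma WHP.markov {X : ∀ N, Ω N → ℝ} {b t : ℕ → ℝ} (hX : ∀ N, AEMeasurable (X N) (P N))
    (hb : ∀ᶠ N in l, ∫⁻ ω, ENNReal.ofReal (X N ω) ∂P N ≤ ENNReal.ofReal (b N))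
    (ht : ∀ᶠ N in l, 0 < t N) (hbt : Tendsto (fun N => b N / t N) l (𝓝 0)) :
    WHP l P fun N ω => X N ω < t N := by
  have h0 : Tendsto (fun N => ENNReal.ofReal (b N / t N)) l (𝓝 0) := by
    simpa using ENNReal.tendsto_ofReal hbt
  refine WHP.of_le h0 ?_
  filter_upwards [hb, ht] with N hbN htN
  rw [ENNReal.ofReal_div_of_pos htN]
  refine le_trans ?_ (ENNReal.div_le_div_right hbN _)
  refine le_trans (measure_mono fun ω hω => ?_)
    (meas_ge_le_lintegral_div (hX N).ennreal_ofReal (by simpa using htN) ENNReal.ofReal_ne_top)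
  simp only [Set.mem_ofPred_eq, not_lt] at hω ⊢
  exact ENNReal.ofReal_le_ofReal hω

/-- A bounded-in-probability factor times a factor tending to zero in probability. -/
lemma WHP.mul_of_tight {X Y : ∀ N, Ω N → ℝ} (hY0 : ∀ N ω, 0 ≤ Y N ω)
    (hX : ∀ η : ℝ, 0 < η → ∃ A : ℝ, 0 < A ∧ ∀ᶠ N in l, P N {ω | ¬ X N ω < A} ≤ ENNReal.ofReal η)
    (hY : ∀ t : ℝ, 0 < t → WHP l P fun N ω => Y N ω < t) {t : ℝ} (ht : 0 < t) :
    WHP l P fun N ω => X N ω * Y N ω < t := by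
  refine WHP.of_forall fun η hη => ?_
  obtain ⟨A, hA, hXA⟩ := hX (η / 2) (by positivity)
  have hYA := hY (t / A) (by positivity)
  have hYA' := ENNReal.tendsto_nhds_zero.1 hYA (ENNReal.ofReal (η / 2)) (by simpa using hη)
  filter_upwards [hXA, hYA'] with N h1 h2
  calc P N {ω | ¬ X N ω * Y N ω < t} ≤ P N ({ω | ¬ X N ω < A} ∪ {ω | ¬ Y N ω < t / A}) := by
        refine measure_mono fun ω hω => ?_
        simp only [Set.mem_ofPred_eq, Set.mem_union] at hω ⊢
        by_contra hcon
        push Not at hcon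
        apply hω
        rw [lt_div_iff₀ hA] at hcon
        nlinarith [hY0 N ω]
    _ ≤ ENNReal.ofReal (η / 2) + ENNReal.ofReal (η / 2) :=
      (measure_union_le _ _).trans (add_le_add h1 h2)
    _ = ENNReal.ofReal η := by rw [← ENNReal.ofReal_add] <;> [skip; positivity; positivity]; simp

lemma tendstoZeroInProb_iff {X : ∀ N, Ω N → ℝ} :
    TendstoZeroInProb P X ↔ ∀ t : ℝ, 0 < t → WHP atTop P fun N ω => |X N ω| < t := by
  simp only [TendstoZeroInProb, WHP, not_lt]

/-- Bernstein's inequality along a sequence, for families of at most `exp (b x)` variables, at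
the scale `√(x / N)`, where `x → ∞` and `x / N → 0`. -/
lemma WHP.bernstein [∀ N, IsProbabilityMeasure (P N)] {α : ℕ → Type*}
    [∀ N, MeasurableSpace (α N)] {W : ∀ N, Fin N → Ω N → α N} {μ : ∀ N, Measure (α N)}
    [∀ N, IsProbabilityMeasure (μ N)] (h : ∀ N, IsSample (W N) (μ N) (P N)) (hl : l ≤ atTop)
    {M b A : ℝ} (hM : 0 < M) (hA : 0 ≤ A) (hAb : 64 * M ^ 2 * (b + 1) ≤ A ^ 2) {x : ℕ → ℝ}
    (hx : Tendsto x l atTop) (hxN : Tendsto (fun N => x N / N) l (𝓝 0))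
    {ι : ℕ → Type*} (s : ∀ N, Finset (ι N)) {F : ∀ N, ι N → α N → ℝ}
    (hF : ∀ N, ∀ j ∈ s N, OrliczLE 1 (F N j) M (μ N))
    (hs : ∀ᶠ N in l, ((s N).card : ℝ) ≤ Real.exp (b * x N)) :
    WHP l P fun N ω => ∀ j ∈ s N,
      |avg (fun i => W N i ω) (F N j) - ∫ y, F N j y ∂μ N| < A * √(x N / N) := by
  have hlim : Tendsto (fun N => ENNReal.ofReal (2 * Real.exp (-x N))) l (𝓝 0) := by
    have : Tendsto (fun N => 2 * Real.exp (-x N)) l (𝓝 (2 * 0)) :=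
      (Real.tendsto_exp_neg_atTop_nhds_zero.comp hx).const_mul 2
    simpa using ENNReal.tendsto_ofReal this
  have hsq : Tendsto (fun N => A * √(x N / N)) l (𝓝 0) := by
    simpa using (hxN.sqrt).const_mul A
  refine WHP.of_le hlim ?_
  filter_upwards [hs, hx.eventually_ge_atTop 0, hl (eventually_gt_atTop 0),
    hsq.eventually_le_const (show 0 < 16 * M by positivity)] with N hsN hxN0 hN htM
  refine ((h N).bernstein_family hM (by positivity) htM (s N) (hF N)).trans
    (ENNReal.ofReal_le_ofReal ?_)
  have hN' : (0 : ℝ) < N := by exact_mod_cast hN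
  have e1 : (N : ℝ) * (A * √(x N / N)) ^ 2 / (64 * M ^ 2) = A ^ 2 * x N / (64 * M ^ 2) := by
    rw [mul_pow, Real.sq_sqrt (by positivity)]; field_simp
  have e2 : (b + 1) * x N ≤ A ^ 2 * x N / (64 * M ^ 2) := by
    rw [le_div_iff₀ (by positivity)]; nlinarith
  rw [e1]
  calc 2 * ((s N).card : ℝ) * Real.exp (-(A ^ 2 * x N / (64 * M ^ 2)))
      ≤ 2 * Real.exp (b * x N) * Real.exp (-((b + 1) * x N)) := by gcongr
    _ = 2 * Real.exp (-x N) := by rw [mul_assoc, ← Real.exp_add]; congr 2; ring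

end WHP

/-- A sequence that grows to infinity slowly enough not to spoil a given null sequence. -/
lemma exists_slow {a : ℕ → ℝ} (ha : Tendsto a atTop (𝓝 0)) :
    ∃ w : ℕ → ℝ, (∀ N, 1 ≤ w N) ∧ Tendsto w atTop atTop ∧
      Tendsto (fun N => w N * a N) atTop (𝓝 0) := by
  set b : ℕ → ℝ := fun N => |a N| + 1 / ((N : ℝ) + 1) with hb
  have hb0 : ∀ N, 0 < b N := fun N => by positivity
  have hblim : Tendsto b atTop (𝓝 0) := by
    have := ha.abs.add tendsto_one_div_add_atTop_nhds_zero_nat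
    simpa [hb] using this
  have hsq : Tendsto (fun N => √(b N)) atTop (𝓝 0) := by simpa using hblim.sqrt
  refine ⟨fun N => 1 + 1 / √(b N), fun N => ?_, ?_, ?_⟩
  · have : 0 < √(b N) := Real.sqrt_pos.2 (hb0 N)
    simp
  · refine tendsto_atTop_add_const_left _ _ ?_
    have : Tendsto (fun N => √(b N)) atTop (𝓝[>] 0) :=
      tendsto_nhdsWithin_iff.2 ⟨hsq, Eventually.of_forall fun N => Real.sqrt_pos.2 (hb0 N)⟩
    simpa [Function.comp_def] using tendsto_inv_nhdsGT_zero.comp this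
  · have h2 : Tendsto (fun N => |a N| + √(b N)) atTop (𝓝 0) := by simpa using ha.abs.add hsq
    refine squeeze_zero_norm (fun N => ?_) h2
    have hs : 0 < √(b N) := Real.sqrt_pos.2 (hb0 N)
    rw [Real.norm_eq_abs, abs_mul, abs_of_pos (by positivity)]
    have h3 : |a N| ≤ b N := by simp only [hb]; linarith [show 0 < 1 / ((N : ℝ) + 1) by positivity]
    have h4 : 1 / √(b N) * |a N| ≤ √(b N) := by
      rw [one_div, inv_mul_le_iff₀ hs]
      calc |a N| ≤ b N := h3
        _ = _ := (Real.mul_self_sqrt (hb0 N).le).symm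
    linarith

/-! ### Nets of the unit sphere -/

lemma five_le_exp_two : (5 : ℝ) ≤ Real.exp 2 := by
  have h := Real.exp_one_gt_d9
  rw [show (2 : ℝ) = 1 + 1 by norm_num, Real.exp_add]; nlinarith

/-- The unit sphere of `ℝ^d` has a `1/2`-net of at most `5 ^ d` points: a maximal `1/2`-separated
set is a net, and volume comparison bounds its size. -/
lemma exists_sphere_net (d : ℕ) : ∃ s : Finset (E d), (∀ u ∈ s, ‖u‖ = 1) ∧ s.card ≤ 5 ^ d ∧
    ∀ x : E d, ‖x‖ = 1 → ∃ u ∈ s, ‖x - u‖ ≤ 1 / 2 := by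
  classical
  let good : Finset (E d) → Prop := fun s => (∀ u ∈ s, ‖u‖ = 1) ∧
    ∀ u ∈ s, ∀ v ∈ s, u ≠ v → 1 / 2 ≤ ‖u - v‖
  have hcard : ∀ s, good s → s.card ≤ 5 ^ d := by
    intro s hs
    have hinj : Function.Injective (fun u : E d => (2 : ℝ) • u) :=
      smul_right_injective _ two_ne_zero
    have := Besicovitch.card_le_of_separated (s.image fun u => (2 : ℝ) • u) ?_ ?_
    · rwa [Finset.card_image_of_injective _ hinj, finrank_euclideanSpace_fin] at this
    · intro c hc
      obtain ⟨u, hu, rfl⟩ := Finset.mem_image.1 hc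
      simp [norm_smul, hs.1 u hu]
    · intro c hc c' hc' hne
      obtain ⟨u, hu, rfl⟩ := Finset.mem_image.1 hc
      obtain ⟨v, hv, rfl⟩ := Finset.mem_image.1 hc'
      have := hs.2 u hu v hv (fun h => hne (by rw [h]))
      rw [← smul_sub, norm_smul]
      norm_num
      linarith
  have hne : ∃ n, ∃ s, good s ∧ s.card = n := ⟨0, ∅, by simp [good], rfl⟩
  have hbdd : BddAbove {n | ∃ s, good s ∧ s.card = n} := ⟨5 ^ d, by
    rintro n ⟨s, hs, rfl⟩; exact hcard s hs⟩
  obtain ⟨s, hs, hsn⟩ := Nat.sSup_mem (s := {n | ∃ s, good s ∧ s.card = n}) hne hbdd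
  refine ⟨s, hs.1, hcard s hs, fun x hx => ?_⟩
  by_contra! hcon
  have hxs : x ∉ s := fun hxs => by have := hcon x hxs; simp at this; linarith
  have hgood : good (insert x s) := by
    refine ⟨fun u hu => ?_, fun u hu v hv huv => ?_⟩
    · rcases Finset.mem_insert.1 hu with rfl | hu
      exacts [hx, hs.1 u hu]
    · rcases Finset.mem_insert.1 hu with rfl | hu' <;> rcases Finset.mem_insert.1 hv with rfl | hv'
      · exact absurd rfl huv
      · exact (hcon v hv').le
      · rw [norm_sub_rev]; exact (hcon u hu').le
      · exact hs.2 u hu' v hv' huv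
  have := le_csSup hbdd ⟨_, hgood, rfl⟩
  rw [Finset.card_insert_of_notMem hxs, hsn] at this
  omega

/-- A chosen `1/2`-net of the unit sphere with at most `5 ^ d` points. -/
noncomputable def sphereNet (d : ℕ) : Finset (E d) := (exists_sphere_net d).choose

lemma norm_of_mem_sphereNet {d : ℕ} {u : E d} (hu : u ∈ sphereNet d) : ‖u‖ = 1 :=
  (exists_sphere_net d).choose_spec.1 u hu

lemma card_sphereNet_le (d : ℕ) : (sphereNet d).card ≤ 5 ^ d :=
  (exists_sphere_net d).choose_spec.2.1

lemma exists_mem_sphereNet {d : ℕ} {x : E d} (hx : ‖x‖ = 1) : ∃ u ∈ sphereNet d, ‖x - u‖ ≤ 1 / 2 :=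
  (exists_sphere_net d).choose_spec.2.2 x hx

lemma norm_le_of_sphereNet {d : ℕ} {x : E d} {t : ℝ} (ht : 0 ≤ t)
    (h : ∀ u ∈ sphereNet d, inner ℝ u x ≤ t) : ‖x‖ ≤ 2 * t := by
  rcases eq_or_ne x 0 with rfl | hx
  · simpa using ht
  have hx' : 0 < ‖x‖ := norm_pos_iff.2 hx
  obtain ⟨u, hu, hxu⟩ := exists_mem_sphereNet (x := ‖x‖⁻¹ • x) (by
    rw [norm_smul, norm_inv, norm_norm, inv_mul_cancel₀ hx'.ne'])
  have h1 : inner ℝ (‖x‖⁻¹ • x) x = ‖x‖ := by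
    rw [real_inner_smul_left, real_inner_self_eq_norm_sq]; field_simp
  have h2 : inner ℝ (‖x‖⁻¹ • x - u) x ≤ 1 / 2 * ‖x‖ :=
    (real_inner_le_norm _ _).trans (by gcongr)
  rw [inner_sub_left, h1] at h2
  linarith [h u hu]

lemma opNorm_le_of_sphereNet {d : ℕ} {J : E d →L[ℝ] E d} {t : ℝ} (ht : 0 ≤ t)
    (h : ∀ u ∈ sphereNet d, ∀ v ∈ sphereNet d, inner ℝ u (J v) ≤ t) : ‖J‖ ≤ 4 * t := by
  have h1 : ∀ v ∈ sphereNet d, ‖J v‖ ≤ 2 * t := fun v hv =>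
    norm_le_of_sphereNet ht fun u hu => h u hu v hv
  have h2 : ‖J‖ ≤ 2 * t + ‖J‖ * (1 / 2) := by
    refine J.opNorm_le_of_unit_norm (by positivity) fun x hx => ?_
    obtain ⟨v, hv, hxv⟩ := exists_mem_sphereNet hx
    calc ‖J x‖ = ‖J v + J (x - v)‖ := by rw [← map_add]; congr 2; abel
      _ ≤ ‖J v‖ + ‖J (x - v)‖ := norm_add_le _ _
      _ ≤ 2 * t + ‖J‖ * (1 / 2) := by
        gcongr
        · exact h1 v hv
        · exact (J.le_opNorm _).trans (by gcongr)
  linarith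


/-! ### The group lasso with vector-valued coefficients: deterministic bounds -/

section GroupLasso

variable {J V : Type*} [Fintype J] [NormedAddCommGroup V]

/-- The group norm `∑ ‖D_j‖`. -/
noncomputable def l1 (D : J → V) : ℝ := ∑ j, ‖D j‖

lemma l1_nonneg (D : J → V) : 0 ≤ l1 D := Finset.sum_nonneg fun _ _ => norm_nonneg _

lemma sq_l1_le (D : J → V) : l1 D ^ 2 ≤ Fintype.card J * ∑ j, ‖D j‖ ^ 2 := by
  simpa [l1] using sq_sum_le_card_mul_sum_sq (s := Finset.univ) (f := fun j => ‖D j‖)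

variable [InnerProductSpace ℝ V]

/-- The bilinear form `∑ H_{jk} ⟪D_j, D'_k⟫` on families of vectors. -/
noncomputable def bil (H : Matrix J J ℝ) (D D' : J → V) : ℝ :=
  ∑ j, ∑ k, H j k * inner ℝ (D j) (D' k)

lemma bil_smul_right (H : Matrix J J ℝ) (D D' : J → V) (t : ℝ) :
    bil H D (t • D') = t * bil H D D' := by
  simp only [bil, Pi.smul_apply, inner_smul_right, Finset.mul_sum]
  exact Finset.sum_congr rfl fun j _ => Finset.sum_congr rfl fun k _ => by ring

lemma bil_add_right (H : Matrix J J ℝ) (D D' D'' : J → V) :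
    bil H D (D' + D'') = bil H D D' + bil H D D'' := by
  simp only [bil, Pi.add_apply, inner_add_right, mul_add, Finset.sum_add_distrib]

lemma bil_comm {H : Matrix J J ℝ} (hH : ∀ j k, H j k = H k j) (D D' : J → V) :
    bil H D D' = bil H D' D := by
  simp only [bil]
  rw [Finset.sum_comm]
  exact Finset.sum_congr rfl fun j _ => Finset.sum_congr rfl fun k _ => by
    rw [hH, real_inner_comm]

lemma abs_bil_le {H : Matrix J J ℝ} {τ : ℝ} (hH : ∀ j k, |H j k| ≤ τ) (D D' : J → V) :
    |bil H D D'| ≤ τ * l1 D * l1 D' := by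
  calc |bil H D D'| ≤ ∑ j, ∑ k, τ * (‖D j‖ * ‖D' k‖) := by
        refine (Finset.abs_sum_le_sum_abs _ _).trans (Finset.sum_le_sum fun j _ => ?_)
        refine (Finset.abs_sum_le_sum_abs _ _).trans (Finset.sum_le_sum fun k _ => ?_)
        rw [abs_mul]
        exact mul_le_mul (hH j k) (abs_real_inner_le_norm _ _) (abs_nonneg _)
          ((abs_nonneg _).trans (hH j k))
    _ = τ * l1 D * l1 D' := by
      simp only [l1, Finset.mul_sum, Finset.sum_mul]
      rw [Finset.sum_comm]
      exact Finset.sum_congr rfl fun j _ => Finset.sum_congr rfl fun k _ => by ring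

lemma bil_sub_left (H G : Matrix J J ℝ) (D D' : J → V) :
    bil H D D' = bil G D D' + bil (H - G) D D' := by
  simp only [bil, Matrix.sub_apply, sub_mul, Finset.sum_sub_distrib]; ring

/-- The group-lasso objective in terms of the deviation `D` from the true coefficients `Γ`, up to
an additive constant: `H` is the Gram matrix and `z` the noise score at `Γ`. -/
noncomputable def glObj (H : Matrix J J ℝ) (z : J → V) (lam : ℝ) (Γ D : J → V) : ℝ :=
  1 / 2 * bil H D D - ∑ j, inner ℝ (z j) (D j) + lam * ∑ j, ‖Γ j + D j‖

variable {H G : Matrix J J ℝ} {z Γ D : J → V} {lam c τ ζ : ℝ}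

lemma abs_sum_inner_le (hz : ∀ j, ‖z j‖ ≤ ζ) (D : J → V) :
    |∑ j, inner ℝ (z j) (D j)| ≤ ζ * l1 D := by
  refine (Finset.abs_sum_le_sum_abs _ _).trans ?_
  rw [l1, Finset.mul_sum]
  refine Finset.sum_le_sum fun j _ => (abs_real_inner_le_norm _ _).trans ?_
  gcongr; exact hz j

/-- Restricted eigenvalue bound: the Gram matrix inherits the curvature of its population version
up to the entrywise deviation times the squared group norm. -/
lemma bil_self_lower (hG : ∀ D : J → V, c * ∑ j, ‖D j‖ ^ 2 ≤ bil G D D)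
    (hτ : ∀ j k, |H j k - G j k| ≤ τ) (D : J → V) :
    c * ∑ j, ‖D j‖ ^ 2 - τ * l1 D ^ 2 ≤ bil H D D := by
  rw [bil_sub_left H G]
  have h1 := abs_bil_le (H := H - G) (τ := τ) hτ D D
  have h2 := (abs_le.1 h1).1
  nlinarith [hG D]

/-- Without sparsity: the group norm of the error is at most `4 |J| (ζ + λ) / c`. -/
lemma l1_le_of_isMin (hc : 0 < c) (hG : ∀ D : J → V, c * ∑ j, ‖D j‖ ^ 2 ≤ bil G D D)
    (hτ : ∀ j k, |H j k - G j k| ≤ τ) (hτc : 2 * τ * Fintype.card J ≤ c) (hτ0 : 0 ≤ τ)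
    (hlam : 0 ≤ lam) (hz : ∀ j, ‖z j‖ ≤ ζ)
    (hmin : glObj H z lam Γ D ≤ glObj H z lam Γ 0) :
    l1 D ≤ 4 * Fintype.card J * (ζ + lam) / c := by
  have h1 : lam * ∑ j, ‖Γ j‖ ≤ lam * ∑ j, ‖Γ j + D j‖ + lam * l1 D := by
    rw [← mul_add, l1, ← Finset.sum_add_distrib]
    gcongr with j
    calc ‖Γ j‖ = ‖(Γ j + D j) - D j‖ := by simp
      _ ≤ _ := norm_sub_le _ _
  have h2 := (abs_le.1 (abs_sum_inner_le hz D)).2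
  have h3 := bil_self_lower hG hτ D
  have h4 := sq_l1_le D
  have h5 : glObj H z lam Γ 0 = lam * ∑ j, ‖Γ j‖ := by simp [glObj, bil]
  rw [h5, glObj] at hmin
  set Q := ∑ j, ‖D j‖ ^ 2
  have hQ : 0 ≤ Q := Finset.sum_nonneg fun _ _ => sq_nonneg _
  have h6 : 1 / 4 * c * Q ≤ (ζ + lam) * l1 D := by
    have : τ * l1 D ^ 2 ≤ c / 2 * Q := by
      calc τ * l1 D ^ 2 ≤ τ * (Fintype.card J * Q) := by gcongr
        _ = (2 * τ * Fintype.card J) / 2 * Q := by ring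
        _ ≤ c / 2 * Q := by gcongr
    nlinarith
  rw [le_div_iff₀ hc]
  rcases (l1_nonneg D).eq_or_lt with h0 | h0
  · rcases isEmpty_or_nonempty J with hJ | ⟨⟨j⟩⟩
    · simp [← h0]
    · rw [← h0, zero_mul]
      have : 0 ≤ ζ := (norm_nonneg _).trans (hz j)
      positivity
  · have h7 : l1 D * (l1 D * c) ≤ l1 D * (4 * Fintype.card J * (ζ + lam)) := by
      have : (Fintype.card J : ℝ) * (1 / 4 * c * Q) ≤ Fintype.card J * ((ζ + lam) * l1 D) := by
        gcongr
      nlinarith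
    exact le_of_mul_le_mul_left h7 h0

/-- Sparse rates: if the noise is at most `λ / 2`, the error lies in a cone, on which the Gram
matrix is well conditioned. -/
lemma lasso_rates [DecidableEq J] (hc : 0 < c)
    (hG : ∀ D : J → V, c * ∑ j, ‖D j‖ ^ 2 ≤ bil G D D)
    (hH : ∀ D : J → V, 0 ≤ bil H D D)
    (hτ : ∀ j k, |H j k - G j k| ≤ τ) (hτ0 : 0 ≤ τ) (hlam : 0 < lam)
    (hz : ∀ j, ‖z j‖ ≤ lam / 2) {S : Finset J} (hS : ∀ j, j ∉ S → Γ j = 0)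
    (hτS : 32 * τ * S.card ≤ c)
    (hmin : glObj H z lam Γ D ≤ glObj H z lam Γ 0) :
    l1 D ≤ 24 * lam * S.card / c ∧ ∑ j, ‖D j‖ ^ 2 ≤ 36 * lam ^ 2 * S.card / c ^ 2 := by
  set nS := ∑ j ∈ S, ‖D j‖ with hnS
  set nT := ∑ j ∈ Sᶜ, ‖D j‖ with hnT
  have hn : l1 D = nS + nT := (Finset.sum_add_sum_compl S _).symm
  have hnS0 : 0 ≤ nS := Finset.sum_nonneg fun _ _ => norm_nonneg _
  have hnT0 : 0 ≤ nT := Finset.sum_nonneg fun _ _ => norm_nonneg _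
  -- off `S` the penalty grows by the full norm of the error
  have h1 : ∑ j, ‖Γ j‖ + nT - nS ≤ ∑ j, ‖Γ j + D j‖ := by
    rw [← Finset.sum_add_sum_compl S (fun j => ‖Γ j‖),
      ← Finset.sum_add_sum_compl S (fun j => ‖Γ j + D j‖)]
    have e1 : ∑ j ∈ Sᶜ, ‖Γ j‖ = 0 := Finset.sum_eq_zero fun j hj => by
      rw [hS j (Finset.mem_compl.1 hj), norm_zero]
    have e2 : ∑ j ∈ Sᶜ, ‖Γ j + D j‖ = nT := Finset.sum_congr rfl fun j hj => by
      rw [hS j (Finset.mem_compl.1 hj), zero_add]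
    have e3 : ∑ j ∈ S, ‖Γ j‖ ≤ ∑ j ∈ S, ‖Γ j + D j‖ + nS := by
      rw [hnS, ← Finset.sum_add_distrib]
      refine Finset.sum_le_sum fun j _ => ?_
      calc ‖Γ j‖ = ‖(Γ j + D j) - D j‖ := by simp
        _ ≤ _ := norm_sub_le _ _
    linarith
  have h2 := (abs_le.1 (abs_sum_inner_le hz D)).2
  have h5 : glObj H z lam Γ 0 = lam * ∑ j, ‖Γ j‖ := by simp [glObj, bil]
  rw [h5, glObj] at hmin
  have h6 : lam * (∑ j, ‖Γ j‖ + nT - nS) ≤ lam * ∑ j, ‖Γ j + D j‖ := by gcongr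
  have h7 : 1 / 2 * bil H D D ≤ 3 / 2 * lam * nS - 1 / 2 * lam * nT := by
    rw [hn] at h2; nlinarith
  have hcone : nT ≤ 3 * nS := by
    have : lam * nT ≤ lam * (3 * nS) := by nlinarith [hH D]
    exact le_of_mul_le_mul_left this hlam
  set Q := ∑ j, ‖D j‖ ^ 2 with hQdef
  have hQ : 0 ≤ Q := Finset.sum_nonneg fun _ _ => sq_nonneg _
  have hCS : nS ^ 2 ≤ S.card * Q := by
    calc nS ^ 2 ≤ S.card * ∑ j ∈ S, ‖D j‖ ^ 2 := sq_sum_le_card_mul_sum_sq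
      _ ≤ S.card * Q := by
        gcongr; exact Finset.sum_le_univ_sum_of_nonneg fun _ => sq_nonneg _
  -- on the cone `l1 D ≤ 4 nS`, so half of the curvature survives
  have h8 : c / 2 * Q ≤ bil H D D := by
    have h9 := bil_self_lower hG hτ D
    have : τ * l1 D ^ 2 ≤ c / 2 * Q := by
      calc τ * l1 D ^ 2 ≤ τ * (4 * nS) ^ 2 := by rw [hn]; gcongr; linarith
        _ = τ * (16 * nS ^ 2) := by ring
        _ ≤ τ * (16 * (S.card * Q)) := by gcongr
        _ = (32 * τ * S.card) / 2 * Q := by ring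
        _ ≤ c / 2 * Q := by gcongr
    linarith
  have h9 : c * Q ≤ 6 * lam * nS := by nlinarith [mul_nonneg hlam.le hnT0]
  have h10 : c * nS ≤ 6 * lam * S.card := by
    rcases hnS0.eq_or_lt with h0 | h0
    · rw [← h0, mul_zero]; positivity
    · have : nS * (c * nS) ≤ nS * (6 * lam * S.card) := by
        have := mul_le_mul_of_nonneg_left h9 (Nat.cast_nonneg (α := ℝ) S.card)
        nlinarith
      exact le_of_mul_le_mul_left this h0
  constructor
  · rw [le_div_iff₀ hc, hn]; nlinarith
  · rw [le_div_iff₀ (by positivity)]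
    have := mul_le_mul_of_nonneg_left h10 (show 0 ≤ 6 * lam by positivity)
    nlinarith

/-- First-order optimality, as a variational inequality: the one-sided derivative of the objective
in the direction `A`, with the derivative of the penalty replaced by its increment, which is larger
by convexity. -/
lemma variational_of_isMin (hsymm : ∀ j k, H j k = H k j) (hlam : 0 ≤ lam)
    (hmin : ∀ D', glObj H z lam Γ D ≤ glObj H z lam Γ D') (A : J → V) :
    0 ≤ bil H D A - ∑ j, inner ℝ (z j) (A j) +
      lam * ∑ j, (‖Γ j + D j + A j‖ - ‖Γ j + D j‖) := by
  set a := bil H D A - ∑ j, inner ℝ (z j) (A j) + lam * ∑ j, (‖Γ j + D j + A j‖ - ‖Γ j + D j‖)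
    with ha
  have key : ∀ t : ℝ, 0 < t → t ≤ 1 → 0 ≤ a + t * (1 / 2 * bil H A A) := by
    intro t ht ht1
    have h := hmin (D + t • A)
    have e1 : bil H (D + t • A) (D + t • A) =
        bil H D D + 2 * t * bil H D A + t ^ 2 * bil H A A := by
      rw [bil_add_right, bil_smul_right, bil_comm hsymm _ D, bil_comm hsymm _ A, bil_add_right,
        bil_add_right, bil_smul_right, bil_smul_right, bil_comm hsymm A D]
      ring
    have e2 : ∑ j, inner ℝ (z j) ((D + t • A) j) =
        ∑ j, inner ℝ (z j) (D j) + t * ∑ j, inner ℝ (z j) (A j) := by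
      rw [Finset.mul_sum, ← Finset.sum_add_distrib]
      exact Finset.sum_congr rfl fun j _ => by simp [inner_add_right, inner_smul_right]
    have e3 : ∑ j, ‖Γ j + (D + t • A) j‖ ≤
        ∑ j, ‖Γ j + D j‖ + t * ∑ j, (‖Γ j + D j + A j‖ - ‖Γ j + D j‖) := by
      rw [Finset.mul_sum, ← Finset.sum_add_distrib]
      refine Finset.sum_le_sum fun j _ => ?_
      have : Γ j + (D + t • A) j = (1 - t) • (Γ j + D j) + t • (Γ j + D j + A j) := by
        simp only [Pi.add_apply, Pi.smul_apply]; module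
      rw [this]
      refine (norm_add_le _ _).trans ?_
      rw [norm_smul, norm_smul, Real.norm_of_nonneg ht.le, Real.norm_of_nonneg (by linarith)]
      linarith
    simp only [glObj] at h
    rw [e1, e2] at h
    have h3 := mul_le_mul_of_nonneg_left e3 hlam
    have : 0 ≤ t * (a + t * (1 / 2 * bil H A A)) := by rw [ha]; nlinarith
    exact nonneg_of_mul_nonneg_right this ht
  by_contra! hneg
  have hb : 0 ≤ |1 / 2 * bil H A A| := abs_nonneg _
  set b := 1 / 2 * bil H A A
  have ht : 0 < min 1 (-a / (2 * (|b| + 1))) := by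
    apply lt_min one_pos; apply div_pos <;> linarith
  have h1 := key _ ht (min_le_left _ _)
  have h2 : min 1 (-a / (2 * (|b| + 1))) * b ≤ -a / 2 := by
    calc _ ≤ min 1 (-a / (2 * (|b| + 1))) * (|b| + 1) := by
          gcongr; linarith [le_abs_self b]
      _ ≤ -a / (2 * (|b| + 1)) * (|b| + 1) := by gcongr; exact min_le_right _ _
      _ = -a / 2 := by field_simp
  linarith

/-- Support recovery under incoherence. The optimality condition is tested in the direction that
equals the error off `S` and is corrected on `S` so that `G` times it vanishes on `S`; the
curvature term then has a sign, and incoherence controls the correction. -/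
lemma support_recovery [DecidableEq J] {κ : ℝ} (hκ : 0 < κ)
    (hG : ∀ D : J → V, 0 ≤ bil G D D)
    (hGsymm : ∀ j k, G j k = G k j) (hHsymm : ∀ j k, H j k = H k j)
    (hτ : ∀ j k, |H j k - G j k| ≤ τ) (hlam : 0 < lam)
    (hz : ∀ j, ‖z j‖ ≤ κ * lam / 8) {S : Finset J} (hS : ∀ j, j ∉ S → Γ j = 0)
    {a : J → J → ℝ} (ha : ∀ j, j ∉ S → ∑ t ∈ S, |a j t| ≤ 1 - κ)
    (haG : ∀ j, j ∉ S → ∀ u ∈ S, ∑ t ∈ S, a j t * G t u = G j u)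
    (hτD : τ * l1 D ≤ κ * lam / 8)
    (hmin : ∀ D', glObj H z lam Γ D ≤ glObj H z lam Γ D') :
    ∀ j, j ∉ S → D j = 0 := by
  -- the test direction, corrected on `S`
  set A : J → V := fun j => if j ∈ S then -∑ k ∈ Sᶜ, a k j • D k else D j with hA
  set nT := ∑ j ∈ Sᶜ, ‖D j‖ with hnT
  have hnT0 : 0 ≤ nT := Finset.sum_nonneg fun _ _ => norm_nonneg _
  have hAS : ∑ j ∈ S, ‖A j‖ ≤ (1 - κ) * nT := by
    calc ∑ j ∈ S, ‖A j‖ ≤ ∑ j ∈ S, ∑ k ∈ Sᶜ, |a k j| * ‖D k‖ := by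
          refine Finset.sum_le_sum fun j hj => ?_
          simp only [hA, hj, if_true, norm_neg]
          refine (norm_sum_le _ _).trans (Finset.sum_le_sum fun k _ => ?_)
          rw [norm_smul, Real.norm_eq_abs]
      _ = ∑ k ∈ Sᶜ, (∑ j ∈ S, |a k j|) * ‖D k‖ := by
          rw [Finset.sum_comm]; simp_rw [Finset.sum_mul]
      _ ≤ ∑ k ∈ Sᶜ, (1 - κ) * ‖D k‖ := by
          refine Finset.sum_le_sum fun k hk => ?_
          gcongr; exact ha k (Finset.mem_compl.1 hk)
      _ = _ := by rw [Finset.mul_sum]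
  have hAT : ∑ j ∈ Sᶜ, ‖A j‖ = nT := Finset.sum_congr rfl fun j hj => by
    simp [hA, Finset.mem_compl.1 hj]
  have hAl1 : l1 A ≤ 2 * nT := by
    rw [l1, ← Finset.sum_add_sum_compl S, hAT]; nlinarith
  -- `G` times the test direction vanishes on `S`
  have hGA : ∀ u ∈ S, ∑ k, G u k • A k = 0 := by
    intro u hu
    rw [← Finset.sum_add_sum_compl S]
    have e1 : ∑ k ∈ S, G u k • A k = -∑ k ∈ Sᶜ, (∑ t ∈ S, a k t * G t u) • D k := by
      calc ∑ k ∈ S, G u k • A k = ∑ t ∈ S, -∑ k ∈ Sᶜ, (a k t * G t u) • D k := by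
            refine Finset.sum_congr rfl fun t ht => ?_
            simp only [hA, ht, if_true, smul_neg, Finset.smul_sum, smul_smul]
            congr 1
            exact Finset.sum_congr rfl fun k _ => by rw [hGsymm u t, mul_comm]
        _ = _ := by rw [Finset.sum_neg_distrib, Finset.sum_comm]; simp_rw [Finset.sum_smul]
    have e2 : ∑ k ∈ Sᶜ, G u k • A k = ∑ k ∈ Sᶜ, (∑ t ∈ S, a k t * G t u) • D k := by
      refine Finset.sum_congr rfl fun k hk => ?_
      have hk' := Finset.mem_compl.1 hk
      rw [haG k hk' u hu, hGsymm u k]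
      simp [hA, hk']
    rw [e1, e2, neg_add_cancel]
  have hbil : ∀ B : J → V, bil G B A = ∑ j, inner ℝ (B j) (∑ k, G j k • A k) := by
    intro B
    simp only [bil, inner_sum, inner_smul_right]
  have hDA : bil G D A = bil G A A := by
    rw [hbil, hbil]
    refine Finset.sum_congr rfl fun j _ => ?_
    by_cases hj : j ∈ S
    · rw [hGA j hj, inner_zero_right, inner_zero_right]
    · simp [hA, hj]
  -- moving along `-A` removes the error off `S` completely
  have hv := variational_of_isMin hHsymm hlam.le hmin (-A)
  have e1 : bil H D (-A) = -bil H D A := by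
    have := bil_smul_right H D A (-1); simpa using this
  have e2 : ∑ j, inner ℝ (z j) ((-A) j) = -∑ j, inner ℝ (z j) (A j) := by simp
  have e3 : ∑ j, (‖Γ j + D j + (-A) j‖ - ‖Γ j + D j‖) ≤ (1 - κ) * nT - nT := by
    rw [← Finset.sum_add_sum_compl S]
    have f1 : ∑ j ∈ S, (‖Γ j + D j + (-A) j‖ - ‖Γ j + D j‖) ≤ ∑ j ∈ S, ‖A j‖ := by
      refine Finset.sum_le_sum fun j _ => ?_
      have := norm_add_le (Γ j + D j) ((-A) j)
      rw [Pi.neg_apply, norm_neg] at this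
      rw [Pi.neg_apply]; linarith
    have f2 : ∑ j ∈ Sᶜ, (‖Γ j + D j + (-A) j‖ - ‖Γ j + D j‖) = -nT := by
      rw [hnT, ← Finset.sum_neg_distrib]
      refine Finset.sum_congr rfl fun j hj => ?_
      have hj' := Finset.mem_compl.1 hj
      simp [hA, hj', hS j hj']
    linarith
  have h1 := (abs_le.1 (abs_sum_inner_le hz A)).2
  have h2 := (abs_le.1 (abs_bil_le (H := H - G) (τ := τ) hτ D A)).1
  have h3 := hG A
  rw [e1, e2, bil_sub_left H G, hDA] at hv
  have h4 := mul_le_mul_of_nonneg_left e3 hlam.le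
  have h5 : τ * l1 D * l1 A ≤ κ * lam / 8 * (2 * nT) :=
    mul_le_mul hτD hAl1 (l1_nonneg _) (by positivity)
  have h6 : κ * lam / 8 * l1 A ≤ κ * lam / 8 * (2 * nT) := by gcongr
  -- gain `κ λ nT` against `λ κ / 4 * nT` each for the noise and for the Gram matrix
  have h7 : κ * lam * nT ≤ 0 := by nlinarith
  have h8 : nT = 0 := by
    have : 0 < κ * lam := by positivity
    nlinarith
  intro j hj
  have := (Finset.sum_eq_zero_iff_of_nonneg fun _ _ => norm_nonneg _).1 h8 j (Finset.mem_compl.2 hj)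
  exact norm_eq_zero.1 this

/-- The coefficients `G_{jS} G_{SS}⁻¹` of the incoherence condition, for positive definite `G`. -/
lemma Incoherent.exists_coeff [DecidableEq J] {κ : ℝ} (hc : 0 < c)
    (hG : ∀ v : J → ℝ, c * ∑ j, v j ^ 2 ≤ v ⬝ᵥ G.mulVec v) {S : Finset J}
    (h : Incoherent G S κ) :
    ∃ a : J → J → ℝ, (∀ j, j ∉ S → ∑ t ∈ S, |a j t| ≤ 1 - κ) ∧
      ∀ j, j ∉ S → ∀ u ∈ S, ∑ t ∈ S, a j t * G t u = G j u := by
  set B : Matrix S S ℝ := G.submatrix (fun u : S => (u : J)) (fun u : S => (u : J)) with hB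
  have hdet : IsUnit B.det := by
    rw [← Matrix.isUnit_iff_isUnit_det, ← Matrix.mulVec_injective_iff_isUnit]
    refine (injective_iff_map_eq_zero (Matrix.mulVecLin B)).2 fun v hv => ?_
    replace hv : B.mulVec v = 0 := hv
    set w : J → ℝ := fun j => if hj : j ∈ S then v ⟨j, hj⟩ else 0 with hw
    have hsum : ∀ f : J → ℝ, ∑ j, w j * f j = ∑ t : S, v t * f t := by
      intro f
      rw [← Finset.sum_add_sum_compl S, Finset.sum_eq_zero (s := Sᶜ), add_zero,
        ← Finset.sum_coe_sort S]
      · exact Finset.sum_congr rfl fun t _ => by simp [hw]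
      · intro j hj; simp [hw, Finset.mem_compl.1 hj]
    have h1 : w ⬝ᵥ G.mulVec w = 0 := by
      simp only [dotProduct]
      rw [hsum]
      refine Finset.sum_eq_zero fun t _ => ?_
      have : G.mulVec w t = B.mulVec v t := by
        simp only [Matrix.mulVec, dotProduct]
        simp_rw [mul_comm (G _ _) (w _)]
        rw [hsum]
        exact Finset.sum_congr rfl fun s _ => by simp [hB, mul_comm]
      rw [this, hv]; simp
    have h2 := hG w
    rw [h1] at h2
    have h3 : ∑ j, w j ^ 2 = 0 :=
      le_antisymm (by nlinarith) (Finset.sum_nonneg fun _ _ => sq_nonneg _)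
    ext t
    have := (Finset.sum_eq_zero_iff_of_nonneg fun _ _ => sq_nonneg _).1 h3 t (Finset.mem_univ _)
    simpa [hw] using this
  refine ⟨fun j t => if ht : t ∈ S then Matrix.vecMul (fun u : S => G j u) B⁻¹ ⟨t, ht⟩ else 0,
    fun j hj => ?_, fun j hj u hu => ?_⟩
  · rw [← Finset.sum_coe_sort S]
    simpa using h j hj
  · rw [← Finset.sum_coe_sort S]
    have h1 : Matrix.vecMul (Matrix.vecMul (fun u : S => G j u) B⁻¹) B = fun u : S => G j u := by
      rw [Matrix.vecMul_vecMul, Matrix.nonsing_inv_mul _ hdet, Matrix.vecMul_one]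
    have h2 := congrFun h1 ⟨u, hu⟩
    simpa [Matrix.vecMul, dotProduct, hB] using h2

end GroupLasso


/-! ### The law of a record -/

/-- The labelling indicator of a record as a real number. -/
noncomputable def ind {p K : ℕ} (z : Record p K) : ℝ := if z.2 then 1 else 0

@[simp] lemma ind_true {p K : ℕ} (w : Obs p K) : ind (w, true) = 1 := by simp [ind]
@[simp] lemma ind_false {p K : ℕ} (w : Obs p K) : ind (w, false) = 0 := by simp [ind]

lemma ind_nonneg {p K : ℕ} (z : Record p K) : 0 ≤ ind z := by unfold ind; split <;> norm_num
lemma ind_le_one {p K : ℕ} (z : Record p K) : ind z ≤ 1 := by unfold ind; split <;> norm_num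

@[fun_prop] lemma measurable_ind {p K : ℕ} : Measurable (ind : Record p K → ℝ) := by
  have : (ind : Record p K → ℝ) = (fun b : Bool => if b then (1 : ℝ) else 0) ∘ Prod.snd := rfl
  rw [this]
  exact (measurable_of_countable _).comp measurable_snd

namespace Model

variable {p d K : ℕ} {M : Model p d K} {ε C c δ ℓ : ℝ}

lemma Regular.rho_mem (hM : M.Regular ε C c δ ℓ) (w : Obs p K) :
    ε ≤ M.rhoObs w ∧ M.rhoObs w ≤ 1 := ⟨hM.rho_ge _ _, hM.rho_le _ _⟩

lemma Regular.eps_le_one (hM : M.Regular ε C c δ ℓ) : ε ≤ 1 :=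
  (hM.rho_mem (0, 0, 0)).1.trans (hM.rho_mem (0, 0, 0)).2

lemma Regular.map_fst (hM : M.Regular ε C c δ ℓ) (hε : 0 < ε) :
    M.recordLaw.map Prod.fst = M.law := by
  have m1 : Measurable (fun w : Obs p K => (w, true)) := by fun_prop
  have m2 : Measurable (fun w : Obs p K => (w, false)) := by fun_prop
  have hr := hM.rho_meas
  rw [recordLaw, Measure.map_add _ _ measurable_fst, Measure.map_map measurable_fst m1,
    Measure.map_map measurable_fst m2]
  have e1 : (Prod.fst ∘ fun w : Obs p K => (w, true)) = id := rfl
  have e2 : (Prod.fst ∘ fun w : Obs p K => (w, false)) = id := rfl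
  rw [e1, e2, Measure.map_id, Measure.map_id, ← withDensity_add_left (by fun_prop)]
  have : ((fun w => ENNReal.ofReal (M.rhoObs w)) +
      fun w => ENNReal.ofReal (1 - M.rhoObs w)) = 1 := by
    ext w
    have := hM.rho_mem w
    simp only [Pi.add_apply, Pi.one_apply]
    rw [← ENNReal.ofReal_add (by linarith) (by linarith)]
    simp
  rw [this, withDensity_one]

lemma Regular.hasLaw_fst (hM : M.Regular ε C c δ ℓ) (hε : 0 < ε) :
    HasLaw Prod.fst M.law M.recordLaw := ⟨measurable_fst.aemeasurable, hM.map_fst hε⟩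

lemma Regular.isProbabilityMeasure_recordLaw (hM : M.Regular ε C c δ ℓ) (hε : 0 < ε) :
    IsProbabilityMeasure M.recordLaw := by
  have := hM.law_prob
  exact (hM.hasLaw_fst hε).isProbabilityMeasure

lemma Regular.ae_fst (hM : M.Regular ε C c δ ℓ) (hε : 0 < ε) {q : Obs p K → Prop}
    (hq : ∀ᵐ w ∂M.law, q w) : ∀ᵐ z ∂M.recordLaw, q z.1 := by
  rw [← hM.map_fst hε] at hq
  exact ae_of_ae_map measurable_fst.aemeasurable hq

lemma Regular.aemeasurable_fst (hM : M.Regular ε C c δ ℓ) (hε : 0 < ε) {F : Type*}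
    [MeasurableSpace F] {f : Obs p K → F} (hf : AEMeasurable f M.law) :
    AEMeasurable (fun z : Record p K => f z.1) M.recordLaw := by
  rw [← hM.map_fst hε] at hf
  exact hf.comp_aemeasurable measurable_fst.aemeasurable

lemma Regular.recordLaw_integral (hM : M.Regular ε C c δ ℓ) (hε : 0 < ε) {F : Record p K → ℝ}
    (h1 : Integrable (fun w => F (w, true)) M.law) (h0 : Integrable (fun w => F (w, false)) M.law) :
    Integrable F M.recordLaw ∧ ∫ z, F z ∂M.recordLaw =
      ∫ w, (M.rhoObs w * F (w, true) + (1 - M.rhoObs w) * F (w, false)) ∂M.law := by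
  have hr := hM.rho_meas
  have emb : ∀ b : Bool, MeasurableEmbedding (fun w : Obs p K => (w, b)) := fun b =>
    measurableEmbedding_prod_mk_right b
  have r0 : ∀ w, 0 ≤ M.rhoObs w := fun w => hε.le.trans (hM.rho_mem w).1
  have r1 : ∀ w, 0 ≤ 1 - M.rhoObs w := fun w => by linarith [(hM.rho_mem w).2]
  have key : ∀ (g : Obs p K → ℝ) (f : Obs p K → ℝ), Measurable g → (∀ w, 0 ≤ g w) →
      (∀ w, g w ≤ 1) → Integrable f M.law →
      Integrable f (M.law.withDensity fun w => ENNReal.ofReal (g w)) ∧ 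
      Integrable (fun w => g w * f w) M.law ∧
      ∫ w, f w ∂(M.law.withDensity fun w => ENNReal.ofReal (g w)) = ∫ w, g w * f w ∂M.law := by
    intro g f hg hg0 hg1 hf
    have hgf : Integrable (fun w => g w * f w) M.law := by
      refine hf.bdd_mul (c := 1) hg.aestronglyMeasurable (ae_of_all _ fun w => ?_)
      rw [Real.norm_of_nonneg (hg0 w)]; exact hg1 w
    refine ⟨?_, hgf, ?_⟩
    · rw [integrable_withDensity_iff (by fun_prop) (ae_of_all _ fun _ => ENNReal.ofReal_lt_top)]
      refine hgf.congr (ae_of_all _ fun w => ?_)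
      simp only [ENNReal.toReal_ofReal (hg0 w)]; ring
    · rw [integral_withDensity_eq_integral_toReal_smul (by fun_prop)
        (ae_of_all _ fun _ => ENNReal.ofReal_lt_top)]
      refine integral_congr_ae (ae_of_all _ fun w => ?_)
      simp only [ENNReal.toReal_ofReal (hg0 w), smul_eq_mul]
  obtain ⟨a1, a2, a3⟩ := key M.rhoObs _ hr r0 (fun w => (hM.rho_mem w).2) h1
  obtain ⟨b1, b2, b3⟩ := key (fun w => 1 - M.rhoObs w) _ (by fun_prop) r1
    (fun w => by linarith [r0 w]) h0
  have i1 : Integrable F ((M.law.withDensity (fun w => ENNReal.ofReal (M.rhoObs w))).map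
      fun w => (w, true)) := ((emb true).integrable_map_iff).2 a1
  have i2 : Integrable F ((M.law.withDensity (fun w => ENNReal.ofReal (1 - M.rhoObs w))).map
      fun w => (w, false)) := ((emb false).integrable_map_iff).2 b1
  refine ⟨i1.add_measure i2, ?_⟩
  rw [recordLaw, integral_add_measure i1 i2, (emb true).integral_map, (emb false).integral_map,
    a3, b3, integral_add a2 b2]

/-- Multiplication by a bounded function of the record keeps an Orlicz bound. -/
lemma Regular.orlicz_mul (hM : M.Regular ε C c δ ℓ) (hε : 0 < ε) {a : ℕ} {X : Obs p K → ℝ}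
    {B b : ℝ} (hX : OrliczLE a X B M.law) (hB : 0 < B) (hb : 0 < b) {g : Record p K → ℝ}
    (hg : Measurable g) (hgb : ∀ z, |g z| ≤ b) :
    OrliczLE a (fun z : Record p K => g z * X z.1) (b * B) M.recordLaw := by
  have h1 : OrliczLE a (fun z : Record p K => X z.1) B M.recordLaw := by
    refine ⟨hM.aemeasurable_fst hε hX.1, ?_⟩
    have hX' := hX.1
    have := (hM.hasLaw_fst hε).map_eq
    have h3 := hX.2
    rw [← this, lintegral_map' _ measurable_fst.aemeasurable] at h3
    · exact h3
    · rw [this]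
      exact (((hX'.norm.div_const B).pow_const a).exp).ennreal_ofReal
  refine h1.of_abs_le (by positivity) (hg.aemeasurable.mul h1.1) (ae_of_all _ fun z => ?_)
  rw [abs_mul, div_le_div_iff₀ (by positivity) hB]
  have := hgb z
  have h4 := abs_nonneg (X z.1)
  calc |g z| * |X z.1| * B ≤ b * |X z.1| * B := by gcongr
    _ = _ := by ring

/-- Inverse-probability weighting: `R / ρ` times a function of the observation has the mean of
that function. -/
lemma Regular.integral_ipw (hM : M.Regular ε C c δ ℓ) (hε : 0 < ε) {X : Obs p K → ℝ}
    (hX : Integrable X M.law) :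
    ∫ z : Record p K, ind z / M.rhoObs z.1 * X z.1 ∂M.recordLaw = ∫ w, X w ∂M.law := by
  have hr := hM.rho_meas
  have h1 : Integrable (fun w => ind (w, true) / M.rhoObs w * X w) M.law := by
    refine hX.bdd_mul (c := 1 / ε) (by simp; fun_prop) (ae_of_all _ fun w => ?_)
    have := hM.rho_mem w
    rw [ind_true, Real.norm_of_nonneg (div_nonneg zero_le_one (by linarith))]
    exact one_div_le_one_div_of_le hε this.1
  have h0 : Integrable (fun w => ind (w, false) / M.rhoObs w * X w) M.law := by simp
  rw [(hM.recordLaw_integral hε (F := fun z => ind z / M.rhoObs z.1 * X z.1) h1 h0).2]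
  refine integral_congr_ae (ae_of_all _ fun w => ?_)
  have := (hM.rho_mem w).1
  have : M.rhoObs w ≠ 0 := by linarith
  simp; field_simp

lemma Regular.integral_fst (hM : M.Regular ε C c δ ℓ) (hε : 0 < ε) {F : Type*}
    [NormedAddCommGroup F] [NormedSpace ℝ F] {X : Obs p K → F}
    (hX : AEStronglyMeasurable X M.law) :
    ∫ z : Record p K, X z.1 ∂M.recordLaw = ∫ w, X w ∂M.law := by
  rw [← hM.map_fst hε, integral_map measurable_fst.aemeasurable]
  rw [hM.map_fst hε]; exact hX

/-! ### Tails and moments of the influence functions -/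

lemma Regular.psi_coord (hM : M.Regular ε C c δ ℓ) (l : Fin p) :
    OrliczLE 2 (fun w => M.psi w l) C M.law := by
  have := hM.psi_tail (EuclideanSpace.single l 1) (by simp)
  simpa [EuclideanSpace.inner_single_left] using this

lemma Regular.resid_coord (hM : M.Regular ε C c δ ℓ) (l : Fin p) :
    OrliczLE 2 (fun w => M.resid w l) C M.law := by
  have := hM.resid_tail (EuclideanSpace.single l 1) (by simp)
  simpa [EuclideanSpace.inner_single_left] using this

lemma Regular.eta_coord (hM : M.Regular ε C c δ ℓ) (j : Idx d K) :
    OrliczLE 2 (fun w => M.eta w j) C M.law := by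
  have := hM.eta_tail j.1 (EuclideanSpace.single j.2 1) (by simp)
  simpa [EuclideanSpace.inner_single_left, eta] using this

lemma Regular.weight_nonneg (hM : M.Regular ε C c δ ℓ) (hε : 0 < ε) (w : Obs p K) :
    0 ≤ (1 - M.rhoObs w) / M.rhoObs w :=
  div_nonneg (by linarith [(hM.rho_mem w).2]) (by linarith [(hM.rho_mem w).1])

lemma Regular.weight_le (hM : M.Regular ε C c δ ℓ) (hε : 0 < ε) (w : Obs p K) :
    (1 - M.rhoObs w) / M.rhoObs w ≤ 1 / ε := by
  have := hM.rho_mem w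
  exact div_le_div₀ zero_le_one (by linarith) hε this.1

lemma Regular.integrable_weight_mul (hM : M.Regular ε C c δ ℓ) (hε : 0 < ε)
    {X : Obs p K → ℝ} (hX : Integrable X M.law) :
    Integrable (fun w => (1 - M.rhoObs w) / M.rhoObs w * X w) M.law := by
  have hr := hM.rho_meas
  refine hX.bdd_mul (c := 1 / ε) (Measurable.aestronglyMeasurable (by fun_prop))
    (ae_of_all _ fun w => ?_)
  rw [Real.norm_of_nonneg (hM.weight_nonneg hε w)]
  exact hM.weight_le hε w

lemma Regular.integrable_inv_rho_mul (hM : M.Regular ε C c δ ℓ) (hε : 0 < ε)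
    {X : Obs p K → ℝ} (hX : Integrable X M.law) :
    Integrable (fun w => 1 / M.rhoObs w * X w) M.law := by
  have hr := hM.rho_meas
  refine hX.bdd_mul (c := 1 / ε) (Measurable.aestronglyMeasurable (by fun_prop))
    (ae_of_all _ fun w => ?_)
  have := hM.rho_mem w
  rw [Real.norm_of_nonneg (div_nonneg zero_le_one (by linarith))]
  exact one_div_le_one_div_of_le hε this.1

lemma OrliczLE.integrable_mul {α : Type*} [MeasurableSpace α] {μ : Measure α} {X Y : α → ℝ} {B : ℝ}
    (hB : 0 < B) (hX : OrliczLE 2 X B μ) (hY : OrliczLE 2 Y B μ) :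
    Integrable (fun w => X w * Y w) μ := (hX.mul hY).integrable (by positivity)

/-- The integral of a vector-valued influence function vanishes when the estimating function has
mean zero; integrability comes from the tail bounds. -/
lemma integral_neg_inverse_coord {m : ℕ} {α : Type*} [MeasurableSpace α] {μ : Measure α}
    {A : E m →L[ℝ] E m} (hA : A.IsInvertible) {f : α → E m}
    (hf : ∫ w, f w ∂μ = 0) (hi : ∀ l, Integrable (fun w => (-(A.inverse (f w))) l) μ) (l : Fin m) :
    ∫ w, (-(A.inverse (f w))) l ∂μ = 0 := by
  have h1 : Integrable (fun w => -(A.inverse (f w))) μ := by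
    exact Integrable.of_eval_piLp hi
  have h2 : Integrable f μ := by
    have := A.integrable_comp h1.neg
    refine this.congr (ae_of_all _ fun w => ?_)
    simp [hA.self_apply_inverse]
  have h3 : ∫ w, (-(A.inverse (f w))) ∂μ = 0 := by
    rw [integral_neg, ContinuousLinearMap.integral_comp_comm _ h2, hf, map_zero, neg_zero]
  have h4 := (EuclideanSpace.proj (𝕜 := ℝ) l).integral_comp_comm h1
  rw [h3] at h4
  simpa using h4

lemma Regular.integral_psi (hM : M.Regular ε C c δ ℓ) (hC : 0 < C) (l : Fin p) :
    ∫ w, M.psi w l ∂M.law = 0 := by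
  have := hM.law_prob
  exact integral_neg_inverse_coord hM.A_inv.1 hM.m_zero
    (fun l => ((hM.psi_coord l).one_of_two hC).integrable (by positivity)) l

lemma Regular.integral_eta (hM : M.Regular ε C c δ ℓ) (hC : 0 < C) (j : Idx d K) :
    ∫ w, M.eta w j ∂M.law = 0 := by
  have := hM.law_prob
  exact integral_neg_inverse_coord (hM.B_inv j.1).1 (hM.h_zero j.1)
    (fun l => ((hM.eta_coord (j.1, l)).one_of_two hC).integrable (by positivity)) j.2

/-! ### The optimal weighting matrix -/

lemma G_symm (M : Model p d K) (i j : Idx d K) : M.G i j = M.G j i := by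
  simp only [G]; congr 1; ext w; ring

lemma Regular.posDef_G (hM : M.Regular ε C c δ ℓ) (hc : 0 < c) : M.G.PosDef := by
  refine Matrix.PosDef.of_dotProduct_mulVec_pos ?_ fun v hv => ?_
  · ext i j; simp [M.G_symm i j]
  · have h1 := hM.G_lower v
    have h2 : 0 < ∑ j, v j ^ 2 := by
      obtain ⟨j, hj⟩ := Function.ne_iff.1 hv
      exact Finset.sum_pos' (fun _ _ => sq_nonneg _) ⟨j, Finset.mem_univ _, by
        have : v j ≠ 0 := hj
        positivity⟩
    have : 0 < c * ∑ j, v j ^ 2 := by positivity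
    simpa using this.trans_le h1

lemma Regular.Gamma0_mul_G (hM : M.Regular ε C c δ ℓ) (hc : 0 < c) :
    M.Gamma0 * M.G = M.crossMoment := by
  have hdet : IsUnit M.G.det := (Matrix.isUnit_iff_isUnit_det _).1 (hM.posDef_G hc).isUnit
  rw [Gamma0, Matrix.mul_assoc, Matrix.nonsing_inv_mul _ hdet, Matrix.mul_one]

/-- The residual `ψ - Γ₀ η` is uncorrelated with `η` under the weight `(1 - ρ) / ρ`. -/
lemma Regular.integral_resid_eta (hM : M.Regular ε C c δ ℓ) (hε : 0 < ε) (hC : 0 < C) (hc : 0 < c)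
    (l : Fin p) (j : Idx d K) :
    ∫ w, (1 - M.rhoObs w) / M.rhoObs w * (M.resid w l * M.eta w j) ∂M.law = 0 := by
  have h1 := congrFun (congrFun (hM.Gamma0_mul_G hc) l) j
  rw [Matrix.mul_apply] at h1
  have hi : ∀ k, Integrable (fun w => (1 - M.rhoObs w) / M.rhoObs w * (M.eta w k * M.eta w j))
      M.law := fun k =>
    hM.integrable_weight_mul hε (OrliczLE.integrable_mul hC (hM.eta_coord k) (hM.eta_coord j))
  have e : ∀ w, (1 - M.rhoObs w) / M.rhoObs w * (M.resid w l * M.eta w j) =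
      (1 - M.rhoObs w) / M.rhoObs w * (M.psi w l * M.eta w j) -
      ∑ k, M.Gamma0 l k * ((1 - M.rhoObs w) / M.rhoObs w * (M.eta w k * M.eta w j)) := by
    intro w
    simp only [resid, PiLp.sub_apply, Matrix.mulVec, dotProduct]
    rw [sub_mul, mul_sub, Finset.sum_mul, Finset.mul_sum]
    congr 1
    exact Finset.sum_congr rfl fun k _ => by ring
  simp_rw [e]
  rw [integral_sub, integral_finsetSum]
  · simp_rw [integral_const_mul]
    rw [sub_eq_zero]
    exact h1.symm
  · exact fun k _ => (hi k).const_mul _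
  · exact hM.integrable_weight_mul hε (OrliczLE.integrable_mul hC (hM.psi_coord l) (hM.eta_coord j))
  · exact integrable_finsetSum _ fun k _ => (hi k).const_mul _

/-! ### The variance of the influence function -/

lemma Regular.orlicz_psiTilde_terms (hM : M.Regular ε C c δ ℓ) (hε : 0 < ε) (hC : 0 < C) :
    (∀ l, OrliczLE 2 (fun z : Record p K => ind z / M.rhoObs z.1 * M.psi z.1 l) (1 / ε * C)
      M.recordLaw) ∧
    ∀ j, OrliczLE 2 (fun z : Record p K => (M.rhoObs z.1 - ind z) / M.rhoObs z.1 * M.eta z.1 j)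
      (1 / ε * C) M.recordLaw := by
  have hr := hM.rho_meas
  refine ⟨fun l => hM.orlicz_mul hε (hM.psi_coord l) hC (by positivity) (by fun_prop) fun z => ?_,
    fun j => hM.orlicz_mul hε (hM.eta_coord j) hC (by positivity) (by fun_prop) fun z => ?_⟩
  · have := hM.rho_mem z.1
    rw [abs_div, abs_of_nonneg (ind_nonneg z), abs_of_pos (by linarith : 0 < M.rhoObs z.1)]
    exact div_le_div₀ zero_le_one (ind_le_one z) hε this.1
  · have := hM.rho_mem z.1
    rw [abs_div, abs_of_pos (by linarith : 0 < M.rhoObs z.1)]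
    refine div_le_div₀ zero_le_one ?_ hε this.1
    rw [abs_le]
    constructor <;> linarith [ind_nonneg z, ind_le_one z]

lemma psiTilde_eq (M : Model p d K) (Γ : Weight p d K) (z : Record p K) (l : Fin p) :
    M.psiTilde Γ z l = ind z / M.rhoObs z.1 * M.psi z.1 l +
      ∑ j, Γ l j * ((M.rhoObs z.1 - ind z) / M.rhoObs z.1 * M.eta z.1 j) := by
  simp only [psiTilde, Matrix.mulVec, dotProduct, ind, Finset.mul_sum]
  congr 1
  · ring
  · exact Finset.sum_congr rfl fun j _ => by ring

lemma Regular.memLp_psiTilde (hM : M.Regular ε C c δ ℓ) (hε : 0 < ε) (hC : 0 < C)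
    (Γ : Weight p d K) (l : Fin p) : MemLp (fun z => M.psiTilde Γ z l) 2 M.recordLaw := by
  have := hM.isProbabilityMeasure_recordLaw hε
  obtain ⟨h1, h2⟩ := hM.orlicz_psiTilde_terms hε hC
  simp_rw [psiTilde_eq]
  refine ((h1 l).one_of_two (by positivity)).memLp_two (by positivity) |>.add ?_
  exact memLp_finsetSum _ fun j _ =>
    (((h2 j).one_of_two (by positivity)).memLp_two (by positivity)).const_mul _

lemma Regular.integral_psiTilde (hM : M.Regular ε C c δ ℓ) (hε : 0 < ε) (hC : 0 < C)
    (Γ : Weight p d K) (l : Fin p) : ∫ z, M.psiTilde Γ z l ∂M.recordLaw = 0 := by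
  have := hM.isProbabilityMeasure_recordLaw hε
  have := hM.law_prob
  have hψ := ((hM.psi_coord l).one_of_two hC).integrable (by positivity)
  have hη := fun j => ((hM.eta_coord j).one_of_two hC).integrable (by positivity)
  have h1 : Integrable (fun w => M.psiTilde Γ (w, true) l) M.law := by
    have e : ∀ w, M.psiTilde Γ (w, true) l = 1 / M.rhoObs w * M.psi w l -
        ∑ j, Γ l j * ((1 - M.rhoObs w) / M.rhoObs w * M.eta w j) := by
      intro w
      rw [psiTilde_eq, sub_eq_add_neg (1 / M.rhoObs w * _), ← Finset.sum_neg_distrib]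
      simp only [ind_true]
      congr 1
      exact Finset.sum_congr rfl fun j _ => by ring
    simp_rw [e]
    exact (hM.integrable_inv_rho_mul hε hψ).sub
      (integrable_finsetSum _ fun j _ => (hM.integrable_weight_mul hε (hη j)).const_mul _)
  have e0 : ∀ w, M.psiTilde Γ (w, false) l = ∑ j, Γ l j * M.eta w j := by
    intro w
    have : M.rhoObs w ≠ 0 := by linarith [(hM.rho_mem w).1]
    rw [psiTilde_eq]; simp [this]
  have h0 : Integrable (fun w => M.psiTilde Γ (w, false) l) M.law := by
    simp_rw [e0]
    exact integrable_finsetSum _ fun j _ => (hη j).const_mul _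
  rw [(hM.recordLaw_integral hε h1 h0).2, ← hM.integral_psi hC l]
  refine integral_congr_ae (ae_of_all _ fun w => ?_)
  have : M.rhoObs w ≠ 0 := by linarith [(hM.rho_mem w).1]
  simp only [psiTilde, if_true, Bool.false_eq_true, if_false]
  field_simp; ring

lemma integral_sub_sub_add {α : Type*} [MeasurableSpace α] {μ : Measure α} {f g h k : α → ℝ}
    (hf : Integrable f μ) (hg : Integrable g μ) (hh : Integrable h μ) (hk : Integrable k μ) :
    ∫ x, (f x - g x - h x + k x) ∂μ = ∫ x, f x ∂μ - ∫ x, g x ∂μ - ∫ x, h x ∂μ + ∫ x, k x ∂μ := by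
  have h1 : ∫ x, (f x - g x - h x) ∂μ = ∫ x, (f x - g x) ∂μ - ∫ x, h x ∂μ :=
    integral_sub (hf.sub hg) hh
  rw [← integral_sub hf hg, ← h1]
  exact integral_add ((hf.sub hg).sub hh) hk

/-- The variance of `ψ̃` as a quadratic polynomial in the weighting matrix. -/
lemma Regular.varTilde_eq (hM : M.Regular ε C c δ ℓ) (hε : 0 < ε) (hC : 0 < C)
    (Γ : Weight p d K) : M.varTilde Γ = M.baseMoment - M.crossMoment * Γ.transpose -
      Γ * M.crossMoment.transpose + Γ * M.G * Γ.transpose := by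
  have := hM.isProbabilityMeasure_recordLaw hε
  have := hM.law_prob
  ext l l'
  simp only [varTilde]
  rw [covariance_eq_sub (hM.memLp_psiTilde hε hC Γ l) (hM.memLp_psiTilde hε hC Γ l'),
    hM.integral_psiTilde hε hC, zero_mul, sub_zero]
  have hψψ := hM.integrable_inv_rho_mul hε
    (OrliczLE.integrable_mul hC (hM.psi_coord l) (hM.psi_coord l'))
  have hψη : ∀ m j, Integrable (fun w => (1 - M.rhoObs w) / M.rhoObs w * (M.psi w m * M.eta w j))
      M.law := fun m j =>
    hM.integrable_weight_mul hε (OrliczLE.integrable_mul hC (hM.psi_coord m) (hM.eta_coord j))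
  have hηη : ∀ i j, Integrable (fun w => (1 - M.rhoObs w) / M.rhoObs w * (M.eta w i * M.eta w j))
      M.law := fun i j =>
    hM.integrable_weight_mul hε (OrliczLE.integrable_mul hC (hM.eta_coord i) (hM.eta_coord j))
  -- the integrand after averaging over the indicator
  have key : ∀ w, M.rhoObs w * (M.psiTilde Γ (w, true) l * M.psiTilde Γ (w, true) l') +
      (1 - M.rhoObs w) * (M.psiTilde Γ (w, false) l * M.psiTilde Γ (w, false) l') =
      1 / M.rhoObs w * (M.psi w l * M.psi w l') -
      (∑ j, Γ l' j * ((1 - M.rhoObs w) / M.rhoObs w * (M.psi w l * M.eta w j))) -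
      (∑ j, Γ l j * ((1 - M.rhoObs w) / M.rhoObs w * (M.psi w l' * M.eta w j))) +
      ∑ j, ∑ i, Γ l i * Γ l' j * ((1 - M.rhoObs w) / M.rhoObs w * (M.eta w i * M.eta w j)) := by
    intro w
    have hr : M.rhoObs w ≠ 0 := by linarith [(hM.rho_mem w).1]
    have e1 : ∀ m m', ∑ j, Γ m' j * ((1 - M.rhoObs w) / M.rhoObs w * (M.psi w m * M.eta w j)) =
        (1 - M.rhoObs w) / M.rhoObs w * M.psi w m * Γ.mulVec (M.eta w) m' := by
      intro m m'
      simp only [Matrix.mulVec, dotProduct, Finset.mul_sum]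
      exact Finset.sum_congr rfl fun j _ => by ring
    have e2 : ∑ j, ∑ i, Γ l i * Γ l' j * ((1 - M.rhoObs w) / M.rhoObs w * (M.eta w i * M.eta w j)) =
        (1 - M.rhoObs w) / M.rhoObs w * Γ.mulVec (M.eta w) l * Γ.mulVec (M.eta w) l' := by
      simp only [Matrix.mulVec, dotProduct, Finset.mul_sum, Finset.sum_mul]
      exact Finset.sum_congr rfl fun j _ => Finset.sum_congr rfl fun i _ => by ring
    rw [e1, e1, e2]
    simp only [psiTilde, if_true, Bool.false_eq_true, if_false]
    field_simp
    ring
  have hint : ∀ b : Bool, Integrable (fun w => M.psiTilde Γ (w, b) l * M.psiTilde Γ (w, b) l')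
      M.law := by
    intro b
    have hm : ∀ m, MemLp (fun w => M.psiTilde Γ (w, b) m) 2 M.law := by
      intro m
      have hr := hM.rho_meas
      have bd : ∀ (g : Obs p K → ℝ) (X : Obs p K → ℝ), Measurable g → (∀ w, |g w| ≤ 1 / ε) →
          OrliczLE 2 X C M.law → MemLp (fun w => g w * X w) 2 M.law := by
        intro g X hg hgb hX
        have hX2 := (hX.one_of_two hC).memLp_two (by positivity)
        refine (hX2.const_mul (1 / ε)).of_le (hg.aestronglyMeasurable.mul hX2.1)
          (ae_of_all _ fun w => ?_)
        rw [norm_mul, norm_mul, Real.norm_eq_abs, Real.norm_of_nonneg (by positivity : 0 ≤ 1 / ε)]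
        gcongr; exact hgb w
      have hind : ∀ w : Obs p K, ind (w, b) = if b then 1 else 0 := fun w => rfl
      simp_rw [psiTilde_eq, hind]
      have hb0 : (0 : ℝ) ≤ if b then 1 else 0 := by split <;> norm_num
      have hb1 : (if b then 1 else 0 : ℝ) ≤ 1 := by split <;> norm_num
      set s : ℝ := if b then 1 else 0
      refine (bd _ _ (by fun_prop) (fun w => ?_) (hM.psi_coord m)).add
        (memLp_finsetSum _ fun j _ =>
          (bd _ _ (by fun_prop) (fun w => ?_) (hM.eta_coord j)).const_mul _)
      · have := hM.rho_mem w
        rw [abs_div, abs_of_nonneg hb0, abs_of_pos (by linarith : 0 < M.rhoObs w)]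
        exact div_le_div₀ zero_le_one hb1 hε this.1
      · have := hM.rho_mem w
        rw [abs_div, abs_of_pos (by linarith : 0 < M.rhoObs w)]
        refine div_le_div₀ zero_le_one ?_ hε this.1
        rw [abs_le]
        constructor <;> linarith
    exact (hm l).integrable_mul (hm l')
  have hR := (hM.recordLaw_integral hε (F := fun z => M.psiTilde Γ z l * M.psiTilde Γ z l')
    (hint true) (hint false)).2
  have hR' : ∫ z, ((fun z => M.psiTilde Γ z l) * fun z => M.psiTilde Γ z l') z ∂M.recordLaw =
    ∫ z, M.psiTilde Γ z l * M.psiTilde Γ z l' ∂M.recordLaw := rfl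
  rw [hR', hR]
  simp_rw [key]
  have i1 : ∀ m m', Integrable (fun w => ∑ j, Γ m' j *
      ((1 - M.rhoObs w) / M.rhoObs w * (M.psi w m * M.eta w j))) M.law := fun m m' =>
    integrable_finsetSum _ fun j _ => (hψη m j).const_mul _
  have i2 : Integrable (fun w => ∑ j, ∑ i, Γ l i * Γ l' j *
      ((1 - M.rhoObs w) / M.rhoObs w * (M.eta w i * M.eta w j))) M.law :=
    integrable_finsetSum _ fun j _ => integrable_finsetSum _ fun i _ => (hηη i j).const_mul _
  refine (integral_sub_sub_add hψψ (i1 l l') (i1 l' l) i2).trans ?_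
  rw [integral_finsetSum _ fun j _ => (hψη l j).const_mul _,
    integral_finsetSum _ fun j _ => (hψη l' j).const_mul _,
    integral_finsetSum _ fun j _ => integrable_finsetSum _ fun i _ => (hηη i j).const_mul _]
  simp_rw [integral_finsetSum _ fun i (_ : i ∈ Finset.univ) => (hηη i _).const_mul _,
    integral_const_mul]
  simp only [Matrix.add_apply, Matrix.sub_apply, Matrix.mul_apply, Matrix.transpose_apply,
    Finset.sum_mul]
  congr 1
  · congr 1
    congr 1
    exact Finset.sum_congr rfl fun j _ => mul_comm _ _
  · exact Finset.sum_congr rfl fun j _ => Finset.sum_congr rfl fun i _ => by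
      simp only [G]; ring

/-- Completing the square: the excess variance over the optimum. -/
lemma Regular.varTilde_sub_SigmaOpt (hM : M.Regular ε C c δ ℓ) (hε : 0 < ε) (hC : 0 < C)
    (hc : 0 < c) (Γ : Weight p d K) :
    M.varTilde Γ - M.SigmaOpt = (Γ - M.Gamma0) * M.G * (Γ - M.Gamma0).transpose := by
  have hdet : IsUnit M.G.det := (Matrix.isUnit_iff_isUnit_det _).1 (hM.posDef_G hc).isUnit
  have hGt : M.G.transpose = M.G := by ext i j; exact M.G_symm j i
  have h1 := hM.Gamma0_mul_G hc
  have h2 : M.G * M.Gamma0.transpose = M.crossMoment.transpose := by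
    rw [← h1, Matrix.transpose_mul, hGt]
  have h3 : M.crossMoment * M.G⁻¹ = M.Gamma0 := rfl
  rw [hM.varTilde_eq hε hC, SigmaOpt, h3, Matrix.transpose_sub, Matrix.sub_mul, Matrix.sub_mul,
    Matrix.mul_sub, Matrix.mul_sub, Matrix.mul_assoc Γ M.G M.Gamma0.transpose, h2, h1,
    Matrix.mul_assoc Γ]
  have h4 : M.crossMoment * M.Gamma0.transpose = M.Gamma0 * M.crossMoment.transpose := by
    rw [← h1, Matrix.mul_assoc, h2, h1]
  rw [h4]
  abel

lemma Regular.SigmaOpt_eq (hM : M.Regular ε C c δ ℓ) (hε : 0 < ε) (hC : 0 < C) (hc : 0 < c) :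
    M.SigmaOpt = M.varTilde M.Gamma0 := by
  have := hM.varTilde_sub_SigmaOpt hε hC hc M.Gamma0
  rw [sub_self, Matrix.zero_mul, Matrix.zero_mul, sub_eq_zero] at this
  exact this.symm

lemma Regular.posSemidef_excess (hM : M.Regular ε C c δ ℓ) (hε : 0 < ε) (hC : 0 < C)
    (hc : 0 < c) (Γ : Weight p d K) : (M.varTilde Γ - M.SigmaOpt).PosSemidef := by
  rw [hM.varTilde_sub_SigmaOpt hε hC hc]
  exact (hM.posDef_G hc).posSemidef.mul_mul_conjTranspose_same (Γ - M.Gamma0)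

lemma Regular.trace_SigmaOpt_le (hM : M.Regular ε C c δ ℓ) (hε : 0 < ε) (hC : 0 < C)
    (hc : 0 < c) (Γ : Weight p d K) : M.SigmaOpt.trace ≤ (M.varTilde Γ).trace := by
  have := (hM.posSemidef_excess hε hC hc Γ).trace_nonneg
  rw [Matrix.trace_sub] at this
  linarith

end Model


/-! ### A central limit theorem for triangular arrays of growing dimension -/

lemma norm_pow_sub_pow_le_mul {z w : ℂ} (hz : ‖z‖ ≤ 1) (hw : ‖w‖ ≤ 1) (n : ℕ) :
    ‖z ^ n - w ^ n‖ ≤ n * ‖z - w‖ := by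
  induction n with
  | zero => simp
  | succ n ih =>
    have : z ^ (n + 1) - w ^ (n + 1) = z ^ n * (z - w) + (z ^ n - w ^ n) * w := by ring
    rw [this]
    calc _ ≤ ‖z ^ n * (z - w)‖ + ‖(z ^ n - w ^ n) * w‖ := norm_add_le _ _
      _ ≤ 1 * ‖z - w‖ + (n * ‖z - w‖) * 1 := by
        rw [norm_mul, norm_mul]
        gcongr
        rw [norm_pow]; exact pow_le_one₀ (norm_nonneg _) hz
      _ = _ := by push_cast; ring

section CLT

variable {α : Type*} [MeasurableSpace α] {μ : Measure α} [IsProbabilityMeasure μ] {g : α → ℝ}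
  {B s : ℝ}

/-- Second-order expansion of the characteristic function of a centred sub-exponential variable,
with an explicit error. -/
lemma OrliczLE.charFun_expansion (hg : OrliczLE 1 g B μ) (hB : 0 < B) (h0 : ∫ x, g x ∂μ = 0)
    (hs0 : 0 ≤ s) (hs : s * (2 * B) ≤ 1) :
    ‖∫ x, Complex.exp (s * g x * Complex.I) ∂μ - ((1 - s ^ 2 / 2 * ∫ x, g x ^ 2 ∂μ : ℝ) : ℂ)‖ ≤
      96 * s ^ 3 * B ^ 3 := by
  have hi1 := hg.integrable hB
  have hi2 := hg.integrable_pow hB 2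
  have hexp : Integrable (fun x => Complex.exp (s * g x * Complex.I)) μ := by
    have hm : AEMeasurable g μ := hg.1
    refine Integrable.of_bound (C := 1) ?_ (ae_of_all _ fun x => ?_)
    · exact (Complex.measurable_exp.comp_aemeasurable
        (((Complex.measurable_ofReal.comp_aemeasurable hm).const_mul _).mul_const
          _)).aestronglyMeasurable
    · rw [← Complex.ofReal_mul, Complex.norm_exp_ofReal_mul_I]
  have hpoly : Integrable
      (fun x => (((1 - s ^ 2 / 2 * g x ^ 2 : ℝ) : ℂ) + (s * g x : ℝ) * Complex.I)) μ := by
    refine Integrable.add ?_ ?_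
    · exact ((integrable_const (1 : ℝ)).sub (hi2.const_mul (s ^ 2 / 2))).ofReal
    · exact ((hi1.const_mul s).ofReal).mul_const _
  have hmean : ∫ x, (((1 - s ^ 2 / 2 * g x ^ 2 : ℝ) : ℂ) + (s * g x : ℝ) * Complex.I) ∂μ =
      ((1 - s ^ 2 / 2 * ∫ x, g x ^ 2 ∂μ : ℝ) : ℂ) := by
    have e1 : ∫ x, ((1 - s ^ 2 / 2 * g x ^ 2 : ℝ) : ℂ) ∂μ =
        ((1 - s ^ 2 / 2 * ∫ x, g x ^ 2 ∂μ : ℝ) : ℂ) := by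
      rw [integral_complex_ofReal, integral_sub (integrable_const _) (hi2.const_mul _),
        integral_const_mul]
      simp
    have e2 : ∫ x, ((s * g x : ℝ) : ℂ) * Complex.I ∂μ = 0 := by
      rw [integral_mul_const, integral_complex_ofReal, integral_const_mul, h0]; simp
    rw [integral_add, e1, e2, add_zero]
    · exact ((integrable_const (1 : ℝ)).sub (hi2.const_mul (s ^ 2 / 2))).ofReal
    · exact ((hi1.const_mul s).ofReal).mul_const _
  rw [← hmean, ← integral_sub hexp hpoly]
  have hpt : ∀ x, ‖Complex.exp (s * g x * Complex.I) -
      (((1 - s ^ 2 / 2 * g x ^ 2 : ℝ) : ℂ) + (s * g x : ℝ) * Complex.I)‖ ≤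
      48 * s ^ 3 * B ^ 3 * Real.exp (|g x| / B) := by
    intro x
    have h := Complex.norm_exp_sub_sum_le_norm_mul_exp (s * g x * Complex.I) 3
    have e : ∑ m ∈ Finset.range 3, ((s : ℂ) * g x * Complex.I) ^ m / (m.factorial : ℂ) =
        (((1 - s ^ 2 / 2 * g x ^ 2 : ℝ) : ℂ) + (s * g x : ℝ) * Complex.I) := by
      simp only [Finset.sum_range_succ, Finset.range_zero, Finset.sum_empty]
      norm_num [Nat.factorial]
      rw [mul_pow, mul_pow, Complex.I_sq]
      ring
    rw [e] at h
    refine h.trans ?_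
    have hn : ‖(s : ℂ) * g x * Complex.I‖ = s * |g x| := by
      simp [abs_of_nonneg hs0]
    rw [hn]
    have h1 : s * |g x| ≤ |g x| / (2 * B) := by
      rw [le_div_iff₀ (by positivity)]; nlinarith [abs_nonneg (g x)]
    have h2 := abs_pow_le_exp (show 0 < 2 * B by positivity) 3 (g x)
    have h3 : Real.exp (|g x| / B) = Real.exp (|g x| / (2 * B)) * Real.exp (|g x| / (2 * B)) := by
      rw [← Real.exp_add]; congr 1; field_simp; ring
    have h2' : |g x| ^ 3 ≤ 48 * B ^ 3 * Real.exp (|g x| / (2 * B)) := by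
      norm_num [Nat.factorial] at h2
      linarith
    calc (s * |g x|) ^ 3 * Real.exp (s * |g x|)
        = s ^ 3 * |g x| ^ 3 * Real.exp (s * |g x|) := by ring
      _ ≤ s ^ 3 * (48 * B ^ 3 * Real.exp (|g x| / (2 * B))) * Real.exp (|g x| / (2 * B)) := by
        gcongr
      _ = _ := by rw [h3]; ring
  calc _ ≤ ∫ x, 48 * s ^ 3 * B ^ 3 * Real.exp (|g x| / B) ∂μ :=
        norm_integral_le_of_norm_le (hg.integrable_exp.const_mul _) (ae_of_all _ hpt)
    _ = 48 * s ^ 3 * B ^ 3 * ∫ x, Real.exp (|g x| / B) ∂μ := integral_const_mul _ _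
    _ ≤ 48 * s ^ 3 * B ^ 3 * 2 := by gcongr; exact hg.integral_exp_le
    _ = _ := by ring

/-- The characteristic function of a sum of i.i.d. variables against that of a Gaussian variable
with the same variance: the `N`-th powers of two numbers in the unit disc are compared. -/
lemma IsSample.charFun_sum_le {Ω : Type*} [MeasurableSpace Ω] {P : Measure Ω}
    [IsProbabilityMeasure P] {N : ℕ} {W : Fin N → Ω → α} (h : IsSample W μ P)
    (hg : OrliczLE 1 g B μ) (hB : 0 < B) (h0 : ∫ x, g x ∂μ = 0)
    (hs0 : 0 ≤ s) (hs : s * (2 * B) ≤ 1) :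
    ‖∫ ω, Complex.exp ((s * ∑ i, g (W i ω) : ℝ) * Complex.I) ∂P -
      Complex.exp ((-(N * s ^ 2 / 2 * ∫ x, g x ^ 2 ∂μ) : ℝ) : ℂ)‖ ≤
      N * (96 * s ^ 3 * B ^ 3 + 4 * s ^ 4 * B ^ 4) := by
  set φ := ∫ x, Complex.exp (s * g x * Complex.I) ∂μ with hφ
  set v := ∫ x, g x ^ 2 ∂μ with hv
  have hv0 : 0 ≤ v := integral_nonneg fun _ => sq_nonneg _
  have hvB : v ≤ 4 * B ^ 2 := hg.integral_sq_le hB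
  have hmeas : ∀ i, AEMeasurable (fun ω => g (W i ω)) P := h.aemeasurable_comp hg.1
  have hφ1 : ∀ i, charFun (P.map fun ω => g (W i ω)) s = φ := by
    intro i
    rw [charFun_apply_real, integral_map (hmeas i) (by fun_prop), hφ]
    have hm : AEMeasurable g μ := hg.1
    exact h.integral_comp (f := fun x => Complex.exp (s * g x * Complex.I))
      (Complex.measurable_exp.comp_aemeasurable ((((Complex.measurable_ofReal.comp_aemeasurable
        hm).const_mul _)).mul_const _)).aestronglyMeasurable i
  have hprod : ∫ ω, Complex.exp ((s * ∑ i, g (W i ω) : ℝ) * Complex.I) ∂P = φ ^ N := by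
    have h1 := congrFun ((h.iIndepFun_comp hg.1).charFun_map_fun_sum_eq_prod hmeas) s
    rw [charFun_apply_real, integral_map (Finset.aemeasurable_fun_sum _ fun i _ => hmeas i)
      (by fun_prop)] at h1
    rw [Finset.prod_apply] at h1
    simp_rw [hφ1] at h1
    simp only [Finset.prod_const, Finset.card_univ, Fintype.card_fin] at h1
    rw [← h1]
    congr 1; ext ω; push_cast; ring_nf
  have hpow : Complex.exp ((-(N * s ^ 2 / 2 * v) : ℝ) : ℂ) =
      Complex.exp ((-(s ^ 2 / 2 * v) : ℝ) : ℂ) ^ N := by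
    rw [← Complex.exp_nat_mul]; congr 1; push_cast; ring
  rw [hprod, hpow]
  have hφn : ‖φ‖ ≤ 1 := by
    have h2 := norm_integral_le_of_norm_le_const (μ := μ) (C := 1)
      (f := fun x => Complex.exp (s * g x * Complex.I)) (ae_of_all _ fun x => by
        rw [← Complex.ofReal_mul, Complex.norm_exp_ofReal_mul_I])
    simpa using h2
  have hwn : ‖Complex.exp ((-(s ^ 2 / 2 * v) : ℝ) : ℂ)‖ ≤ 1 := by
    rw [Complex.norm_exp_ofReal]
    exact Real.exp_le_one_iff.2 (by have : 0 ≤ s ^ 2 / 2 * v := by positivity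
                                    linarith)
  refine (norm_pow_sub_pow_le_mul hφn hwn N).trans ?_
  gcongr
  have hy : s ^ 2 / 2 * v ≤ 2 * s ^ 2 * B ^ 2 := by nlinarith [sq_nonneg s]
  have hy0 : 0 ≤ s ^ 2 / 2 * v := by positivity
  have hy1 : 2 * s ^ 2 * B ^ 2 ≤ 1 := by nlinarith [mul_nonneg hs0 hB.le]
  have h2 := Real.norm_exp_sub_one_sub_id_le (x := -(s ^ 2 / 2 * v)) (by
    rw [norm_neg, Real.norm_of_nonneg hy0]; linarith)
  have h3 : ‖Complex.exp ((-(s ^ 2 / 2 * v) : ℝ) : ℂ) - ((1 - s ^ 2 / 2 * v : ℝ) : ℂ)‖ ≤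
      4 * s ^ 4 * B ^ 4 := by
    rw [← Complex.ofReal_exp, ← Complex.ofReal_sub, Complex.norm_real]
    calc _ = ‖Real.exp (-(s ^ 2 / 2 * v)) - 1 - -(s ^ 2 / 2 * v)‖ := by congr 1; ring
      _ ≤ (s ^ 2 / 2 * v) ^ 2 := by rwa [norm_neg, Real.norm_of_nonneg hy0] at h2
      _ ≤ (2 * s ^ 2 * B ^ 2) ^ 2 := by gcongr
      _ = _ := by ring
  calc _ ≤ ‖φ - ((1 - s ^ 2 / 2 * v : ℝ) : ℂ)‖ +
        ‖((1 - s ^ 2 / 2 * v : ℝ) : ℂ) - Complex.exp ((-(s ^ 2 / 2 * v) : ℝ) : ℂ)‖ :=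
        norm_sub_le_norm_sub_add_norm_sub _ _ _
    _ ≤ _ := by
      rw [norm_sub_rev _ (Complex.exp _)]
      exact add_le_add (hg.charFun_expansion hB h0 hs0 hs) h3

end CLT

section Merging

variable {a : ℕ}

/-- Pointwise limits of positive semidefinite matrices are positive semidefinite. -/
lemma posSemidef_of_tendsto {V : ℕ → Matrix (Fin a) (Fin a) ℝ} {S : Matrix (Fin a) (Fin a) ℝ}
    (hV : ∀ N, (V N).PosSemidef) (h : Tendsto V atTop (𝓝 S)) : S.PosSemidef := by
  refine Matrix.PosSemidef.of_dotProduct_mulVec_nonneg ?_ fun x => ?_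
  · have h1 : Tendsto (fun N => (V N).conjTranspose) atTop (𝓝 S.conjTranspose) :=
      (Continuous.tendsto (by fun_prop) S).comp h
    simp_rw [(hV _).1.eq] at h1
    exact tendsto_nhds_unique h1 h
  · have h1 : Tendsto (fun N => star x ⬝ᵥ (V N).mulVec x) atTop (𝓝 (star x ⬝ᵥ S.mulVec x)) :=
      ((Continuous.dotProduct continuous_const
        (Continuous.matrix_mulVec continuous_id continuous_const)).tendsto S).comp h
    exact ge_of_tendsto' h1 fun N => (hV N).dotProduct_mulVec_nonneg x

lemma tendsto_charFun_gaussian {V : ℕ → Matrix (Fin a) (Fin a) ℝ} {S : Matrix (Fin a) (Fin a) ℝ}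
    (hV : ∀ N, (V N).PosSemidef) (h : Tendsto V atTop (𝓝 S)) (t : E a) :
    Tendsto (fun N => charFun (multivariateGaussian 0 (V N)) t) atTop
      (𝓝 (charFun (multivariateGaussian 0 S) t)) := by
  have hS := posSemidef_of_tendsto hV h
  simp_rw [charFun_multivariateGaussian (hV _), charFun_multivariateGaussian hS]
  have h1 : Tendsto (fun N => t.ofLp ⬝ᵥ (V N).mulVec t.ofLp) atTop
      (𝓝 (t.ofLp ⬝ᵥ S.mulVec t.ofLp)) :=
    ((Continuous.dotProduct continuous_const
      (Continuous.matrix_mulVec continuous_id continuous_const)).tendsto S).comp h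
  have h2 := (Complex.continuous_ofReal.tendsto _).comp h1
  exact (Complex.continuous_exp.tendsto _).comp
    ((tendsto_const_nhds).sub (h2.div_const 2))

lemma tendsto_gaussian_of_charFun {ν : ℕ → ProbabilityMeasure (E a)}
    {V : ℕ → Matrix (Fin a) (Fin a) ℝ} {S : Matrix (Fin a) (Fin a) ℝ}
    (hV : ∀ N, (V N).PosSemidef) (h : Tendsto V atTop (𝓝 S))
    (hν : ∀ t : E a, Tendsto (fun N => charFun (ν N : Measure (E a)) t -
      charFun (multivariateGaussian 0 (V N)) t) atTop (𝓝 0)) :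
    Tendsto ν atTop (𝓝 ⟨multivariateGaussian 0 S, inferInstance⟩) := by
  refine ProbabilityMeasure.tendsto_of_tendsto_charFun fun t => ?_
  have := (hν t).add (tendsto_charFun_gaussian hV h t)
  simpa using this

/-- If the characteristic functions of `ν N` and of `N(0, V N)` merge and the `V N` are bounded,
then the measures merge weakly: every subsequence has a further one along which `V N` converges,
and there Lévy's theorem applies to both. -/
lemma merge_gaussian_of_charFun {ν : ℕ → ProbabilityMeasure (E a)}
    {V : ℕ → Matrix (Fin a) (Fin a) ℝ} (hV : ∀ N, (V N).PosSemidef) {b : ℝ}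
    (hb : ∀ N i j, |V N i j| ≤ b)
    (hν : ∀ t : E a, Tendsto (fun N => charFun (ν N : Measure (E a)) t -
      charFun (multivariateGaussian 0 (V N)) t) atTop (𝓝 0)) (f : E a →ᵇ ℝ) :
    Tendsto (fun N => ∫ x, f x ∂(ν N : Measure (E a)) - ∫ x, f x ∂multivariateGaussian 0 (V N))
      atTop (𝓝 0) := by
  refine tendsto_of_subseq_tendsto fun ns hns => ?_
  have hbd : Bornology.IsBounded (Set.pi Set.univ fun _ : Fin a => Set.pi Set.univ
      fun _ : Fin a => Metric.closedBall (0 : ℝ) b) :=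
    Bornology.IsBounded.pi fun _ => Bornology.IsBounded.pi fun _ => Metric.isBounded_closedBall
  obtain ⟨S, -, ms, hms, hlim⟩ := tendsto_subseq_of_bounded hbd
    (x := fun k => (V (ns k) : Fin a → Fin a → ℝ)) (fun k i _ j _ =>
      mem_closedBall_zero_iff.2 (hb (ns k) i j))
  refine ⟨ms, ?_⟩
  have hsub : Tendsto (fun k => ns (ms k)) atTop atTop := hns.comp hms.tendsto_atTop
  have h1 := tendsto_gaussian_of_charFun (ν := fun k => ν (ns (ms k))) (V := fun k => V (ns (ms k)))
    (S := S) (fun k => hV _) hlim (fun t => (hν t).comp hsub)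
  have h2 := tendsto_gaussian_of_charFun
    (ν := fun k =>
      (⟨multivariateGaussian 0 (V (ns (ms k))), inferInstance⟩ : ProbabilityMeasure (E a)))
    (V := fun k => V (ns (ms k))) (S := S) (fun k => hV _) hlim (fun t => by simp)
  have h3 := ProbabilityMeasure.tendsto_iff_forall_integral_tendsto.1 h1 f
  have h4 := ProbabilityMeasure.tendsto_iff_forall_integral_tendsto.1 h2 f
  simpa using h3.sub h4

end Merging

/-- The covariances are bounded entrywise, since a quadratic form determines the entries by
polarization. -/
lemma exists_bound_of_quadratic {a : ℕ} {α : ℕ → Type*} [∀ N, MeasurableSpace (α N)]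
    {μ : ∀ N, Measure (α N)} {f : ∀ N, α N → E a} {V : ℕ → Matrix (Fin a) (Fin a) ℝ} {r : ℕ → ℝ}
    (hf : ∀ t : E a, ∃ B : ℝ, 0 < B ∧ ∀ N, OrliczLE 1 (fun x => inner ℝ t (f N x)) B (μ N))
    (hVq : ∀ (t : E a) N, ∫ x, (inner ℝ t (f N x)) ^ 2 ∂μ N = t.ofLp ⬝ᵥ (V N).mulVec t.ofLp)
    (hV : ∀ N, (V N).PosSemidef) (hr : ∀ N, 0 ≤ r N ∧ r N ≤ 1) :
    ∃ b : ℝ, ∀ N i j, |(r N • V N) i j| ≤ b := by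
  have hq : ∀ t : E a, ∃ b : ℝ, 0 ≤ b ∧ ∀ N, 0 ≤ t.ofLp ⬝ᵥ (V N).mulVec t.ofLp ∧
      t.ofLp ⬝ᵥ (V N).mulVec t.ofLp ≤ b := by
    intro t
    obtain ⟨B, hB, h⟩ := hf t
    refine ⟨4 * B ^ 2, by positivity, fun N => ?_⟩
    rw [← hVq]
    exact ⟨integral_nonneg fun _ => sq_nonneg _, (h N).integral_sq_le hB⟩
  have hij : ∀ i j, ∃ b : ℝ, ∀ N, |(r N • V N) i j| ≤ b := by
    intro i j
    obtain ⟨b1, h1, hb1⟩ := hq (EuclideanSpace.single i 1)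
    obtain ⟨b2, h2, hb2⟩ := hq (EuclideanSpace.single j 1)
    obtain ⟨b3, h3, hb3⟩ := hq (EuclideanSpace.single i 1 + EuclideanSpace.single j 1)
    refine ⟨b1 + b2 + b3, fun N => ?_⟩
    have hsymm : V N j i = V N i j := by
      have := congrFun (congrFun (hV N).1 i) j
      simpa using this
    have e1 := hb1 N
    have e2 := hb2 N
    have e3 := hb3 N
    simp only [WithLp.ofLp_add, PiLp.ofLp_single, Matrix.mulVec_add, add_dotProduct,
      dotProduct_add, Matrix.mulVec_single_one, single_one_dotProduct, Matrix.col_apply] at e1 e2 e3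
    rw [hsymm] at e3
    have h4 : |V N i j| ≤ b1 + b2 + b3 := by rw [abs_le]; constructor <;> linarith
    rw [Matrix.smul_apply, smul_eq_mul, abs_mul, abs_of_nonneg (hr N).1]
    nlinarith [(hr N).2, (hr N).1, abs_nonneg (V N i j)]
  choose b hb using hij
  refine ⟨∑ i, ∑ j, |b i j|, fun N i j => (hb i j N).trans ((le_abs_self _).trans ?_)⟩
  refine (Finset.single_le_sum (f := fun j => |b i j|) (fun _ _ => abs_nonneg _)
    (Finset.mem_univ j)).trans ?_
  exact Finset.single_le_sum (f := fun i => ∑ j, |b i j|)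
    (fun _ _ => Finset.sum_nonneg fun _ _ => abs_nonneg _) (Finset.mem_univ i)

section Array

variable {a : ℕ} {Ω α : ℕ → Type*} [∀ N, MeasurableSpace (Ω N)] [∀ N, MeasurableSpace (α N)]
  {P : ∀ N, Measure (Ω N)} [∀ N, IsProbabilityMeasure (P N)] {μ : ∀ N, Measure (α N)}
  [∀ N, IsProbabilityMeasure (μ N)] {W : ∀ N, Fin N → Ω N → α N}
  {f : ∀ N, α N → E a} {V : ℕ → Matrix (Fin a) (Fin a) ℝ} {r : ℕ → ℝ} {Y : ∀ N, Ω N → E a}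

/-- The characteristic functions of `Y N ≈ √(r N / N) ∑ f (W i)` and of `N(0, r V)` merge. -/
lemma charFun_merge (h : ∀ N, IsSample (W N) (μ N) (P N))
    (hf : ∀ t : E a, ∃ B : ℝ, 0 < B ∧ ∀ N, OrliczLE 1 (fun x => inner ℝ t (f N x)) B (μ N))
    (hf0 : ∀ (t : E a) N, ∫ x, inner ℝ t (f N x) ∂μ N = 0)
    (hVq : ∀ (t : E a) N, ∫ x, (inner ℝ t (f N x)) ^ 2 ∂μ N = t.ofLp ⬝ᵥ (V N).mulVec t.ofLp)
    (hV : ∀ N, (V N).PosSemidef) (hr : ∀ N, 0 ≤ r N ∧ r N ≤ 1)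
    (hY : ∀ N, AEMeasurable (Y N) (P N))
    (hYf : ∀ t : E a, ∀ s : ℝ, 0 < s → WHP atTop P fun N ω =>
      |inner ℝ t (Y N ω) - √(r N / N) * ∑ i, inner ℝ t (f N (W N i ω))| < s) (t : E a) :
    Tendsto (fun N => charFun ((P N).map (Y N)) t -
      charFun (multivariateGaussian 0 (r N • V N)) t) atTop (𝓝 0) := by
  obtain ⟨B, hB, hfB⟩ := hf t
  set X : ∀ N, Ω N → ℝ := fun N ω => √(r N / N) * ∑ i, inner ℝ t (f N (W N i ω)) with hX
  have hXm : ∀ N, AEMeasurable (X N) (P N) := fun N =>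
    (Finset.aemeasurable_fun_sum _ fun i _ => (h N).aemeasurable_comp (hfB N).1 i).const_mul _
  have hZm : ∀ N, AEMeasurable (fun ω => inner ℝ t (Y N ω)) (P N) := fun N =>
    (Continuous.measurable (by fun_prop : Continuous fun y : E a => inner ℝ t y)).comp_aemeasurable
      (hY N)
  have hcexp : ∀ N (Z : Ω N → ℝ), AEMeasurable Z (P N) →
      Integrable (fun ω => Complex.exp (Z ω * Complex.I)) (P N) := by
    intro N Z hZ
    refine Integrable.of_bound (C := 1) ?_ (ae_of_all _ fun x => ?_)
    · exact (Complex.measurable_exp.comp_aemeasurable ((Complex.measurable_ofReal.comp_aemeasurable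
        hZ).mul_const _)).aestronglyMeasurable
    · rw [Complex.norm_exp_ofReal_mul_I]
  -- the Gaussian limit for the linear form
  have hlin : Tendsto (fun N => ∫ ω, Complex.exp (X N ω * Complex.I) ∂P N -
      charFun (multivariateGaussian 0 (r N • V N)) t) atTop (𝓝 0) := by
    have hs : Tendsto (fun N : ℕ => 1 / √(N : ℝ)) atTop (𝓝 0) := by
      have := tendsto_inv_atTop_zero.comp (Real.tendsto_sqrt_atTop.comp
        (tendsto_natCast_atTop_atTop (R := ℝ)))
      simpa [Function.comp_def] using this
    have hbound : Tendsto (fun N : ℕ => 96 * B ^ 3 * (1 / √(N : ℝ)) +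
        4 * B ^ 4 * (1 / √(N : ℝ)) ^ 2) atTop (𝓝 0) := by
      have := (hs.const_mul (96 * B ^ 3)).add ((hs.pow 2).const_mul (4 * B ^ 4))
      simpa using this
    refine squeeze_zero_norm' ?_ hbound
    have hs1 : ∀ᶠ N : ℕ in atTop, 1 / √(N : ℝ) * (2 * B) ≤ 1 := by
      have : Tendsto (fun N : ℕ => 1 / √(N : ℝ) * (2 * B)) atTop (𝓝 0) := by
        simpa using hs.mul_const (2 * B)
      exact (this.eventually_lt_const one_pos).mono fun _ h => h.le
    filter_upwards [hs1, eventually_gt_atTop 0] with N h1 hN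
    have hN' : (0 : ℝ) < N := by exact_mod_cast hN
    have hsN : √(r N / N) ≤ 1 / √(N : ℝ) := by
      rw [Real.sqrt_div (hr N).1]
      gcongr
      exact Real.sqrt_le_one.2 (hr N).2
    have hm := (h N).charFun_sum_le (hfB N) hB (hf0 t N) (Real.sqrt_nonneg (r N / N))
      ((mul_le_mul_of_nonneg_right hsN (by positivity)).trans h1)
    have hg : charFun (multivariateGaussian 0 (r N • V N)) t =
        Complex.exp ((-(N * √(r N / N) ^ 2 / 2 * ∫ x, (inner ℝ t (f N x)) ^ 2 ∂μ N) : ℝ) : ℂ) := by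
      rw [charFun_multivariateGaussian ((hV N).smul (hr N).1), hVq,
        Real.sq_sqrt (div_nonneg (hr N).1 hN'.le)]
      congr 1
      rw [Matrix.smul_mulVec, dotProduct_smul, mul_div_cancel₀ _ hN'.ne', inner_zero_right]
      push_cast
      simp only [smul_eq_mul, Complex.ofReal_mul]
      ring
    rw [hg]
    refine hm.trans ?_
    have hq : 1 / √(N : ℝ) * √(N : ℝ) = 1 := by
      have : √(N : ℝ) ≠ 0 := (Real.sqrt_pos.2 hN').ne'
      field_simp
    have hq2 : (N : ℝ) * (1 / √(N : ℝ)) ^ 2 = 1 := by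
      rw [div_pow, Real.sq_sqrt hN'.le]; field_simp
    set q := 1 / √(N : ℝ)
    have hq0 : 0 ≤ q := by positivity
    calc (N : ℝ) * (96 * √(r N / N) ^ 3 * B ^ 3 + 4 * √(r N / N) ^ 4 * B ^ 4)
        ≤ N * (96 * q ^ 3 * B ^ 3 + 4 * q ^ 4 * B ^ 4) := by gcongr
      _ = (N * q ^ 2) * (96 * B ^ 3 * q + 4 * B ^ 4 * q ^ 2) := by ring
      _ = _ := by rw [hq2, one_mul]
  -- the remainder is negligible
  have hdiff : Tendsto (fun N => charFun ((P N).map (Y N)) t -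
      ∫ ω, Complex.exp (X N ω * Complex.I) ∂P N) atTop (𝓝 0) := by
    have hchar : ∀ N, charFun ((P N).map (Y N)) t =
        ∫ ω, Complex.exp ((inner ℝ t (Y N ω) : ℝ) * Complex.I) ∂P N := by
      intro N
      rw [charFun_apply, integral_map (hY N) (by fun_prop)]
      simp_rw [real_inner_comm]
    rw [Metric.tendsto_nhds]
    intro η hη
    have hw := hYf t (η / 4) (by positivity)
    have hw' := ENNReal.tendsto_nhds_zero.1 hw (ENNReal.ofReal (η / 8)) (by simpa using hη)
    filter_upwards [hw'] with N hN
    rw [dist_zero_right, hchar, ← integral_sub (hcexp N _ (hZm N)) (hcexp N _ (hXm N))]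
    -- `bad` need not be measurable, so its measurable hull is used
    set bad := {ω | ¬ |inner ℝ t (Y N ω) - X N ω| < η / 4} with hbad
    have hpt : ∀ ω, ‖Complex.exp ((inner ℝ t (Y N ω) : ℝ) * Complex.I) -
        Complex.exp (X N ω * Complex.I)‖ ≤
          η / 4 + (toMeasurable (P N) bad).indicator (fun _ => 2) ω := by
      intro ω
      by_cases hω : ω ∈ bad
      · rw [Set.indicator_of_mem (subset_toMeasurable _ _ hω)]
        refine (norm_sub_le _ _).trans ?_
        rw [Complex.norm_exp_ofReal_mul_I, Complex.norm_exp_ofReal_mul_I]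
        linarith
      · have h1 : |inner ℝ t (Y N ω) - X N ω| < η / 4 := by
          by_contra hcon; exact hω hcon
        have h2 : Complex.exp ((inner ℝ t (Y N ω) : ℝ) * Complex.I) -
            Complex.exp (X N ω * Complex.I) =
            Complex.exp (X N ω * Complex.I) *
              (Complex.exp (Complex.I * ((inner ℝ t (Y N ω) - X N ω : ℝ) : ℂ)) - 1) := by
          rw [mul_sub, ← Complex.exp_add, mul_one]
          congr 2; push_cast; ring
        have h3 : 0 ≤ (toMeasurable (P N) bad).indicator (fun _ => (2 : ℝ)) ω :=
          Set.indicator_nonneg (fun _ _ => by norm_num) _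
        rw [h2, norm_mul, Complex.norm_exp_ofReal_mul_I, one_mul]
        have h4 := Real.norm_exp_I_mul_ofReal_sub_one_le (x := inner ℝ t (Y N ω) - X N ω)
        rw [Real.norm_eq_abs] at h4
        linarith
    have hmeasb := measurableSet_toMeasurable (P N) bad
    calc _ ≤ ∫ ω, (η / 4 + (toMeasurable (P N) bad).indicator (fun _ => (2 : ℝ)) ω) ∂P N :=
          norm_integral_le_of_norm_le ((integrable_const _).add
            ((integrable_const _).indicator hmeasb)) (ae_of_all _ hpt)
      _ = η / 4 + (P N).real (toMeasurable (P N) bad) * 2 := by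
          rw [integral_add (integrable_const _) ((integrable_const _).indicator hmeasb),
            integral_indicator hmeasb]
          simp only [Measure.real, measure_toMeasurable]
          simp [Measure.real]
      _ ≤ η / 4 + η / 8 * 2 := by
          gcongr
          rw [Measure.real, measure_toMeasurable]
          exact ENNReal.toReal_le_of_le_ofReal (by positivity) hN
      _ < η := by linarith
  simpa using hdiff.add hlin

/-- The central limit theorem for triangular arrays, in the form of weak merging with `N(0, r V)`
and of convergence in distribution along convergent covariances. -/
theorem asymptotic_normality_array (h : ∀ N, IsSample (W N) (μ N) (P N))
    (hf : ∀ t : E a, ∃ B : ℝ, 0 < B ∧ ∀ N, OrliczLE 1 (fun x => inner ℝ t (f N x)) B (μ N))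
    (hf0 : ∀ (t : E a) N, ∫ x, inner ℝ t (f N x) ∂μ N = 0)
    (hVq : ∀ (t : E a) N, ∫ x, (inner ℝ t (f N x)) ^ 2 ∂μ N = t.ofLp ⬝ᵥ (V N).mulVec t.ofLp)
    (hV : ∀ N, (V N).PosSemidef) (hr : ∀ N, 0 ≤ r N ∧ r N ≤ 1)
    (hY : ∀ N, AEMeasurable (Y N) (P N))
    (hYf : ∀ t : E a, ∀ s : ℝ, 0 < s → WHP atTop P fun N ω =>
      |inner ℝ t (Y N ω) - √(r N / N) * ∑ i, inner ℝ t (f N (W N i ω))| < s) :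
    (∀ g : E a →ᵇ ℝ, Tendsto (fun N => (∫ ω, g (Y N ω) ∂P N) -
      ∫ x, g x ∂multivariateGaussian 0 (r N • V N)) atTop (𝓝 0)) ∧
    ∀ S : Matrix (Fin a) (Fin a) ℝ, Tendsto (fun N => r N • V N) atTop (𝓝 S) →
      TendstoInDistribution Y atTop (fun x : E a => x) P (multivariateGaussian 0 S) := by
  have hc := charFun_merge h hf hf0 hVq hV hr hY hYf
  have hV' : ∀ N, (r N • V N).PosSemidef := fun N => (hV N).smul (hr N).1
  obtain ⟨b, hb⟩ := exists_bound_of_quadratic hf hVq hV hr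
  let ν : ℕ → ProbabilityMeasure (E a) := fun N =>
    ⟨(P N).map (Y N), Measure.isProbabilityMeasure_map (hY N)⟩
  constructor
  · intro g
    have := merge_gaussian_of_charFun (ν := ν) hV' hb hc g
    refine this.congr fun N => ?_
    congr 1
    exact integral_map (hY N) g.continuous.aestronglyMeasurable
  · intro S hS
    refine ⟨hY, aemeasurable_id', ?_⟩
    have := tendsto_gaussian_of_charFun (ν := ν) hV' hS hc
    have e : (⟨Measure.map (fun x : E a => x) (multivariateGaussian 0 S),
        Measure.isProbabilityMeasure_map aemeasurable_id'⟩ : ProbabilityMeasure (E a)) =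
        ⟨multivariateGaussian 0 S, inferInstance⟩ := Subtype.ext Measure.map_id
    rw [e]
    exact this

end Array


/-! ### Linearization of estimating equations: deterministic part -/

/-- The average of a vector-valued function over the data. -/
noncomputable def vavg {α F : Type*} [AddCommGroup F] [Module ℝ F] {N : ℕ} (D : Fin N → α)
    (f : α → F) : F := (1 / (N : ℝ)) • ∑ i, f (D i)

lemma inner_vavg {α : Type*} {N m : ℕ} (D : Fin N → α) (f : α → E m) (u : E m) :
    inner ℝ u (vavg D f) = avg D fun x => inner ℝ u (f x) := by
  simp [vavg, avg, inner_smul_right, inner_sum]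

lemma vavg_apply {α : Type*} {N m : ℕ} (D : Fin N → α) (f : α → E m) (l : Fin m) :
    vavg D f l = avg D fun x => f x l := by
  simp [vavg, avg]

section Deterministic

variable {m : ℕ}

/-- Second-order Taylor bound from a Lipschitz bound on the derivative. -/
lemma norm_taylor_le {g : E m → E m} {θ0 θ : E m} {δ L : ℝ}
    (hd : ∀ b ∈ Metric.ball θ0 δ, DifferentiableAt ℝ g b)
    (hL : ∀ b ∈ Metric.ball θ0 δ, ‖fderiv ℝ g b - fderiv ℝ g θ0‖ ≤ L * ‖b - θ0‖)
    (hθ : ‖θ - θ0‖ < δ) :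
    ‖g θ - g θ0 - fderiv ℝ g θ0 (θ - θ0)‖ ≤ max L 0 * ‖θ - θ0‖ ^ 2 := by
  have hsub : Metric.closedBall θ0 ‖θ - θ0‖ ⊆ Metric.ball θ0 δ :=
    Metric.closedBall_subset_ball hθ
  have h := (convex_closedBall θ0 ‖θ - θ0‖).norm_image_sub_le_of_norm_fderiv_le'
    (f := g) (φ := fderiv ℝ g θ0) (C := max L 0 * ‖θ - θ0‖) (x := θ0) (y := θ)
    (fun b hb => hd b (hsub hb)) (fun b hb => ?_)
    (Metric.mem_closedBall_self (norm_nonneg _)) (by simp [dist_eq_norm])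
  · calc _ ≤ _ := h
      _ = _ := by ring
  · calc _ ≤ L * ‖b - θ0‖ := hL b (hsub hb)
      _ ≤ max L 0 * ‖b - θ0‖ := by gcongr; exact le_max_left _ _
      _ ≤ _ := by
        gcongr
        rw [Metric.mem_closedBall, dist_eq_norm] at hb
        exact hb

/-- The error of a root of a weighted estimating equation, up to a quadratic remainder. -/
lemma root_expansion {N : ℕ} {g : Fin N → E m → E m} {wt L : Fin N → ℝ} {θ0 θ : E m} {δ : ℝ}
    (hwt : ∀ i, 0 ≤ wt i)
    (hd : ∀ i, ∀ b ∈ Metric.ball θ0 δ, DifferentiableAt ℝ (g i) b)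
    (hL : ∀ i, ∀ b ∈ Metric.ball θ0 δ, ‖fderiv ℝ (g i) b - fderiv ℝ (g i) θ0‖ ≤ L i * ‖b - θ0‖)
    (hθ : ‖θ - θ0‖ < δ) (hroot : (1 / (N : ℝ)) • ∑ i, wt i • g i θ = 0)
    {B : E m →L[ℝ] E m} (hB : B.IsInvertible) :
    ∃ R : E m, ‖R‖ ≤ (1 / (N : ℝ) * ∑ i, wt i * max (L i) 0) * ‖θ - θ0‖ ^ 2 ∧
      θ - θ0 = (1 / (N : ℝ)) • ∑ i, wt i • (-(B.inverse (g i θ0))) -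
        B.inverse (((1 / (N : ℝ)) • ∑ i, wt i • fderiv ℝ (g i) θ0 - B) (θ - θ0) + R) := by
  set rem : Fin N → E m := fun i => g i θ - g i θ0 - fderiv ℝ (g i) θ0 (θ - θ0) with hrem
  refine ⟨(1 / (N : ℝ)) • ∑ i, wt i • rem i, ?_, ?_⟩
  · rw [norm_smul, Real.norm_of_nonneg (by positivity), mul_assoc, Finset.sum_mul]
    gcongr
    refine (norm_sum_le _ _).trans (Finset.sum_le_sum fun i _ => ?_)
    rw [norm_smul, Real.norm_of_nonneg (hwt i), mul_assoc]
    exact mul_le_mul_of_nonneg_left (norm_taylor_le (hd i) (hL i) hθ) (hwt i)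
  · have h1 : (1 / (N : ℝ)) • ∑ i, wt i • g i θ =
        (1 / (N : ℝ)) • ∑ i, wt i • g i θ0 +
        ((1 / (N : ℝ)) • ∑ i, wt i • fderiv ℝ (g i) θ0) (θ - θ0) +
        (1 / (N : ℝ)) • ∑ i, wt i • rem i := by
      simp only [_root_.smul_apply, _root_.sum_apply, hrem]
      rw [← smul_add, ← smul_add, ← Finset.sum_add_distrib, ← Finset.sum_add_distrib]
      congr 1
      exact Finset.sum_congr rfl fun i _ => by rw [← smul_add, ← smul_add]; congr 1; abel
    rw [hroot] at h1
    have h2 : (1 / (N : ℝ)) • ∑ i, wt i • (-(B.inverse (g i θ0))) =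
        -B.inverse ((1 / (N : ℝ)) • ∑ i, wt i • g i θ0) := by
      simp only [map_smul, map_sum, smul_neg, Finset.sum_neg_distrib]
    have h3 : B.inverse (B (θ - θ0)) = θ - θ0 := hB.inverse_apply_self _
    rw [h2, _root_.sub_apply]
    have h4 := congrArg B.inverse h1
    rw [map_zero, map_add, map_add] at h4
    rw [map_add, map_sub, h3]
    have h5 : (0 : E m) = -(B.inverse ((1 / (N : ℝ)) • ∑ i, wt i • g i θ0) +
      B.inverse (((1 / (N : ℝ)) • ∑ i, wt i • fderiv ℝ (g i) θ0) (θ - θ0)) +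
        B.inverse ((1 / (N : ℝ)) • ∑ i, wt i • rem i)) := by rw [← h4, neg_zero]
    calc θ - θ0 = θ - θ0 + 0 := (add_zero _).symm
      _ = _ := by rw [h5]; abel

/-- If the linear part of the error dominates, the error is at most twice the average of the
influence function, and the remainder is of second order. -/
lemma root_rate {x y R : E m} {B J : E m →L[ℝ] E m} {C Lb : ℝ} (hC : 0 ≤ C) (hLb : 0 ≤ Lb)
    (hB : ‖B‖ ≤ C) (hR : ‖R‖ ≤ Lb * ‖x‖ ^ 2) (hx : x = y - B (J x + R))
    (hJ : C * ‖J‖ ≤ 1 / 4) (hL : C * (Lb * ‖x‖) ≤ 1 / 4) :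
    ‖x‖ ≤ 2 * ‖y‖ ∧ ‖x - y‖ ≤ C * (‖J‖ + Lb * (2 * ‖y‖)) * (2 * ‖y‖) := by
  have h1 : ‖x - y‖ ≤ C * (‖J‖ + Lb * ‖x‖) * ‖x‖ := by
    have : x - y = -B (J x + R) := by nth_rewrite 1 [hx]; abel
    rw [this, norm_neg]
    calc ‖B (J x + R)‖ ≤ ‖B‖ * ‖J x + R‖ := B.le_opNorm _
      _ ≤ C * (‖J‖ * ‖x‖ + Lb * ‖x‖ ^ 2) := by
        gcongr
        exact (norm_add_le _ _).trans (add_le_add (J.le_opNorm _) hR)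
      _ = _ := by ring
  have h2 : ‖x‖ ≤ 2 * ‖y‖ := by
    have h3 : ‖x‖ ≤ ‖x - y‖ + ‖y‖ := by simpa using norm_add_le (x - y) y
    have h4 : C * (‖J‖ + Lb * ‖x‖) * ‖x‖ ≤ 1 / 2 * ‖x‖ := by
      gcongr; linarith
    linarith
  refine ⟨h2, h1.trans ?_⟩
  gcongr

end Deterministic

/-! ### Unbiased weights and averages over a sample of records -/

/-- A bounded weight that does not change the mean of functions of the observation: the
inverse-probability weight `R / ρ` of the validation set, or the weight `1` of the full data. -/
structure UnbiasedWeight {p d K : ℕ} (M : Model p d K) (ε : ℝ) (wt : Record p K → ℝ) : Prop where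
  meas : Measurable wt
  nonneg : ∀ z, 0 ≤ wt z
  le : ∀ z, wt z ≤ 1 / ε
  unbiased : ∀ X : Obs p K → ℝ, Integrable X M.law →
    ∫ z, wt z * X z.1 ∂M.recordLaw = ∫ w, X w ∂M.law

namespace Model

variable {p d K : ℕ} {M : Model p d K} {ε C c δ ℓ : ℝ}

/-- The inverse-probability weight of the validation set. -/
noncomputable def ipw (M : Model p d K) (z : Record p K) : ℝ := ind z / M.rhoObs z.1

lemma Regular.unbiasedWeight_ipw (hM : M.Regular ε C c δ ℓ) (hε : 0 < ε) :
    UnbiasedWeight M ε M.ipw where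
  meas := by have := hM.rho_meas; unfold ipw; fun_prop
  nonneg z := div_nonneg (ind_nonneg z) (hε.le.trans (hM.rho_mem z.1).1)
  le z := div_le_div₀ zero_le_one (ind_le_one z) hε (hM.rho_mem z.1).1
  unbiased _ hX := hM.integral_ipw hε hX

lemma Regular.unbiasedWeight_one (hM : M.Regular ε C c δ ℓ) (hε : 0 < ε) :
    UnbiasedWeight M ε (fun _ => 1) where
  meas := measurable_const
  nonneg _ := zero_le_one
  le _ := by rw [le_div_iff₀ hε, one_mul]; exact hM.eps_le_one
  unbiased X hX := by simpa using hM.integral_fst hε hX.1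

variable {wt : Record p K → ℝ}

lemma Regular.orlicz_weighted (hM : M.Regular ε C c δ ℓ) (hε : 0 < ε)
    (hw : UnbiasedWeight M ε wt) {a : ℕ} {X : Obs p K → ℝ} {B : ℝ}
    (hX : OrliczLE a X B M.law) (hB : 0 < B) :
    OrliczLE a (fun z => wt z * X z.1) (1 / ε * B) M.recordLaw :=
  hM.orlicz_mul hε hX hB (by positivity) hw.meas fun z => by
    rw [abs_of_nonneg (hw.nonneg z)]; exact hw.le z

/-- The mean square error of a weighted average of a square-integrable function. -/
lemma Regular.lintegral_sq_avg_le (hM : M.Regular ε C c δ ℓ) (hε : 0 < ε)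
    (hw : UnbiasedWeight M ε wt) {Ω : Type*} [MeasurableSpace Ω] {P : Measure Ω}
    [IsProbabilityMeasure P] {N : ℕ} (hN : 0 < N) {W : Fin N → Ω → Record p K}
    (hW : IsSample W M.recordLaw P) {X : Obs p K → ℝ} (hX : MemLp X 2 M.law) {b : ℝ}
    (hb : ∫ w, X w ^ 2 ∂M.law ≤ b) :
    ∫⁻ ω, ENNReal.ofReal ((avg (fun i => W i ω) (fun z => wt z * X z.1) - ∫ w, X w ∂M.law) ^ 2) ∂P ≤
      ENNReal.ofReal (b / (ε ^ 2 * N)) := by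
  have := hM.isProbabilityMeasure_recordLaw hε
  have := hM.law_prob
  have hX1 : MemLp (fun z : Record p K => X z.1) 2 M.recordLaw := by
    have h := hX
    rw [← hM.map_fst hε] at h
    exact h.comp_of_map measurable_fst.aemeasurable
  have hle : ∀ z : Record p K, ‖wt z * X z.1‖ ≤ ‖1 / ε * X z.1‖ := fun z => by
    rw [norm_mul, norm_mul, Real.norm_of_nonneg (hw.nonneg z),
      Real.norm_of_nonneg (by positivity : 0 ≤ 1 / ε)]
    gcongr; exact hw.le z
  have hf : MemLp (fun z : Record p K => wt z * X z.1) 2 M.recordLaw :=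
    (hX1.const_mul (1 / ε)).of_le (hw.meas.aestronglyMeasurable.mul hX1.1) (ae_of_all _ hle)
  have h1 := hW.integral_sq_avg_le hf hN
  rw [hw.unbiased X (hX.integrable (by norm_num))] at h1
  refine h1.trans (ENNReal.ofReal_le_ofReal ?_)
  have hN' : (0 : ℝ) < N := by exact_mod_cast hN
  have h2 : ∫ z : Record p K, (wt z * X z.1) ^ 2 ∂M.recordLaw ≤ 1 / ε ^ 2 * b := by
    calc _ ≤ ∫ z : Record p K, 1 / ε ^ 2 * X z.1 ^ 2 ∂M.recordLaw := by
          refine integral_mono hf.integrable_sq (hX1.integrable_sq.const_mul _) fun z => ?_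
          have := hle z
          rw [Real.norm_eq_abs, Real.norm_eq_abs] at this
          have := sq_le_sq.2 this
          simpa [mul_pow] using this
      _ = 1 / ε ^ 2 * ∫ w, X w ^ 2 ∂M.law := by
          rw [integral_const_mul, hM.integral_fst hε (X := fun w => X w ^ 2) (hX.1.pow 2)]
      _ ≤ _ := by gcongr
  calc _ ≤ 1 / (N : ℝ) * (1 / ε ^ 2 * b) := by gcongr
    _ = _ := by field_simp

/-- The error of the averaged Jacobian for `θ⁽ᵏ⁾`. -/
noncomputable def jacErrTheta (M : Model p d K) (wt : Record p K → ℝ) {N : ℕ}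
    (D : Fin N → Record p K) (k : Fin K) : E d →L[ℝ] E d :=
  vavg D (fun z => wt z • M.Dh k (M.theta0 k) z.1) - M.B k

/-- The error of the averaged Jacobian for `β`. -/
noncomputable def jacErrBeta (M : Model p d K) (wt : Record p K → ℝ) {N : ℕ}
    (D : Fin N → Record p K) : E p →L[ℝ] E p :=
  vavg D (fun z => wt z • M.Dm M.beta0 z.1) - M.A

/-- The weighted average of the influence function of `θ⁽ᵏ⁾`. -/
noncomputable def etaBar (M : Model p d K) (wt : Record p K → ℝ) {N : ℕ}
    (D : Fin N → Record p K) (k : Fin K) : E d := vavg D fun z => wt z • M.etaBlock k z.1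

/-- The weighted average of the influence function of `β`. -/
noncomputable def psiBar (M : Model p d K) (wt : Record p K → ℝ) {N : ℕ}
    (D : Fin N → Record p K) : E p := vavg D fun z => wt z • M.psi z.1

lemma inner_vavg_clm {α : Type*} {N m : ℕ} (D : Fin N → α) (f : α → E m →L[ℝ] E m) (u v : E m) :
    inner ℝ u (vavg D f v) = avg D fun x => inner ℝ u (f x v) := by
  simp [vavg, avg, inner_smul_right, inner_sum, _root_.sum_apply]

lemma integral_inner_clm {α : Type*} [MeasurableSpace α] {μ : Measure α} {m : ℕ}
    {f : α → E m →L[ℝ] E m} (hf : Integrable f μ) (u v : E m) :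
    ∫ x, inner ℝ u (f x v) ∂μ = inner ℝ u ((∫ x, f x ∂μ) v) := by
  have h1 : Integrable (fun x => f x v) μ := hf.apply_continuousLinearMap v
  rw [ContinuousLinearMap.integral_apply hf, ← integral_inner h1]

lemma inner_jacErrTheta (hM : M.Regular ε C c δ ℓ) {N : ℕ} (D : Fin N → Record p K) (k : Fin K)
    (u v : E d) : inner ℝ u (M.jacErrTheta wt D k v) =
      avg D (fun z => wt z * inner ℝ u (M.Dh k (M.theta0 k) z.1 v)) -
        ∫ w, inner ℝ u (M.Dh k (M.theta0 k) w v) ∂M.law := by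
  rw [integral_inner_clm (hM.Dh_int k), jacErrTheta, _root_.sub_apply, inner_sub_right,
    inner_vavg_clm]
  simp [inner_smul_right, B]

lemma inner_jacErrBeta (hM : M.Regular ε C c δ ℓ) {N : ℕ} (D : Fin N → Record p K)
    (u v : E p) : inner ℝ u (M.jacErrBeta wt D v) =
      avg D (fun z => wt z * inner ℝ u (M.Dm M.beta0 z.1 v)) -
        ∫ w, inner ℝ u (M.Dm M.beta0 w v) ∂M.law := by
  rw [integral_inner_clm hM.Dm_int, jacErrBeta, _root_.sub_apply, inner_sub_right,
    inner_vavg_clm]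
  simp [inner_smul_right, A]

lemma sum_valid_eq {N : ℕ} (D : Fin N → Record p K) {F : Type*} [AddCommGroup F] [Module ℝ F]
    (f : Fin N → F) :
    ∑ i ∈ valid D, (1 / M.rhoObs (D i).1) • f i = ∑ i, M.ipw (D i) • f i := by
  rw [valid, Finset.sum_filter]
  refine Finset.sum_congr rfl fun i _ => ?_
  by_cases h : (D i).2 = true <;> simp [ipw, ind, h]

end Model


/-! ### Linear expansions of the estimators of the surrogate parameters -/

/-- A factor `w → ∞` so slow that `w² ℓ D` is still negligible compared with `√N`; here `D` is the
effective dimension and `ℓ` the curvature of the estimating functions. -/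
structure SlowScale (w ℓ D : ℕ → ℝ) : Prop where
  one_le : ∀ N, 1 ≤ w N
  tendsto : Tendsto w atTop atTop
  one_le_dim : ∀ N, 1 ≤ D N
  one_le_curv : ∀ N, 1 ≤ ℓ N
  small : Tendsto (fun N => w N ^ 2 * (ℓ N * D N) / √N) atTop (𝓝 0)

section SlowScale

variable {w ℓ D : ℕ → ℝ}

lemma SlowScale.tendsto_mul (h : SlowScale w ℓ D) :
    Tendsto (fun N => w N * D N) atTop atTop :=
  tendsto_atTop_mono (fun N => le_mul_of_one_le_right (zero_le_one.trans (h.one_le N))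
    (h.one_le_dim N)) h.tendsto

lemma SlowScale.mul_le (h : SlowScale w ℓ D) (N : ℕ) : w N * D N ≤ w N ^ 2 * (ℓ N * D N) := by
  have h1 := h.one_le N
  have h2 := h.one_le_dim N
  have h3 := h.one_le_curv N
  have : 1 ≤ w N * ℓ N := by nlinarith
  calc w N * D N ≤ (w N * D N) * (w N * ℓ N) := le_mul_of_one_le_right (by positivity) this
    _ = _ := by ring

lemma SlowScale.tendsto_div (h : SlowScale w ℓ D) :
    Tendsto (fun N => w N * D N / N) atTop (𝓝 0) := by
  refine squeeze_zero' (Eventually.of_forall fun N => ?_) ?_ h.small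
  · have := h.one_le N
    have := h.one_le_dim N
    positivity
  · filter_upwards [eventually_ge_atTop 1] with N hN
    have hN' : (1 : ℝ) ≤ N := by exact_mod_cast hN
    have h0 : 0 ≤ w N * D N := by
      have := h.one_le N
      have := h.one_le_dim N
      positivity
    have : √(N : ℝ) ≤ N := by
      rw [Real.sqrt_le_left (by positivity)]; nlinarith
    calc w N * D N / N ≤ w N * D N / √N := by gcongr
      _ ≤ _ := div_le_div_of_nonneg_right (h.mul_le N) (Real.sqrt_nonneg _)

lemma SlowScale.tendsto_sqrt (h : SlowScale w ℓ D) :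
    Tendsto (fun N => √(w N * D N / N)) atTop (𝓝 0) := by
  simpa using h.tendsto_div.sqrt

end SlowScale

/-- Variables whose positive parts have bounded means are tight from above. -/
lemma tight_of_lintegral {Ω : ℕ → Type*} [∀ N, MeasurableSpace (Ω N)] {l : Filter ℕ}
    {P : ∀ N, Measure (Ω N)} {X : ∀ N, Ω N → ℝ} {b : ℝ} (hb0 : 0 < b)
    (hX : ∀ N, AEMeasurable (X N) (P N))
    (hb : ∀ᶠ N in l, ∫⁻ ω, ENNReal.ofReal (X N ω) ∂P N ≤ ENNReal.ofReal b) {η : ℝ} (hη : 0 < η) :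
    ∃ A : ℝ, 0 < A ∧ ∀ᶠ N in l, P N {ω | ¬ X N ω < A} ≤ ENNReal.ofReal η := by
  refine ⟨b / η, by positivity, hb.mono fun N hN => ?_⟩
  have h0 : 0 < b / η := by positivity
  have h1 := meas_ge_le_lintegral_div (hX N).ennreal_ofReal (ε := ENNReal.ofReal (b / η))
    (by simpa using h0) ENNReal.ofReal_ne_top
  refine (measure_mono fun ω hω => ?_).trans (h1.trans ?_)
  · simp only [Set.mem_ofPred_eq, not_lt] at hω ⊢
    exact ENNReal.ofReal_le_ofReal hω
  · refine (ENNReal.div_le_div_right hN _).trans ?_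
    rw [← ENNReal.ofReal_div_of_pos h0]
    exact ENNReal.ofReal_le_ofReal (le_of_eq (by field_simp))

namespace Model

/-- The mean of the averaged Lipschitz modulus. -/
lemma Regular.lintegral_avg_le {p d K : ℕ} {M : Model p d K} {ε C c δ ℓ : ℝ}
    (hM : M.Regular ε C c δ ℓ) (hε : 0 < ε) {wt : Record p K → ℝ} (hw : UnbiasedWeight M ε wt)
    {Ω : Type*} [MeasurableSpace Ω] {P : Measure Ω} {N : ℕ} {W : Fin N → Ω → Record p K}
    (hW : IsSample W M.recordLaw P) {L : Obs p K → ℝ} (hL : AEMeasurable L M.law) {b : ℝ}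
    (hb : ∫⁻ w, ENNReal.ofReal (L w) ∂M.law ≤ ENNReal.ofReal b) :
    AEMeasurable (fun ω => avg (fun i => W i ω) fun z => wt z * max (L z.1) 0) P ∧
    ∫⁻ ω, ENNReal.ofReal (avg (fun i => W i ω) fun z => wt z * max (L z.1) 0) ∂P ≤
      ENNReal.ofReal (b / ε) := by
  have hLm : AEMeasurable (fun z : Record p K => L z.1) M.recordLaw := hM.aemeasurable_fst hε hL
  have hm : AEMeasurable (fun z : Record p K => wt z * max (L z.1) 0) M.recordLaw :=
    hw.meas.aemeasurable.mul (hLm.max aemeasurable_const)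
  have hLW : ∀ i, AEMeasurable (fun ω => L (W i ω).1) P := fun i => hW.aemeasurable_comp hLm i
  refine ⟨by
    unfold avg
    exact (Finset.aemeasurable_fun_sum _ fun i _ => hW.aemeasurable_comp hm i).const_mul _, ?_⟩
  have hint : ∀ i, ∫⁻ ω, ENNReal.ofReal (L (W i ω).1) ∂P ≤ ENNReal.ofReal b := fun i => by
    have h1 := ((hM.hasLaw_fst hε).fun_comp (hW.law i)).lintegral_comp
      (f := fun w => ENNReal.ofReal (L w)) hL.ennreal_ofReal
    rw [h1]; exact hb
  calc _ ≤ ∫⁻ ω, ENNReal.ofReal (1 / ε * (1 / N)) * ∑ i, ENNReal.ofReal (L (W i ω).1) ∂P := by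
        refine lintegral_mono fun ω => ?_
        simp only
        have h1 : ∀ x : ℝ, ENNReal.ofReal x = ENNReal.ofReal (max x 0) := fun x => by
          rw [ENNReal.ofReal_max]; simp
        simp_rw [h1 (L _)]
        rw [← ENNReal.ofReal_sum_of_nonneg fun _ _ => le_max_right _ _,
          ← ENNReal.ofReal_mul (by positivity)]
        refine ENNReal.ofReal_le_ofReal ?_
        rw [avg, mul_comm (1 / ε), mul_assoc, Finset.mul_sum (f := fun i => max (L (W i ω).1) 0)]
        refine mul_le_mul_of_nonneg_left (Finset.sum_le_sum fun i _ => ?_) (by positivity)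
        exact mul_le_mul_of_nonneg_right (hw.le _) (le_max_right _ _)
    _ = ENNReal.ofReal (1 / ε * (1 / N)) * ∑ i, ∫⁻ ω, ENNReal.ofReal (L (W i ω).1) ∂P := by
        rw [lintegral_const_mul' _ _ ENNReal.ofReal_ne_top,
          lintegral_finsetSum' _ fun i _ => (hLW i).ennreal_ofReal]
    _ ≤ ENNReal.ofReal (1 / ε * (1 / N)) * ∑ i : Fin N, ENNReal.ofReal b := by
        gcongr; exact hint _
    _ ≤ ENNReal.ofReal (b / ε) := by
        rw [Finset.sum_const, Finset.card_univ, Fintype.card_fin, nsmul_eq_mul,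
          ← ENNReal.ofReal_natCast, ← ENNReal.ofReal_mul (by positivity),
          ← ENNReal.ofReal_mul (by positivity)]
        rcases Nat.eq_zero_or_pos N with rfl | hN
        · simp
        · have : (0 : ℝ) < N := by exact_mod_cast hN
          exact ENNReal.ofReal_le_ofReal (le_of_eq (by field_simp))

lemma Regular.integral_inner_etaBlock {p d K : ℕ} {M : Model p d K} {ε C c δ ℓ : ℝ}
    (hM : M.Regular ε C c δ ℓ) (hC : 0 < C) (k : Fin K) (u : E d) :
    ∫ w, inner ℝ u (M.etaBlock k w) ∂M.law = 0 := by
  have := hM.law_prob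
  have h1 : ∀ j : Fin d, Integrable (fun w => M.eta w (k, j) * u j) M.law := fun j =>
    (((hM.eta_coord (k, j)).one_of_two hC).integrable (by positivity)).mul_const _
  calc _ = ∫ w, ∑ j, M.eta w (k, j) * u j ∂M.law := by
        simp [PiLp.inner_apply, eta]
    _ = 0 := by
        rw [integral_finsetSum _ fun j _ => h1 j]
        refine Finset.sum_eq_zero fun j _ => ?_
        rw [integral_mul_const, hM.integral_eta hC, zero_mul]

lemma Regular.integral_inner_psi {p d K : ℕ} {M : Model p d K} {ε C c δ ℓ : ℝ}
    (hM : M.Regular ε C c δ ℓ) (hC : 0 < C) (u : E p) :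
    ∫ w, inner ℝ u (M.psi w) ∂M.law = 0 := by
  have := hM.law_prob
  have h1 : ∀ j : Fin p, Integrable (fun w => M.psi w j * u j) M.law := fun j =>
    (((hM.psi_coord j).one_of_two hC).integrable (by positivity)).mul_const _
  calc _ = ∫ w, ∑ j, M.psi w j * u j ∂M.law := by
        simp [PiLp.inner_apply]
    _ = 0 := by
        rw [integral_finsetSum _ fun j _ => h1 j]
        refine Finset.sum_eq_zero fun j _ => ?_
        rw [integral_mul_const, hM.integral_psi hC, zero_mul]

section Expansion

variable {p d K : ℕ → ℕ} {M : ∀ N, Model (p N) (d N) (K N)} {ε C c δ : ℝ} {w ℓ D : ℕ → ℝ}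
  {Ω : ℕ → Type*} [∀ N, MeasurableSpace (Ω N)] {P : ∀ N, Measure (Ω N)}
  [∀ N, IsProbabilityMeasure (P N)] {W : ∀ N, Fin N → Ω N → Record (p N) (K N)}
  {wt : ∀ N, Record (p N) (K N) → ℝ}

lemma card_le_exp {d K : ℕ} (hd : 0 < d) (hK : 0 < K) {D w : ℝ} (hw : 1 ≤ w)
    (hD : d + Real.log ((d : ℝ) * K) ≤ D) :
    (K : ℝ) * 5 ^ d * 5 ^ d ≤ Real.exp (4 * (w * D)) := by
  have hd' : (1 : ℝ) ≤ d := by exact_mod_cast hd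
  have hK' : (1 : ℝ) ≤ K := by exact_mod_cast hK
  have hlog : 0 ≤ Real.log ((d : ℝ) * K) := Real.log_nonneg (by nlinarith)
  have h1 : (K : ℝ) ≤ Real.exp (Real.log ((d : ℝ) * K)) := by
    rw [Real.exp_log (by positivity)]; nlinarith
  have h5 := five_le_exp_two
  have h2 : (5 : ℝ) ^ d ≤ Real.exp (2 * d) := by
    calc (5 : ℝ) ^ d ≤ Real.exp 2 ^ d := by gcongr
      _ = _ := by rw [← Real.exp_nat_mul]; ring_nf
  calc (K : ℝ) * 5 ^ d * 5 ^ d ≤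
        Real.exp (Real.log ((d : ℝ) * K)) * Real.exp (2 * d) * Real.exp (2 * d) := by gcongr
    _ = Real.exp (Real.log ((d : ℝ) * K) + 2 * d + 2 * d) := by
        rw [Real.exp_add, Real.exp_add]
    _ ≤ _ := by
        apply Real.exp_le_exp.2
        nlinarith

lemma whp_norm_etaBar_le (hε : 0 < ε) (hC : 0 < C) (hM : ∀ N, (M N).Regular ε C c δ (ℓ N))
    (hW : ∀ N, IsSample (W N) (M N).recordLaw (P N)) (hS : SlowScale w ℓ D)
    (hd : ∀ N, 0 < d N) (hK : ∀ N, 0 < K N)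
    (hD : ∀ N, d N + Real.log ((d N : ℝ) * K N) ≤ D N)
    (hwt : ∀ N, UnbiasedWeight (M N) ε (wt N)) :
    WHP atTop P fun N ω => ∀ k,
      ‖(M N).etaBar (wt N) (fun i => W N i ω) k‖ ≤ 96 * (C / ε) * √(w N * D N / N) := by
  have := fun N => (hM N).isProbabilityMeasure_recordLaw hε
  have hb := WHP.bernstein hW le_rfl (M := 1 / ε * (2 * C)) (b := 4) (A := 24 * (1 / ε * (2 * C)))
    (by positivity) (by positivity) (by nlinarith [sq_nonneg (1 / ε * (2 * C))])
    hS.tendsto_mul hS.tendsto_div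
    (fun N => (Finset.univ : Finset (Fin (K N))) ×ˢ sphereNet (d N))
    (F := fun N a z => wt N z * inner ℝ a.2 ((M N).etaBlock a.1 z.1))
    (fun N a ha => by
      have := (hM N).law_prob
      refine (hM N).orlicz_weighted hε (hwt N) (X := fun w => inner ℝ a.2 ((M N).etaBlock a.1 w))
        (OrliczLE.one_of_two ?_ hC) (by positivity)
      exact (hM N).eta_tail a.1 a.2 (norm_of_mem_sphereNet (Finset.mem_product.1 ha).2))
    (Eventually.of_forall fun N => by
      refine le_trans ?_ (card_le_exp (hd N) (hK N) (hS.one_le N) (hD N))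
      rw [Finset.card_product, Finset.card_univ, Fintype.card_fin]
      push_cast
      have h1 : ((sphereNet (d N)).card : ℝ) ≤ 5 ^ d N := by exact_mod_cast card_sphereNet_le _
      have h2 : (1 : ℝ) ≤ 5 ^ d N := one_le_pow₀ (by norm_num)
      calc (K N : ℝ) * ((sphereNet (d N)).card : ℝ) ≤ K N * 5 ^ d N := by gcongr
        _ ≤ _ := le_mul_of_one_le_right (by positivity) h2)
  refine hb.mono (Eventually.of_forall fun N ω hω k => ?_)
  have h := norm_le_of_sphereNet (x := (M N).etaBar (wt N) (fun i => W N i ω) k)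
    (t := 24 * (1 / ε * (2 * C)) * √(w N * D N / N)) (by positivity) fun u hu => ?_
  · refine h.trans (le_of_eq (by ring))
  · have := hω (k, u) (by simpa using hu)
    have hint : Integrable (fun w => inner ℝ u ((M N).etaBlock k w)) (M N).law := by
      have := (hM N).law_prob
      exact (((hM N).eta_tail k u (norm_of_mem_sphereNet hu)).one_of_two hC).integrable
        (by positivity)
    rw [(hwt N).unbiased _ hint, (hM N).integral_inner_etaBlock hC, sub_zero] at this
    rw [etaBar, inner_vavg]
    simp only [inner_smul_right]
    exact (le_abs_self _).trans this.le

lemma whp_norm_jacErrTheta_le (hε : 0 < ε) (hC : 0 < C) (hM : ∀ N, (M N).Regular ε C c δ (ℓ N))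
    (hW : ∀ N, IsSample (W N) (M N).recordLaw (P N)) (hS : SlowScale w ℓ D)
    (hd : ∀ N, 0 < d N) (hK : ∀ N, 0 < K N)
    (hD : ∀ N, d N + Real.log ((d N : ℝ) * K N) ≤ D N)
    (hwt : ∀ N, UnbiasedWeight (M N) ε (wt N)) :
    WHP atTop P fun N ω => ∀ k,
      ‖(M N).jacErrTheta (wt N) (fun i => W N i ω) k‖ ≤ 96 * (C / ε) * √(w N * D N / N) := by
  have := fun N => (hM N).isProbabilityMeasure_recordLaw hε
  have hb := WHP.bernstein hW le_rfl (M := 1 / ε * C) (b := 4) (A := 24 * (1 / ε * C))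
    (by positivity) (by positivity) (by nlinarith [sq_nonneg (1 / ε * C)])
    hS.tendsto_mul hS.tendsto_div
    (fun N => (Finset.univ : Finset (Fin (K N))) ×ˢ (sphereNet (d N) ×ˢ sphereNet (d N)))
    (F := fun N a z => wt N z * inner ℝ a.2.1 ((M N).Dh a.1 ((M N).theta0 a.1) z.1 a.2.2))
    (fun N a ha => by
      have := (hM N).law_prob
      simp only [Finset.mem_product] at ha
      refine (hM N).orlicz_weighted hε (hwt N)
        (X := fun w => inner ℝ a.2.1 ((M N).Dh a.1 ((M N).theta0 a.1) w a.2.2)) ?_ hC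
      exact (hM N).Dh_tail a.1 a.2.1 a.2.2 (norm_of_mem_sphereNet ha.2.1)
        (norm_of_mem_sphereNet ha.2.2))
    (Eventually.of_forall fun N => by
      refine le_trans ?_ (card_le_exp (hd N) (hK N) (hS.one_le N) (hD N))
      rw [Finset.card_product, Finset.card_product, Finset.card_univ, Fintype.card_fin]
      push_cast
      have h1 : ((sphereNet (d N)).card : ℝ) ≤ 5 ^ d N := by exact_mod_cast card_sphereNet_le _
      rw [mul_assoc]
      gcongr)
  refine hb.mono (Eventually.of_forall fun N ω hω k => ?_)
  have h := opNorm_le_of_sphereNet (J := (M N).jacErrTheta (wt N) (fun i => W N i ω) k)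
    (t := 24 * (1 / ε * C) * √(w N * D N / N)) (by positivity) fun u hu v hv => ?_
  · refine h.trans (le_of_eq (by ring))
  · have := hω (k, u, v) (by simp [hu, hv])
    have hint : Integrable
        (fun w => inner ℝ u ((M N).Dh k ((M N).theta0 k) w v)) (M N).law :=
      ((hM N).Dh_tail k u v (norm_of_mem_sphereNet hu) (norm_of_mem_sphereNet hv)).integrable hC
    rw [(hwt N).unbiased _ hint] at this
    rw [inner_jacErrTheta (hM N)]
    exact (le_abs_self _).trans this.le

end Expansion

end Model


namespace Model

section Expansion

variable {p d K : ℕ → ℕ} {M : ∀ N, Model (p N) (d N) (K N)} {ε C c δ : ℝ} {w ℓ D : ℕ → ℝ}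
  {Ω : ℕ → Type*} [∀ N, MeasurableSpace (Ω N)] {P : ∀ N, Measure (Ω N)}
  [∀ N, IsProbabilityMeasure (P N)] {W : ∀ N, Fin N → Ω N → Record (p N) (K N)}
  {wt : ∀ N, Record (p N) (K N) → ℝ}

omit [∀ N, IsProbabilityMeasure (P N)] in
/-- The averaged Lipschitz modulus is `O(ℓ)` in probability. -/
lemma whp_avg_lip_lt (hε : 0 < ε) (hM : ∀ N, (M N).Regular ε C c δ (ℓ N))
    (hW : ∀ N, IsSample (W N) (M N).recordLaw (P N)) (hS : SlowScale w ℓ D)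
    (hwt : ∀ N, UnbiasedWeight (M N) ε (wt N)) {L : ∀ N, Obs (p N) (K N) → ℝ}
    (hL : ∀ N, AEMeasurable (L N) (M N).law)
    (hLi : ∀ N, ∫⁻ x, ENNReal.ofReal (L N x) ∂(M N).law ≤ ENNReal.ofReal (ℓ N)) :
    WHP atTop P fun N ω =>
      avg (fun i => W N i ω) (fun z => wt N z * max (L N z.1) 0) < w N * ℓ N := by
  have h := fun N => (hM N).lintegral_avg_le hε (hwt N) (hW N) (hL N) (hLi N)
  refine WHP.markov (b := fun N => ℓ N / ε) (fun N => (h N).1)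
    (Eventually.of_forall fun N => (h N).2) (Eventually.of_forall fun N => ?_) ?_
  · have := hS.one_le N
    have := hS.one_le_curv N
    positivity
  · have h1 : Tendsto (fun N => (1 / ε) * (w N)⁻¹) atTop (𝓝 0) := by
      simpa using hS.tendsto.inv_tendsto_atTop.const_mul (1 / ε)
    refine h1.congr fun N => ?_
    have h2 := (zero_lt_one.trans_le (hS.one_le N)).ne'
    have h3 := (zero_lt_one.trans_le (hS.one_le_curv N)).ne'
    field_simp

omit [∀ N, IsProbabilityMeasure (P N)] in
/-- The averaged Lipschitz modulus times an error that is negligible at the scale `1 / ℓ` vanishes;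
here consistency at that scale is used. -/
lemma whp_avg_lip_mul_lt (hε : 0 < ε) (hM : ∀ N, (M N).Regular ε C c δ (ℓ N))
    (hW : ∀ N, IsSample (W N) (M N).recordLaw (P N)) (hℓ : ∀ N, 1 ≤ ℓ N)
    (hwt : ∀ N, UnbiasedWeight (M N) ε (wt N)) {L : ∀ N, Obs (p N) (K N) → ℝ}
    (hL : ∀ N, AEMeasurable (L N) (M N).law)
    (hLi : ∀ N, ∫⁻ x, ENNReal.ofReal (L N x) ∂(M N).law ≤ ENNReal.ofReal (ℓ N))
    {Y : ∀ N, Ω N → ℝ} (hY0 : ∀ N ω, 0 ≤ Y N ω)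
    (hY : ∀ s : ℝ, 0 < s → WHP atTop P fun N ω => ℓ N * Y N ω < s) {s : ℝ} (hs : 0 < s) :
    WHP atTop P fun N ω =>
      avg (fun i => W N i ω) (fun z => wt N z * max (L N z.1) 0) * Y N ω < s := by
  have h := fun N => (hM N).lintegral_avg_le hε (hwt N) (hW N) (hL N) (hLi N)
  have hℓ0 : ∀ N, 0 < ℓ N := fun N => zero_lt_one.trans_le (hℓ N)
  have h1 := WHP.mul_of_tight (P := P) (l := atTop)
    (X := fun N ω => (ℓ N)⁻¹ * avg (fun i => W N i ω) (fun z => wt N z * max (L N z.1) 0))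
    (Y := fun N ω => ℓ N * Y N ω) (fun N ω => mul_nonneg (hℓ0 N).le (hY0 N ω))
    (fun η hη => tight_of_lintegral (b := 1 / ε) (by positivity)
      (fun N => (h N).1.const_mul _) (Eventually.of_forall fun N => by
        simp_rw [ENNReal.ofReal_mul (inv_pos.2 (hℓ0 N)).le]
        rw [lintegral_const_mul' _ _ ENNReal.ofReal_ne_top]
        refine (mul_le_mul_right (h N).2 _).trans ?_
        rw [← ENNReal.ofReal_mul (inv_pos.2 (hℓ0 N)).le]
        refine ENNReal.ofReal_le_ofReal (le_of_eq ?_)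
        have := (hℓ0 N).ne'
        field_simp) hη) hY hs
  refine h1.mono (Eventually.of_forall fun N ω hω => lt_of_eq_of_lt ?_ hω)
  have := (hℓ0 N).ne'
  field_simp

/-- Uniformly over the surrogates, a consistent root of the weighted estimating equations for
`θ` is the average of the influence function up to an error of smaller order than `1 / √N`. -/
theorem theta_expansion (hε : 0 < ε) (hC : 0 < C) (hδ : 0 < δ)
    (hM : ∀ N, (M N).Regular ε C c δ (ℓ N))
    (hW : ∀ N, IsSample (W N) (M N).recordLaw (P N)) (hS : SlowScale w ℓ D)
    (hd : ∀ N, 0 < d N) (hK : ∀ N, 0 < K N)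
    (hD : ∀ N, d N + Real.log ((d N : ℝ) * K N) ≤ D N)
    (hwt : ∀ N, UnbiasedWeight (M N) ε (wt N)) {t : ∀ N, Ω N → Fin (K N) → E (d N)}
    (hroot : WHP atTop P fun N ω => ∀ k, (1 / (N : ℝ)) •
      ∑ i, wt N (W N i ω) • (M N).hObs k (t N ω k) (W N i ω).1 = 0)
    (hcons : ∀ s : ℝ, 0 < s → WHP atTop P fun N ω => ∀ k, ℓ N * ‖t N ω k - (M N).theta0 k‖ < s) :
    ∃ A : ℝ, 0 < A ∧ WHP atTop P fun N ω => ∀ k,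
      ‖t N ω k - (M N).theta0 k - (M N).etaBar (wt N) (fun i => W N i ω) k‖ ≤
        A * (w N ^ 2 * (ℓ N * D N) / N) := by
  choose L hLm hLi hL using fun N => (hM N).lip
  have hℓ0 : ∀ N, 0 < ℓ N := fun N => zero_lt_one.trans_le (hS.one_le_curv N)
  set a : ℝ := 96 * (C / ε) with ha
  have ha0 : 0 < a := by positivity
  refine ⟨6 * C * a ^ 2, by positivity, ?_⟩
  -- the largest estimation error over the surrogates
  set Y : ∀ N, Ω N → ℝ := fun N ω => ‖fun k => t N ω k - (M N).theta0 k‖ with hYdef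
  have hY : ∀ s : ℝ, 0 < s → WHP atTop P fun N ω => ℓ N * Y N ω < s := fun s hs =>
    (hcons s hs).mono (Eventually.of_forall fun N ω hω => by
      rw [mul_comm, ← lt_div_iff₀ (hℓ0 N), hYdef, pi_norm_lt_iff (div_pos hs (hℓ0 N))]
      intro k
      rw [lt_div_iff₀ (hℓ0 N), mul_comm]; exact hω k)
  have hgood : ∀ N, ∀ᵐ ω ∂P N, ∀ i, (∀ k, ∀ t ∈ Metric.ball ((M N).theta0 k) δ,
      DifferentiableAt ℝ (fun t' => (M N).hObs k t' (W N i ω).1) t) ∧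
      ∀ k, ∀ t ∈ Metric.ball ((M N).theta0 k) δ,
        ‖(M N).Dh k t (W N i ω).1 - (M N).Dh k ((M N).theta0 k) (W N i ω).1‖ ≤
          L N (W N i ω).1 * ‖t - (M N).theta0 k‖ := fun N =>
    (hW N).ae_all ((hM N).ae_fst hε (q := fun x => (∀ k, ∀ t ∈ Metric.ball ((M N).theta0 k) δ,
      DifferentiableAt ℝ (fun t' => (M N).hObs k t' x) t) ∧
      ∀ k, ∀ t ∈ Metric.ball ((M N).theta0 k) δ,
        ‖(M N).Dh k t x - (M N).Dh k ((M N).theta0 k) x‖ ≤ L N x * ‖t - (M N).theta0 k‖)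
      ((hM N).h_diff.and ((hL N).mono fun x hx => hx.2)))
  have hsmall : ∀ᶠ N in atTop, C * (a * √(w N * D N / N)) ≤ 1 / 4 := by
    have : Tendsto (fun N => C * (a * √(w N * D N / N))) atTop (𝓝 0) := by
      simpa using (hS.tendsto_sqrt.const_mul a).const_mul C
    exact (this.eventually_lt_const (by norm_num : (0 : ℝ) < 1 / 4)).mono fun N h => h.le
  refine WHP.mono_ae (((((whp_norm_etaBar_le hε hC hM hW hS hd hK hD hwt).and
    (whp_norm_jacErrTheta_le hε hC hM hW hS hd hK hD hwt)).and
    (whp_avg_lip_lt hε hM hW hS hwt hLm hLi)).and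
    (whp_avg_lip_mul_lt hε hM hW hS.one_le_curv hwt hLm hLi (Y := Y) (fun _ _ => norm_nonneg _) hY
      (s := 1 / (4 * C)) (by positivity))).and (hroot.and (hcons δ hδ))) ?_
  filter_upwards [hsmall] with N hN
  filter_upwards [hgood N] with ω hω
  rintro ⟨⟨⟨⟨h1, h2⟩, h3⟩, h4⟩, h5, h6⟩ k
  have hxδ : ‖t N ω k - (M N).theta0 k‖ < δ := by
    refine lt_of_le_of_lt ?_ (h6 k)
    exact le_mul_of_one_le_left (norm_nonneg _) (hS.one_le_curv N)
  obtain ⟨R, hR, hx⟩ := root_expansion (N := N) (g := fun i t' => (M N).hObs k t' (W N i ω).1)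
    (wt := fun i => wt N (W N i ω)) (L := fun i => L N (W N i ω).1)
    (fun i => (hwt N).nonneg _) (fun i => (hω i).1 k) (fun i => (hω i).2 k) hxδ (h5 k)
    ((hM N).B_inv k).1
  set Lb := avg (fun i => W N i ω) (fun z => wt N z * max (L N z.1) 0) with hLb
  have hLb0 : 0 ≤ Lb := by
    rw [hLb, avg]
    exact mul_nonneg (by positivity) (Finset.sum_nonneg fun i _ =>
      mul_nonneg ((hwt N).nonneg _) (le_max_right _ _))
  have hYk : ‖t N ω k - (M N).theta0 k‖ ≤ Y N ω :=
    norm_le_pi_norm (fun k => t N ω k - (M N).theta0 k) k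
  have h7 := root_rate (x := t N ω k - (M N).theta0 k)
    (y := (M N).etaBar (wt N) (fun i => W N i ω) k)
    (J := (M N).jacErrTheta (wt N) (fun i => W N i ω) k) hC.le hLb0 ((hM N).B_inv k).2 hR hx
    ((mul_le_mul_of_nonneg_left (h2 k) hC.le).trans hN) (by
      have h8 : Lb * ‖t N ω k - (M N).theta0 k‖ ≤ 1 / (4 * C) :=
        (mul_le_mul_of_nonneg_left hYk hLb0).trans h4.le
      calc C * (Lb * ‖t N ω k - (M N).theta0 k‖) ≤ C * (1 / (4 * C)) := by gcongr
        _ = 1 / 4 := by field_simp)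
  refine h7.2.trans ?_
  have hw := hS.one_le N
  have hℓ := hS.one_le_curv N
  have hDN := hS.one_le_dim N
  have hs2 : √(w N * D N / N) ^ 2 = w N * D N / N := Real.sq_sqrt (by positivity)
  set s := √(w N * D N / N) with hs
  have hs0 : 0 ≤ s := Real.sqrt_nonneg _
  calc _ ≤ C * (a * s + (w N * ℓ N) * (2 * (a * s))) * (2 * (a * s)) := by
        gcongr
        exacts [h2 k, h1 k, h1 k]
    _ = 2 * C * a ^ 2 * s ^ 2 * (1 + 2 * (w N * ℓ N)) := by ring
    _ ≤ 2 * C * a ^ 2 * s ^ 2 * (3 * (w N * ℓ N)) := by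
        gcongr; nlinarith
    _ = _ := by rw [hs2]; ring

end Expansion

/-! ### Linear expansion of the estimator of the target parameter -/

lemma sq_inner_clm_le {m : ℕ} (J : E m →L[ℝ] E m) (u x : E m) :
    (inner ℝ u (J x)) ^ 2 ≤
      (∑ l, (inner ℝ u (J (EuclideanSpace.single l (1 : ℝ)))) ^ 2) * ‖x‖ ^ 2 := by
  have h1 : inner ℝ u (J x) = ∑ l, inner ℝ u (J (EuclideanSpace.single l (1 : ℝ))) * x l := by
    conv_lhs => rw [← (EuclideanSpace.basisFun (Fin m) ℝ).sum_repr x]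
    rw [map_sum, inner_sum]
    refine Finset.sum_congr rfl fun l _ => ?_
    rw [map_smul, inner_smul_right, EuclideanSpace.basisFun_apply, EuclideanSpace.basisFun_repr]
    ring
  rw [h1, EuclideanSpace.norm_sq_eq]
  simpa using Finset.sum_mul_sq_le_sq_mul_sq Finset.univ
    (fun l => inner ℝ u (J (EuclideanSpace.single l (1 : ℝ)))) fun l => x l

/-- The operator norm is at most the Hilbert--Schmidt norm. -/
lemma opNorm_sq_le_sum {m : ℕ} (J : E m →L[ℝ] E m) :
    ‖J‖ ^ 2 ≤ ∑ l', ∑ l, (inner ℝ (EuclideanSpace.single l' (1 : ℝ))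
      (J (EuclideanSpace.single l (1 : ℝ)))) ^ 2 := by
  set s := ∑ l', ∑ l, (inner ℝ (EuclideanSpace.single l' (1 : ℝ))
      (J (EuclideanSpace.single l (1 : ℝ)))) ^ 2 with hs
  have hs0 : 0 ≤ s := Finset.sum_nonneg fun _ _ => Finset.sum_nonneg fun _ _ => sq_nonneg _
  have h : ‖J‖ ≤ √s := by
    refine J.opNorm_le_bound (Real.sqrt_nonneg _) fun x => ?_
    refine abs_le_of_sq_le_sq' ?_ (by positivity) |>.2
    rw [mul_pow, Real.sq_sqrt hs0, EuclideanSpace.norm_sq_eq, hs, Finset.sum_mul]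
    refine Finset.sum_le_sum fun l' _ => ?_
    have := sq_inner_clm_le J (EuclideanSpace.single l' (1 : ℝ)) x
    rw [EuclideanSpace.inner_single_left] at this
    simpa using this
  calc ‖J‖ ^ 2 ≤ √s ^ 2 := by gcongr
    _ = s := Real.sq_sqrt hs0

lemma Regular.memLp_inner_Dm {p d K : ℕ} {M : Model p d K} {ε C c δ ℓ : ℝ}
    (hM : M.Regular ε C c δ ℓ) (hC : 0 < C) (u v : E p) (hv : ‖v‖ = 1) :
    MemLp (fun w => inner ℝ u (M.Dm M.beta0 w v)) 2 M.law ∧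
      ∫ w, (inner ℝ u (M.Dm M.beta0 w v)) ^ 2 ∂M.law ≤ ‖u‖ ^ 2 * C := by
  have key : ∀ u : E p, ‖u‖ = 1 → MemLp (fun w => inner ℝ u (M.Dm M.beta0 w v)) 2 M.law ∧
      ∫ w, (inner ℝ u (M.Dm M.beta0 w v)) ^ 2 ∂M.law ≤ C := fun u hu => by
    have hm : AEStronglyMeasurable (fun w => inner ℝ u (M.Dm M.beta0 w v)) M.law :=
      (hM.Dm_int.apply_continuousLinearMap v).const_inner u |>.1
    have hle := hM.Dm_tail u v hu hv
    have hint : Integrable (fun w => (inner ℝ u (M.Dm M.beta0 w v)) ^ 2) M.law := by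
      refine ⟨hm.pow 2, ?_⟩
      rw [hasFiniteIntegral_iff_ofReal (ae_of_all _ fun _ => sq_nonneg _)]
      exact hle.trans_lt ENNReal.ofReal_lt_top
    refine ⟨(memLp_two_iff_integrable_sq hm).2 hint, ?_⟩
    rw [← ofReal_integral_eq_lintegral_ofReal hint (ae_of_all _ fun _ => sq_nonneg _)] at hle
    exact (ENNReal.ofReal_le_ofReal_iff hC.le).1 hle
  rcases eq_or_ne u 0 with rfl | hu
  · simp
  · have hu' : ‖u‖ ≠ 0 := norm_ne_zero_iff.2 hu
    obtain ⟨h1, h2⟩ := key (‖u‖⁻¹ • u) (by rw [norm_smul, norm_inv, norm_norm, inv_mul_cancel₀ hu'])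
    have hEq : ∀ w, inner ℝ u (M.Dm M.beta0 w v) =
        ‖u‖ * inner ℝ (‖u‖⁻¹ • u) (M.Dm M.beta0 w v) := fun w => by
      rw [real_inner_smul_left, ← mul_assoc, mul_inv_cancel₀ hu', one_mul]
    simp_rw [hEq]
    refine ⟨h1.const_mul _, ?_⟩
    simp_rw [mul_pow]
    rw [integral_const_mul]
    gcongr

/-- The mean square of the error of the averaged Jacobian in a fixed direction. -/
lemma Regular.lintegral_sum_jacErrBeta_le {p d K : ℕ} {M : Model p d K} {ε C c δ ℓ : ℝ}
    (hM : M.Regular ε C c δ ℓ) (hε : 0 < ε) (hC : 0 < C) {wt : Record p K → ℝ}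
    (hw : UnbiasedWeight M ε wt) {Ω : Type*} [MeasurableSpace Ω] {P : Measure Ω}
    [IsProbabilityMeasure P] {N : ℕ} {W : Fin N → Ω → Record p K}
    (hW : IsSample W M.recordLaw P) (u : E p) :
    AEMeasurable (fun ω => ∑ l, (inner ℝ u (M.jacErrBeta wt (fun i => W i ω)
      (EuclideanSpace.single l (1 : ℝ)))) ^ 2) P ∧
    (0 < N → ∫⁻ ω, ENNReal.ofReal (∑ l, (inner ℝ u (M.jacErrBeta wt (fun i => W i ω)
      (EuclideanSpace.single l (1 : ℝ)))) ^ 2) ∂P ≤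
      ENNReal.ofReal (p * (‖u‖ ^ 2 * C) / (ε ^ 2 * N))) := by
  have hX := fun l : Fin p => hM.memLp_inner_Dm hC u (EuclideanSpace.single l (1 : ℝ)) (by simp)
  have hm : ∀ l : Fin p, AEMeasurable (fun ω => (inner ℝ u (M.jacErrBeta wt (fun i => W i ω)
      (EuclideanSpace.single l (1 : ℝ)))) ^ 2) P := fun l => by
    simp_rw [inner_jacErrBeta hM]
    refine AEMeasurable.pow_const (AEMeasurable.sub_const ?_ _) 2
    unfold avg
    refine (Finset.aemeasurable_fun_sum _ fun i _ => ?_).const_mul _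
    exact hW.aemeasurable_comp (hw.meas.aemeasurable.mul
      (hM.aemeasurable_fst hε (hX l).1.1.aemeasurable)) i
  refine ⟨Finset.aemeasurable_fun_sum _ fun l _ => hm l, fun hN => ?_⟩
  simp_rw [ENNReal.ofReal_sum_of_nonneg fun _ _ => sq_nonneg _]
  rw [lintegral_finsetSum' _ fun l _ => (hm l).ennreal_ofReal]
  calc _ ≤ ∑ l : Fin p, ENNReal.ofReal (‖u‖ ^ 2 * C / (ε ^ 2 * N)) := by
        refine Finset.sum_le_sum fun l _ => ?_
        simp_rw [inner_jacErrBeta hM]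
        exact hM.lintegral_sq_avg_le hε hw hN hW (hX l).1 (hX l).2
    _ = _ := by
        rw [Finset.sum_const, Finset.card_univ, Fintype.card_fin, nsmul_eq_mul,
          ← ENNReal.ofReal_natCast, ← ENNReal.ofReal_mul (by positivity)]
        congr 1; ring

section Expansion

variable {p d K : ℕ → ℕ} {M : ∀ N, Model (p N) (d N) (K N)} {ε C c δ : ℝ} {w ℓ D : ℕ → ℝ}
  {Ω : ℕ → Type*} [∀ N, MeasurableSpace (Ω N)] {P : ∀ N, Measure (Ω N)}
  [∀ N, IsProbabilityMeasure (P N)] {W : ∀ N, Fin N → Ω N → Record (p N) (K N)}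
  {wt : ∀ N, Record (p N) (K N) → ℝ}

lemma whp_norm_psiBar_le (hε : 0 < ε) (hC : 0 < C) (hM : ∀ N, (M N).Regular ε C c δ (ℓ N))
    (hW : ∀ N, IsSample (W N) (M N).recordLaw (P N)) (hS : SlowScale w ℓ D)
    (hD : ∀ N, (p N : ℝ) ≤ D N)
    (hwt : ∀ N, UnbiasedWeight (M N) ε (wt N)) :
    WHP atTop P fun N ω =>
      ‖(M N).psiBar (wt N) (fun i => W N i ω)‖ ≤ 96 * (C / ε) * √(w N * D N / N) := by
  have := fun N => (hM N).isProbabilityMeasure_recordLaw hε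
  have hb := WHP.bernstein hW le_rfl (M := 1 / ε * (2 * C)) (b := 4) (A := 24 * (1 / ε * (2 * C)))
    (by positivity) (by positivity) (by nlinarith [sq_nonneg (1 / ε * (2 * C))])
    hS.tendsto_mul hS.tendsto_div (fun N => sphereNet (p N))
    (F := fun N a z => wt N z * inner ℝ a ((M N).psi z.1))
    (fun N a ha => by
      have := (hM N).law_prob
      refine (hM N).orlicz_weighted hε (hwt N) (X := fun w => inner ℝ a ((M N).psi w))
        (OrliczLE.one_of_two ?_ hC) (by positivity)
      exact (hM N).psi_tail a (norm_of_mem_sphereNet ha))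
    (Eventually.of_forall fun N => by
      have h1 : ((sphereNet (p N)).card : ℝ) ≤ 5 ^ p N := by exact_mod_cast card_sphereNet_le _
      have h5 : (5 : ℝ) ≤ Real.exp 4 := by
        have h := Real.add_one_le_exp (4 : ℝ); linarith
      calc ((sphereNet (p N)).card : ℝ) ≤ Real.exp 4 ^ p N := h1.trans (by gcongr)
        _ = Real.exp (4 * p N) := by rw [← Real.exp_nat_mul]; ring_nf
        _ ≤ _ := by
          have := hS.one_le N
          have := hS.one_le_dim N
          apply Real.exp_le_exp.2
          nlinarith [hD N])
  refine hb.mono (Eventually.of_forall fun N ω hω => ?_)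
  have h := norm_le_of_sphereNet (x := (M N).psiBar (wt N) (fun i => W N i ω))
    (t := 24 * (1 / ε * (2 * C)) * √(w N * D N / N)) (by positivity) fun u hu => ?_
  · refine h.trans (le_of_eq (by ring))
  · have := hω u hu
    have hint : Integrable (fun w => inner ℝ u ((M N).psi w)) (M N).law := by
      have := (hM N).law_prob
      exact (((hM N).psi_tail u (norm_of_mem_sphereNet hu)).one_of_two hC).integrable
        (by positivity)
    rw [(hwt N).unbiased _ hint, (hM N).integral_inner_psi hC, sub_zero] at this
    rw [psiBar, inner_vavg]
    simp only [inner_smul_right]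
    exact (le_abs_self _).trans this.le

/-- A consistent root of the weighted estimating equation for `β` is, in any given direction, the
average of the influence function up to an error of smaller order than `1 / √N`. The direction is
fixed in advance because only second moments of the Jacobian are available: its error is small of
order `√(p / N)` in a given direction, but only of order `p / √N` as an operator. -/
theorem beta_expansion (hε : 0 < ε) (hC : 0 < C) (hδ : 0 < δ)
    (hM : ∀ N, (M N).Regular ε C c δ (ℓ N))
    (hW : ∀ N, IsSample (W N) (M N).recordLaw (P N)) (hS : SlowScale w ℓ D)
    (hD : ∀ N, (p N : ℝ) ≤ D N)
    (hwt : ∀ N, UnbiasedWeight (M N) ε (wt N)) {b : ∀ N, Ω N → E (p N)}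
    (hroot : WHP atTop P fun N ω => (1 / (N : ℝ)) •
      ∑ i, wt N (W N i ω) • (M N).mObs (b N ω) (W N i ω).1 = 0)
    (hcons : ∀ s : ℝ, 0 < s → WHP atTop P fun N ω => ℓ N * ‖b N ω - (M N).beta0‖ < s)
    {Q : ℝ} (hQ : 0 < Q) {u : ∀ N, E (p N)} (hu : ∀ N, ‖u N‖ ≤ Q) :
    ∃ A : ℝ, 0 < A ∧ WHP atTop P fun N ω =>
      |inner ℝ (u N) (b N ω - (M N).beta0 - (M N).psiBar (wt N) (fun i => W N i ω))| ≤
        A * (w N ^ 2 * (ℓ N * D N) / N) := by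
  choose L hLm hLi hL using fun N => (hM N).lip
  have hℓ0 : ∀ N, 0 < ℓ N := fun N => zero_lt_one.trans_le (hS.one_le_curv N)
  set a : ℝ := 96 * (C / ε) with ha
  have ha0 : 0 < a := by positivity
  refine ⟨2 * a + 4 * Q * C * a ^ 2, by positivity, ?_⟩
  -- the direction in which the error of the estimating equation is seen by `u`
  set v : ∀ N, E (p N) := fun N => ContinuousLinearMap.adjoint (M N).A.inverse (u N) with hv
  have hvn : ∀ N, ‖v N‖ ≤ Q * C := fun N => by
    calc ‖v N‖ ≤ ‖ContinuousLinearMap.adjoint (M N).A.inverse‖ * ‖u N‖ :=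
          ContinuousLinearMap.le_opNorm _ _
      _ ≤ C * Q := by
          rw [LinearIsometryEquiv.norm_map]
          gcongr
          exacts [(hM N).A_inv.2, hu N]
      _ = Q * C := mul_comm _ _
  -- the error of the Jacobian in the direction that matters
  have hdir : WHP atTop P fun N ω => ∑ l, (inner ℝ (v N) ((M N).jacErrBeta (wt N)
      (fun i => W N i ω) (EuclideanSpace.single l (1 : ℝ)))) ^ 2 < w N * D N / N := by
    have h := fun N => (hM N).lintegral_sum_jacErrBeta_le hε hC (hwt N) (hW N) (v N)
    refine WHP.markov (b := fun N => p N * ((Q * C) ^ 2 * C) / (ε ^ 2 * N)) (fun N => (h N).1)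
      ?_ ?_ ?_
    · filter_upwards [eventually_gt_atTop 0] with N hN
      refine ((h N).2 hN).trans (ENNReal.ofReal_le_ofReal ?_)
      have := hvn N
      gcongr
    · filter_upwards [eventually_gt_atTop 0] with N hN
      have hN' : (0 : ℝ) < N := by exact_mod_cast hN
      have := hS.one_le N
      have := hS.one_le_dim N
      positivity
    · have h1 : Tendsto (fun N => ((Q * C) ^ 2 * C / ε ^ 2) * (w N)⁻¹) atTop (𝓝 0) := by
        simpa using hS.tendsto.inv_tendsto_atTop.const_mul ((Q * C) ^ 2 * C / ε ^ 2)
      refine squeeze_zero' (Eventually.of_forall fun N => ?_) ?_ h1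
      · have := hS.one_le N
        have := hS.one_le_dim N
        positivity
      · filter_upwards [eventually_gt_atTop 0] with N hN
        have hN' : (0 : ℝ) < N := by exact_mod_cast hN
        have hw0 : 0 < w N := zero_lt_one.trans_le (hS.one_le N)
        have hD0 : 0 < D N := zero_lt_one.trans_le (hS.one_le_dim N)
        calc p N * ((Q * C) ^ 2 * C) / (ε ^ 2 * N) / (w N * D N / N)
            = ((Q * C) ^ 2 * C / ε ^ 2) * (w N)⁻¹ * (p N / D N) := by field_simp
          _ ≤ ((Q * C) ^ 2 * C / ε ^ 2) * (w N)⁻¹ * 1 := by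
              gcongr
              exact (div_le_one hD0).2 (hD N)
          _ = _ := mul_one _
  -- the error of the Jacobian as an operator
  have hop : WHP atTop P fun N ω =>
      ‖(M N).jacErrBeta (wt N) (fun i => W N i ω)‖ ≤ 1 / (4 * C) := by
    have h := fun N (l : Fin (p N)) => (hM N).lintegral_sum_jacErrBeta_le hε hC (hwt N) (hW N)
      (EuclideanSpace.single l (1 : ℝ))
    have h1 := WHP.markov (P := P) (l := atTop)
      (X := fun N ω => ∑ l', ∑ l, (inner ℝ (EuclideanSpace.single l' (1 : ℝ))
        ((M N).jacErrBeta (wt N) (fun i => W N i ω) (EuclideanSpace.single l (1 : ℝ)))) ^ 2)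
      (b := fun N => p N * (p N * C / (ε ^ 2 * N))) (t := fun _ => (1 / (4 * C)) ^ 2)
      (fun N => Finset.aemeasurable_fun_sum _ fun l _ => (h N l).1) ?_
      (Eventually.of_forall fun N => by positivity) ?_
    · refine h1.mono (Eventually.of_forall fun N ω hω => ?_)
      exact (pow_le_pow_iff_left₀ (norm_nonneg _) (by positivity) two_ne_zero).1
        ((opNorm_sq_le_sum _).trans hω.le)
    · filter_upwards [eventually_gt_atTop 0] with N hN
      simp_rw [ENNReal.ofReal_sum_of_nonneg fun (_ : Fin (p N)) _ =>
        Finset.sum_nonneg fun (_ : Fin (p N)) _ => sq_nonneg _]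
      rw [lintegral_finsetSum' _ fun l _ => (h N l).1.ennreal_ofReal]
      calc _ ≤ ∑ l : Fin (p N), ENNReal.ofReal (p N * C / (ε ^ 2 * N)) := by
            refine Finset.sum_le_sum fun l _ => ?_
            simpa using (h N l).2 hN
        _ = _ := by
            rw [Finset.sum_const, Finset.card_univ, Fintype.card_fin, nsmul_eq_mul,
              ← ENNReal.ofReal_natCast, ← ENNReal.ofReal_mul (by positivity)]
    · have h2 : Tendsto (fun N => 16 * C ^ 3 / ε ^ 2 *
          (w N ^ 2 * (ℓ N * D N) / √N) ^ 2) atTop (𝓝 0) := by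
        simpa using (hS.small.pow 2).const_mul (16 * C ^ 3 / ε ^ 2)
      refine squeeze_zero' (Eventually.of_forall fun N => by positivity) ?_ h2
      filter_upwards [eventually_gt_atTop 0] with N hN
      have hN' : (0 : ℝ) < N := by exact_mod_cast hN
      have hp : (p N : ℝ) ≤ w N ^ 2 * (ℓ N * D N) := by
        refine le_trans ?_ (hS.mul_le N)
        exact (hD N).trans (le_mul_of_one_le_left (zero_le_one.trans (hS.one_le_dim N))
          (hS.one_le N))
      calc p N * (p N * C / (ε ^ 2 * N)) / (1 / (4 * C)) ^ 2
          = 16 * C ^ 3 / ε ^ 2 * (p N ^ 2 / N) := by field_simp; ring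
        _ ≤ 16 * C ^ 3 / ε ^ 2 * ((w N ^ 2 * (ℓ N * D N)) ^ 2 / N) := by gcongr
        _ = _ := by rw [div_pow, Real.sq_sqrt hN'.le]
  have hgood : ∀ N, ∀ᵐ ω ∂P N, ∀ i, (∀ t ∈ Metric.ball (M N).beta0 δ,
      DifferentiableAt ℝ (fun t' => (M N).mObs t' (W N i ω).1) t) ∧
      ∀ t ∈ Metric.ball (M N).beta0 δ,
        ‖(M N).Dm t (W N i ω).1 - (M N).Dm (M N).beta0 (W N i ω).1‖ ≤
          L N (W N i ω).1 * ‖t - (M N).beta0‖ := fun N =>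
    (hW N).ae_all ((hM N).ae_fst hε (q := fun x => (∀ t ∈ Metric.ball (M N).beta0 δ,
      DifferentiableAt ℝ (fun t' => (M N).mObs t' x) t) ∧
      ∀ t ∈ Metric.ball (M N).beta0 δ,
        ‖(M N).Dm t x - (M N).Dm (M N).beta0 x‖ ≤ L N x * ‖t - (M N).beta0‖)
      ((hM N).m_diff.and ((hL N).mono fun x hx => hx.1)))
  refine WHP.mono_ae (((((whp_norm_psiBar_le hε hC hM hW hS hD hwt).and
    (hdir.and hop)).and
    (whp_avg_lip_lt hε hM hW hS hwt hLm hLi)).and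
    (whp_avg_lip_mul_lt hε hM hW hS.one_le_curv hwt hLm hLi
      (Y := fun N ω => ‖b N ω - (M N).beta0‖) (fun _ _ => norm_nonneg _) hcons
      (s := 1 / (4 * C)) (by positivity))).and (hroot.and (hcons δ hδ))) ?_
  refine Eventually.of_forall fun N => ?_
  filter_upwards [hgood N] with ω hω
  rintro ⟨⟨⟨⟨h1, h2, h2'⟩, h3⟩, h4⟩, h5, h6⟩
  have hxδ : ‖b N ω - (M N).beta0‖ < δ := by
    refine lt_of_le_of_lt ?_ h6
    exact le_mul_of_one_le_left (norm_nonneg _) (hS.one_le_curv N)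
  obtain ⟨R, hR, hx⟩ := root_expansion (N := N) (g := fun i t' => (M N).mObs t' (W N i ω).1)
    (wt := fun i => wt N (W N i ω)) (L := fun i => L N (W N i ω).1)
    (fun i => (hwt N).nonneg _) (fun i => (hω i).1) (fun i => (hω i).2) hxδ h5
    (hM N).A_inv.1
  set Lb := avg (fun i => W N i ω) (fun z => wt N z * max (L N z.1) 0) with hLb
  have hLb0 : 0 ≤ Lb := by
    rw [hLb, avg]
    exact mul_nonneg (by positivity) (Finset.sum_nonneg fun i _ =>
      mul_nonneg ((hwt N).nonneg _) (le_max_right _ _))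
  set x := b N ω - (M N).beta0 with hxdef
  set y := (M N).psiBar (wt N) (fun i => W N i ω) with hy
  set J := (M N).jacErrBeta (wt N) (fun i => W N i ω) with hJ
  have hxJ : x = y - (M N).A.inverse (J x + R) := hx
  have hR' : ‖R‖ ≤ Lb * ‖x‖ ^ 2 := hR
  have h7 := (root_rate (x := x) (y := y) (J := J) hC.le hLb0 (hM N).A_inv.2 hR hxJ
    (by
      calc C * ‖J‖ ≤ C * (1 / (4 * C)) := by gcongr
        _ = 1 / 4 := by field_simp) (by
      calc C * (Lb * ‖x‖) ≤ C * (1 / (4 * C)) := by gcongr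
        _ = 1 / 4 := by field_simp)).1
  have hw := hS.one_le N
  have hℓ := hS.one_le_curv N
  have hDN := hS.one_le_dim N
  have hs2 : √(w N * D N / N) ^ 2 = w N * D N / N := Real.sq_sqrt (by positivity)
  set s := √(w N * D N / N) with hs
  have hs0 : 0 ≤ s := Real.sqrt_nonneg _
  have hxs : ‖x‖ ≤ 2 * (a * s) := h7.trans (by gcongr)
  have hin : inner ℝ (u N) (x - y) = -(inner ℝ (v N) (J x)) - inner ℝ (v N) R := by
    have : x - y = -((M N).A.inverse (J x + R)) := by
      conv_lhs => rw [hxJ]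
      abel
    rw [this, inner_neg_right, hv, ← ContinuousLinearMap.adjoint_inner_left, inner_add_right]
    ring
  -- only one direction of `J` enters, so its second moments give `√(p / N)` and not the operator
  -- norm, which they bound only by `p / √N`
  have hJx : |inner ℝ (v N) (J x)| ≤ s * (2 * (a * s)) := by
    refine abs_le_of_sq_le_sq ?_ (by positivity)
    refine (sq_inner_clm_le J (v N) x).trans ?_
    rw [mul_pow s, hs2]
    gcongr
  have hRx : |inner ℝ (v N) R| ≤ Q * C * (w N * ℓ N * (2 * (a * s)) ^ 2) := by
    refine (abs_real_inner_le_norm _ _).trans ?_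
    gcongr
    · exact hvn N
    · exact hR'.trans (mul_le_mul h3.le (pow_le_pow_left₀ (norm_nonneg _) hxs 2) (sq_nonneg _)
        (by positivity))
  have hwℓ : 1 ≤ w N * ℓ N := by nlinarith
  have h2a : 2 * a ≤ 2 * a * (w N * ℓ N) := le_mul_of_one_le_right (by positivity) hwℓ
  rw [hin]
  calc |-(inner ℝ (v N) (J x)) - inner ℝ (v N) R| ≤
        |inner ℝ (v N) (J x)| + |inner ℝ (v N) R| := by
        refine (abs_sub _ _).trans ?_
        rw [abs_neg]
    _ ≤ s * (2 * (a * s)) + Q * C * (w N * ℓ N * (2 * (a * s)) ^ 2) := add_le_add hJx hRx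
    _ = s ^ 2 * (2 * a + 4 * Q * C * a ^ 2 * (w N * ℓ N)) := by ring
    _ ≤ s ^ 2 * (2 * a * (w N * ℓ N) + 4 * Q * C * a ^ 2 * (w N * ℓ N)) := by
        gcongr
    _ = _ := by rw [hs2]; ring

end Expansion

end Model


/-! ### Asymptotic normality of asymptotically linear estimators -/

lemma norm_le_sum_abs {m : ℕ} (x : E m) : ‖x‖ ≤ ∑ l, |x l| := by
  refine (abs_le_of_sq_le_sq' ?_ (Finset.sum_nonneg fun _ _ => abs_nonneg _)).2
  rw [EuclideanSpace.norm_sq_eq]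
  exact Finset.sum_sq_le_sq_sum_of_nonneg fun _ _ => norm_nonneg _

section Orlicz

variable {α : Type*} [MeasurableSpace α] {μ : Measure α}

lemma OrliczLE.add {X Y : α → ℝ} {B : ℝ} (hX : OrliczLE 1 X B μ) (hY : OrliczLE 1 Y B μ)
    (hB : 0 < B) : OrliczLE 1 (fun w => X w + Y w) (2 * B) μ := by
  refine ⟨hX.1.add hY.1, ?_⟩
  have hexp : ∀ Z : α → ℝ, AEMeasurable Z μ →
      AEMeasurable (fun w => ENNReal.ofReal (Real.exp ((|Z w| / B) ^ 1))) μ := fun Z hZ =>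
    (Real.measurable_exp.comp_aemeasurable
      (((continuous_abs.measurable.comp_aemeasurable hZ).div_const _).pow_const _)).ennreal_ofReal
  have key : ∀ w, ENNReal.ofReal (Real.exp ((|X w + Y w| / (2 * B)) ^ 1)) ≤
      ENNReal.ofReal (1 / 2) * (ENNReal.ofReal (Real.exp ((|X w| / B) ^ 1)) +
        ENNReal.ofReal (Real.exp ((|Y w| / B) ^ 1))) := by
    intro w
    rw [← ENNReal.ofReal_add (by positivity) (by positivity), ← ENNReal.ofReal_mul (by norm_num)]
    apply ENNReal.ofReal_le_ofReal
    simp only [pow_one]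
    have h1 : |X w + Y w| / (2 * B) ≤ |X w| / B / 2 + |Y w| / B / 2 := by
      rw [div_div, div_div, ← add_div, mul_comm B]
      gcongr
      exact abs_add_le _ _
    have h2 := Real.exp_le_exp.2 h1
    rw [Real.exp_add] at h2
    have h3 : Real.exp (|X w| / B) = Real.exp (|X w| / B / 2) ^ 2 := by
      rw [← Real.exp_nat_mul]; congr 1; push_cast; ring
    have h4 : Real.exp (|Y w| / B) = Real.exp (|Y w| / B / 2) ^ 2 := by
      rw [← Real.exp_nat_mul]; congr 1; push_cast; ring
    rw [h3, h4]
    nlinarith [sq_nonneg (Real.exp (|X w| / B / 2) - Real.exp (|Y w| / B / 2))]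
  calc _ ≤ ∫⁻ w, ENNReal.ofReal (1 / 2) * (ENNReal.ofReal (Real.exp ((|X w| / B) ^ 1)) +
        ENNReal.ofReal (Real.exp ((|Y w| / B) ^ 1))) ∂μ := lintegral_mono key
    _ = ENNReal.ofReal (1 / 2) * (∫⁻ w, ENNReal.ofReal (Real.exp ((|X w| / B) ^ 1)) ∂μ +
        ∫⁻ w, ENNReal.ofReal (Real.exp ((|Y w| / B) ^ 1)) ∂μ) := by
        rw [lintegral_const_mul' _ _ ENNReal.ofReal_ne_top, lintegral_add_left' (hexp X hX.1)]
    _ ≤ ENNReal.ofReal (1 / 2) * (2 + 2) := by gcongr; exacts [hX.2, hY.2]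
    _ = 2 := by
      rw [show (2 : ENNReal) + 2 = ENNReal.ofReal 4 by norm_num, ← ENNReal.ofReal_mul (by norm_num)]
      norm_num

lemma OrliczLE.inner_of_unit [IsProbabilityMeasure μ] {m a : ℕ} (ha : a ≠ 0) {Y : α → E m} {B Q : ℝ}
    (hB : 0 < B)
    (hQ : 0 < Q) (h : ∀ u : E m, ‖u‖ = 1 → OrliczLE a (fun w => inner ℝ u (Y w)) B μ) {u : E m}
    (hu : ‖u‖ ≤ Q) : OrliczLE a (fun w => inner ℝ u (Y w)) (Q * B) μ := by
  rcases eq_or_ne u 0 with rfl | hu0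
  · refine ⟨by simp, ?_⟩
    simp [ha]
  · have hu' : ‖u‖ ≠ 0 := norm_ne_zero_iff.2 hu0
    have h1 := h (‖u‖⁻¹ • u) (by rw [norm_smul, norm_inv, norm_norm, inv_mul_cancel₀ hu'])
    have hEq : ∀ w, inner ℝ u (Y w) = ‖u‖ * inner ℝ (‖u‖⁻¹ • u) (Y w) := fun w => by
      rw [real_inner_smul_left, ← mul_assoc, mul_inv_cancel₀ hu', one_mul]
    refine h1.of_abs_le (by positivity) ?_ (ae_of_all _ fun w => ?_)
    · simp_rw [hEq]; exact h1.1.const_mul _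
    · rw [hEq, abs_mul, abs_norm, div_le_div_iff₀ (by positivity) hB]
      calc ‖u‖ * |inner ℝ (‖u‖⁻¹ • u) (Y w)| * B ≤ Q * |inner ℝ (‖u‖⁻¹ • u) (Y w)| * B := by gcongr
        _ = _ := by ring

end Orlicz

namespace Model

section Single

variable {p d K : ℕ} {M : Model p d K} {ε C c δ ℓ : ℝ}

lemma Regular.r_mem (hM : M.Regular ε C c δ ℓ) (hε : 0 < ε) : ε ≤ M.r ∧ M.r ≤ 1 := by
  have := hM.law_prob
  have hint : Integrable M.rhoObs M.law :=
    Integrable.of_bound hM.rho_meas.aestronglyMeasurable 1 (ae_of_all _ fun w => by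
      rw [Real.norm_of_nonneg (hε.le.trans (hM.rho_mem w).1)]; exact (hM.rho_mem w).2)
  constructor
  · simpa [r] using integral_mono (μ := M.law) (integrable_const ε) hint fun w => (hM.rho_mem w).1
  · simpa [r] using integral_mono (μ := M.law) hint (integrable_const 1) fun w => (hM.rho_mem w).2

lemma Regular.integral_ind (hM : M.Regular ε C c δ ℓ) (hε : 0 < ε) :
    ∫ z : Record p K, ind z ∂M.recordLaw = M.r := by
  have := hM.law_prob
  rw [(hM.recordLaw_integral hε (F := ind) (by simp) (by simp)).2]
  simp [r]

lemma orlicz_const_of_abs_le {α : Type*} [MeasurableSpace α] {μ : Measure α}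
    [IsProbabilityMeasure μ] {X : α → ℝ} (hX : Measurable X) (h : ∀ x, |X x| ≤ 1) :
    OrliczLE 1 X 2 μ := by
  refine ⟨hX.aemeasurable, ?_⟩
  calc _ ≤ ∫⁻ _, 2 ∂μ := by
        refine lintegral_mono fun x => ?_
        rw [show (2 : ENNReal) = ENNReal.ofReal 2 by norm_num]
        refine ENNReal.ofReal_le_ofReal ?_
        have h1 : (|X x| / 2) ^ 1 ≤ 1 / 2 := by have := h x; simp; linarith
        have h2 : Real.exp (1 / 2) ^ 2 = Real.exp 1 := by
          rw [← Real.exp_nat_mul]; norm_num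
        have h3 := Real.exp_one_lt_d9
        refine (Real.exp_le_exp.2 h1).trans ?_
        nlinarith [Real.exp_pos (1 / 2)]
    _ = 2 := by simp

lemma nValid_div_eq_avg {N : ℕ} (D : Fin N → Record p K) : (nValid D : ℝ) / N = avg D ind := by
  rw [avg, nValid, valid, Finset.card_filter]
  push_cast
  rw [div_eq_inv_mul, one_div]
  rfl

/-- The influence function of the optimal estimator has sub-exponential directions: it equals
`ψ + (R/ρ - 1)(ψ - Γ₀ η)`. -/
lemma Regular.orlicz_psiTilde_Gamma0 (hM : M.Regular ε C c δ ℓ) (hε : 0 < ε) (hC : 0 < C) (u : E p)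
    (hu : ‖u‖ = 1) :
    OrliczLE 1 (fun z => inner ℝ u (WithLp.toLp 2 (M.psiTilde M.Gamma0 z))) (4 * (1 / ε * C))
      M.recordLaw := by
  have := hM.isProbabilityMeasure_recordLaw hε
  have h1e : 1 ≤ 1 / ε := by rw [le_div_iff₀ hε, one_mul]; exact hM.eps_le_one
  have hρ := hM.rho_meas
  have h1 := hM.orlicz_mul hε (hM.psi_tail u hu) hC (b := 1 / ε) (by positivity)
    (g := fun _ => 1) measurable_const (fun z => by simpa using h1e)
  have h2 := hM.orlicz_mul hε (hM.resid_tail u hu) hC (b := 1 / ε) (by positivity)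
    (g := fun z => M.ipw z - 1) ((hM.unbiasedWeight_ipw hε).meas.sub_const 1) (fun z => by
      have h3 := (hM.unbiasedWeight_ipw hε).nonneg z
      have h4 := (hM.unbiasedWeight_ipw hε).le z
      rw [abs_le]; constructor <;> linarith)
  have h3 := (h1.one_of_two (by positivity)).add (h2.one_of_two (by positivity)) (by positivity)
  rw [show 4 * (1 / ε * C) = 2 * (2 * (1 / ε * C)) by ring]
  convert h3 using 1
  funext z
  have hρ0 : M.rhoObs z.1 ≠ 0 := (hε.trans_le (hM.rho_mem z.1).1).ne'
  rw [one_mul, ← inner_smul_right, ← inner_add_right]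
  congr 1
  ext l
  simp only [psiTilde, ipw, resid, PiLp.add_apply, PiLp.smul_apply, PiLp.sub_apply, smul_eq_mul,
    ind]
  field_simp
  ring

lemma Regular.orlicz_psiTilde_zero (hM : M.Regular ε C c δ ℓ) (hε : 0 < ε) (hC : 0 < C) (u : E p)
    (hu : ‖u‖ = 1) :
    OrliczLE 1 (fun z => inner ℝ u (WithLp.toLp 2 (M.psiTilde 0 z))) (4 * (1 / ε * C))
      M.recordLaw := by
  have := hM.isProbabilityMeasure_recordLaw hε
  have h1 := (hM.orlicz_weighted hε (hM.unbiasedWeight_ipw hε) (hM.psi_tail u hu) hC).one_of_two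
    (by positivity)
  refine OrliczLE.mono (M := 2 * (1 / ε * C)) ?_ (by positivity)
    (by nlinarith [show 0 < 1 / ε * C by positivity])
  convert h1 using 1
  funext z
  rw [← inner_smul_right]
  congr 1
  ext l
  simp only [psiTilde, ipw, PiLp.smul_apply, smul_eq_mul, ind]
  by_cases h : z.2 = true <;> simp [h, div_eq_inv_mul]

lemma Regular.varTilde_quadratic (hM : M.Regular ε C c δ ℓ) (hε : 0 < ε) (hC : 0 < C)
    (Γ : Weight p d K) (u : Fin p → ℝ) :
    ∫ z, (∑ l, u l * M.psiTilde Γ z l) ^ 2 ∂M.recordLaw = u ⬝ᵥ (M.varTilde Γ).mulVec u := by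
  have := hM.isProbabilityMeasure_recordLaw hε
  have hL := hM.memLp_psiTilde hε hC Γ
  have hint : ∀ l l', Integrable (fun z => M.psiTilde Γ z l * M.psiTilde Γ z l') M.recordLaw :=
    fun l l' => (hL l).integrable_mul (hL l')
  have hcov : ∀ l l', M.varTilde Γ l l' = ∫ z, M.psiTilde Γ z l * M.psiTilde Γ z l' ∂M.recordLaw :=
    fun l l' => by simp [varTilde, covariance, hM.integral_psiTilde hε hC]
  have hexp : ∀ z, (∑ l, u l * M.psiTilde Γ z l) ^ 2 =
      ∑ l, ∑ l', u l * u l' * (M.psiTilde Γ z l * M.psiTilde Γ z l') := fun z => by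
    rw [sq, Finset.sum_mul_sum]
    exact Finset.sum_congr rfl fun l _ => Finset.sum_congr rfl fun l' _ => by ring
  simp_rw [hexp]
  rw [integral_finsetSum _ fun l _ => integrable_finsetSum _ fun l' _ => (hint l l').const_mul _]
  simp only [dotProduct, Matrix.mulVec, Finset.mul_sum]
  refine Finset.sum_congr rfl fun l _ => ?_
  rw [integral_finsetSum _ fun l' _ => (hint l l').const_mul _]
  refine Finset.sum_congr rfl fun l' _ => ?_
  rw [integral_const_mul, hcov]
  ring

lemma Regular.posSemidef_varTilde (hM : M.Regular ε C c δ ℓ) (hε : 0 < ε) (hC : 0 < C)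
    (Γ : Weight p d K) : (M.varTilde Γ).PosSemidef := by
  refine Matrix.PosSemidef.of_dotProduct_mulVec_nonneg ?_ fun u => ?_
  · ext l l'
    simp [varTilde, covariance_comm]
  · rw [star_trivial, ← hM.varTilde_quadratic hε hC]
    exact integral_nonneg fun z => sq_nonneg _

end Single

section Normality

variable {p d K : ℕ → ℕ} {M : ∀ N, Model (p N) (d N) (K N)} {ε C c δ : ℝ} {ℓ : ℕ → ℝ}
  {Ω : ℕ → Type*} [∀ N, MeasurableSpace (Ω N)] {P : ∀ N, Measure (Ω N)}
  [∀ N, IsProbabilityMeasure (P N)] {W : ∀ N, Fin N → Ω N → Record (p N) (K N)}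

/-- The observed selection rate approaches `r`. -/
lemma whp_abs_nValid_div_sub_lt (hε : 0 < ε) (hM : ∀ N, (M N).Regular ε C c δ (ℓ N))
    (hW : ∀ N, IsSample (W N) (M N).recordLaw (P N)) {s : ℝ} (hs : 0 < s) :
    WHP atTop P fun N ω => |(nValid (fun i => W N i ω) : ℝ) / N - (M N).r| < s := by
  have := fun N => (hM N).isProbabilityMeasure_recordLaw hε
  have h1 : Tendsto (fun N : ℕ => √(N : ℝ)) atTop atTop :=
    Real.tendsto_sqrt_atTop.comp tendsto_natCast_atTop_atTop
  have h2 : Tendsto (fun N : ℕ => √(N : ℝ) / N) atTop (𝓝 0) := by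
    have := h1.inv_tendsto_atTop
    refine this.congr fun N => ?_
    simp [Real.sqrt_div_self]
  have h3 := WHP.bernstein hW le_rfl (M := 2) (b := 0) (A := 16) (by norm_num) (by norm_num)
    (by norm_num) h1 h2 (fun N => (Finset.univ : Finset Unit)) (F := fun N _ => ind)
    (fun N _ _ => orlicz_const_of_abs_le measurable_ind fun z => by
      rw [abs_of_nonneg (ind_nonneg z)]; exact ind_le_one z) (by simp)
  have h4 : Tendsto (fun N : ℕ => 16 * √(√(N : ℝ) / N)) atTop (𝓝 0) := by
    simpa using h2.sqrt.const_mul 16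
  refine h3.mono ?_
  filter_upwards [h4.eventually_lt_const hs] with N hN ω hω
  have := hω () (Finset.mem_univ _)
  rw [(hM N).integral_ind hε, ← nValid_div_eq_avg] at this
  exact this.trans hN

/-- The normalized average `√N · avg` of centred variables is tight. -/
lemma tight_sqrt_mul_avg (hε : 0 < ε) (hM : ∀ N, (M N).Regular ε C c δ (ℓ N))
    (hW : ∀ N, IsSample (W N) (M N).recordLaw (P N)) {f : ∀ N, Record (p N) (K N) → ℝ} {B : ℝ}
    (hB : 0 < B) (hf : ∀ N, OrliczLE 1 (f N) B (M N).recordLaw)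
    (hf0 : ∀ N, ∫ z, f N z ∂(M N).recordLaw = 0) {η : ℝ} (hη : 0 < η) :
    ∃ A : ℝ, 0 < A ∧ ∀ᶠ N in atTop,
      P N {ω | ¬ √N * |avg (fun i => W N i ω) (f N)| < A} ≤ ENNReal.ofReal η := by
  have := fun N => (hM N).isProbabilityMeasure_recordLaw hε
  have hm : ∀ N, AEMeasurable (fun ω => N * (avg (fun i => W N i ω) (f N)) ^ 2) (P N) := fun N => by
    unfold avg
    exact (((Finset.aemeasurable_fun_sum _ fun i _ =>
      (hW N).aemeasurable_comp (hf N).1 i).const_mul _).pow_const 2).const_mul _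
  obtain ⟨A, hA, h⟩ := tight_of_lintegral (P := P) (l := atTop)
    (X := fun N ω => N * (avg (fun i => W N i ω) (f N)) ^ 2) (b := 4 * B ^ 2) (by positivity) hm (by
      filter_upwards [eventually_gt_atTop 0] with N hN
      have hN' : (0 : ℝ) < N := by exact_mod_cast hN
      have h1 := (hW N).integral_sq_avg_le ((hf N).memLp_two hB) hN
      rw [hf0 N] at h1
      simp only [sub_zero] at h1
      simp_rw [ENNReal.ofReal_mul hN'.le]
      rw [lintegral_const_mul' _ _ ENNReal.ofReal_ne_top]
      refine (mul_le_mul_right h1 _).trans ?_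
      rw [← ENNReal.ofReal_mul hN'.le]
      refine ENNReal.ofReal_le_ofReal ?_
      rw [← mul_assoc, mul_one_div_cancel hN'.ne', one_mul]
      exact (hf N).integral_sq_le hB) hη
  refine ⟨√A, Real.sqrt_pos.2 hA, h.mono fun N hN => le_trans (measure_mono fun ω hω => ?_) hN⟩
  simp only [Set.mem_ofPred_eq, not_lt] at hω ⊢
  calc A = √A ^ 2 := (Real.sq_sqrt hA.le).symm
    _ ≤ (√N * |avg (fun i => W N i ω) (f N)|) ^ 2 := by gcongr
    _ = _ := by rw [mul_pow, Real.sq_sqrt (by positivity), sq_abs]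

lemma measurable_nValid {p K N : ℕ} {Ω : Type*} [MeasurableSpace Ω] {P : Measure Ω}
    {W : Fin N → Ω → Record p K} (hW : ∀ i, AEMeasurable (W i) P) :
    AEMeasurable (fun ω => (nValid (fun i => W i ω) : ℝ)) P := by
  have : ∀ ω, (nValid (fun i => W i ω) : ℝ) = ∑ i, ind (W i ω) := fun ω => by
    rw [nValid, valid, Finset.card_filter]; push_cast; rfl
  simp_rw [this]
  exact Finset.aemeasurable_fun_sum _ fun i _ => measurable_ind.comp_aemeasurable (hW i)

/-- An estimator whose error is, in every direction with bounded `ℓ¹` norm, the average of the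
influence function `ψ̃_Γ` up to `o(1 / √N)` is asymptotically normal. -/
theorem asympNormal_of_linear (hε : 0 < ε) (hC : 0 < C) (hM : ∀ N, (M N).Regular ε C c δ (ℓ N))
    (hW : ∀ N, IsSample (W N) (M N).recordLaw (P N)) {Γ : ∀ N, Weight (p N) (d N) (K N)}
    {B : ℝ} (hB : 0 < B)
    (hΓ : ∀ N (u : E (p N)), ‖u‖ = 1 →
      OrliczLE 1 (fun z => inner ℝ u (WithLp.toLp 2 ((M N).psiTilde (Γ N) z))) B (M N).recordLaw)
    {b : ∀ N, Ω N → E (p N)} (hb : ∀ N, AEMeasurable (b N) (P N))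
    (hlin : ∀ (Q : ℝ) (u : ∀ N, E (p N)), (∀ N, ∑ l, |u N l| ≤ Q) → ∀ s : ℝ, 0 < s →
      WHP atTop P fun N ω => √N * |inner ℝ (u N) (b N ω - (M N).beta0) -
        avg (fun i => W N i ω)
          (fun z => inner ℝ (u N) (WithLp.toLp 2 ((M N).psiTilde (Γ N) z)))| < s) :
    AsympNormal M P W b fun N => (M N).varTilde (Γ N) := by
  rintro a T ⟨Q, hQ⟩
  have := fun N => (hM N).isProbabilityMeasure_recordLaw hε
  -- the direction in `ℝ^p` seen by the test vector `t`
  set u : E a → ∀ N, E (p N) := fun t N => WithLp.toLp 2 ((T N).transpose.mulVec t.ofLp) with hu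
  have hu1 : ∀ t N, ∑ l, |u t N l| ≤ (∑ i, |t i|) * Q := fun t N => by
    calc ∑ l, |u t N l| ≤ ∑ l, ∑ i, |T N i l| * |t i| := by
          refine Finset.sum_le_sum fun l _ => ?_
          have h1 : u t N l = ∑ i, T N i l * t i := rfl
          rw [h1]
          refine (Finset.abs_sum_le_sum_abs (fun i => T N i l * t i) _).trans_eq ?_
          exact Finset.sum_congr rfl fun i _ => abs_mul _ _
      _ = ∑ i, |t i| * ∑ l, |T N i l| := by
          rw [Finset.sum_comm]
          exact Finset.sum_congr rfl fun i _ => by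
            rw [Finset.mul_sum]; exact Finset.sum_congr rfl fun l _ => mul_comm _ _
      _ ≤ ∑ i, |t i| * Q := by gcongr with i; exact hQ N i
      _ = _ := by rw [Finset.sum_mul]
  have hun : ∀ t N, ‖u t N‖ ≤ (∑ i, |t i|) * |Q| + 1 := fun t N => by
    have h1 := norm_le_sum_abs (u t N)
    have h2 : (∑ i, |t i|) * Q ≤ (∑ i, |t i|) * |Q| := by
      gcongr
      exact le_abs_self Q
    linarith [hu1 t N]
  have hQt : ∀ t : E a, 0 < (∑ i, |t i|) * |Q| + 1 := fun t => by
    have : 0 ≤ ∑ i, |t i| := Finset.sum_nonneg fun i _ => abs_nonneg (t i)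
    positivity
  have hin : ∀ (t : E a) N (x : Fin (p N) → ℝ),
      inner ℝ t (WithLp.toLp 2 ((T N).mulVec x)) = inner ℝ (u t N) (WithLp.toLp 2 x) :=
    fun t N x => by
    simp only [EuclideanSpace.inner_eq_star_dotProduct, hu, star_trivial]
    rw [Matrix.mulVec_transpose, dotProduct_comm, Matrix.dotProduct_mulVec, dotProduct_comm]
  have hsum : ∀ (t : E a) N z, inner ℝ (u t N) (WithLp.toLp 2 ((M N).psiTilde (Γ N) z)) =
      ∑ l, u t N l * (M N).psiTilde (Γ N) z l := fun t N z => by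
    simp [PiLp.inner_apply, mul_comm]
  have horl : ∀ (t : E a) N, OrliczLE 1
      (fun z => inner ℝ (u t N) (WithLp.toLp 2 ((M N).psiTilde (Γ N) z)))
      (((∑ i, |t i|) * |Q| + 1) * B) (M N).recordLaw := fun t N =>
    OrliczLE.inner_of_unit one_ne_zero hB (hQt t) (hΓ N) (hun t N)
  have hmean : ∀ (t : E a) N,
      ∫ z, inner ℝ (u t N) (WithLp.toLp 2 ((M N).psiTilde (Γ N) z)) ∂(M N).recordLaw = 0 :=
    fun t N => by
      simp_rw [hsum]
      rw [integral_finsetSum _ fun l _ =>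
        (((hM N).memLp_psiTilde hε hC (Γ N) l).integrable (by norm_num)).const_mul _]
      refine Finset.sum_eq_zero fun l _ => ?_
      rw [integral_const_mul, (hM N).integral_psiTilde hε hC, mul_zero]
  refine asymptotic_normality_array (μ := fun N => (M N).recordLaw)
    (f := fun N z => WithLp.toLp 2 ((T N).mulVec ((M N).psiTilde (Γ N) z)))
    (V := fun N => T N * (M N).varTilde (Γ N) * (T N).transpose) (r := fun N => (M N).r) hW
    (fun t => ⟨_, mul_pos (hQt t) hB, fun N => by simp_rw [hin]; exact horl t N⟩)
    (fun t N => by simp_rw [hin]; exact hmean t N)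
    (fun t N => ?_) (fun N => ?_) (fun N => ?_) (fun N => ?_) (fun t s hs => ?_)
  · simp_rw [hin, hsum]
    rw [(hM N).varTilde_quadratic hε hC]
    simp only [hu]
    rw [← Matrix.mulVec_mulVec, ← Matrix.mulVec_mulVec, Matrix.dotProduct_mulVec t.ofLp,
      ← Matrix.mulVec_transpose]
  · have := ((hM N).posSemidef_varTilde hε hC (Γ N)).mul_mul_conjTranspose_same (T N)
    rwa [Matrix.conjTranspose_eq_transpose_of_trivial] at this
  · exact ⟨hε.le.trans ((hM N).r_mem hε).1, ((hM N).r_mem hε).2⟩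
  · unfold scaled
    have h1 := measurable_nValid (P := P N) (W := W N) fun i => ((hW N).law i).aemeasurable
    have h2 : AEMeasurable (fun ω => WithLp.toLp 2 ((T N).mulVec fun l =>
        b N ω l - (M N).beta0 l)) (P N) := by
      have h3 : Continuous fun x : E (p N) => (WithLp.toLp 2 ((T N).mulVec fun l =>
        x l - (M N).beta0 l) : E a) := by
        refine (PiLp.continuous_toLp 2 _).comp ?_
        refine Continuous.matrix_mulVec continuous_const ?_
        fun_prop
      exact h3.measurable.comp_aemeasurable (hb N)
    exact h1.sqrt.smul h2
  · have hr : ∀ N, 0 < (M N).r := fun N => hε.trans_le ((hM N).r_mem hε).1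
    have h1 := hlin _ (u t) (hu1 t) (s / 2) (by positivity)
    have h2 := WHP.mul_of_tight (P := P) (l := atTop)
      (Y := fun N ω => |√((nValid (fun i => W N i ω) : ℝ) / N) - √((M N).r)|)
      (fun _ _ => abs_nonneg _) (fun η hη => tight_sqrt_mul_avg hε hM hW
        (mul_pos (hQt t) hB) (horl t) (hmean t) hη) (fun s' hs' =>
          (whp_abs_nValid_div_sub_lt hε hM hW (s := s' * √ε) (by positivity)).mono
            (Eventually.of_forall fun N ω hω => by
              set x := (nValid (fun i => W N i ω) : ℝ) / N with hx
              have hx0 : 0 ≤ x := by positivity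
              have h3 : (√x - √((M N).r)) * (√x + √((M N).r)) = x - (M N).r := by
                have h4 := Real.sq_sqrt hx0
                have h5 := Real.sq_sqrt (hr N).le
                linear_combination h4 - h5
              rw [← h3, abs_mul] at hω
              have h6 : √ε ≤ |√x + √((M N).r)| := by
                rw [abs_of_nonneg (by positivity)]
                have := Real.sqrt_le_sqrt ((hM N).r_mem hε).1
                have := Real.sqrt_nonneg x
                linarith
              have h7 : 0 < √ε := Real.sqrt_pos.2 hε
              by_contra hcon
              push Not at hcon
              have := mul_le_mul hcon h6 h7.le (abs_nonneg _)
              linarith)) (t := s / 2) (by positivity)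
    refine (h1.and h2).mono ?_
    filter_upwards [eventually_gt_atTop 0] with N hN ω
    rintro ⟨h3, h4⟩
    have hN' : (0 : ℝ) < N := by exact_mod_cast hN
    simp only [hin]
    set x := (nValid (fun i => W N i ω) : ℝ) / N with hx
    set v := inner ℝ (u t N) (b N ω - (M N).beta0) with hv
    set y := avg (fun i => W N i ω)
      (fun z => inner ℝ (u t N) (WithLp.toLp 2 ((M N).psiTilde (Γ N) z))) with hy
    have hx1 : x ≤ 1 := by
      rw [hx, nValid_div_eq_avg, avg]
      have : ∑ i, ind (W N i ω) ≤ ∑ i : Fin N, (1 : ℝ) := Finset.sum_le_sum fun i _ => ind_le_one _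
      simp at this
      rw [one_div, inv_mul_le_iff₀ hN']; linarith
    have e1 : inner ℝ t (scaled (M N) (fun i => W N i ω) (T N) (b N ω)) = √x * √N * v := by
      rw [scaled, inner_smul_right, hin, hv, hx, ← Real.sqrt_mul (by positivity),
        div_mul_cancel₀ _ hN'.ne']
      rfl
    have e2 : √((M N).r / N) * ∑ i, inner ℝ (u t N)
        (WithLp.toLp 2 ((M N).psiTilde (Γ N) (W N i ω))) = √((M N).r) * (√N * y) := by
      rw [hy, avg, Real.sqrt_div (hr N).le]
      have : √(N : ℝ) ≠ 0 := (Real.sqrt_pos.2 hN').ne'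
      have h5 : (N : ℝ) = √N * √N := (Real.mul_self_sqrt hN'.le).symm
      rw [show √(N : ℝ) * (1 / (N : ℝ) * ∑ i, inner ℝ (u t N)
        (WithLp.toLp 2 ((M N).psiTilde (Γ N) (W N i ω)))) = (√N * (1 / N)) * ∑ i, inner ℝ (u t N)
        (WithLp.toLp 2 ((M N).psiTilde (Γ N) (W N i ω))) by ring]
      have h6 : √(N : ℝ) * (1 / N) = 1 / √N := by
        rw [mul_one_div, Real.sqrt_div_self']
      rw [h6]; ring
    rw [e1, e2, show √x * √N * v - √((M N).r) * (√N * y) =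
      √x * (√N * (v - y)) + (√x - √((M N).r)) * (√N * y) by ring]
    calc _ ≤ |√x * (√N * (v - y))| + |(√x - √((M N).r)) * (√N * y)| := abs_add_le _ _
      _ = √x * (√N * |v - y|) + √N * |y| * |√x - √((M N).r)| := by
          rw [abs_mul, abs_mul, abs_mul, abs_mul, abs_of_nonneg (Real.sqrt_nonneg _),
            abs_of_nonneg (Real.sqrt_nonneg (N : ℝ))]
          ring
      _ < s / 2 + s / 2 := by
          refine add_lt_add_of_le_of_lt ?_ h4
          refine (mul_le_of_le_one_left (by positivity) ?_).trans h3.le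
          exact Real.sqrt_le_one.2 hx1
      _ = s := by ring

end Normality

end Model


/-! ### Asymptotic linearity of the base estimators -/

lemma sqrt_mul_div_self {N : ℕ} (x : ℝ) : √(N : ℝ) * (x / N) = x / √N := by
  rcases Nat.eq_zero_or_pos N with rfl | hN
  · simp
  · have hN' : (0 : ℝ) < N := by exact_mod_cast hN
    have h1 : √(N : ℝ) ≠ 0 := (Real.sqrt_pos.2 hN').ne'
    have h2 : (N : ℝ) = √N * √N := (Real.mul_self_sqrt hN'.le).symm
    field_simp
    rw [Real.sq_sqrt hN'.le, mul_comm]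

lemma avg_sum_mul {α ι : Type*} {N : ℕ} (D : Fin N → α) (s : Finset ι) (a : ι → ℝ)
    (F : ι → α → ℝ) : avg D (fun x => ∑ j ∈ s, a j * F j x) = ∑ j ∈ s, a j * avg D (F j) := by
  simp only [avg]
  rw [Finset.sum_comm, Finset.mul_sum]
  refine Finset.sum_congr rfl fun j _ => ?_
  rw [← Finset.mul_sum]
  ring

namespace Model

/-- The linear part of `θ̂_V - θ̂_F`: the difference of the two averages of the influence
function. -/
noncomputable def etaDiff {p d K : ℕ} (M : Model p d K) {N : ℕ} (D : Fin N → Record p K)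
    (j : Idx d K) : ℝ :=
  avg D fun z => (M.ipw z - 1) * M.eta z.1 j

lemma etaDiff_eq {p d K : ℕ} (M : Model p d K) {N : ℕ} (D : Fin N → Record p K) (j : Idx d K) :
    M.etaDiff D j = M.etaBar M.ipw D j.1 j.2 - M.etaBar (fun _ => 1) D j.1 j.2 := by
  simp only [etaDiff, etaBar, vavg_apply, avg, ← mul_sub, ← Finset.sum_sub_distrib]
  congr 1
  refine Finset.sum_congr rfl fun i _ => ?_
  simp [eta]
  ring

lemma Regular.avg_psiTilde {p d K : ℕ} {M : Model p d K} {ε C c δ ℓ : ℝ}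
    (hM : M.Regular ε C c δ ℓ) (hε : 0 < ε) (Γ : Weight p d K) {N : ℕ} (D : Fin N → Record p K)
    (u : E p) :
    avg D (fun z => inner ℝ u (WithLp.toLp 2 (M.psiTilde Γ z))) =
      inner ℝ u (M.psiBar M.ipw D) - ∑ l, u l * ∑ j, Γ l j * M.etaDiff D j := by
  have h1 : ∀ z : Record p K, inner ℝ u (WithLp.toLp 2 (M.psiTilde Γ z)) =
      inner ℝ u (M.ipw z • M.psi z.1) -
        ∑ l, u l * ∑ j, Γ l j * ((M.ipw z - 1) * M.eta z.1 j) := fun z => by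
    have hρ : M.rhoObs z.1 ≠ 0 := (hε.trans_le (hM.rho_mem z.1).1).ne'
    simp only [PiLp.inner_apply, RCLike.inner_apply, conj_trivial, PiLp.smul_apply, smul_eq_mul]
    rw [← Finset.sum_sub_distrib]
    refine Finset.sum_congr rfl fun l _ => ?_
    have h2 : ∑ j, Γ l j * ((M.rhoObs z.1 - ind z) / M.rhoObs z.1 * M.eta z.1 j) =
        -∑ j, Γ l j * ((M.ipw z - 1) * M.eta z.1 j) := by
      rw [← Finset.sum_neg_distrib]
      refine Finset.sum_congr rfl fun j _ => ?_
      rw [ipw]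
      field_simp
      ring
    rw [psiTilde_eq, h2, ipw]
    ring
  have h2 : ∑ l, u l * ∑ j, Γ l j * M.etaDiff D j =
      avg D (fun z => ∑ l, u l * ∑ j, Γ l j * ((M.ipw z - 1) * M.eta z.1 j)) := by
    simp_rw [etaDiff, avg_sum_mul]
  rw [h2, psiBar, inner_vavg, avg, avg, avg, ← mul_sub, ← Finset.sum_sub_distrib]
  simp_rw [h1]

section Linear

variable {p d K : ℕ → ℕ} {M : ∀ N, Model (p N) (d N) (K N)} {ε C c δ : ℝ} {w ℓ D : ℕ → ℝ}
  {Ω : ℕ → Type*} [∀ N, MeasurableSpace (Ω N)] {P : ∀ N, Measure (Ω N)}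
  [∀ N, IsProbabilityMeasure (P N)] {W : ∀ N, Fin N → Ω N → Record (p N) (K N)}
  {bV : ∀ N, Ω N → E (p N)} {tV tF : ∀ N, Ω N → Fin (K N) → E (d N)}

/-- `θ̂_V - θ̂_F` is uniformly close to its linear part. -/
lemma whp_diff_sub_etaDiff_le (hε : 0 < ε) (hC : 0 < C) (hδ : 0 < δ)
    (hM : ∀ N, (M N).Regular ε C c δ (ℓ N)) (hS : SlowScale w ℓ D)
    (hd : ∀ N, 0 < d N) (hK : ∀ N, 0 < K N)
    (hD : ∀ N, d N + Real.log ((d N : ℝ) * K N) ≤ D N)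
    (hE : Estimation M ℓ P W bV tV tF) :
    ∃ A : ℝ, 0 < A ∧ WHP atTop P fun N ω => ∀ j : Idx (d N) (K N),
      |tV N ω j.1 j.2 - tF N ω j.1 j.2 - (M N).etaDiff (fun i => W N i ω) j| ≤
        A * (w N ^ 2 * (ℓ N * D N) / N) := by
  have hW : ∀ N, IsSample (W N) (M N).recordLaw (P N) := fun N => ⟨hE.indep N, hE.record N⟩
  obtain ⟨A, hA, h1⟩ := theta_expansion hε hC hδ hM hW hS hd hK hD
    (fun N => (hM N).unbiasedWeight_ipw hε) (t := tV)
    (WHP.mono (l := atTop) hE.tV_solves (Eventually.of_forall fun N ω hω k => by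
      have := hω k
      rwa [SolvesThetaV, sum_valid_eq] at this)) hE.tV_consistent
  obtain ⟨A', hA', h2⟩ := theta_expansion hε hC hδ hM hW hS hd hK hD
    (fun N => (hM N).unbiasedWeight_one hε) (t := tF)
    (WHP.mono (l := atTop) hE.tF_solves (Eventually.of_forall fun N ω hω k => by
      have := hω k
      simpa [SolvesThetaF] using this)) hE.tF_consistent
  refine ⟨A + A', by positivity, (h1.and h2).mono (Eventually.of_forall fun N ω hω j => ?_)⟩
  have h3 := (PiLp.norm_apply_le _ j.2).trans (hω.1 j.1)
  have h4 := (PiLp.norm_apply_le _ j.2).trans (hω.2 j.1)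
  rw [Real.norm_eq_abs] at h3 h4
  simp only [PiLp.sub_apply] at h3 h4
  rw [etaDiff_eq]
  rw [add_mul]
  refine le_trans ?_ (add_le_add h3 h4)
  refine le_trans (le_of_eq ?_) (abs_sub _ _)
  congr 1
  ring

/-- The validation-only estimator is asymptotically linear with influence function `ψ̃₀`. -/
lemma whp_bV_linear (hε : 0 < ε) (hC : 0 < C) (hδ : 0 < δ)
    (hM : ∀ N, (M N).Regular ε C c δ (ℓ N)) (hS : SlowScale w ℓ D)
    (hD : ∀ N, (p N : ℝ) ≤ D N)
    (hE : Estimation M ℓ P W bV tV tF) (Q : ℝ) (u : ∀ N, E (p N)) (hu : ∀ N, ∑ l, |u N l| ≤ Q)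
    (s : ℝ) (hs : 0 < s) :
    WHP atTop P fun N ω => √N * |inner ℝ (u N) (bV N ω - (M N).beta0) -
      inner ℝ (u N) ((M N).psiBar (M N).ipw (fun i => W N i ω))| < s := by
  have hW : ∀ N, IsSample (W N) (M N).recordLaw (P N) := fun N => ⟨hE.indep N, hE.record N⟩
  have hun : ∀ N, ‖u N‖ ≤ |Q| + 1 := fun N => by
    have h1 := norm_le_sum_abs (u N)
    linarith [hu N, le_abs_self Q]
  obtain ⟨A, hA, h⟩ := beta_expansion hε hC hδ hM hW hS hD
    (fun N => (hM N).unbiasedWeight_ipw hε) (b := bV)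
    (WHP.mono (l := atTop) hE.bV_solves (Eventually.of_forall fun N ω hω => by
      rwa [SolvesBetaV, sum_valid_eq] at hω)) hE.bV_consistent
    (Q := |Q| + 1) (by positivity) hun
  have hlim : Tendsto (fun N => A * (w N ^ 2 * (ℓ N * D N) / √N)) atTop (𝓝 0) := by
    simpa using hS.small.const_mul A
  refine h.mono ?_
  filter_upwards [hlim.eventually_lt_const hs] with N hN ω hω
  rw [← inner_sub_right]
  refine lt_of_le_of_lt (mul_le_mul_of_nonneg_left hω (Real.sqrt_nonneg _)) ?_
  rwa [mul_left_comm, sqrt_mul_div_self]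

/-- Asymptotic normality of the validation-only estimator. -/
theorem asympNormal_bV (hε : 0 < ε) (hC : 0 < C) (hδ : 0 < δ)
    (hM : ∀ N, (M N).Regular ε C c δ (ℓ N)) (hS : SlowScale w ℓ D)
    (hD : ∀ N, (p N : ℝ) ≤ D N)
    (hE : Estimation M ℓ P W bV tV tF) :
    AsympNormal M P W bV (fun N => (M N).varTilde 0) := by
  have hW : ∀ N, IsSample (W N) (M N).recordLaw (P N) := fun N => ⟨hE.indep N, hE.record N⟩
  refine asympNormal_of_linear hε hC hM hW (Γ := fun N => 0) (B := 4 * (1 / ε * C)) (by positivity)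
    (fun N u hu => (hM N).orlicz_psiTilde_zero hε hC u hu) hE.bV_meas fun Q u hu s hs => ?_
  refine (whp_bV_linear hε hC hδ hM hS hD hE Q u hu s hs).mono
    (Eventually.of_forall fun N ω hω => ?_)
  rw [(hM N).avg_psiTilde hε]
  simpa using hω

/-- Any estimator that is equivalent to the optimal estimator is asymptotically normal with the
optimal variance. -/
theorem asympNormal_spi (hε : 0 < ε) (hC : 0 < C) (hδ : 0 < δ) (hc : 0 < c)
    (hM : ∀ N, (M N).Regular ε C c δ (ℓ N)) (hS : SlowScale w ℓ D)
    (hd : ∀ N, 0 < d N) (hK : ∀ N, 0 < K N)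
    (hD : ∀ N, d N + Real.log ((d N : ℝ) * K N) ≤ D N) (hDp : ∀ N, (p N : ℝ) ≤ D N)
    (hE : Estimation M ℓ P W bV tV tF) {b : ∀ N, Ω N → E (p N)}
    (hb : ∀ N, AEMeasurable (b N) (P N))
    (heq : ∀ s : ℝ, 0 < s → WHP atTop P fun N ω =>
      √N * ‖b N ω - spi (M N).Gamma0 (bV N ω) (tV N ω) (tF N ω)‖ < s) :
    AsympNormal M P W b (fun N => (M N).SigmaOpt) := by
  have hW : ∀ N, IsSample (W N) (M N).recordLaw (P N) := fun N => ⟨hE.indep N, hE.record N⟩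
  have hSig : (fun N => (M N).SigmaOpt) = fun N => (M N).varTilde (M N).Gamma0 :=
    funext fun N => (hM N).SigmaOpt_eq hε hC hc
  rw [hSig]
  refine asympNormal_of_linear hε hC hM hW (Γ := fun N => (M N).Gamma0) (B := 4 * (1 / ε * C))
    (by positivity)
    (fun N u hu => (hM N).orlicz_psiTilde_Gamma0 hε hC u hu) hb fun Q u hu s hs => ?_
  obtain ⟨A, hA, hv⟩ := whp_diff_sub_etaDiff_le hε hC hδ hM hS hd hK hD hE
  set Q' : ℝ := |Q| + 1 with hQ'
  have hQ'0 : 0 < Q' := by positivity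
  have hu' : ∀ N, ∑ l, |u N l| ≤ Q' := fun N => by linarith [hu N, le_abs_self Q]
  have hlim : Tendsto (fun N => (Q' * C * A) * (w N ^ 2 * (ℓ N * D N) / √N)) atTop (𝓝 0) := by
    simpa using hS.small.const_mul (Q' * C * A)
  refine (((whp_bV_linear hε hC hδ hM hS hDp hE Q u hu (s / 3) (by positivity)).and hv).and
    (heq (s / (3 * Q')) (by positivity))).mono ?_
  filter_upwards [hlim.eventually_lt_const (show 0 < s / 3 by positivity)] with N hN ω
  rintro ⟨⟨h1, h2⟩, h3⟩
  rw [(hM N).avg_psiTilde hε]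
  set D' := fun i => W N i ω with hD'
  set e := b N ω - spi (M N).Gamma0 (bV N ω) (tV N ω) (tF N ω) with he
  set v : Idx (d N) (K N) → ℝ := fun j => tV N ω j.1 j.2 - tF N ω j.1 j.2 with hvdef
  have hun : ‖u N‖ ≤ Q' := by
    have h1 := norm_le_sum_abs (u N)
    exact h1.trans (hu' N)
  have hsplit : inner ℝ (u N) (b N ω - (M N).beta0) = inner ℝ (u N) e +
      inner ℝ (u N) (bV N ω - (M N).beta0) - ∑ l, u N l * ∑ j, (M N).Gamma0 l j * v j := by
    have h4 : b N ω - (M N).beta0 = e + (bV N ω - (M N).beta0) -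
        WithLp.toLp 2 ((M N).Gamma0.mulVec v) := by
      rw [he, spi]; abel
    rw [h4, inner_sub_right, inner_add_right]
    congr 1
    simp [PiLp.inner_apply, Matrix.mulVec, dotProduct, mul_comm]
  rw [hsplit]
  set B1 := inner ℝ (u N) (bV N ω - (M N).beta0)
  set B2 := inner ℝ (u N) ((M N).psiBar (M N).ipw D')
  have hrem : |∑ l, u N l * ∑ j, (M N).Gamma0 l j * v j -
      ∑ l, u N l * ∑ j, (M N).Gamma0 l j * (M N).etaDiff D' j| ≤
      Q' * (C * (A * (w N ^ 2 * (ℓ N * D N) / N))) := by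
    have hr0 : 0 ≤ A * (w N ^ 2 * (ℓ N * D N) / N) := by
      have := hS.one_le_curv N
      have := hS.one_le_dim N
      positivity
    rw [← Finset.sum_sub_distrib]
    calc _ ≤ ∑ l, |u N l| * (C * (A * (w N ^ 2 * (ℓ N * D N) / N))) := by
          refine (Finset.abs_sum_le_sum_abs _ _).trans (Finset.sum_le_sum fun l _ => ?_)
          rw [← mul_sub, abs_mul, ← Finset.sum_sub_distrib]
          gcongr
          calc _ ≤ ∑ j, |(M N).Gamma0 l j| * (A * (w N ^ 2 * (ℓ N * D N) / N)) := by
                refine (Finset.abs_sum_le_sum_abs _ _).trans (Finset.sum_le_sum fun j _ => ?_)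
                rw [← mul_sub, abs_mul]
                gcongr
                exact h2 j
            _ ≤ _ := by
                rw [← Finset.sum_mul]
                gcongr
                exact (hM N).Gamma0_row l
      _ ≤ _ := by
          rw [← Finset.sum_mul]
          gcongr
          exact hu' N
  set S1 := ∑ l, u N l * ∑ j, (M N).Gamma0 l j * v j
  set S2 := ∑ l, u N l * ∑ j, (M N).Gamma0 l j * (M N).etaDiff D' j
  have h5 : √N * |inner ℝ (u N) e| < s / 3 := by
    calc √N * |inner ℝ (u N) e| ≤ √N * (Q' * ‖e‖) := by
          gcongr
          exact (abs_real_inner_le_norm _ _).trans (by gcongr)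
      _ = Q' * (√N * ‖e‖) := by ring
      _ < Q' * (s / (3 * Q')) := by gcongr
      _ = s / 3 := by field_simp
  have h6 : √N * |S1 - S2| < s / 3 := by
    refine lt_of_le_of_lt (mul_le_mul_of_nonneg_left hrem (Real.sqrt_nonneg _)) ?_
    refine lt_of_eq_of_lt ?_ hN
    rw [← sqrt_mul_div_self]; ring
  calc √N * |inner ℝ (u N) e + B1 - S1 - (B2 - S2)| ≤
        √N * (|inner ℝ (u N) e| + |B1 - B2| + |S1 - S2|) := by
        gcongr
        rw [show inner ℝ (u N) e + B1 - S1 - (B2 - S2) =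
          inner ℝ (u N) e + (B1 - B2) - (S1 - S2) by ring]
        exact (abs_sub _ _).trans (by gcongr; exact abs_add_le _ _)
    _ = √N * |inner ℝ (u N) e| + √N * |B1 - B2| + √N * |S1 - S2| := by ring
    _ < s / 3 + s / 3 + s / 3 := by gcongr
    _ = s := by ring

end Linear

end Model


/-! ### The weighted lasso as a penalized quadratic problem -/

section Avg

variable {α ι : Type*} {N : ℕ} (D : Fin N → α)

lemma avg_mul_left (a : ℝ) (f : α → ℝ) : avg D (fun x => a * f x) = a * avg D f := by
  simp only [avg, ← Finset.mul_sum]; ring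

lemma avg_add (f g : α → ℝ) : avg D (fun x => f x + g x) = avg D f + avg D g := by
  simp only [avg, Finset.sum_add_distrib]; ring

lemma avg_sub (f g : α → ℝ) : avg D (fun x => f x - g x) = avg D f - avg D g := by
  simp only [avg, Finset.sum_sub_distrib]; ring

lemma avg_sum (s : Finset ι) (F : ι → α → ℝ) :
    avg D (fun x => ∑ j ∈ s, F j x) = ∑ j ∈ s, avg D (F j) := by
  simpa using avg_sum_mul D s (fun _ => 1) F

lemma avg_nonneg {f : α → ℝ} (hf : ∀ x, 0 ≤ f x) : 0 ≤ avg D f :=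
  mul_nonneg (by positivity) (Finset.sum_nonneg fun _ _ => hf _)

end Avg

/-- If a separable sum is minimal then each of its terms is minimal. -/
lemma le_of_sum_le_sum {ι β : Type*} [Fintype ι] [DecidableEq ι] {F : ι → β → ℝ} {X : ι → β}
    (h : ∀ X' : ι → β, ∑ i, F i (X i) ≤ ∑ i, F i (X' i)) (i : ι) (y : β) : F i (X i) ≤ F i y := by
  have h1 := h (Function.update X i y)
  rw [← Finset.add_sum_erase _ _ (Finset.mem_univ i), ← Finset.add_sum_erase (a := i)
    (f := fun i' => F i' (Function.update X i y i')) _ (Finset.mem_univ i)] at h1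
  have h2 : ∑ x ∈ Finset.univ.erase i, F x (Function.update X i y x) =
      ∑ x ∈ Finset.univ.erase i, F x (X x) :=
    Finset.sum_congr rfl fun x hx => by rw [Function.update_of_ne (Finset.ne_of_mem_erase hx)]
  rw [h2, Function.update_self] at h1
  linarith

lemma bil_real {J : Type*} [Fintype J] (H : Matrix J J ℝ) (x y : J → ℝ) :
    bil H x y = ∑ j, ∑ k, H j k * (x j * y k) := by
  simp [bil, mul_comm]

lemma bil_euclidean {J : Type*} [Fintype J] {m : ℕ} (H : Matrix J J ℝ) (x y : J → E m) :
    bil H x y = ∑ l, bil H (fun j => x j l) (fun j => y j l) := by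
  simp only [bil, PiLp.inner_apply, Finset.mul_sum]
  rw [Finset.sum_comm' (t' := Finset.univ) (s' := fun _ => Finset.univ) (by simp)]
  rw [Finset.sum_comm]
  conv_rhs => rw [Finset.sum_comm]
  refine Finset.sum_congr rfl fun j _ => ?_
  rw [Finset.sum_comm]

namespace Model

variable {p d K : ℕ} (M : Model p d K)

/-- The weight `R (1 - ρ) / ρ²` of the regression of `ψ` on `η`. -/
noncomputable def regWeight (z : Record p K) : ℝ :=
  ind z * ((1 - M.rhoObs z.1) / M.rhoObs z.1 ^ 2)

/-- The Gram matrix of the weighted regression, normalized by the full sample size. -/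
noncomputable def gramHat {N : ℕ} (D : Fin N → Record p K) : Matrix (Idx d K) (Idx d K) ℝ :=
  fun j k => avg D fun z => M.regWeight z * (M.eta z.1 j * M.eta z.1 k)

/-- The noise of the weighted regression: the covariance of the residual with the regressors. -/
noncomputable def noiseHat {N : ℕ} (D : Fin N → Record p K) : Weight p d K :=
  fun l j => avg D fun z => M.regWeight z * (M.resid z.1 l * M.eta z.1 j)

variable {M} {N : ℕ} (D : Fin N → Record p K)

lemma gramHat_symm (j k : Idx d K) : M.gramHat D j k = M.gramHat D k j := by
  simp only [gramHat, mul_comm (M.eta _ j)]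

lemma mul_loss_eq_avg (hn : 0 < nValid D) (Γ : Weight p d K) :
    (nValid D : ℝ) / N * M.loss D Γ = avg D fun z => 1 / 2 * (M.regWeight z *
      ∑ l, (M.psi z.1 l - Γ.mulVec (M.eta z.1) l) ^ 2) := by
  have hn' : (nValid D : ℝ) ≠ 0 := by exact_mod_cast hn.ne'
  rw [loss, valid, Finset.sum_filter, avg_mul_left, avg]
  have h1 : ∀ i, (if (D i).2 = true then (1 - M.rhoObs (D i).1) / M.rhoObs (D i).1 ^ 2 *
      ∑ l, (M.psi (D i).1 l - Γ.mulVec (M.eta (D i).1) l) ^ 2 else 0) =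
      M.regWeight (D i) * ∑ l, (M.psi (D i).1 l - Γ.mulVec (M.eta (D i).1) l) ^ 2 := fun i => by
    by_cases h : (D i).2 = true <;> simp [regWeight, ind, h]
  simp_rw [h1]
  field_simp

/-- The loss, scaled to the full sample, as a quadratic function of the deviation from `Γ₀`. -/
lemma mul_loss_eq (hn : 0 < nValid D) (Γ : Weight p d K) :
    (nValid D : ℝ) / N * M.loss D Γ =
      avg D (fun z => 1 / 2 * (M.regWeight z * ∑ l, M.resid z.1 l ^ 2)) +
      ∑ l, (1 / 2 * bil (M.gramHat D) (Γ l - M.Gamma0 l) (Γ l - M.Gamma0 l) -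
        ∑ j, M.noiseHat D l j * (Γ l j - M.Gamma0 l j)) := by
  rw [mul_loss_eq_avg D hn]
  have h1 : ∀ z : Record p K, 1 / 2 * (M.regWeight z *
      ∑ l, (M.psi z.1 l - Γ.mulVec (M.eta z.1) l) ^ 2) =
      1 / 2 * (M.regWeight z * ∑ l, M.resid z.1 l ^ 2) +
      ∑ l, (1 / 2 * ∑ j, ∑ k, ((Γ l j - M.Gamma0 l j) * (Γ l k - M.Gamma0 l k)) *
          (M.regWeight z * (M.eta z.1 j * M.eta z.1 k)) -
        ∑ j, (Γ l j - M.Gamma0 l j) * (M.regWeight z * (M.resid z.1 l * M.eta z.1 j))) := by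
    intro z
    rw [Finset.mul_sum, Finset.mul_sum, Finset.mul_sum, Finset.mul_sum, ← Finset.sum_add_distrib]
    refine Finset.sum_congr rfl fun l _ => ?_
    have e1 : M.psi z.1 l - Γ.mulVec (M.eta z.1) l =
        M.resid z.1 l - ∑ j, (Γ l j - M.Gamma0 l j) * M.eta z.1 j := by
      simp only [resid, PiLp.sub_apply, Matrix.mulVec, dotProduct, sub_mul, Finset.sum_sub_distrib]
      ring
    have e2 : ∑ j, ∑ k, ((Γ l j - M.Gamma0 l j) * (Γ l k - M.Gamma0 l k)) *
          (M.regWeight z * (M.eta z.1 j * M.eta z.1 k)) =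
        M.regWeight z * (∑ j, (Γ l j - M.Gamma0 l j) * M.eta z.1 j) ^ 2 := by
      rw [sq, Finset.sum_mul_sum, Finset.mul_sum]
      refine Finset.sum_congr rfl fun j _ => ?_
      rw [Finset.mul_sum]
      exact Finset.sum_congr rfl fun k _ => by ring
    have e3 : ∑ j, (Γ l j - M.Gamma0 l j) * (M.regWeight z * (M.resid z.1 l * M.eta z.1 j)) =
        M.regWeight z * (M.resid z.1 l * ∑ j, (Γ l j - M.Gamma0 l j) * M.eta z.1 j) := by
      rw [Finset.mul_sum, Finset.mul_sum]
      exact Finset.sum_congr rfl fun k _ => by ring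
    rw [e1, e2, e3]
    ring
  simp_rw [h1]
  rw [avg_add, avg_sum]
  congr 1
  refine Finset.sum_congr rfl fun l _ => ?_
  rw [avg_sub, avg_mul_left, avg_sum, avg_sum, bil_real]
  congr 1
  · congr 1
    refine Finset.sum_congr rfl fun j _ => ?_
    rw [avg_sum]
    refine Finset.sum_congr rfl fun k _ => ?_
    rw [avg_mul_left, gramHat, mul_comm]
    rfl
  · refine Finset.sum_congr rfl fun j _ => ?_
    rw [avg_mul_left, noiseHat, mul_comm]

/-- The lasso objective separates over the rows. -/
lemma lasso_objective_eq (hn : 0 < nValid D) (lam : ℝ) (Γ : Weight p d K) :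
    (nValid D : ℝ) / N * (M.loss D Γ + lam * ∑ l, ∑ j, |Γ l j|) =
      avg D (fun z => 1 / 2 * (M.regWeight z * ∑ l, M.resid z.1 l ^ 2)) +
      ∑ l, glObj (M.gramHat D) (M.noiseHat D l) ((nValid D : ℝ) / N * lam) (M.Gamma0 l)
        (Γ l - M.Gamma0 l) := by
  rw [mul_add, mul_loss_eq D hn, add_assoc, ← mul_assoc, Finset.mul_sum, ← Finset.sum_add_distrib]
  congr 1
  refine Finset.sum_congr rfl fun l _ => ?_
  rw [glObj]
  congr 1
  · congr 1
    exact Finset.sum_congr rfl fun j _ => by simp [mul_comm]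
  · simp

/-- Column `j` of a weighting matrix. -/
def colVec (Γ : Weight p d K) (j : Idx d K) : E p := WithLp.toLp 2 fun l => Γ l j

/-- The group-lasso objective in terms of the columns. -/
lemma groupLasso_objective_eq (hn : 0 < nValid D) (lam : ℝ) (Γ : Weight p d K) :
    (nValid D : ℝ) / N * (M.loss D Γ + lam * ∑ j, √(∑ l, Γ l j ^ 2)) =
      avg D (fun z => 1 / 2 * (M.regWeight z * ∑ l, M.resid z.1 l ^ 2)) +
      glObj (M.gramHat D) (colVec (M.noiseHat D)) ((nValid D : ℝ) / N * lam) (colVec M.Gamma0)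
        (colVec (Γ - M.Gamma0)) := by
  rw [mul_add, mul_loss_eq D hn, add_assoc, ← mul_assoc, glObj, bil_euclidean]
  congr 2
  · rw [Finset.sum_sub_distrib, ← Finset.mul_sum]
    congr 1
    rw [Finset.sum_comm]
    refine Finset.sum_congr rfl fun j _ => ?_
    simp [PiLp.inner_apply, colVec, mul_comm]
  · congr 1
    refine Finset.sum_congr rfl fun j _ => ?_
    simp [EuclideanSpace.norm_eq, colVec]

lemma gramHat_psd_real {ε C c δ ℓ : ℝ} (hM : M.Regular ε C c δ ℓ)
    (x : Idx d K → ℝ) : 0 ≤ bil (M.gramHat D) x x := by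
  have h1 : bil (M.gramHat D) x x =
      avg D fun z => M.regWeight z * (∑ j, x j * M.eta z.1 j) ^ 2 := by
    rw [bil_real]
    have : ∀ z : Record p K, M.regWeight z * (∑ j, x j * M.eta z.1 j) ^ 2 =
        ∑ j, ∑ k, (x j * x k) * (M.regWeight z * (M.eta z.1 j * M.eta z.1 k)) := fun z => by
      rw [sq, Finset.sum_mul_sum, Finset.mul_sum]
      refine Finset.sum_congr rfl fun j _ => ?_
      rw [Finset.mul_sum]
      exact Finset.sum_congr rfl fun k _ => by ring
    simp_rw [this]
    rw [avg_sum]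
    refine Finset.sum_congr rfl fun j _ => ?_
    rw [avg_sum]
    refine Finset.sum_congr rfl fun k _ => ?_
    rw [avg_mul_left, gramHat, mul_comm]
  rw [h1]
  refine avg_nonneg D fun z => mul_nonneg (mul_nonneg (ind_nonneg z) ?_) (sq_nonneg _)
  exact div_nonneg (sub_nonneg.2 (hM.rho_mem z.1).2) (sq_nonneg _)

lemma gramHat_psd {ε C c δ ℓ : ℝ} (hM : M.Regular ε C c δ ℓ)
    (x : Idx d K → E p) : 0 ≤ bil (M.gramHat D) x x := by
  rw [bil_euclidean]
  exact Finset.sum_nonneg fun l _ => gramHat_psd_real D hM _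

lemma Regular.G_lower_real {ε C c δ ℓ : ℝ} (hM : M.Regular ε C c δ ℓ) (x : Idx d K → ℝ) :
    c * ∑ j, ‖x j‖ ^ 2 ≤ bil M.G x x := by
  have h := hM.G_lower x
  have h1 : bil M.G x x = x ⬝ᵥ M.G.mulVec x := by
    rw [bil_real]
    simp only [dotProduct, Matrix.mulVec, Finset.mul_sum]
    exact Finset.sum_congr rfl fun j _ => Finset.sum_congr rfl fun k _ => by ring
  rw [h1]
  simpa using h

lemma Regular.G_lower_euclidean {ε C c δ ℓ : ℝ} (hM : M.Regular ε C c δ ℓ)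
    (x : Idx d K → E p) : c * ∑ j, ‖x j‖ ^ 2 ≤ bil M.G x x := by
  rw [bil_euclidean]
  calc c * ∑ j, ‖x j‖ ^ 2 = ∑ l, c * ∑ j, ‖x j l‖ ^ 2 := by
        simp_rw [EuclideanSpace.norm_sq_eq]
        rw [← Finset.mul_sum, Finset.sum_comm]
    _ ≤ _ := Finset.sum_le_sum fun l _ => hM.G_lower_real _

/-! ### Error bounds for the estimated weighting matrix -/

/-- The bounds that the analysis of the (group) lasso gives for `(Γ - Γ₀) v`, in terms of a bound
`ζ` for the noise, a bound `τ` for the entrywise error of the Gram matrix and the sparsity `s`: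
a crude one for low dimension, the `ℓ¹` rate, and, when `G` is incoherent (`Inc`), the `ℓ²` rate,
where only the coordinates of `v` in the support matter. The numbers `ε` and `κ` are the lower
bound of the selection probability and the incoherence constant. -/
structure FitBound (M : Model p d K) (Γ : Weight p d K) (ε c κ lam ζ τ : ℝ) (s : ℕ)
    (Inc : Prop) : Prop where
  crude : 2 * τ * Fintype.card (Idx d K) ≤ c →
    ∀ (V : ℝ) (v : Idx d K → ℝ), 0 ≤ V → (∀ j, |v j| ≤ V) →
    ‖(WithLp.toLp 2 ((Γ - M.Gamma0).mulVec v) : E p)‖ ≤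
      p * (4 * Fintype.card (Idx d K) * (ζ + lam) / c) * V
  fast : 32 * τ * s ≤ c → ζ ≤ ε / 4 * lam → ∀ (V : ℝ) (v : Idx d K → ℝ), 0 ≤ V → (∀ j, |v j| ≤ V) →
    ‖(WithLp.toLp 2 ((Γ - M.Gamma0).mulVec v) : E p)‖ ≤ 24 * lam * s / c * V
  sparse : Inc → 32 * τ * s ≤ c → 192 * τ * s ≤ κ * c → ζ ≤ ε / 4 * lam → ζ ≤ κ * ε / 16 * lam →
    ∀ v : Idx d K → ℝ, ‖(WithLp.toLp 2 ((Γ - M.Gamma0).mulVec v) : E p)‖ ^ 2 ≤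
      36 * lam ^ 2 * s / c ^ 2 * ∑ j ∈ M.colSupport, v j ^ 2

lemma abs_sum_mul_le_l1 {J : Type*} [Fintype J] {x v : J → ℝ} {V : ℝ} (hv : ∀ j, |v j| ≤ V) :
    |∑ j, x j * v j| ≤ l1 x * V := by
  rw [l1, Finset.sum_mul]
  refine (Finset.abs_sum_le_sum_abs _ _).trans (Finset.sum_le_sum fun j _ => ?_)
  rw [abs_mul, Real.norm_eq_abs]
  gcongr
  exact hv j

lemma mem_rowSupport {l : Fin p} {j : Idx d K} : j ∈ M.rowSupport l ↔ M.Gamma0 l j ≠ 0 := by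
  simp [rowSupport]

lemma mem_colSupport {j : Idx d K} : j ∈ M.colSupport ↔ ∃ l, M.Gamma0 l j ≠ 0 := by
  simp [colSupport]

lemma rowSupport_subset (l : Fin p) : M.rowSupport l ⊆ M.colSupport := fun _ hj =>
  mem_colSupport.2 ⟨l, mem_rowSupport.1 hj⟩

lemma card_rowSupport_le (l : Fin p) : (M.rowSupport l).card ≤ M.numNonzero :=
  Finset.single_le_sum (f := fun l => (M.rowSupport l).card) (fun _ _ => Nat.zero_le _)
    (Finset.mem_univ l)

lemma card_colSupport_le : M.colSupport.card ≤ M.numNonzero := by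
  classical
  have h1 : M.colSupport ⊆ Finset.univ.biUnion M.rowSupport := fun j hj => by
    obtain ⟨l, hl⟩ := mem_colSupport.1 hj
    exact Finset.mem_biUnion.2 ⟨l, Finset.mem_univ l, mem_rowSupport.2 hl⟩
  exact (Finset.card_le_card h1).trans Finset.card_biUnion_le

variable {ε C c δ ℓ κ lam ζ τ : ℝ} {s : ℕ} {Γ : Weight p d K}

lemma scale_le_one : (nValid D : ℝ) / N ≤ 1 := by
  rcases Nat.eq_zero_or_pos N with rfl | hN
  · simp
  · have hN' : (0 : ℝ) < N := by exact_mod_cast hN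
    rw [div_le_one hN']
    exact_mod_cast (Finset.card_filter_le _ _).trans (by simp)

/-- The bounds for the lasso: the rows of `Γ` solve separate problems with scalar groups, and the
supports of the rows of `Γ₀` add up to at most `s`. -/
theorem Regular.fitBound_lasso (hM : M.Regular ε C c δ ℓ) (hε : 0 < ε) (hc : 0 < c) (hκ : 0 < κ)
    (hlam : 0 < lam) (hfit : M.IsLasso D lam Γ) (hs : M.numNonzero ≤ s)
    (hnN : ε / 2 ≤ (nValid D : ℝ) / N) (hτ0 : 0 ≤ τ)
    (hτ : ∀ j k, |M.gramHat D j k - M.G j k| ≤ τ) (hζ : ∀ l j, |M.noiseHat D l j| ≤ ζ) :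
    FitBound M Γ ε c κ lam ζ τ s (∀ l, Incoherent M.G (M.rowSupport l) κ) := by
  classical
  have hν0 : 0 < (nValid D : ℝ) / N := lt_of_lt_of_le (by positivity) hnN
  have hn : 0 < nValid D := by
    rcases Nat.eq_zero_or_pos (nValid D) with h | h
    · rw [h] at hν0; simp at hν0
    · exact h
  -- the loss is divided by `n`, the averages by `N`; so `λ` is effectively `ν λ`
  set ν := (nValid D : ℝ) / N with hν
  have hν1 : ν ≤ 1 := scale_le_one D
  have hlam' : 0 < ν * lam := by positivity
  have hle : ν * lam ≤ lam := mul_le_of_le_one_left hlam.le hν1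
  have hge : ε / 2 * lam ≤ ν * lam := by gcongr
  have hmin : ∀ l (D' : Idx d K → ℝ), glObj (M.gramHat D) (M.noiseHat D l) (ν * lam) (M.Gamma0 l)
      (Γ l - M.Gamma0 l) ≤ glObj (M.gramHat D) (M.noiseHat D l) (ν * lam) (M.Gamma0 l) D' := by
    refine fun l => le_of_sum_le_sum (F := fun l => glObj (M.gramHat D) (M.noiseHat D l) (ν * lam)
      (M.Gamma0 l)) (X := fun l => Γ l - M.Gamma0 l) (fun X' => ?_) l
    set Γ' : Weight p d K := fun l => X' l + M.Gamma0 l with hΓ'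
    have hX : ∀ l, Γ' l - M.Gamma0 l = X' l := fun l => by rw [hΓ']; exact add_sub_cancel_right _ _
    have h1 : M.loss D Γ + lam * ∑ l, ∑ j, |Γ l j| ≤ M.loss D Γ' + lam * ∑ l, ∑ j, |Γ' l j| :=
      hfit (Set.mem_univ Γ')
    have h2 := mul_le_mul_of_nonneg_left h1 hν0.le
    rw [hν, lasso_objective_eq D hn, lasso_objective_eq D hn] at h2
    simp_rw [hX] at h2
    linarith
  have hmv : ∀ (v : Idx d K → ℝ) l, (Γ - M.Gamma0).mulVec v l = ∑ j, (Γ l - M.Gamma0 l) j * v j :=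
    fun v l => rfl
  have hSl : ∀ l, ∀ j, j ∉ M.rowSupport l → M.Gamma0 l j = 0 := fun l j hj => by
    by_contra h; exact hj (mem_rowSupport.2 h)
  have hcard : ∀ l, ((M.rowSupport l).card : ℝ) ≤ s := fun l => by
    exact_mod_cast (card_rowSupport_le l).trans hs
  have hsum : ∑ l, ((M.rowSupport l).card : ℝ) ≤ s := by
    have : ((M.numNonzero : ℕ) : ℝ) ≤ s := by exact_mod_cast hs
    simpa [numNonzero] using this
  have hrates : 32 * τ * s ≤ c → ζ ≤ ε / 4 * lam → ∀ l,
      l1 (Γ l - M.Gamma0 l) ≤ 24 * (ν * lam) * (M.rowSupport l).card / c ∧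
      ∑ j, ‖(Γ l - M.Gamma0 l) j‖ ^ 2 ≤ 36 * (ν * lam) ^ 2 * (M.rowSupport l).card / c ^ 2 := by
    intro h1 h2 l
    exact lasso_rates hc hM.G_lower_real (gramHat_psd_real D hM) hτ hτ0 hlam'
      (fun j => (hζ l j).trans (by linarith)) (hSl l)
      (le_trans (mul_le_mul_of_nonneg_left (hcard l) (by positivity)) h1) (hmin l 0)
  refine ⟨fun h1 V v hV hv => ?_, fun h1 h2 V v hV hv => ?_, fun hInc h1 h2 h3 h4 v => ?_⟩
  · have hl := fun l => l1_le_of_isMin hc hM.G_lower_real hτ h1 hτ0 hlam'.le (hζ l) (hmin l 0)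
    refine (norm_le_sum_abs _).trans ?_
    calc ∑ l, |(Γ - M.Gamma0).mulVec v l| ≤
          ∑ l : Fin p, 4 * Fintype.card (Idx d K) * (ζ + lam) / c * V := by
          refine Finset.sum_le_sum fun l _ => ?_
          rw [hmv]
          refine (abs_sum_mul_le_l1 hv).trans ?_
          refine mul_le_mul_of_nonneg_right ((hl l).trans ?_) hV
          gcongr
      _ = _ := by simp; ring
  · refine (norm_le_sum_abs _).trans ?_
    calc ∑ l, |(Γ - M.Gamma0).mulVec v l| ≤
          ∑ l : Fin p, 24 * lam * (M.rowSupport l).card / c * V := by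
          refine Finset.sum_le_sum fun l _ => ?_
          rw [hmv]
          refine (abs_sum_mul_le_l1 hv).trans ?_
          refine mul_le_mul_of_nonneg_right (((hrates h1 h2 l).1).trans ?_) hV
          gcongr
      _ = 24 * lam * (∑ l, ((M.rowSupport l).card : ℝ)) / c * V := by
          rw [← Finset.sum_mul, ← Finset.sum_div, ← Finset.mul_sum]
      _ ≤ _ := by gcongr
  · rw [EuclideanSpace.norm_sq_eq]
    have hrow : ∀ l, ((Γ - M.Gamma0).mulVec v l) ^ 2 ≤
        36 * lam ^ 2 * (M.rowSupport l).card / c ^ 2 * ∑ j ∈ M.colSupport, v j ^ 2 := by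
      intro l
      obtain ⟨a, ha, haG⟩ := (hInc l).exists_coeff hc hM.G_lower
      have hzero := support_recovery hκ
        (fun x => le_trans (by positivity) (hM.G_lower_real x)) (G_symm M) (gramHat_symm D) hτ hlam'
        (fun j => (hζ l j).trans (by nlinarith)) (hSl l) ha haG
        (by
          calc τ * l1 (Γ l - M.Gamma0 l) ≤ τ * (24 * (ν * lam) * s / c) := by
                refine mul_le_mul_of_nonneg_left (((hrates h1 h3 l).1).trans ?_) hτ0
                have := hcard l
                gcongr
            _ = 192 * τ * s * (ν * lam) / (8 * c) := by field_simp; ring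
            _ ≤ κ * c * (ν * lam) / (8 * c) := by gcongr
            _ = _ := by field_simp) (hmin l)
      rw [hmv, ← Finset.sum_subset (Finset.subset_univ (M.rowSupport l))
        (fun j _ hj => by rw [hzero j hj, zero_mul])]
      calc (∑ j ∈ M.rowSupport l, (Γ l - M.Gamma0 l) j * v j) ^ 2 ≤
            (∑ j ∈ M.rowSupport l, (Γ l - M.Gamma0 l) j ^ 2) * ∑ j ∈ M.rowSupport l, v j ^ 2 :=
            Finset.sum_mul_sq_le_sq_mul_sq _ _ _
        _ ≤ (36 * lam ^ 2 * (M.rowSupport l).card / c ^ 2) * ∑ j ∈ M.colSupport, v j ^ 2 := by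
            have hr := (hrates h1 h3 l).2
            simp only [Real.norm_eq_abs, sq_abs] at hr
            refine mul_le_mul ?_ ?_ (Finset.sum_nonneg fun _ _ => sq_nonneg _) (by positivity)
            · refine (Finset.sum_le_univ_sum_of_nonneg fun _ => sq_nonneg _).trans (hr.trans ?_)
              gcongr
            · exact Finset.sum_le_sum_of_subset_of_nonneg (rowSupport_subset l)
                fun _ _ _ => sq_nonneg _
    calc ∑ l, ‖(Γ - M.Gamma0).mulVec v l‖ ^ 2 ≤
          ∑ l, 36 * lam ^ 2 * (M.rowSupport l).card / c ^ 2 * ∑ j ∈ M.colSupport, v j ^ 2 := by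
          refine Finset.sum_le_sum fun l _ => ?_
          rw [Real.norm_eq_abs, sq_abs]
          exact hrow l
      _ = 36 * lam ^ 2 * (∑ l, ((M.rowSupport l).card : ℝ)) / c ^ 2 *
          ∑ j ∈ M.colSupport, v j ^ 2 := by
          rw [← Finset.sum_mul, ← Finset.sum_div, ← Finset.mul_sum]
      _ ≤ _ := by gcongr

/-- The bounds for the group lasso, one problem whose groups are the columns. -/
theorem Regular.fitBound_groupLasso (hM : M.Regular ε C c δ ℓ) (hε : 0 < ε) (hc : 0 < c)
    (hκ : 0 < κ) (hp : 0 < p) (hlam : 0 < lam) (hfit : M.IsGroupLasso D lam Γ)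
    (hs : M.colSupport.card ≤ s)
    (hnN : ε / 2 ≤ (nValid D : ℝ) / N) (hτ0 : 0 ≤ τ)
    (hτ : ∀ j k, |M.gramHat D j k - M.G j k| ≤ τ)
    (hζ : ∀ j, ‖(colVec (M.noiseHat D) j : E p)‖ ≤ ζ) :
    FitBound M Γ ε c κ lam ζ τ s (Incoherent M.G M.colSupport κ) := by
  classical
  have hν0 : 0 < (nValid D : ℝ) / N := lt_of_lt_of_le (by positivity) hnN
  have hn : 0 < nValid D := by
    rcases Nat.eq_zero_or_pos (nValid D) with h | h
    · rw [h] at hν0; simp at hν0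
    · exact h
  -- the loss is divided by `n`, the averages by `N`; so `λ` is effectively `ν λ`
  set ν := (nValid D : ℝ) / N with hν
  have hν1 : ν ≤ 1 := scale_le_one D
  have hlam' : 0 < ν * lam := by positivity
  have hle : ν * lam ≤ lam := mul_le_of_le_one_left hlam.le hν1
  have hge : ε / 2 * lam ≤ ν * lam := by gcongr
  set Δ := colVec (Γ - M.Gamma0) with hΔ
  have hmin : ∀ D' : Idx d K → E p, glObj (M.gramHat D) (colVec (M.noiseHat D)) (ν * lam)
      (colVec M.Gamma0) Δ ≤
      glObj (M.gramHat D) (colVec (M.noiseHat D)) (ν * lam) (colVec M.Gamma0) D' := by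
    intro D'
    set Γ' : Weight p d K := fun l j => D' j l + M.Gamma0 l j with hΓ'
    have h1 : M.loss D Γ + lam * ∑ j, √(∑ l, Γ l j ^ 2) ≤
        M.loss D Γ' + lam * ∑ j, √(∑ l, Γ' l j ^ 2) := hfit (Set.mem_univ Γ')
    have h2 := mul_le_mul_of_nonneg_left h1 hν0.le
    rw [hν, groupLasso_objective_eq D hn, groupLasso_objective_eq D hn] at h2
    have h3 : colVec (Γ' - M.Gamma0) = D' := by
      funext j; ext l
      exact add_sub_cancel_right (D' j l) (M.Gamma0 l j)
    rw [h3] at h2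
    linarith
  have hmv : ∀ v : Idx d K → ℝ, (WithLp.toLp 2 ((Γ - M.Gamma0).mulVec v) : E p) =
      ∑ j, v j • Δ j := fun v => by
    ext l
    simp [hΔ, colVec, Matrix.mulVec, dotProduct, mul_comm]
  have hnorm : ∀ (V : ℝ) (v : Idx d K → ℝ), (∀ j, |v j| ≤ V) →
      ‖(WithLp.toLp 2 ((Γ - M.Gamma0).mulVec v) : E p)‖ ≤ l1 Δ * V := fun V v hv => by
    rw [hmv, l1, Finset.sum_mul]
    refine (norm_sum_le _ _).trans (Finset.sum_le_sum fun j _ => ?_)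
    rw [norm_smul, Real.norm_eq_abs, mul_comm]
    gcongr
    exact hv j
  have hS : ∀ j, j ∉ M.colSupport → colVec M.Gamma0 j = 0 := fun j hj => by
    ext l
    by_contra h
    exact hj (mem_colSupport.2 ⟨l, h⟩)
  have hcard : (M.colSupport.card : ℝ) ≤ s := by exact_mod_cast hs
  have hrates : 32 * τ * s ≤ c → ζ ≤ ε / 4 * lam →
      l1 Δ ≤ 24 * (ν * lam) * M.colSupport.card / c ∧
      ∑ j, ‖Δ j‖ ^ 2 ≤ 36 * (ν * lam) ^ 2 * M.colSupport.card / c ^ 2 := by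
    intro h1 h2
    exact lasso_rates hc hM.G_lower_euclidean (gramHat_psd D hM) hτ hτ0 hlam'
      (fun j => (hζ j).trans (by linarith)) hS
      (le_trans (by gcongr) h1) (hmin 0)
  refine ⟨fun h1 V v hV hv => ?_, fun h1 h2 V v hV hv => ?_, fun hInc h1 h2 h3 h4 v => ?_⟩
  · have hl := l1_le_of_isMin hc hM.G_lower_euclidean hτ h1 hτ0 hlam'.le hζ (hmin 0)
    refine (hnorm V v hv).trans ?_
    rcases isEmpty_or_nonempty (Idx d K) with h | ⟨⟨j⟩⟩
    · simp only [l1, Finset.univ_eq_empty, Finset.sum_empty, zero_mul, Fintype.card_eq_zero,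
        Nat.cast_zero, mul_zero, zero_div]
      exact le_rfl
    · have hζ0 : 0 ≤ ζ := (norm_nonneg _).trans (hζ j)
      refine mul_le_mul_of_nonneg_right (hl.trans ?_) hV
      have hp' : (1 : ℝ) ≤ p := by exact_mod_cast hp
      refine le_trans ?_ (le_mul_of_one_le_left (by positivity) hp')
      gcongr
  · refine (hnorm V v hv).trans ?_
    refine mul_le_mul_of_nonneg_right (((hrates h1 h2).1).trans ?_) hV
    gcongr
  · obtain ⟨a, ha, haG⟩ := hInc.exists_coeff hc hM.G_lower
    have hzero := support_recovery hκ
      (fun x => le_trans (by positivity) (hM.G_lower_euclidean x)) (G_symm M) (gramHat_symm D) hτ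
      hlam' (fun j => (hζ j).trans (by nlinarith)) hS ha haG
      (by
        calc τ * l1 Δ ≤ τ * (24 * (ν * lam) * s / c) := by
              refine mul_le_mul_of_nonneg_left (((hrates h1 h3).1).trans ?_) hτ0
              gcongr
          _ = 192 * τ * s * (ν * lam) / (8 * c) := by field_simp; ring
          _ ≤ κ * c * (ν * lam) / (8 * c) := by gcongr
          _ = _ := by field_simp) hmin
    rw [hmv, ← Finset.sum_subset (Finset.subset_univ M.colSupport)
      (fun j _ hj => by rw [hzero j hj, smul_zero])]
    have hr := (hrates h1 h3).2
    calc ‖∑ j ∈ M.colSupport, v j • Δ j‖ ^ 2 ≤ (∑ j ∈ M.colSupport, ‖Δ j‖ * |v j|) ^ 2 := by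
          gcongr
          refine (norm_sum_le _ _).trans (le_of_eq (Finset.sum_congr rfl fun j _ => ?_))
          rw [norm_smul, Real.norm_eq_abs, mul_comm]
      _ ≤ (∑ j ∈ M.colSupport, ‖Δ j‖ ^ 2) * ∑ j ∈ M.colSupport, |v j| ^ 2 :=
          Finset.sum_mul_sq_le_sq_mul_sq _ _ _
      _ ≤ _ := by
          simp only [sq_abs]
          refine mul_le_mul_of_nonneg_right ?_ (Finset.sum_nonneg fun _ _ => sq_nonneg _)
          refine (Finset.sum_le_univ_sum_of_nonneg fun _ => sq_nonneg _).trans (hr.trans ?_)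
          gcongr

end Model


namespace Model

/-! ### Stochastic bounds for the weighted regression -/

section Single

variable {p d K : ℕ} {M : Model p d K} {ε C c δ ℓ : ℝ}

lemma Regular.measurable_regWeight (hM : M.Regular ε C c δ ℓ) : Measurable M.regWeight := by
  have := hM.rho_meas
  unfold regWeight
  fun_prop

lemma Regular.abs_regWeight_le (hM : M.Regular ε C c δ ℓ) (hε : 0 < ε) (z : Record p K) :
    |M.regWeight z| ≤ 1 / ε ^ 2 := by
  obtain ⟨h1, h2⟩ := hM.rho_mem z.1
  have h3 := ind_nonneg z
  have h4 := ind_le_one z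
  have h5 : 0 < M.rhoObs z.1 := hε.trans_le h1
  have h6 : 0 ≤ (1 - M.rhoObs z.1) / M.rhoObs z.1 ^ 2 :=
    div_nonneg (sub_nonneg.2 h2) (sq_nonneg _)
  rw [regWeight, abs_of_nonneg (mul_nonneg h3 h6)]
  refine (mul_le_of_le_one_left h6 h4).trans ?_
  exact div_le_div₀ zero_le_one (by linarith) (by positivity) (by gcongr)

/-- The regression on the validation set, weighted by `R (1 - ρ) / ρ²`, has the population weight
`(1 - ρ) / ρ`. -/
lemma Regular.integral_regWeight_mul (hM : M.Regular ε C c δ ℓ) (hε : 0 < ε)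
    {X : Obs p K → ℝ} (hX : Integrable X M.law) :
    ∫ z : Record p K, M.regWeight z * X z.1 ∂M.recordLaw =
      ∫ w, (1 - M.rhoObs w) / M.rhoObs w * X w ∂M.law := by
  have hρ := hM.rho_meas
  have h1 : Integrable (fun w : Obs p K => M.regWeight (w, true) * X w) M.law :=
    hX.bdd_mul (c := 1 / ε ^ 2)
      (hM.measurable_regWeight.comp (measurable_id.prodMk measurable_const)).aestronglyMeasurable
      (ae_of_all _ fun w => by rw [Real.norm_eq_abs]; exact hM.abs_regWeight_le hε _)
  rw [(hM.recordLaw_integral hε (F := fun z => M.regWeight z * X z.1) h1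
    (by simp [regWeight])).2]
  refine integral_congr_ae (ae_of_all _ fun w => ?_)
  have h2 : M.rhoObs w ≠ 0 := (hε.trans_le (hM.rho_mem w).1).ne'
  simp only [regWeight, ind_true, ind_false]
  field_simp
  ring

lemma Regular.orlicz_regWeight (hM : M.Regular ε C c δ ℓ) (hε : 0 < ε) (hC : 0 < C)
    {X Y : Obs p K → ℝ} (hX : OrliczLE 2 X C M.law) (hY : OrliczLE 2 Y C M.law) :
    OrliczLE 1 (fun z : Record p K => M.regWeight z * (X z.1 * Y z.1)) (1 / ε ^ 2 * C ^ 2)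
      M.recordLaw :=
  hM.orlicz_mul hε (hX.mul hY) (by positivity) (by positivity) hM.measurable_regWeight
    (hM.abs_regWeight_le hε)

/-- The population normal equation: the residual is uncorrelated with `η`. -/
lemma Regular.integral_resid_direction (hM : M.Regular ε C c δ ℓ) (hε : 0 < ε) (hC : 0 < C)
    (hc : 0 < c) (u : E p) (j : Idx d K) :
    ∫ w, (1 - M.rhoObs w) / M.rhoObs w * (inner ℝ u (M.resid w) * M.eta w j) ∂M.law = 0 := by
  have h1 : ∀ l, Integrable (fun w => u l *
      ((1 - M.rhoObs w) / M.rhoObs w * (M.resid w l * M.eta w j))) M.law := fun l =>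
    (hM.integrable_weight_mul hε
      (OrliczLE.integrable_mul hC (hM.resid_coord l) (hM.eta_coord j))).const_mul _
  calc _ = ∫ w, ∑ l, u l * ((1 - M.rhoObs w) / M.rhoObs w * (M.resid w l * M.eta w j)) ∂M.law := by
        refine integral_congr_ae (ae_of_all _ fun w => ?_)
        simp only [PiLp.inner_apply, RCLike.inner_apply, conj_trivial]
        rw [Finset.sum_mul, Finset.mul_sum]
        exact Finset.sum_congr rfl fun l _ => by ring
    _ = 0 := by
        rw [integral_finsetSum _ fun l _ => h1 l]
        refine Finset.sum_eq_zero fun l _ => ?_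
        rw [integral_const_mul, hM.integral_resid_eta hε hC hc, mul_zero]

lemma Regular.orlicz_etaDiff (hM : M.Regular ε C c δ ℓ) (hε : 0 < ε) (hC : 0 < C) (j : Idx d K) :
    OrliczLE 1 (fun z : Record p K => (M.ipw z - 1) * M.eta z.1 j) (2 * (1 / ε * C))
      M.recordLaw := by
  have := hM.isProbabilityMeasure_recordLaw hε
  have h1e : 1 ≤ 1 / ε := by rw [le_div_iff₀ hε, one_mul]; exact hM.eps_le_one
  refine (hM.orlicz_mul hε (hM.eta_coord j) hC (b := 1 / ε) (by positivity)
    (g := fun z => M.ipw z - 1) ((hM.unbiasedWeight_ipw hε).meas.sub_const 1)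
    (fun z => ?_)).one_of_two (by positivity)
  have h3 := (hM.unbiasedWeight_ipw hε).nonneg z
  have h4 := (hM.unbiasedWeight_ipw hε).le z
  rw [abs_le]; constructor <;> linarith

lemma Regular.integral_etaDiff (hM : M.Regular ε C c δ ℓ) (hε : 0 < ε) (hC : 0 < C)
    (j : Idx d K) : ∫ z : Record p K, (M.ipw z - 1) * M.eta z.1 j ∂M.recordLaw = 0 := by
  have := hM.isProbabilityMeasure_recordLaw hε
  have := hM.law_prob
  have h1 : OrliczLE 1 (fun w => M.eta w j) (2 * C) M.law := (hM.eta_coord j).one_of_two hC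
  have hi : Integrable (fun w => M.eta w j) M.law := h1.integrable (by positivity)
  have h2 := (hM.orlicz_weighted hε (hM.unbiasedWeight_ipw hε) h1 (by positivity)).integrable
    (by positivity)
  have h3 := (hM.orlicz_weighted hε (hM.unbiasedWeight_one hε) h1 (by positivity)).integrable
    (by positivity)
  have h4 : ∀ z : Record p K, (M.ipw z - 1) * M.eta z.1 j =
      M.ipw z * M.eta z.1 j - 1 * M.eta z.1 j := fun z => by ring
  simp_rw [h4]
  rw [integral_sub h2 h3, (hM.unbiasedWeight_ipw hε).unbiased _ hi,
    (hM.unbiasedWeight_one hε).unbiased _ hi, sub_self]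

end Single

section Sequence

variable {p d K : ℕ → ℕ} {M : ∀ N, Model (p N) (d N) (K N)} {ε C c δ : ℝ} {ℓ x : ℕ → ℝ}
  {Ω : ℕ → Type*} [∀ N, MeasurableSpace (Ω N)] {P : ∀ N, Measure (Ω N)}
  [∀ N, IsProbabilityMeasure (P N)] {W : ∀ N, Fin N → Ω N → Record (p N) (K N)} {l : Filter ℕ}

lemma card_idx_le_exp {d K : ℕ} {x : ℝ} (hx : Real.log ((d : ℝ) * K) ≤ x) (hd : 0 < d)
    (hK : 0 < K) : ((Finset.univ : Finset (Idx d K)).card : ℝ) ≤ Real.exp x := by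
  have h0 : (0 : ℝ) < (d : ℝ) * K := by positivity
  rw [Finset.card_univ, Fintype.card_prod, Fintype.card_fin, Fintype.card_fin]
  push_cast
  rw [mul_comm, ← Real.log_le_iff_le_exp h0]
  exact hx

lemma whp_gramHat (hε : 0 < ε) (hC : 0 < C) (hM : ∀ N, (M N).Regular ε C c δ (ℓ N))
    (hW : ∀ N, IsSample (W N) (M N).recordLaw (P N)) (hd : ∀ N, 0 < d N) (hK : ∀ N, 0 < K N)
    (hl : l ≤ atTop) (hx : Tendsto x l atTop) (hxN : Tendsto (fun N => x N / N) l (𝓝 0))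
    (hlog : ∀ᶠ N in l, Real.log ((d N : ℝ) * K N) ≤ x N) :
    WHP l P fun N ω => ∀ j k, |(M N).gramHat (fun i => W N i ω) j k - (M N).G j k| ≤
      16 * (1 / ε ^ 2 * C ^ 2) * √(x N / N) := by
  have := fun N => (hM N).isProbabilityMeasure_recordLaw hε
  refine (WHP.bernstein hW hl (M := 1 / ε ^ 2 * C ^ 2) (b := 3)
    (A := 16 * (1 / ε ^ 2 * C ^ 2)) (by positivity) (by positivity)
    (by nlinarith [sq_nonneg (1 / ε ^ 2 * C ^ 2)]) hx hxN
    (fun N => (Finset.univ : Finset (Idx (d N) (K N))) ×ˢ (Finset.univ : Finset (Idx (d N) (K N))))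
    (F := fun N a z => (M N).regWeight z * ((M N).eta z.1 a.1 * (M N).eta z.1 a.2))
    (fun N a _ => (hM N).orlicz_regWeight hε hC ((hM N).eta_coord a.1) ((hM N).eta_coord a.2))
    ?_).mono (Eventually.of_forall fun N ω hω j k => ?_)
  · filter_upwards [hlog, hx.eventually_ge_atTop 0] with N hN hx0
    have h := card_idx_le_exp hN (hd N) (hK N)
    rw [Finset.card_product]
    push_cast
    calc _ ≤ Real.exp (x N) * Real.exp (x N) := by gcongr
      _ = Real.exp (x N + x N) := (Real.exp_add _ _).symm
      _ ≤ _ := Real.exp_le_exp.2 (by linarith)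
  · have h := hω (j, k) (by simp)
    have hi : Integrable (fun w => (M N).eta w j * (M N).eta w k) (M N).law :=
      OrliczLE.integrable_mul hC ((hM N).eta_coord j) ((hM N).eta_coord k)
    rw [(hM N).integral_regWeight_mul hε (X := fun w => (M N).eta w j * (M N).eta w k) hi] at h
    exact h.le

lemma whp_noiseHat_entry (hε : 0 < ε) (hC : 0 < C) (hc : 0 < c)
    (hM : ∀ N, (M N).Regular ε C c δ (ℓ N))
    (hW : ∀ N, IsSample (W N) (M N).recordLaw (P N)) (hp : ∀ N, 0 < p N) (hd : ∀ N, 0 < d N)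
    (hK : ∀ N, 0 < K N)
    (hl : l ≤ atTop) (hx : Tendsto x l atTop) (hxN : Tendsto (fun N => x N / N) l (𝓝 0))
    (hlog : ∀ᶠ N in l, Real.log ((p N : ℝ) * (d N * K N)) ≤ x N) :
    WHP l P fun N ω => ∀ i j, |(M N).noiseHat (fun i => W N i ω) i j| ≤
      32 * (1 / ε ^ 2 * C ^ 2) * √(x N / N) := by
  have := fun N => (hM N).isProbabilityMeasure_recordLaw hε
  refine (WHP.bernstein hW hl (M := 1 / ε ^ 2 * C ^ 2) (b := 3)
    (A := 16 * (1 / ε ^ 2 * C ^ 2)) (by positivity) (by positivity)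
    (by nlinarith [sq_nonneg (1 / ε ^ 2 * C ^ 2)]) hx hxN
    (fun N => (Finset.univ : Finset (Fin (p N) × Idx (d N) (K N))))
    (F := fun N a z => (M N).regWeight z * ((M N).resid z.1 a.1 * (M N).eta z.1 a.2))
    (fun N a _ => (hM N).orlicz_regWeight hε hC ((hM N).resid_coord a.1) ((hM N).eta_coord a.2))
    ?_).mono (Eventually.of_forall fun N ω hω i j => ?_)
  · filter_upwards [hlog, hx.eventually_ge_atTop 0] with N hN hx0
    have h1 := hp N
    have h2 := hd N
    have h3 := hK N
    have h0 : (0 : ℝ) < (p N : ℝ) * (d N * K N) := by positivity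
    rw [Real.log_le_iff_le_exp h0] at hN
    have h4 : Real.exp (x N) ≤ Real.exp (3 * x N) := Real.exp_le_exp.2 (by linarith)
    refine le_trans (le_of_eq ?_) (hN.trans h4)
    rw [Finset.card_univ, Fintype.card_prod, Fintype.card_prod, Fintype.card_fin, Fintype.card_fin,
      Fintype.card_fin]
    push_cast; ring
  · have h := hω (i, j) (by simp)
    have hi : Integrable (fun w => (M N).resid w i * (M N).eta w j) (M N).law :=
      OrliczLE.integrable_mul hC ((hM N).resid_coord i) ((hM N).eta_coord j)
    rw [(hM N).integral_regWeight_mul hε (X := fun w => (M N).resid w i * (M N).eta w j) hi,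
      (hM N).integral_resid_eta hε hC hc, sub_zero] at h
    refine h.le.trans ?_
    gcongr
    norm_num

/-- The noise in the group norm, by a net of the unit sphere of `ℝ^p` with at most `5 ^ p` points;
hence the scale `p ∨ log q`. -/
lemma whp_noiseHat_col (hε : 0 < ε) (hC : 0 < C) (hc : 0 < c)
    (hM : ∀ N, (M N).Regular ε C c δ (ℓ N))
    (hW : ∀ N, IsSample (W N) (M N).recordLaw (P N)) (hd : ∀ N, 0 < d N)
    (hK : ∀ N, 0 < K N)
    (hl : l ≤ atTop) (hx : Tendsto x l atTop) (hxN : Tendsto (fun N => x N / N) l (𝓝 0))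
    (hlog : ∀ᶠ N in l, max (p N : ℝ) (Real.log ((d N : ℝ) * K N)) ≤ x N) :
    WHP l P fun N ω => ∀ j, ‖(colVec ((M N).noiseHat (fun i => W N i ω)) j : E (p N))‖ ≤
      32 * (1 / ε ^ 2 * C ^ 2) * √(x N / N) := by
  have := fun N => (hM N).isProbabilityMeasure_recordLaw hε
  refine (WHP.bernstein hW hl (M := 1 / ε ^ 2 * C ^ 2) (b := 3)
    (A := 16 * (1 / ε ^ 2 * C ^ 2)) (by positivity) (by positivity)
    (by nlinarith [sq_nonneg (1 / ε ^ 2 * C ^ 2)]) hx hxN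
    (fun N => sphereNet (p N) ×ˢ (Finset.univ : Finset (Idx (d N) (K N))))
    (F := fun N a z => (M N).regWeight z * (inner ℝ a.1 ((M N).resid z.1) * (M N).eta z.1 a.2))
    (fun N a ha => (hM N).orlicz_regWeight hε hC (X := fun w => inner ℝ a.1 ((M N).resid w))
      ((hM N).resid_tail a.1 (norm_of_mem_sphereNet (Finset.mem_product.1 ha).1))
      ((hM N).eta_coord a.2))
    ?_).mono (Eventually.of_forall fun N ω hω j => ?_)
  · filter_upwards [hlog, hx.eventually_ge_atTop 0] with N hN hx0
    have h := card_idx_le_exp ((le_max_right _ _).trans hN) (hd N) (hK N)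
    have h1 : ((sphereNet (p N)).card : ℝ) ≤ 5 ^ p N := by exact_mod_cast card_sphereNet_le _
    have h5 := five_le_exp_two
    have h2 : (5 : ℝ) ^ p N ≤ Real.exp (2 * x N) := by
      calc (5 : ℝ) ^ p N ≤ Real.exp 2 ^ p N := by gcongr
        _ = Real.exp (2 * p N) := by rw [← Real.exp_nat_mul]; ring_nf
        _ ≤ _ := Real.exp_le_exp.2 (by linarith [(le_max_left _ _).trans hN])
    rw [Finset.card_product]
    push_cast
    calc _ ≤ Real.exp (2 * x N) * Real.exp (x N) := by gcongr; exact h1.trans h2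
      _ = Real.exp (2 * x N + x N) := (Real.exp_add _ _).symm
      _ ≤ _ := Real.exp_le_exp.2 (by linarith)
  · refine (norm_le_of_sphereNet (t := 16 * (1 / ε ^ 2 * C ^ 2) * √(x N / N)) (by positivity)
      fun u hu => ?_).trans (le_of_eq (by ring))
    have h := hω (u, j) (by simp [hu])
    have hi : Integrable (fun w => inner ℝ u ((M N).resid w) * (M N).eta w j) (M N).law :=
      OrliczLE.integrable_mul hC ((hM N).resid_tail u (norm_of_mem_sphereNet hu))
        ((hM N).eta_coord j)
    rw [(hM N).integral_regWeight_mul hε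
      (X := fun w => inner ℝ u ((M N).resid w) * (M N).eta w j) hi,
      (hM N).integral_resid_direction hε hC hc, sub_zero] at h
    refine le_trans (le_of_eq ?_) ((le_abs_self _).trans h.le)
    have e : ∀ z : Record (p N) (K N),
        (M N).regWeight z * (inner ℝ u ((M N).resid z.1) * (M N).eta z.1 j) =
        ∑ i, u i * ((M N).regWeight z * ((M N).resid z.1 i * (M N).eta z.1 j)) := fun z => by
      simp only [PiLp.inner_apply, RCLike.inner_apply, conj_trivial]
      rw [Finset.sum_mul, Finset.mul_sum]
      exact Finset.sum_congr rfl fun i _ => by ring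
    simp_rw [e]
    rw [avg_sum_mul]
    simp only [PiLp.inner_apply, RCLike.inner_apply, conj_trivial, colVec, noiseHat]
    exact Finset.sum_congr rfl fun i _ => mul_comm _ _

/-- In the maximum norm the linear part of `θ̂_V - θ̂_F` is of order `√(log q / N)`, or larger by a
slowly diverging factor. -/
lemma whp_etaDiff_le (hε : 0 < ε) (hC : 0 < C) (hM : ∀ N, (M N).Regular ε C c δ (ℓ N))
    (hW : ∀ N, IsSample (W N) (M N).recordLaw (P N)) (hd : ∀ N, 0 < d N) (hK : ∀ N, 0 < K N)
    (hl : l ≤ atTop) (hx : Tendsto x l atTop) (hxN : Tendsto (fun N => x N / N) l (𝓝 0))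
    (hlog : ∀ᶠ N in l, Real.log ((d N : ℝ) * K N) ≤ x N) :
    WHP l P fun N ω => ∀ j, |(M N).etaDiff (fun i => W N i ω) j| ≤
      32 * (1 / ε * C) * √(x N / N) := by
  have := fun N => (hM N).isProbabilityMeasure_recordLaw hε
  refine (WHP.bernstein hW hl (M := 2 * (1 / ε * C)) (b := 3)
    (A := 16 * (2 * (1 / ε * C))) (by positivity) (by positivity)
    (by nlinarith [sq_nonneg (2 * (1 / ε * C))]) hx hxN
    (fun N => (Finset.univ : Finset (Idx (d N) (K N))))
    (F := fun N j z => ((M N).ipw z - 1) * (M N).eta z.1 j)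
    (fun N j _ => (hM N).orlicz_etaDiff hε hC j)
    ?_).mono (Eventually.of_forall fun N ω hω j => ?_)
  · filter_upwards [hlog, hx.eventually_ge_atTop 0] with N hN hx0
    exact (card_idx_le_exp hN (hd N) (hK N)).trans (Real.exp_le_exp.2 (by linarith))
  · have h := hω j (by simp)
    rw [(hM N).integral_etaDiff hε hC, sub_zero] at h
    exact h.le.trans (le_of_eq (by ring))

/-- On a given small set of coordinates, the linear part of `θ̂_V - θ̂_F` is of order `√(s / N)` in
the Euclidean norm, without a logarithmic factor. -/
lemma whp_sum_etaDiff_sq_lt (hε : 0 < ε) (hC : 0 < C) (hM : ∀ N, (M N).Regular ε C c δ (ℓ N))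
    (hW : ∀ N, IsSample (W N) (M N).recordLaw (P N)) (hl : l ≤ atTop) (hx : Tendsto x l atTop)
    (S : ∀ N, Finset (Idx (d N) (K N))) {s : ℕ → ℕ} (hs : ∀ N, (S N).card ≤ s N) :
    WHP l P fun N ω => ∑ j ∈ S N, (M N).etaDiff (fun i => W N i ω) j ^ 2 <
      x N * (s N + 1) / N := by
  have := fun N => (hM N).isProbabilityMeasure_recordLaw hε
  have hm : ∀ N j, AEMeasurable (fun ω => (M N).etaDiff (fun i => W N i ω) j ^ 2) (P N) :=
    fun N j => by
      unfold etaDiff avg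
      exact ((Finset.aemeasurable_fun_sum _ fun i _ =>
        (hW N).aemeasurable_comp ((hM N).orlicz_etaDiff hε hC j).1 i).const_mul _).pow_const 2
  set B : ℝ := 4 * (2 * (1 / ε * C)) ^ 2 with hB
  have hB0 : 0 < B := by positivity
  have hN0 : ∀ᶠ N : ℕ in l, 0 < N := hl (eventually_gt_atTop 0)
  have hx0 : ∀ᶠ N in l, 0 < x N := hx.eventually_gt_atTop 0
  refine WHP.markov (b := fun N => (s N + 1) * (B / N))
    (fun N => Finset.aemeasurable_fun_sum _ fun j _ => hm N j) ?_ ?_ ?_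
  · filter_upwards [hN0] with N hN
    have hN' : (0 : ℝ) < N := by exact_mod_cast hN
    simp_rw [ENNReal.ofReal_sum_of_nonneg fun _ _ => sq_nonneg _]
    rw [lintegral_finsetSum' _ fun j _ => (hm N j).ennreal_ofReal]
    calc _ ≤ ∑ j ∈ S N, ENNReal.ofReal (B / N) := by
          refine Finset.sum_le_sum fun j _ => ?_
          have ho := (hM N).orlicz_etaDiff hε hC j
          have h1 := (hW N).integral_sq_avg_le (ho.memLp_two (by positivity)) hN
          rw [(hM N).integral_etaDiff hε hC] at h1
          simp only [sub_zero] at h1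
          refine h1.trans (ENNReal.ofReal_le_ofReal ?_)
          rw [one_div, inv_mul_eq_div]
          gcongr
          exact ho.integral_sq_le (by positivity)
      _ ≤ _ := by
          rw [Finset.sum_const, nsmul_eq_mul, ← ENNReal.ofReal_natCast,
            ← ENNReal.ofReal_mul (by positivity)]
          refine ENNReal.ofReal_le_ofReal ?_
          have : ((S N).card : ℝ) ≤ s N := by exact_mod_cast hs N
          gcongr
          linarith
  · filter_upwards [hN0, hx0] with N hN hxN
    have hN' : (0 : ℝ) < N := by exact_mod_cast hN
    positivity
  · have h1 : Tendsto (fun N => B * (x N)⁻¹) l (𝓝 0) := by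
      simpa using hx.inv_tendsto_atTop.const_mul B
    refine h1.congr' ?_
    filter_upwards [hN0, hx0] with N hN hxN
    have hN' : (0 : ℝ) < N := by exact_mod_cast hN
    field_simp

end Sequence

end Model


namespace Model

/-! ### The estimated weighting matrix is as good as the optimal one -/

section Gap

variable {p d K : ℕ → ℕ} {M : ∀ N, Model (p N) (d N) (K N)} {ε C c δ κ : ℝ}
  {w ℓ D b lam : ℕ → ℝ} {s : ℕ → ℕ}
  {Ω : ℕ → Type*} [∀ N, MeasurableSpace (Ω N)] {P : ∀ N, Measure (Ω N)}
  [∀ N, IsProbabilityMeasure (P N)] {W : ∀ N, Fin N → Ω N → Record (p N) (K N)}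
  {bV : ∀ N, Ω N → E (p N)} {tV tF : ∀ N, Ω N → Fin (K N) → E (d N)}
  {Γs : ∀ N, Ω N → Weight (p N) (d N) (K N)}

omit [∀ N, IsProbabilityMeasure (P N)] in
/-- The gap in low dimension, where the dimensions are at most `exp (x N)` with `x → ∞` so slow
that `exp (4 x) = o(√N)`. -/
lemma whp_gap_of_crude {l : Filter ℕ} (hl : l ≤ atTop) (hc : 0 < c) {x ρ : ℕ → ℝ}
    (hx0 : ∀ N, 0 ≤ x N) (hx : Tendsto (fun N => Real.exp (4 * x N) / √N) atTop (𝓝 0))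
    (hp : ∀ᶠ N in l, (p N : ℝ) ≤ Real.exp (x N))
    (hq : ∀ᶠ N in l, (Fintype.card (Idx (d N) (K N)) : ℝ) ≤ Real.exp (x N))
    (hρ0 : ∀ N, 0 ≤ ρ N) (hρ : ∀ᶠ N in l, ρ N ≤ 1)
    {Az Aτ Av A A1 : ℝ} (hAz : 0 ≤ Az) (hAτ : 0 ≤ Aτ) (hAv : 0 ≤ Av) (hA : 0 ≤ A) (hA1 : 0 ≤ A1)
    (hlam0 : ∀ N, 0 < lam N) (hlam : ∀ᶠ N in l, lam N ≤ A1 * √((1 + x N) / N))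
    {Inc : ℕ → Prop} {v : ∀ N, Ω N → Idx (d N) (K N) → ℝ}
    (hfit : WHP l P fun N ω => FitBound (M N) (Γs N ω) ε c κ (lam N) (Az * √(x N / N))
      (Aτ * √(x N / N)) (s N) (Inc N))
    (hv : WHP l P fun N ω => ∀ j, |v N ω j| ≤ Av * √(x N / N) + A * (ρ N / √N))
    {t : ℝ} (ht : 0 < t) :
    WHP l P fun N ω =>
      √N * ‖(WithLp.toLp 2 ((Γs N ω - (M N).Gamma0).mulVec (v N ω)) : E (p N))‖ < t := by
  have h1 : ∀ᶠ N in l, 2 * Aτ * (Real.exp (4 * x N) / √N) < c := hl <| by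
    have : Tendsto (fun N => 2 * Aτ * (Real.exp (4 * x N) / √N)) atTop (𝓝 0) := by
      simpa using hx.const_mul (2 * Aτ)
    exact this.eventually_lt_const hc
  have h2 : ∀ᶠ N in l, 4 / c * ((Az + A1) * (Av + A)) * (Real.exp (4 * x N) / √N) < t := hl <| by
    have : Tendsto (fun N => 4 / c * ((Az + A1) * (Av + A)) * (Real.exp (4 * x N) / √N)) atTop
        (𝓝 0) := by
      simpa using hx.const_mul (4 / c * ((Az + A1) * (Av + A)))
    exact this.eventually_lt_const ht
  refine (hfit.and hv).mono ?_
  filter_upwards [h1, h2, hp, hq, hρ, hlam, hl (eventually_gt_atTop 0)]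
    with N h1 h2 hp hq hρ hlam hN ω
  rintro ⟨hf, hv⟩
  have hN' : (0 : ℝ) < N := by exact_mod_cast hN
  have hn : 0 < √(N : ℝ) := Real.sqrt_pos.2 hN'
  have hx0 := hx0 N
  have hρ0 := hρ0 N
  set e := Real.exp (x N) with he
  have he4 : Real.exp (4 * x N) = e ^ 4 := by rw [he, ← Real.exp_nat_mul]; norm_num
  have hxe : 1 + x N ≤ e := by rw [add_comm]; exact Real.add_one_le_exp _
  have he1 : 1 ≤ e := by linarith
  have hsq : ∀ y : ℝ, 0 ≤ y → y ≤ e → √(y / N) ≤ e / √N := fun y hy hye => by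
    rw [Real.sqrt_div hy]
    gcongr
    rw [Real.sqrt_le_left (by positivity)]; nlinarith
  have hζ : Az * √(x N / N) ≤ Az * (e / √N) := by
    gcongr; exact hsq _ hx0 (by linarith)
  have hlam' : lam N ≤ A1 * (e / √N) := hlam.trans (by
    gcongr; exact hsq _ (by linarith) hxe)
  have hVle : Av * √(x N / N) + A * (ρ N / √N) ≤ (Av + A) * (e / √N) := by
    rw [add_mul]
    gcongr
    · exact hsq _ hx0 (by linarith)
    · linarith
  have hcond : 2 * (Aτ * √(x N / N)) * Fintype.card (Idx (d N) (K N)) ≤ c := by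
    calc _ ≤ 2 * (Aτ * (e / √N)) * e := by gcongr; exact hsq _ hx0 (by linarith)
      _ = 2 * Aτ * (e ^ 2 / √N) := by ring
      _ ≤ 2 * Aτ * (e ^ 4 / √N) := by gcongr; norm_num
      _ ≤ c := by rw [← he4]; exact h1.le
  have hb := hf.crude hcond _ (v N ω) (by positivity) (fun j => (hv j).trans hVle)
  have hlam00 := (hlam0 N).le
  calc _ ≤ √N * (p N * (4 * Fintype.card (Idx (d N) (K N)) * (Az * √(x N / N) + lam N) / c) *
        ((Av + A) * (e / √N))) := by gcongr
    _ ≤ √N * (e * (4 * e * (Az * (e / √N) + A1 * (e / √N)) / c) * ((Av + A) * (e / √N))) := by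
        gcongr
    _ = 4 / c * ((Az + A1) * (Av + A)) * (e ^ 4 / √N) * (√N / √N) := by ring
    _ < t := by rw [div_self hn.ne', mul_one, ← he4]; exact h2

omit [∀ N, IsProbabilityMeasure (P N)] in
/-- The gap from the `ℓ¹` rate of the (group) lasso and the maximum of `θ̂_V - θ̂_F`. -/
lemma whp_gap_of_fast {l : Filter ℕ} (hl : l ≤ atTop) (hc : 0 < c) {x ρ : ℕ → ℝ}
    (hx0 : ∀ᶠ N in l, 0 ≤ x N) (hb1 : ∀ᶠ N in l, 1 ≤ b N)
    (hsb : Tendsto (fun N => (s N : ℝ) ^ 2 * b N / N) l (𝓝 0))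
    (hsx : Tendsto (fun N => (s N : ℝ) ^ 2 * b N * x N / N) l (𝓝 0))
    (hρ0 : ∀ N, 0 ≤ ρ N) (hρ : ∀ᶠ N in l, ρ N ≤ 1)
    {Az Aτ Av A A1 : ℝ} (hAv : 0 ≤ Av) (hA : 0 ≤ A) (hA1 : 0 ≤ A1)
    (hlam : ∀ᶠ N in l, lam N ≤ A1 * √((1 + b N) / N))
    (hζ : ∀ᶠ N in l, Az * √(b N / N) ≤ ε / 4 * lam N)
    {Inc : ℕ → Prop} {v : ∀ N, Ω N → Idx (d N) (K N) → ℝ}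
    (hfit : WHP l P fun N ω => FitBound (M N) (Γs N ω) ε c κ (lam N) (Az * √(b N / N))
      (Aτ * √(b N / N)) (s N) (Inc N))
    (hv : WHP l P fun N ω => ∀ j, |v N ω j| ≤ Av * √(x N / N) + A * (ρ N / √N))
    {t : ℝ} (ht : 0 < t) :
    WHP l P fun N ω =>
      √N * ‖(WithLp.toLp 2 ((Γs N ω - (M N).Gamma0).mulVec (v N ω)) : E (p N))‖ < t := by
  have h1 : ∀ᶠ N in l, 32 * Aτ * √((s N : ℝ) ^ 2 * b N / N) < c := by
    have : Tendsto (fun N => 32 * Aτ * √((s N : ℝ) ^ 2 * b N / N)) l (𝓝 0) := by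
      simpa using hsb.sqrt.const_mul (32 * Aτ)
    exact this.eventually_lt_const hc
  have h2 : ∀ᶠ N in l, 48 * A1 / c * (Av * √((s N : ℝ) ^ 2 * b N * x N / N) +
      A * √((s N : ℝ) ^ 2 * b N / N)) < t := by
    have : Tendsto (fun N => 48 * A1 / c * (Av * √((s N : ℝ) ^ 2 * b N * x N / N) +
        A * √((s N : ℝ) ^ 2 * b N / N))) l (𝓝 0) := by
      simpa using ((hsx.sqrt.const_mul Av).add (hsb.sqrt.const_mul A)).const_mul (48 * A1 / c)
    exact this.eventually_lt_const ht
  refine (hfit.and hv).mono ?_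
  filter_upwards [h1, h2, hx0, hb1, hρ, hlam, hζ, hl (eventually_gt_atTop 0)]
    with N h1 h2 hx0 hb1 hρ hlam hζ hN ω
  rintro ⟨hf, hv⟩
  have hN' : (0 : ℝ) < N := by exact_mod_cast hN
  have hn : 0 < √(N : ℝ) := Real.sqrt_pos.2 hN'
  have hρ0 := hρ0 N
  have hs0 : (0 : ℝ) ≤ s N := Nat.cast_nonneg _
  have hb0 : 0 ≤ b N := by linarith
  have hlam' : lam N ≤ A1 * (2 * (√(b N) / √N)) := hlam.trans (by
    gcongr
    rw [Real.sqrt_div (by linarith), mul_div_assoc', show (2 : ℝ) = √4 by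
      rw [show (4 : ℝ) = 2 ^ 2 by norm_num]; simp, ← Real.sqrt_mul (by norm_num)]
    gcongr
    linarith)
  have e1 : √((s N : ℝ) ^ 2 * b N / N) = s N * (√(b N) / √N) := by
    rw [Real.sqrt_div (by positivity), Real.sqrt_mul (by positivity), Real.sqrt_sq hs0,
      mul_div_assoc]
  have e2 : √((s N : ℝ) ^ 2 * b N * x N / N) = s N * (√(b N) / √N) * √(x N) := by
    rw [Real.sqrt_div (by positivity), Real.sqrt_mul (by positivity), Real.sqrt_mul (by positivity),
      Real.sqrt_sq hs0]
    ring
  have hcond : 32 * (Aτ * √(b N / N)) * s N ≤ c := by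
    refine le_trans (le_of_eq ?_) h1.le
    rw [e1, Real.sqrt_div hb0]; ring
  have hV : ∀ j, |v N ω j| ≤ (Av * √(x N) + A) / √N := fun j => (hv j).trans (by
    rw [Real.sqrt_div hx0, add_div, mul_div_assoc, mul_div_assoc' A]
    gcongr
    exact mul_le_of_le_one_right hA hρ)
  have hb := hf.fast hcond hζ _ (v N ω) (by positivity) hV
  calc _ ≤ √N * (24 * lam N * s N / c * ((Av * √(x N) + A) / √N)) := by gcongr
    _ ≤ √N * (24 * (A1 * (2 * (√(b N) / √N))) * s N / c * ((Av * √(x N) + A) / √N)) := by gcongr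
    _ = 48 * A1 / c * (Av * (s N * (√(b N) / √N) * √(x N)) + A * (s N * (√(b N) / √N))) *
        (√N / √N) := by ring
    _ < t := by rw [div_self hn.ne', mul_one, ← e2, ← e1]; exact h2

omit [∀ N, IsProbabilityMeasure (P N)] in
/-- The gap under incoherence, where the support is recovered: from the `ℓ²` rate and the
Euclidean norm of `θ̂_V - θ̂_F` on the support. -/
lemma whp_gap_of_sparse {l : Filter ℕ} (hl : l ≤ atTop) (hc : 0 < c) (hκ : 0 < κ) {x ρ : ℕ → ℝ}
    (hx1 : ∀ᶠ N in l, 1 ≤ x N) (hb1 : ∀ᶠ N in l, 1 ≤ b N)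
    (hsb : Tendsto (fun N => (s N : ℝ) ^ 2 * b N / N) l (𝓝 0))
    (hsx : Tendsto (fun N => (s N : ℝ) ^ 2 * b N * x N / N) l (𝓝 0))
    (hρ0 : ∀ N, 0 ≤ ρ N) (hρ : ∀ᶠ N in l, ρ N ≤ 1) (hcol : ∀ N, (M N).colSupport.card ≤ s N)
    {Az Aτ A A1 : ℝ} (hA : 0 ≤ A)
    (hlam0 : ∀ N, 0 < lam N) (hlam : ∀ᶠ N in l, lam N ≤ A1 * √((1 + b N) / N))
    (hζ : ∀ᶠ N in l, Az * √(b N / N) ≤ ε / 4 * lam N)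
    (hζ' : ∀ᶠ N in l, Az * √(b N / N) ≤ κ * ε / 16 * lam N)
    {Inc : ℕ → Prop} (hInc : ∀ N, Inc N) {v y : ∀ N, Ω N → Idx (d N) (K N) → ℝ}
    (hfit : WHP l P fun N ω => FitBound (M N) (Γs N ω) ε c κ (lam N) (Az * √(b N / N))
      (Aτ * √(b N / N)) (s N) (Inc N))
    (hv : WHP l P fun N ω => ∀ j, |v N ω j - y N ω j| ≤ A * (ρ N / √N))
    (hy : WHP l P fun N ω => ∑ j ∈ (M N).colSupport, y N ω j ^ 2 < x N * (s N + 1) / N)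
    {t : ℝ} (ht : 0 < t) :
    WHP l P fun N ω =>
      √N * ‖(WithLp.toLp 2 ((Γs N ω - (M N).Gamma0).mulVec (v N ω)) : E (p N))‖ < t := by
  have h1 : ∀ᶠ N in l, 32 * Aτ * √((s N : ℝ) ^ 2 * b N / N) < c := by
    have : Tendsto (fun N => 32 * Aτ * √((s N : ℝ) ^ 2 * b N / N)) l (𝓝 0) := by
      simpa using hsb.sqrt.const_mul (32 * Aτ)
    exact this.eventually_lt_const hc
  have h1' : ∀ᶠ N in l, 192 * Aτ * √((s N : ℝ) ^ 2 * b N / N) < κ * c := by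
    have : Tendsto (fun N => 192 * Aτ * √((s N : ℝ) ^ 2 * b N / N)) l (𝓝 0) := by
      simpa using hsb.sqrt.const_mul (192 * Aτ)
    exact this.eventually_lt_const (by positivity)
  have h2 : ∀ᶠ N in l, 144 * A1 ^ 2 / c ^ 2 * (2 * (2 + 2 * A ^ 2)) *
      ((s N : ℝ) ^ 2 * b N * x N / N) < t ^ 2 := by
    have : Tendsto (fun N => 144 * A1 ^ 2 / c ^ 2 * (2 * (2 + 2 * A ^ 2)) *
      ((s N : ℝ) ^ 2 * b N * x N / N)) l (𝓝 0) := by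
      simpa using hsx.const_mul (144 * A1 ^ 2 / c ^ 2 * (2 * (2 + 2 * A ^ 2)))
    exact this.eventually_lt_const (by positivity)
  refine (hfit.and (hv.and hy)).mono ?_
  filter_upwards [h1, h1', h2, hx1, hb1, hρ, hlam, hζ, hζ', hl (eventually_gt_atTop 0)]
    with N h1 h1' h2 hx1 hb1 hρ hlam hζ hζ' hN ω
  rintro ⟨hf, hv, hy⟩
  have hN' : (0 : ℝ) < N := by exact_mod_cast hN
  have hn : 0 < √(N : ℝ) := Real.sqrt_pos.2 hN'
  have hn2 : √(N : ℝ) ^ 2 = N := Real.sq_sqrt hN'.le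
  have hρ0 := hρ0 N
  have hs0 : (0 : ℝ) ≤ s N := Nat.cast_nonneg _
  have hb0 : 0 ≤ b N := by linarith
  have hlam2 : lam N ^ 2 ≤ A1 ^ 2 * (4 * (b N / N)) := by
    calc lam N ^ 2 ≤ (A1 * √((1 + b N) / N)) ^ 2 := pow_le_pow_left₀ (hlam0 N).le hlam 2
      _ = A1 ^ 2 * ((1 + b N) / N) := by rw [mul_pow, Real.sq_sqrt (by positivity)]
      _ ≤ _ := by
          refine mul_le_mul_of_nonneg_left ?_ (sq_nonneg _)
          rw [mul_div_assoc']
          exact div_le_div_of_nonneg_right (by linarith) hN'.le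
  have e1 : √((s N : ℝ) ^ 2 * b N / N) = s N * √(b N / N) := by
    rw [mul_div_assoc, Real.sqrt_mul (by positivity), Real.sqrt_sq hs0]
  rw [e1] at h1 h1'
  have hbound := hf.sparse (hInc N) (by linarith) (by linarith) hζ hζ' (v N ω)
  have hcard : ((M N).colSupport.card : ℝ) ≤ s N := by exact_mod_cast hcol N
  have hsumv : ∑ j ∈ (M N).colSupport, v N ω j ^ 2 ≤ x N * (s N + 1) * (2 + 2 * A ^ 2) / N := by
    have hrem : ∀ j, v N ω j ^ 2 ≤ 2 * y N ω j ^ 2 + 2 * A ^ 2 / N := fun j => by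
      have h3 : |v N ω j - y N ω j| ≤ A / √N := (hv j).trans (by
        rw [mul_div_assoc']; gcongr; exact mul_le_of_le_one_right hA hρ)
      have h4 : (v N ω j - y N ω j) ^ 2 ≤ A ^ 2 / N := by
        rw [← sq_abs]
        calc _ ≤ (A / √N) ^ 2 := by gcongr
          _ = _ := by rw [div_pow, hn2]
      have h5 : v N ω j ^ 2 ≤ 2 * y N ω j ^ 2 + 2 * (v N ω j - y N ω j) ^ 2 := by
        nlinarith [sq_nonneg (v N ω j - 2 * y N ω j)]
      calc _ ≤ 2 * y N ω j ^ 2 + 2 * (A ^ 2 / N) := by linarith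
        _ = _ := by ring
    calc _ ≤ ∑ j ∈ (M N).colSupport, (2 * y N ω j ^ 2 + 2 * A ^ 2 / N) :=
          Finset.sum_le_sum fun j _ => hrem j
      _ = 2 * ∑ j ∈ (M N).colSupport, y N ω j ^ 2 +
          (M N).colSupport.card * (2 * A ^ 2 / N) := by
          rw [Finset.sum_add_distrib, ← Finset.mul_sum, Finset.sum_const, nsmul_eq_mul]
      _ ≤ 2 * (x N * (s N + 1) / N) + (x N * (s N + 1)) * (2 * A ^ 2 / N) := by
          gcongr
          nlinarith
      _ = _ := by ring
  have hss : (s N : ℝ) * (s N + 1) ≤ 2 * (s N : ℝ) ^ 2 := by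
    have : s N * (s N + 1) ≤ 2 * s N ^ 2 := by
      rcases Nat.eq_zero_or_pos (s N) with h | h
      · simp [h]
      · nlinarith
    exact_mod_cast this
  refine (pow_lt_pow_iff_left₀ (by positivity) ht.le two_ne_zero).1 ?_
  rw [mul_pow, hn2]
  calc _ ≤ N * (36 * (A1 ^ 2 * (4 * (b N / N))) * s N / c ^ 2 *
        (x N * (s N + 1) * (2 + 2 * A ^ 2) / N)) := by
        refine mul_le_mul_of_nonneg_left (hbound.trans ?_) hN'.le
        have h6 : 0 ≤ ∑ j ∈ (M N).colSupport, v N ω j ^ 2 :=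
          Finset.sum_nonneg fun _ _ => sq_nonneg _
        gcongr
    _ = 144 * A1 ^ 2 / c ^ 2 * (2 + 2 * A ^ 2) * (s N * (s N + 1)) * (b N * x N / N) *
        (N / N) := by ring
    _ ≤ 144 * A1 ^ 2 / c ^ 2 * (2 + 2 * A ^ 2) * (2 * (s N : ℝ) ^ 2) * (b N * x N / N) *
        (N / N) := by gcongr
    _ = 144 * A1 ^ 2 / c ^ 2 * (2 * (2 + 2 * A ^ 2)) * ((s N : ℝ) ^ 2 * b N * x N / N) := by
        rw [div_self hN'.ne']; ring
    _ < t ^ 2 := h2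

/-- For a (group) lasso estimate of the weighting matrix, `√N (Γ̂ - Γ₀)(θ̂_V - θ̂_F)` vanishes in
probability. Here `b` is the logarithmic dimension that determines the noise level. The union bound
at the noise level `√(b / N)` only gives a probability tending to one if `b → ∞`; along the
indices where `b` stays below a slowly increasing sequence the crude bound is used instead. -/
theorem whp_gap (hε : 0 < ε) (hC : 0 < C) (hδ : 0 < δ) (hc : 0 < c) (hκ : 0 < κ)
    (hM : ∀ N, (M N).Regular ε C c δ (ℓ N)) (hS : SlowScale w ℓ D)
    (hd : ∀ N, 0 < d N) (hK : ∀ N, 0 < K N)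
    (hD : ∀ N, d N + Real.log ((d N : ℝ) * K N) ≤ D N)
    (hE : Estimation M ℓ P W bV tV tF)
    (hbD : ∀ N, b N ≤ D N) (hblog : ∀ N, Real.log ((d N : ℝ) * K N) ≤ b N)
    (hpb : ∀ N, (p N : ℝ) ≤ Real.exp (b N))
    (hsb : Tendsto (fun N => (s N : ℝ) ^ 2 * b N / N) atTop (𝓝 0))
    (hcol : ∀ N, (M N).colSupport.card ≤ s N)
    {Az A0 A1 : ℝ} (hAz : 0 ≤ Az) (hA0 : Az * (4 / ε + 16 / (κ * ε)) ≤ A0) (hA1 : 0 ≤ A1)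
    (hlam0 : ∀ N, 0 < lam N) (hlamge : ∀ᶠ N in atTop, A0 * √(b N / N) ≤ lam N)
    (hlamle : ∀ᶠ N in atTop, lam N ≤ A1 * √((1 + b N) / N))
    {Noise : ∀ N, (Fin N → Record (p N) (K N)) → ℝ → Prop}
    (hnoise : ∀ (l : Filter ℕ) (x : ℕ → ℝ), l ≤ atTop → Tendsto x l atTop →
      Tendsto (fun N => x N / N) l (𝓝 0) → (∀ᶠ N in l, b N ≤ x N) →
      WHP l P fun N ω => Noise N (fun i => W N i ω) (Az * √(x N / N)))
    {Inc : ℕ → Prop}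
    (hfit : ∀ N, ∀ᵐ ω ∂P N, ∀ ζ τ : ℝ, 0 ≤ τ → ε / 2 ≤ (nValid (fun i => W N i ω) : ℝ) / N →
      (∀ j k, |(M N).gramHat (fun i => W N i ω) j k - (M N).G j k| ≤ τ) →
      Noise N (fun i => W N i ω) ζ →
      FitBound (M N) (Γs N ω) ε c κ (lam N) ζ τ (s N) (Inc N))
    (halt : (∀ N, Inc N) ∨
      Tendsto (fun N => (s N : ℝ) ^ 2 * b N * Real.log ((d N : ℝ) * K N) / N) atTop (𝓝 0))
    {t : ℝ} (ht : 0 < t) :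
    WHP atTop P fun N ω => √N * ‖(WithLp.toLp 2 ((Γs N ω - (M N).Gamma0).mulVec
      fun j => tV N ω j.1 j.2 - tF N ω j.1 j.2) : E (p N))‖ < t := by
  have hW : ∀ N, IsSample (W N) (M N).recordLaw (P N) := fun N => ⟨hE.indep N, hE.record N⟩
  obtain ⟨A, hA, hdiff⟩ := whp_diff_sub_etaDiff_le hε hC hδ hM hS hd hK hD hE
  set ρ : ℕ → ℝ := fun N => w N ^ 2 * (ℓ N * D N) / √N with hρ
  have hlog0 : ∀ N, 0 ≤ Real.log ((d N : ℝ) * K N) := fun N => by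
    have h1 : (1 : ℝ) ≤ d N := by exact_mod_cast hd N
    have h2 : (1 : ℝ) ≤ K N := by exact_mod_cast hK N
    exact Real.log_nonneg (by nlinarith)
  have hb0 : ∀ N, 0 ≤ b N := fun N => (hlog0 N).trans (hblog N)
  have hρ0 : ∀ N, 0 ≤ ρ N := fun N => by
    have := hS.one_le_curv N
    have := hS.one_le_dim N
    positivity
  have hρ1 : ∀ᶠ N in atTop, ρ N ≤ 1 :=
    (hS.small.eventually_lt_const zero_lt_one).mono fun N h => h.le
  have hdiff' : WHP atTop P fun N ω => ∀ j : Idx (d N) (K N),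
      |tV N ω j.1 j.2 - tF N ω j.1 j.2 - (M N).etaDiff (fun i => W N i ω) j| ≤
        A * (ρ N / √N) := hdiff.mono (Eventually.of_forall fun N ω h j => by
    refine (h j).trans (le_of_eq ?_)
    rw [hρ, div_div, Real.mul_self_sqrt (Nat.cast_nonneg N)])
  have hnv : WHP atTop P fun N ω => ε / 2 ≤ (nValid (fun i => W N i ω) : ℝ) / N :=
    (whp_abs_nValid_div_sub_lt hε hM hW (s := ε / 2) (by positivity)).mono
      (Eventually.of_forall fun N ω h => by
        have h1 := (abs_lt.1 h).1
        linarith [((hM N).r_mem hε).1])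
  set Aτ : ℝ := 16 * (1 / ε ^ 2 * C ^ 2) with hAτ
  have hAτ0 : 0 ≤ Aτ := by positivity
  set Av : ℝ := 32 * (1 / ε * C) with hAv
  have hAv0 : 0 ≤ Av := by positivity
  have hFB : ∀ (l : Filter ℕ) (x : ℕ → ℝ), l ≤ atTop → Tendsto x l atTop →
      Tendsto (fun N => x N / N) l (𝓝 0) → (∀ᶠ N in l, b N ≤ x N) →
      WHP l P fun N ω => FitBound (M N) (Γs N ω) ε c κ (lam N) (Az * √(x N / N))
        (Aτ * √(x N / N)) (s N) (Inc N) := by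
    intro l x hl hx hxN hbx
    refine WHP.mono_ae (((hnoise l x hl hx hxN hbx).and (whp_gramHat hε hC hM hW hd hK hl hx hxN
      (hbx.mono fun N h => (hblog N).trans h))).and (hnv.filter_mono hl))
      (Eventually.of_forall fun N => ?_)
    filter_upwards [hfit N] with ω hω h
    exact hω _ _ (by positivity) h.2 h.1.2 h.1.1
  have hVB : ∀ (l : Filter ℕ) (x : ℕ → ℝ), l ≤ atTop → Tendsto x l atTop →
      Tendsto (fun N => x N / N) l (𝓝 0) → (∀ᶠ N in l, Real.log ((d N : ℝ) * K N) ≤ x N) →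
      WHP l P fun N ω => ∀ j : Idx (d N) (K N), |tV N ω j.1 j.2 - tF N ω j.1 j.2| ≤
        Av * √(x N / N) + A * (ρ N / √N) := by
    intro l x hl hx hxN hlog
    refine ((hdiff'.filter_mono hl).and (whp_etaDiff_le hε hC hM hW hd hK hl hx hxN hlog)).mono
      (Eventually.of_forall fun N ω h j => ?_)
    have h1 := abs_add_le (tV N ω j.1 j.2 - tF N ω j.1 j.2 - (M N).etaDiff (fun i => W N i ω) j)
      ((M N).etaDiff (fun i => W N i ω) j)
    rw [sub_add_cancel] at h1
    linarith [h.1 j, h.2 j]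
  have hsqrt : Tendsto (fun N : ℕ => 1 / √(N : ℝ)) atTop (𝓝 0) := by
    have h := (Real.tendsto_sqrt_atTop.comp
      (tendsto_natCast_atTop_atTop (R := ℝ))).inv_tendsto_atTop
    exact h.congr fun N => by simp
  have hdivle : ∀ (N : ℕ) (y : ℝ), 0 ≤ y → y / N ≤ y * (1 / √N) := fun N y hy => by
    rw [mul_one_div]
    rcases Nat.eq_zero_or_pos N with rfl | hN
    · simp
    · have hN' : (1 : ℝ) ≤ N := by exact_mod_cast hN
      have : √(N : ℝ) ≤ N := by rw [Real.sqrt_le_left (by positivity)]; nlinarith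
      have : 0 < √(N : ℝ) := Real.sqrt_pos.2 (by positivity)
      gcongr
  -- the slow sequence `x0` that separates low from high dimension; `b ≤ x0` makes `p` and `q` at
  -- most `exp x0`, with `exp (4 x0) = o(√N)`
  obtain ⟨w', hw'1, hw', hw's⟩ := exists_slow hsqrt
  set x0 : ℕ → ℝ := fun N => Real.log (w' N) / 4 with hx0
  have hx00 : ∀ N, 0 ≤ x0 N := fun N => div_nonneg (Real.log_nonneg (hw'1 N)) (by norm_num)
  have hx0t : Tendsto x0 atTop atTop :=
    (Real.tendsto_log_atTop.comp hw').atTop_div_const (by norm_num)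
  have hexp : ∀ N, Real.exp (4 * x0 N) = w' N := fun N => by
    rw [hx0]
    simp only
    rw [mul_div_cancel₀ _ (by norm_num), Real.exp_log (zero_lt_one.trans_le (hw'1 N))]
  have hx0e : Tendsto (fun N => Real.exp (4 * x0 N) / √N) atTop (𝓝 0) := by
    simp_rw [hexp]
    exact hw's.congr fun N => by rw [mul_one_div]
  have hx0N : Tendsto (fun N => x0 N / N) atTop (𝓝 0) := by
    refine squeeze_zero (fun N => div_nonneg (hx00 N) (Nat.cast_nonneg N)) (fun N => ?_) hw's
    refine (hdivle N _ (hx00 N)).trans ?_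
    gcongr
    rw [← hexp]
    linarith [Real.add_one_le_exp (4 * x0 N), hx00 N]
  set S : Set ℕ := {N | b N ≤ x0 N} with hSdef
  refine WHP.of_split S ?_ ?_
  · set l := atTop ⊓ 𝓟 S with hl
    have hle : l ≤ atTop := inf_le_left
    have hmem : ∀ᶠ N in l, b N ≤ x0 N := mem_inf_of_right (mem_principal_self S)
    refine whp_gap_of_crude hle hc hx00 hx0e ?_ ?_ hρ0 (hle hρ1) hAz hAτ0 hAv0 hA.le hA1 hlam0 ?_
      (hFB l x0 hle (hx0t.mono_left hle) (hx0N.mono_left hle) hmem)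
      (hVB l x0 hle (hx0t.mono_left hle) (hx0N.mono_left hle)
        (hmem.mono fun N h => (hblog N).trans h)) ht
    · exact hmem.mono fun N h => (hpb N).trans (Real.exp_le_exp.2 h)
    · exact hmem.mono fun N h => card_idx_le_exp ((hblog N).trans h) (hd N) (hK N)
    · filter_upwards [hmem, hle hlamle] with N h h1
      refine h1.trans ?_
      gcongr
  · set l := atTop ⊓ 𝓟 Sᶜ with hl
    have hle : l ≤ atTop := inf_le_left
    have hmem : ∀ᶠ N in l, x0 N < b N := by
      have : ∀ᶠ N in l, N ∈ Sᶜ := mem_inf_of_right (mem_principal_self Sᶜ)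
      exact this.mono fun N h => not_le.1 h
    have hbt : Tendsto b l atTop :=
      tendsto_atTop_mono' l (hmem.mono fun N h => h.le) (hx0t.mono_left hle)
    have hDN : Tendsto (fun N => D N / N) atTop (𝓝 0) := by
      refine squeeze_zero (fun N => div_nonneg (zero_le_one.trans (hS.one_le_dim N))
        (Nat.cast_nonneg N)) (fun N => ?_) hS.tendsto_div
      have := hS.one_le_dim N
      gcongr
      exact le_mul_of_one_le_left (by linarith) (hS.one_le N)
    have hbN : Tendsto (fun N => b N / N) atTop (𝓝 0) :=
      squeeze_zero (fun N => div_nonneg (hb0 N) (Nat.cast_nonneg N))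
        (fun N => div_le_div_of_nonneg_right (hbD N) (Nat.cast_nonneg N)) hDN
    have hb1 : ∀ᶠ N in l, 1 ≤ b N := hbt.eventually_ge_atTop 1
    have hAz0 : Az * (4 / ε) ≤ A0 := by
      refine le_trans ?_ hA0
      gcongr
      have : 0 < 16 / (κ * ε) := by positivity
      linarith
    have hAz1 : Az * (16 / (κ * ε)) ≤ A0 := by
      refine le_trans ?_ hA0
      gcongr
      have : 0 < 4 / ε := by positivity
      linarith
    have hζ : ∀ᶠ N in l, Az * √(b N / N) ≤ ε / 4 * lam N := by
      filter_upwards [hle hlamge] with N h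
      calc Az * √(b N / N) = ε / 4 * (Az * (4 / ε) * √(b N / N)) := by field_simp
        _ ≤ ε / 4 * (A0 * √(b N / N)) := by gcongr
        _ ≤ _ := by gcongr
    have hζ' : ∀ᶠ N in l, Az * √(b N / N) ≤ κ * ε / 16 * lam N := by
      filter_upwards [hle hlamge] with N h
      calc Az * √(b N / N) = κ * ε / 16 * (Az * (16 / (κ * ε)) * √(b N / N)) := by field_simp
        _ ≤ κ * ε / 16 * (A0 * √(b N / N)) := by gcongr
        _ ≤ _ := by gcongr
    have hF := hFB l b hle hbt (hbN.mono_left hle) (Eventually.of_forall fun N => le_rfl)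
    -- a diverging factor that the sparsity condition still absorbs
    obtain ⟨x1, hx11, hx1t, hx1s⟩ := exists_slow (a := fun N : ℕ =>
      (s N : ℝ) ^ 2 * b N / N + 1 / √N) (by simpa using hsb.add hsqrt)
    have hsb0 : ∀ N, 0 ≤ (s N : ℝ) ^ 2 * b N / N := fun N => by
      have := hb0 N
      positivity
    have hx1sb : Tendsto (fun N => (s N : ℝ) ^ 2 * b N * x1 N / N) atTop (𝓝 0) := by
      refine squeeze_zero (fun N => ?_) (fun N => ?_) hx1s
      · have := hb0 N
        have := hx11 N
        positivity
      · have := hx11 N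
        calc (s N : ℝ) ^ 2 * b N * x1 N / N = x1 N * ((s N : ℝ) ^ 2 * b N / N) := by ring
          _ ≤ _ := by
            gcongr
            have : 0 ≤ 1 / √(N : ℝ) := by positivity
            linarith
    have hx1N : Tendsto (fun N => x1 N / N) atTop (𝓝 0) := by
      refine squeeze_zero (fun N => ?_) (fun N => ?_) hx1s
      · have := hx11 N
        positivity
      · have h1 := hx11 N
        refine (hdivle N _ (by linarith)).trans ?_
        gcongr
        linarith [hsb0 N]
    rcases halt with hInc | hslog
    · exact whp_gap_of_sparse hle hc hκ (Eventually.of_forall hx11) hb1 (hsb.mono_left hle)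
        (hx1sb.mono_left hle) hρ0 (hle hρ1) hcol hA.le hlam0 (hle hlamle) hζ hζ' hInc hF
        (hdiff'.filter_mono hle) (whp_sum_etaDiff_sq_lt hε hC hM hW hle (hx1t.mono_left hle)
          (fun N => (M N).colSupport) hcol) ht
    · set x2 : ℕ → ℝ := fun N => Real.log ((d N : ℝ) * K N) + x1 N with hx2
      have hx2t : Tendsto x2 atTop atTop :=
        tendsto_atTop_mono (fun N => le_add_of_nonneg_left (hlog0 N)) hx1t
      have hx2N : Tendsto (fun N => x2 N / N) atTop (𝓝 0) := by
        have h1 : Tendsto (fun N => b N / N + x1 N / N) atTop (𝓝 0) := by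
          simpa using hbN.add hx1N
        refine squeeze_zero (fun N => ?_) (fun N => ?_) h1
        · have := hx11 N
          have := hlog0 N
          positivity
        · rw [← add_div]
          gcongr
          exact add_le_add_left (hblog N) _
      have hsx2 : Tendsto (fun N => (s N : ℝ) ^ 2 * b N * x2 N / N) atTop (𝓝 0) := by
        have h1 : Tendsto (fun N => (s N : ℝ) ^ 2 * b N * Real.log ((d N : ℝ) * K N) / N +
          (s N : ℝ) ^ 2 * b N * x1 N / N) atTop (𝓝 0) := by simpa using hslog.add hx1sb
        refine h1.congr fun N => ?_
        rw [hx2]; ring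
      exact whp_gap_of_fast hle hc (Eventually.of_forall fun N => by
          have := hx11 N
          have := hlog0 N
          positivity) hb1 (hsb.mono_left hle) (hsx2.mono_left hle) hρ0 (hle hρ1) hAv0 hA.le
        hA1 (hle hlamle) hζ hF
        (hVB l x2 hle (hx2t.mono_left hle) (hx2N.mono_left hle) (Eventually.of_forall fun N => by
          have := hx11 N
          simp only [hx2]; linarith)) ht

end Gap

end Model


namespace Model

/-! ### The lasso and the group-lasso regimes -/

section Regimes

variable {p d K : ℕ → ℕ} {M : ∀ N, Model (p N) (d N) (K N)} {ε C c δ κ : ℝ}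
  {w ℓ D b lam : ℕ → ℝ}

lemma log_idx_nonneg {d K : ℕ} (hd : 0 < d) (hK : 0 < K) : 0 ≤ Real.log ((d : ℝ) * K) := by
  have h1 : (1 : ℝ) ≤ d := by exact_mod_cast hd
  have h2 : (1 : ℝ) ≤ K := by exact_mod_cast hK
  exact Real.log_nonneg (one_le_mul_of_one_le_of_one_le h1 h2)

/-- Since `n̄ = r N` with `r ≤ 1`, what is negligible with respect to `n̄` is so with respect to
`N`. -/
lemma tendsto_div_of_isLittleO_nBar (hε : 0 < ε) (hM : ∀ N, (M N).Regular ε C c δ (ℓ N))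
    {f : ℕ → ℝ} (hf : f =o[atTop] nBar M) : Tendsto (fun N => f N / N) atTop (𝓝 0) := by
  refine (hf.trans_isBigO
    (IsBigO.of_bound 1 (Eventually.of_forall fun N => ?_))).tendsto_div_nhds_zero
  have hr := (hM N).r_mem hε
  rw [nBar, norm_mul, one_mul, Real.norm_of_nonneg (hε.le.trans hr.1)]
  exact mul_le_of_le_one_left (norm_nonneg _) hr.2

/-- The growth condition leaves room for a slowly diverging factor. -/
lemma exists_slowScale (hε : 0 < ε) (hM : ∀ N, (M N).Regular ε C c δ (ℓ N))
    (hℓ : ∀ N, 1 ≤ ℓ N) (hD : ∀ N, 1 ≤ D N)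
    (h : (fun N => ℓ N * D N) =o[atTop] fun N => √(nBar M N)) : ∃ w, SlowScale w ℓ D := by
  have h1 : Tendsto (fun N => ℓ N * D N / √(N : ℝ)) atTop (𝓝 0) := by
    refine (h.trans_isBigO (IsBigO.of_bound 1
      (Eventually.of_forall fun N => ?_))).tendsto_div_nhds_zero
    have hr := (hM N).r_mem hε
    rw [one_mul, Real.norm_of_nonneg (Real.sqrt_nonneg _), Real.norm_of_nonneg (Real.sqrt_nonneg _)]
    exact Real.sqrt_le_sqrt (mul_le_of_le_one_left (Nat.cast_nonneg N) hr.2)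
  have h0 : ∀ N, 0 ≤ ℓ N * D N / √(N : ℝ) := fun N => by
    have := hℓ N
    have := hD N
    positivity
  obtain ⟨w, hw1, hw, hws⟩ := exists_slow
    (a := fun N : ℕ => √(ℓ N * D N / √(N : ℝ))) (by simpa using h1.sqrt)
  refine ⟨w, hw1, hw, hD, hℓ, ?_⟩
  have h2 := hws.pow 2
  rw [zero_pow two_ne_zero] at h2
  refine h2.congr fun N => ?_
  rw [mul_pow, Real.sq_sqrt (h0 N), mul_div_assoc (w N ^ 2)]

lemma lam_ge_of_nBar (hε : 0 < ε) (hM : ∀ N, (M N).Regular ε C c δ (ℓ N)) (hb : ∀ N, 0 ≤ b N)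
    {A0 : ℝ} (hA0 : 0 ≤ A0) (h : ∀ᶠ N in atTop, A0 * √(b N / nBar M N) ≤ lam N) :
    ∀ᶠ N in atTop, A0 * √(b N / N) ≤ lam N := by
  filter_upwards [h, eventually_gt_atTop 0] with N h hN
  refine le_trans (mul_le_mul_of_nonneg_left (Real.sqrt_le_sqrt ?_) hA0) h
  have hr := (hM N).r_mem hε
  have hN' : (0 : ℝ) < N := by exact_mod_cast hN
  exact div_le_div_of_nonneg_left (hb N) (mul_pos (hε.trans_le hr.1) hN')
    (mul_le_of_le_one_left hN'.le hr.2)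

lemma lam_le_of_nBar (hε : 0 < ε) (hM : ∀ N, (M N).Regular ε C c δ (ℓ N)) (hb : ∀ N, 0 ≤ b N)
    {A1 : ℝ} (h : ∀ᶠ N in atTop, lam N ≤ A1 * √(b N / nBar M N)) :
    ∀ᶠ N in atTop, lam N ≤ |A1| / √ε * √(b N / N) := by
  filter_upwards [h, eventually_gt_atTop 0] with N h hN
  have hr := (hM N).r_mem hε
  have hN' : (0 : ℝ) < N := by exact_mod_cast hN
  calc lam N ≤ A1 * √(b N / nBar M N) := h
    _ ≤ |A1| * √(b N / N / ε) := by
        refine mul_le_mul (le_abs_self _) (Real.sqrt_le_sqrt ?_) (Real.sqrt_nonneg _)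
          (abs_nonneg _)
        rw [div_div]
        refine div_le_div_of_nonneg_left (hb N) (by positivity) ?_
        rw [nBar, mul_comm]
        exact mul_le_mul_of_nonneg_right hr.1 hN'.le
    _ = |A1| / √ε * √(b N / N) := by
        rw [Real.sqrt_div (div_nonneg (hb N) hN'.le)]; ring

variable {Ω : ℕ → Type*} [∀ N, MeasurableSpace (Ω N)] {P : ∀ N, Measure (Ω N)}
  [∀ N, IsProbabilityMeasure (P N)] {W : ∀ N, Fin N → Ω N → Record (p N) (K N)}
  {bV : ∀ N, Ω N → E (p N)} {tV tF : ∀ N, Ω N → Fin (K N) → E (d N)}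
  {Γs : ∀ N, Ω N → Weight (p N) (d N) (K N)}

/-- The lower bound for the constant in the tuning parameter: the noise of the regression must be
dominated by the penalty, with a margin for the selection rate and for the incoherence. -/
noncomputable def tuningConst (ε C κ : ℝ) : ℝ :=
  32 * (1 / ε ^ 2 * C ^ 2) * (4 / ε + 16 / (κ * ε))

lemma tuningConst_pos (hε : 0 < ε) (hC : 0 < C) (hκ : 0 < κ) : 0 < tuningConst ε C κ := by
  unfold tuningConst
  positivity

/-- The gap between SPI+ with the lasso and the optimal estimator is `o(1 / √N)`. The noise is
controlled at the scale `b = log (pq)`. -/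
theorem whp_gap_lasso (hε : 0 < ε) (hC : 0 < C) (hδ : 0 < δ) (hc : 0 < c) (hκ : 0 < κ)
    (hM : ∀ N, (M N).Regular ε C c δ (ℓ N)) (hS : SlowScale w ℓ D)
    (hp : ∀ N, 0 < p N) (hd : ∀ N, 0 < d N) (hK : ∀ N, 0 < K N)
    (hD : ∀ N, D N = p N + d N + Real.log ((d N : ℝ) * K N))
    (hE : Estimation M ℓ P W bV tV tF) (hR : LassoRegime M (tuningConst ε C κ) κ lam)
    (hfit : ∀ N, ∀ᵐ ω ∂(P N), (M N).IsLasso (fun i => W N i ω) (lam N) (Γs N ω))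
    {t : ℝ} (ht : 0 < t) :
    WHP atTop P fun N ω => √N * ‖(WithLp.toLp 2 ((Γs N ω - (M N).Gamma0).mulVec
      fun j => tV N ω j.1 j.2 - tF N ω j.1 j.2) : E (p N))‖ < t := by
  have hW : ∀ N, IsSample (W N) (M N).recordLaw (P N) := fun N => ⟨hE.indep N, hE.record N⟩
  obtain ⟨s, hs, hsb, halt⟩ := hR.sparse
  obtain ⟨A1, hA1⟩ := hR.lam_le
  have hp1 : ∀ N, (1 : ℝ) ≤ p N := fun N => by exact_mod_cast hp N
  have hq1 : ∀ N, (1 : ℝ) ≤ (d N : ℝ) * K N := fun N => by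
    have h1 : (1 : ℝ) ≤ d N := by exact_mod_cast hd N
    have h2 : (1 : ℝ) ≤ K N := by exact_mod_cast hK N
    exact one_le_mul_of_one_le_of_one_le h1 h2
  have hlogq := fun N => log_idx_nonneg (hd N) (hK N)
  have hlog : ∀ N, Real.log ((p N : ℝ) * (d N * K N)) =
      Real.log (p N) + Real.log ((d N : ℝ) * K N) := fun N =>
    Real.log_mul (by linarith [hp1 N]) (by linarith [hq1 N])
  have hlogp : ∀ N, 0 ≤ Real.log (p N) := fun N => Real.log_nonneg (hp1 N)
  refine whp_gap (b := fun N => Real.log ((p N : ℝ) * (d N * K N))) (A1 := |A1| / √ε)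
    (Inc := fun N => ∀ l, Incoherent (M N).G ((M N).rowSupport l) κ)
    (Noise := fun N D ζ => ∀ l j, |(M N).noiseHat D l j| ≤ ζ)
    hε hC hδ hc hκ hM hS hd hK (fun N => ?_) hE (fun N => ?_) (fun N => ?_) (fun N => ?_)
    (tendsto_div_of_isLittleO_nBar hε hM hsb) (fun N => card_colSupport_le.trans (hs N))
    (by positivity) le_rfl (by positivity) hR.lam_pos
    (lam_ge_of_nBar hε hM (fun N => ?_) (tuningConst_pos hε hC hκ).le hR.lam_ge)
    (lam_le_of_nBar hε hM (fun N => ?_) hA1)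
    (fun l x hl hx hxN hbx => whp_noiseHat_entry hε hC hc hM hW hp hd hK hl hx hxN hbx)
    (fun N => (hfit N).mono fun ω h ζ τ hτ0 hn hτ hζ =>
      (hM N).fitBound_lasso _ hε hc hκ (hR.lam_pos N) h (hs N) hn hτ0 hτ hζ)
    (halt.imp_right fun h => tendsto_div_of_isLittleO_nBar hε hM h) ht
  · rw [hD]; linarith [hp1 N]
  · rw [hD, hlog]
    linarith [Real.log_le_self (zero_le_one.trans (hp1 N)), Nat.cast_nonneg (α := ℝ) (d N)]
  · rw [hlog]; linarith [hlogp N]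
  · rw [Real.exp_log (by nlinarith [hp1 N, hq1 N])]
    exact le_mul_of_one_le_right (by linarith [hp1 N]) (hq1 N)
  · rw [hlog]; linarith [hlogp N, hlogq N]
  · rw [hlog]; linarith [hlogp N, hlogq N]

/-- The gap between SPI+ with the group lasso and the optimal estimator is `o(1 / √N)`. The noise is
controlled at the scale `b = p ∨ log q`. -/
theorem whp_gap_groupLasso (hε : 0 < ε) (hC : 0 < C) (hδ : 0 < δ) (hc : 0 < c) (hκ : 0 < κ)
    (hM : ∀ N, (M N).Regular ε C c δ (ℓ N)) (hS : SlowScale w ℓ D)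
    (hp : ∀ N, 0 < p N) (hd : ∀ N, 0 < d N) (hK : ∀ N, 0 < K N)
    (hD : ∀ N, D N = p N + d N + Real.log ((d N : ℝ) * K N))
    (hE : Estimation M ℓ P W bV tV tF) (hR : GroupLassoRegime M (tuningConst ε C κ) κ lam)
    (hfit : ∀ N, ∀ᵐ ω ∂(P N), (M N).IsGroupLasso (fun i => W N i ω) (lam N) (Γs N ω))
    {t : ℝ} (ht : 0 < t) :
    WHP atTop P fun N ω => √N * ‖(WithLp.toLp 2 ((Γs N ω - (M N).Gamma0).mulVec
      fun j => tV N ω j.1 j.2 - tF N ω j.1 j.2) : E (p N))‖ < t := by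
  have hW : ∀ N, IsSample (W N) (M N).recordLaw (P N) := fun N => ⟨hE.indep N, hE.record N⟩
  obtain ⟨s, hs, hsb, halt⟩ := hR.sparse
  obtain ⟨A1, hA1⟩ := hR.lam_le
  have hp1 : ∀ N, (1 : ℝ) ≤ p N := fun N => by exact_mod_cast hp N
  have hlogq := fun N => log_idx_nonneg (hd N) (hK N)
  have hb0 : ∀ N, 0 ≤ max (p N : ℝ) (Real.log ((d N : ℝ) * K N)) := fun N =>
    (Nat.cast_nonneg _).trans (le_max_left _ _)
  refine whp_gap (b := fun N => max (p N : ℝ) (Real.log ((d N : ℝ) * K N))) (A1 := |A1| / √ε)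
    (Inc := fun N => Incoherent (M N).G (M N).colSupport κ)
    (Noise := fun N D ζ => ∀ j, ‖(colVec ((M N).noiseHat D) j : E (p N))‖ ≤ ζ)
    hε hC hδ hc hκ hM hS hd hK (fun N => ?_) hE (fun N => ?_) (fun N => le_max_right _ _)
    (fun N => ?_) ?_ hs (by positivity) le_rfl (by positivity) hR.lam_pos
    (lam_ge_of_nBar hε hM hb0 (tuningConst_pos hε hC hκ).le hR.lam_ge)
    ((lam_le_of_nBar hε hM hb0 hA1).mono fun N h => h.trans ?_)
    (fun l x hl hx hxN hbx => whp_noiseHat_col hε hC hc hM hW hd hK hl hx hxN hbx)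
    (fun N => (hfit N).mono fun ω h ζ τ hτ0 hn hτ hζ =>
      (hM N).fitBound_groupLasso _ hε hc hκ (hp N) (hR.lam_pos N) h (hs N) hn hτ0 hτ hζ)
    (halt.imp_right fun h => tendsto_div_of_isLittleO_nBar hε hM h) ht
  · rw [hD]; linarith [hp1 N]
  · rw [hD, max_le_iff]
    constructor <;> linarith [hlogq N, hp1 N, Nat.cast_nonneg (α := ℝ) (d N)]
  · exact (by linarith [Real.add_one_le_exp (p N : ℝ)] : (p N : ℝ) ≤ Real.exp (p N)).trans
      (Real.exp_le_exp.2 (le_max_left _ _))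
  · refine squeeze_zero (fun N => ?_) (fun N => ?_) (tendsto_div_of_isLittleO_nBar hε hM hsb)
    · have := hb0 N
      positivity
    · have := hb0 N
      refine div_le_div_of_nonneg_right ?_ (Nat.cast_nonneg N)
      refine mul_le_mul_of_nonneg_right ?_ this
      exact le_mul_of_one_le_left (sq_nonneg _) (hp1 N)
  · gcongr
    linarith

lemma spi_sub_spi {p d K : ℕ} (Γ Γ' : Weight p d K) (bV : E p) (tV tF : Fin K → E d) :
    spi Γ bV tV tF - spi Γ' bV tV tF =
      -WithLp.toLp 2 ((Γ - Γ').mulVec fun j => tV j.1 j.2 - tF j.1 j.2) := by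
  rw [spi, spi, Matrix.sub_mulVec, WithLp.toLp_sub]
  abel

lemma aemeasurable_spi {p d K : ℕ} {Ω : Type*} [MeasurableSpace Ω] {P : Measure Ω}
    {Γ : Ω → Weight p d K} {bV : Ω → E p} {tV tF : Ω → Fin K → E d}
    (hΓ : ∀ l j, AEMeasurable (fun ω => Γ ω l j) P) (hb : AEMeasurable bV P)
    (hV : ∀ k, AEMeasurable (fun ω => tV ω k) P) (hF : ∀ k, AEMeasurable (fun ω => tF ω k) P) :
    AEMeasurable (fun ω => spi (Γ ω) (bV ω) (tV ω) (tF ω)) P := by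
  refine hb.sub ((WithLp.measurable_toLp 2 _).comp_aemeasurable (aemeasurable_pi_lambda _
    fun l => ?_))
  simp only [Matrix.mulVec, dotProduct]
  refine Finset.aemeasurable_fun_sum _ fun j _ => (hΓ l j).mul (AEMeasurable.sub ?_ ?_)
  · exact (EuclideanSpace.proj (𝕜 := ℝ) j.2).continuous.measurable.comp_aemeasurable (hV j.1)
  · exact (EuclideanSpace.proj (𝕜 := ℝ) j.2).continuous.measurable.comp_aemeasurable (hF j.1)

end Regimes

end Model

end SPI

theorem theorem2 (ε C c δ κ : ℝ) (hε : 0 < ε) (hC : 0 < C) (hc : 0 < c) (hδ : 0 < δ)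
    (hκ : 0 < κ) :
    ∃ A0 : ℝ, 0 < A0 ∧
      ∀ (p d K : ℕ → ℕ) (M : ∀ N, SPI.Model (p N) (d N) (K N)) (ℓ : ℕ → ℝ)
        (Ω : ℕ → Type*) [∀ N, MeasurableSpace (Ω N)] (P : ∀ N, Measure (Ω N))
        [∀ N, IsProbabilityMeasure (P N)]
        (W : ∀ N, Fin N → Ω N → SPI.Record (p N) (K N))
        (bV : ∀ N, Ω N → SPI.E (p N)) (tV tF : ∀ N, Ω N → Fin (K N) → SPI.E (d N))
        (lam : ℕ → ℝ) (Γs : ∀ N, Ω N → SPI.Weight (p N) (d N) (K N)),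
        (∀ N, 0 < p N) → (∀ N, 0 < d N) → (∀ N, 0 < K N) →
        (∀ N, 1 ≤ ℓ N) → (∀ N, (M N).Regular ε C c δ (ℓ N)) →
        -- growth of the dimensions; for bounded `ℓ` the last condition follows from the others
        ((fun N => (p N : ℝ)) =o[atTop] fun N => √(SPI.nBar M N)) →
        ((fun N => (d N : ℝ)) =o[atTop] fun N => √(SPI.nBar M N)) →
        (∃ e : ℝ, (fun N => (d N : ℝ) * K N) =O[atTop] fun N => SPI.nBar M N ^ e) →
        ((fun N => ℓ N * (p N + d N + Real.log ((d N : ℝ) * K N)))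
          =o[atTop] fun N => √(SPI.nBar M N)) →
        SPI.Estimation M ℓ P W bV tV tF →
        (∀ N l j, AEMeasurable (fun ω => Γs N ω l j) (P N)) →
        -- the lasso or the group lasso
        ((SPI.LassoRegime M A0 κ lam ∧
            ∀ N, ∀ᵐ ω ∂(P N), (M N).IsLasso (fun i => W N i ω) (lam N) (Γs N ω)) ∨
          (SPI.GroupLassoRegime M A0 κ lam ∧
            ∀ N, ∀ᵐ ω ∂(P N), (M N).IsGroupLasso (fun i => W N i ω) (lam N) (Γs N ω))) →
        -- asymptotic equivalence of SPI+ and the optimal Base-SPI estimator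
        SPI.TendstoZeroInProb P (fun N ω =>
          √(SPI.Model.nValid (fun i => W N i ω) : ℝ) *
            ‖SPI.spi (Γs N ω) (bV N ω) (tV N ω) (tF N ω) -
              SPI.spi (M N).Gamma0 (bV N ω) (tV N ω) (tF N ω)‖) ∧
        -- asymptotic normality of SPI+ with the optimal variance
        SPI.AsympNormal M P W
          (fun N ω => SPI.spi (Γs N ω) (bV N ω) (tV N ω) (tF N ω))
          (fun N => (M N).SigmaOpt) ∧
        -- no harm: the variance is that of the influence function at `Γ₀`, it is minimal over all
        -- weighting matrices, and `Γ = 0` gives the variance of the validation-only estimator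
        (∀ N, (M N).SigmaOpt = (M N).varTilde (M N).Gamma0) ∧
        (∀ N Γ, ((M N).varTilde Γ - (M N).SigmaOpt).PosSemidef ∧
          (M N).SigmaOpt.trace ≤ ((M N).varTilde Γ).trace) ∧
        SPI.AsympNormal M P W bV (fun N => (M N).varTilde 0) := by
  refine ⟨SPI.Model.tuningConst ε C κ, SPI.Model.tuningConst_pos hε hC hκ, ?_⟩
  intro p d K M ℓ Ω _ P _ W bV tV tF lam Γs hp hd hK hℓ hM _ _ _ hgrow hE hΓ hreg
  have hp1 : ∀ N, (1 : ℝ) ≤ p N := fun N => by exact_mod_cast hp N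
  have hd0 : ∀ N, (0 : ℝ) ≤ d N := fun N => Nat.cast_nonneg _
  have hlogq := fun N => SPI.Model.log_idx_nonneg (hd N) (hK N)
  obtain ⟨w, hS⟩ := SPI.Model.exists_slowScale
    (D := fun N => (p N : ℝ) + d N + Real.log ((d N : ℝ) * K N)) hε hM hℓ
    (fun N => by linarith [hp1 N, hd0 N, hlogq N]) hgrow
  have hgap : ∀ t : ℝ, 0 < t → SPI.WHP atTop P fun N ω =>
      √N * ‖SPI.spi (Γs N ω) (bV N ω) (tV N ω) (tF N ω) -
        SPI.spi (M N).Gamma0 (bV N ω) (tV N ω) (tF N ω)‖ < t := fun t ht => by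
    simp only [SPI.Model.spi_sub_spi, norm_neg]
    rcases hreg with ⟨hR, hfit⟩ | ⟨hR, hfit⟩
    · exact SPI.Model.whp_gap_lasso hε hC hδ hc hκ hM hS hp hd hK (fun N => rfl) hE hR hfit ht
    · exact SPI.Model.whp_gap_groupLasso hε hC hδ hc hκ hM hS hp hd hK (fun N => rfl) hE hR hfit ht
  refine ⟨SPI.tendstoZeroInProb_iff.2 fun t ht => (hgap t ht).mono
      (Eventually.of_forall fun N ω h => lt_of_le_of_lt ?_ h),
    SPI.Model.asympNormal_spi hε hC hδ hc hM hS hd hK (fun N => by linarith [hp1 N])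
      (fun N => by linarith [hd0 N, hlogq N]) hE
      (fun N => SPI.Model.aemeasurable_spi (hΓ N) (hE.bV_meas N) (hE.tV_meas N) (hE.tF_meas N))
      hgap,
    fun N => (hM N).SigmaOpt_eq hε hC hc,
    fun N Γ => ⟨(hM N).posSemidef_excess hε hC hc Γ, (hM N).trace_SigmaOpt_le hε hC hc Γ⟩,
    SPI.Model.asympNormal_bV hε hC hδ hM hS (fun N => by linarith [hd0 N, hlogq N]) hE⟩
  rw [abs_of_nonneg (by positivity)]
  -- `n ≤ N`
  have hn : SPI.Model.nValid (fun i => W N i ω) ≤ N :=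
    (Finset.card_filter_le _ _).trans (by simp)
  gcongr
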